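/- Let $X=S^1\times D^2\subset\mathbb C\times\mathbb C$ be the solid torus, with longitude $\vec l=S^1\times\{1\}$ and meridian $\vec m=\{1\}\times\partial D^2$. A relative cobordism from a disjoint union of copies of $X$ to another one is a compact smooth $4$-manifold $W$ with corners whose boundary is the union of a vertical wall and of disjoint incoming and outgoing boundaries, these being identified with the given copies of $X$, such that the corners of $W$ are exactly the boundaries of these copies of $X$, where the vertical wall meets the incoming and outgoing boundaries. Relative cobordisms are composed by gluing, and two of them are called equal if they are diffeomorphic compatibly with the identifications of the incoming and outgoing boundaries (and with the vertical walls). *The cobordisms $\Psi,\overline\Psi:X\to X$.* Attach a 2-handle $D^2\times D^2$ to $X\times[0,1]$ at $X\times\{1\}$ along the core circle $S^1\times\{0\}$ with the product framing, the attaching map being $\partial D^2\times D^2\to X\times\{1\}$, $(u,v)\mapsto((u,v),1)$. The incoming boundary is $X\times\{0\}$, the vertical wall is $\partial X\times[0,1]$, and the outgoing boundary is the surgered solid torus $X'=D^2\times S^1$. For $\Psi$ it is identified with $X$ by $\Phi(a,b)=(b,\bar a)$, which sends $\vec m\mapsto\vec l$, $\vec l\mapsto-\vec m$ on $\partial X'=\partial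 X$; for $\overline\Psi$ it is identified with $X$ by $\overline\Phi(a,b)=(\bar b,a)$, which sends $\vec m\mapsto-\vec l$, $\vec l\mapsto\vec m$. *The Y-products $\mathbf Y_X^{(1)},\mathbf Y_X^{(2)}:X\sqcup X\to X$.* Let $X$ be presented as a double $M\cup_N\overline M$ of a manifold $M$ along a part $N$ of its boundary. Let $\widetilde{\mathbf Y}$ be a hexagon, the thickening of the cone on three points, whose sides are alternately the sides $I_1,I_2,I_3$ and the ends of the three arms. The Y-product is obtained from $N\times\widetilde{\mathbf Y}$ by gluing on three copies of $M\times[-1,1]$, identifying $N\times[-1,1]$ with $N\times I_1$, $N\times I_2$, $N\times I_3$. Over each end of $\widetilde{\mathbf Y}$ the two adjacent copies of $M$ and the neck $N\times[-1,1]$ between them form a copy $M\cup (N\times[-1,1])\cup\overline M$ of $X$. The first incoming copy lies between $I_1$ and $I_3$, with $M$ at $I_3$ and $\overline M$ at $I_1$; the second incoming copy lies between $I_3$ and $I_2$, with $\overline M$ at $I_3$ and $M$ at $I_2$; the outgoing copy lies between $I_1$ and $I_2$, with $\overline M$ at $I_1$ and $M$ at $I_2$. For $\mathbf Y_X^{(1)}$,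 $M\cong[0,1]\times D^2$ is the half $\operatorname{Im}u\ge0$ of $X=\{(u,v)\}$, $N\cong\{0,1\}\times D^2$, and the reflection exchanging $M$ and $\overline M$ is $(u,v)\mapsto(\bar u,v)$. For $\mathbf Y_X^{(2)}$, $M\cong S^1\times(\text{half-disc})$ is the half $\operatorname{Im}v\le0$ of $X$, $N\cong S^1\times[-1,1]$, and the reflection is $(u,v)\mapsto(u,\bar v)$. Then, as relative cobordisms $X\sqcup X\to X$, $$\mathbf Y_X^{(1)}\circ(\overline\Psi\sqcup\overline\Psi)=\overline\Psi\circ\mathbf Y_X^{(2)},\qquad \mathbf Y_X^{(1)}\circ(\Psi\sqcup\Psi)=\Psi\circ\mathbf Y_X^{(2)}\circ P,$$ where $P$ swaps the two copies of $X$. -/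

import Mathlib

open Set Topology
open scoped Manifold ContDiff ComplexConjugate

noncomputable section

namespace YProd

/-! ### Smooth functions and smooth embeddings -/

/-- Smooth functions on a subset `S` of a normed space: those that extend, locally around every
point of `S`, to smooth functions on the ambient space. -/
def smoothOn {E : Type} [NormedAddCommGroup E] [NormedSpace ℝ E] (S : Set E) : Set (S → ℝ) :=
  {f | ∀ x : S, ∃ F : E → ℝ, ContDiff ℝ ∞ F ∧ ∀ᶠ y in 𝓝 x, f y = F y}

/-- Smooth functions on a 4-manifold with corners. -/
def smoothFun (W : Type) [TopologicalSpace W] [ChartedSpace (EuclideanQuadrant 4) W] :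
    Set (W → ℝ) :=
  {f | ContMDiff (modelWithCornersEuclideanQuadrant 4) 𝓘(ℝ, ℝ) ∞ f}

/-- `j` is a smooth closed embedding of a compact manifold with corners `A` (with smooth functions
`CA`) in a manifold with corners `W` (with smooth functions `CW`): the functions on `A` that extend
to smooth functions on `W` along `j` are exactly the smooth functions of `A`. That smooth functions
restrict to smooth functions says that `j` is smooth; that all smooth functions on `A`, in
particular its local coordinates, extend, says that `j` is an injective immersion. The image may be
a codimension zero domain with corners whose boundary runs through the interior of `W`. -/
def IsSmoothEmb {A W : Type} (CA : Set (A → ℝ)) (CW : Set (W → ℝ)) (j : A → W) : Prop :=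
  ∀ g : A → ℝ, g ∈ CA ↔ ∃ f ∈ CW, f ∘ j = g

/-- The depth of a point of a 4-manifold with corners: the number of boundary coordinates that
vanish there. Depth `0` is the interior, depth `1` the smooth part of the boundary, and points of
depth at least `2` are corner points. -/
def depth {W : Type} [TopologicalSpace W] [ChartedSpace (EuclideanQuadrant 4) W] (w : W) : ℕ :=
  Set.ncard {i : Fin 4 | (chartAt (EuclideanQuadrant 4) w w).1 i = 0}

/-! ### The solid torus and relative cobordisms -/

/-- The solid torus `X = S¹ × D²`; its longitude is `u ↦ (u, 1)` and its meridian is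
`v ↦ (1, v)`, for `u`, `v` running counterclockwise through the unit circle. -/
def solidTorus : Set (ℂ × ℂ) := {p | ‖p.1‖ = 1 ∧ ‖p.2‖ ≤ 1}

/-- The solid torus as a type. -/
abbrev X : Type := solidTorus

/-- Smooth functions on the disjoint union of `ι` copies of `X`. -/
def smoothCopies (ι : Type) : Set (ι × X → ℝ) :=
  {g | ∀ i, (fun x => g (i, x)) ∈ smoothOn solidTorus}

/-- Relative cobordisms from `ι` copies of `X` to `κ` copies of `X`: compact smooth 4-manifolds
`W` with corners whose boundary is divided into the incoming boundary `range inc`, the outgoing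
boundary `range out` and the vertical wall. Incoming and outgoing boundary are disjoint, and the
corners of `W` are exactly the images of the boundaries of the copies of `X`. -/
structure RelCob (ι κ : Type) where
  W : Type
  [top : TopologicalSpace W]
  [t2 : T2Space W]
  [compact : CompactSpace W]
  [charted : ChartedSpace (EuclideanQuadrant 4) W]
  [mfd : IsManifold (modelWithCornersEuclideanQuadrant 4) ∞ W]
  /-- identification of the incoming boundary -/
  inc : ι × X → W
  /-- identification of the outgoing boundary -/
  out : κ × X → W
  inc_emb : IsSmoothEmb (smoothCopies ι) (smoothFun W) inc
  out_emb : IsSmoothEmb (smoothCopies κ) (smoothFun W) out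
  disj : ∀ p q, inc p ≠ out q
  depth_inc : ∀ p, (‖p.2.1.2‖ < 1 → depth (inc p) = 1) ∧ (‖p.2.1.2‖ = 1 → depth (inc p) = 2)
  depth_out : ∀ p, (‖p.2.1.2‖ < 1 → depth (out p) = 1) ∧ (‖p.2.1.2‖ = 1 → depth (out p) = 2)
  depth_else : ∀ w, w ∉ range inc → w ∉ range out → depth w ≤ 1

attribute [instance] RelCob.top RelCob.t2 RelCob.compact RelCob.charted RelCob.mfd

/-- The vertical wall: the corners together with the part of the boundary that is neither incoming
nor outgoing. -/
def RelCob.wall {ι κ : Type} (A : RelCob ι κ) : Set A.W :=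
  {w | depth w = 2 ∨ depth w = 1 ∧ w ∉ range A.inc ∧ w ∉ range A.out}

/-- Smooth functions on a relative cobordism. -/
def RelCob.smooth {ι κ : Type} (A : RelCob ι κ) : Set (A.W → ℝ) := smoothFun A.W

/-- An isomorphism of relative cobordisms: a diffeomorphism that respects the identifications of
the incoming and of the outgoing boundary, and the vertical walls. -/
structure RelCob.Iso {ι κ : Type} (A B : RelCob ι κ) where
  toDiffeo : Diffeomorph (modelWithCornersEuclideanQuadrant 4)
    (modelWithCornersEuclideanQuadrant 4) A.W B.W ∞
  map_inc : ∀ p, toDiffeo (A.inc p) = B.inc p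
  map_out : ∀ p, toDiffeo (A.out p) = B.out p
  map_wall : ∀ w, toDiffeo w ∈ B.wall ↔ w ∈ A.wall

/-! ### Gluing relative cobordisms -/

/-- `W` is a composite `B ∘ A`: it is the union of smoothly embedded copies of `A` and `B` that
meet exactly along the outgoing boundary of `A`, identified with the incoming boundary of `B`. -/
def IsComposite {ι κ ρ : Type} (B : RelCob κ ρ) (A : RelCob ι κ) (W : RelCob ι ρ) : Prop :=
  ∃ (jA : A.W → W.W) (jB : B.W → W.W),
    IsSmoothEmb A.smooth W.smooth jA ∧ IsSmoothEmb B.smooth W.smooth jB ∧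
    range jA ∪ range jB = univ ∧
    (∀ a b, jA a = jB b ↔ ∃ p, A.out p = a ∧ B.inc p = b) ∧
    (∀ p, W.inc p = jA (A.inc p)) ∧ (∀ p, W.out p = jB (B.out p))

/-- `W` is the disjoint union `A ⊔ B` of relative cobordisms. -/
def IsDisjointUnion {ι κ ι' κ' : Type} (A : RelCob ι κ) (B : RelCob ι' κ')
    (W : RelCob (ι ⊕ ι') (κ ⊕ κ')) : Prop :=
  ∃ (jA : A.W → W.W) (jB : B.W → W.W),
    IsSmoothEmb A.smooth W.smooth jA ∧ IsSmoothEmb B.smooth W.smooth jB ∧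
    range jA ∪ range jB = univ ∧ (∀ a b, jA a ≠ jB b) ∧
    (∀ i x, W.inc (Sum.inl i, x) = jA (A.inc (i, x))) ∧
    (∀ i x, W.inc (Sum.inr i, x) = jB (B.inc (i, x))) ∧
    (∀ k x, W.out (Sum.inl k, x) = jA (A.out (k, x))) ∧
    (∀ k x, W.out (Sum.inr k, x) = jB (B.out (k, x)))

/-- `W` is the composite `A ∘ P`, where the diffeomorphism `P` swaps the two copies of `X`. -/
def IsSwap {ι κ : Type} (A W : RelCob (ι ⊕ ι) κ) : Prop :=
  ∃ e : Diffeomorph (modelWithCornersEuclideanQuadrant 4)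
      (modelWithCornersEuclideanQuadrant 4) A.W W.W ∞,
    (∀ i x, W.inc (i, x) = e (A.inc (i.swap, x))) ∧ (∀ p, W.out p = e (A.out p)) ∧
    ∀ w, e w ∈ W.wall ↔ w ∈ A.wall

/-! ### The 2-handle cobordisms -/

/-- The 4-dimensional 2-handle `D² × D²`. -/
def handle : Set (ℂ × ℂ) := {p | ‖p.1‖ ≤ 1 ∧ ‖p.2‖ ≤ 1}

/-- The diffeomorphism of `X` with the belt region `D² × S¹` inverse to `(a, b) ↦ (b, conj a)`.
On the boundary torus the latter is `(u, v) ↦ (v, conj u)`: it sends the meridian to the longitude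
and the longitude to the reversed meridian. -/
def beltPhi (x : X) : handle :=
  ⟨(conj x.1.2, x.1.1), by
    have h : ‖x.1.1‖ = 1 ∧ ‖x.1.2‖ ≤ 1 := x.2
    simpa [handle] using ⟨h.2, h.1.le⟩⟩

/-- The diffeomorphism of `X` with the belt region `D² × S¹` inverse to `(a, b) ↦ (conj b, a)`.
On the boundary torus the latter is `(u, v) ↦ (conj v, u)`: it sends the meridian to the reversed
longitude and the longitude to the meridian. -/
def beltPhiBar (x : X) : handle :=
  ⟨(x.1.2, conj x.1.1), by
    have h : ‖x.1.1‖ = 1 ∧ ‖x.1.2‖ ≤ 1 := x.2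
    simpa [handle] using ⟨h.2, h.1.le⟩⟩

/-- `Ψ` is obtained from the cylinder `X × [0, 1]` by attaching a 2-handle `D² × D²` to `X × {1}`
along the tubular neighbourhood of the core circle `S¹ × {0}` given by the product framing,
`∂D² × D² → X × {1}`, `(u, v) ↦ ((u, v), 1)`. The incoming boundary is `X × {0}`, the vertical wall
is `∂X × [0, 1]`, and the outgoing boundary is the surgered manifold, the belt region `D² × S¹` of
the handle, identified with `X` by `belt`. -/
def IsHandleCobordism (belt : X → handle) (Ψ : RelCob Unit Unit) : Prop :=
  ∃ (jC : ↥(solidTorus ×ˢ Icc (0 : ℝ) 1) → Ψ.W) (jH : handle → Ψ.W),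
    IsSmoothEmb (smoothOn _) Ψ.smooth jC ∧ IsSmoothEmb (smoothOn _) Ψ.smooth jH ∧
    range jC ∪ range jH = univ ∧
    (∀ c h, jC c = jH h ↔ c.1.2 = 1 ∧ c.1.1 = h.1) ∧
    (∀ x : X, Ψ.inc ((), x) = jC ⟨(x.1, 0), x.2, by simp⟩) ∧
    (∀ x : X, Ψ.out ((), x) = jH (belt x))

/-! ### The Y-product -/

/-- The thickened `Y`, a hexagon. Its side `x i = 0` is `I_i`, its side `x i = 1` is the end of the
arm opposite to `I_i`; going around the hexagon, these two kinds of sides alternate. -/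
def hexagon : Set (Fin 3 → ℝ) := {x | (∀ i, 0 ≤ x i ∧ x i ≤ 1) ∧ x 0 + x 1 + x 2 = 3 / 2}

/-- Parametrization of the side `I_i` by `[-1, 1]`, running from the end opposite to `I_(i+2)` to
the end opposite to `I_(i+1)`. -/
def hexSide (i : Fin 3) (s : Icc (-1 : ℝ) 1) : hexagon :=
  ⟨fun k => if k = i then 0 else if k = i + 1 then (3 + s.1) / 4 else (3 - s.1) / 4, by
    obtain ⟨s, h1, h2⟩ := s
    refine ⟨fun k => ?_, ?_⟩
    · dsimp only
      split_ifs <;> constructor <;> linarith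
    · fin_cases i <;> simp <;> ring⟩

/-- Parametrization of the end opposite to `I_k` by `[-1, 1]`, running from `I_(k+2)` to
`I_(k+1)`. -/
def hexEnd (k : Fin 3) (s : Icc (-1 : ℝ) 1) : hexagon :=
  ⟨fun j => if j = k then 1 else if j = k + 1 then (1 - s.1) / 4 else (1 + s.1) / 4, by
    obtain ⟨s, h1, h2⟩ := s
    refine ⟨fun j => ?_, ?_⟩
    · dsimp only
      split_ifs <;> constructor <;> linarith
    · fin_cases k <;> simp <;> ring⟩

/-- A presentation of `X` as a double: a manifold `M`, a part `N` of its boundary, and maps that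
identify `X` with `M ∪ N × [-1, 1] ∪ M̄`, where `N × {1}` is glued to `N` in `M` and `N × {-1}` is
glued to `N` in the second, reflected copy `M̄` of `M`. -/
structure Double (E : Type) [NormedAddCommGroup E] [NormedSpace ℝ E] where
  M : Set E
  N : Set E
  sub : N ⊆ M
  plus : M → X
  minus : M → X
  neck : N → Icc (-1 : ℝ) 1 → X
  plus_eq : ∀ n : N, plus ⟨n.1, sub n.2⟩ = neck n ⟨1, by norm_num⟩
  minus_eq : ∀ n : N, minus ⟨n.1, sub n.2⟩ = neck n ⟨-1, by norm_num⟩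

/-- `Y` is the Y-product on `X` for the presentation `D` of `X` as a double of `M` along `N`: it is
glued from `N × hexagon` and three strips `M × [-1, 1]`, the part `N × [-1, 1]` of the `i`-th strip
being identified with `N × I_i`.

The three ends are the copies of `X` formed by two ends of strips and the neck between them. The
left incoming end (between `I_1` and `I_0`) has `M` at `I_0` and `M̄` at `I_1`, the right incoming
end (between `I_0` and `I_2`) has `M̄` at `I_0` and `M` at `I_2`, and the outgoing end (between
`I_1` and `I_2`) has `M̄` at `I_1` and `M` at `I_2`. -/
def IsYProduct {E : Type} [NormedAddCommGroup E] [NormedSpace ℝ E] (D : Double E)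
    (Y : RelCob (Unit ⊕ Unit) Unit) : Prop :=
  ∃ (jN : ↥(D.N ×ˢ hexagon) → Y.W) (jM : Fin 3 → ↥(D.M ×ˢ Icc (-1 : ℝ) 1) → Y.W),
    IsSmoothEmb (smoothOn _) Y.smooth jN ∧
    (∀ i, IsSmoothEmb (smoothOn _) Y.smooth (jM i)) ∧
    range jN ∪ (⋃ i, range (jM i)) = univ ∧
    (∀ i a b, jM i a = jN b ↔ a.1.1 = b.1.1 ∧ (hexSide i ⟨a.1.2, a.2.2⟩ : Fin 3 → ℝ) = b.1.2) ∧
    (∀ i i' a b, i ≠ i' → jM i a ≠ jM i' b) ∧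
    -- left incoming end
    (∀ m : D.M, Y.inc (Sum.inl (), D.plus m) = jM 0 ⟨(m.1, -1), m.2, by simp⟩) ∧
    (∀ m : D.M, Y.inc (Sum.inl (), D.minus m) = jM 1 ⟨(m.1, 1), m.2, by simp⟩) ∧
    (∀ (n : D.N) (s : Icc (-1 : ℝ) 1),
      Y.inc (Sum.inl (), D.neck n s) = jN ⟨(n.1, hexEnd 2 s), n.2, (hexEnd 2 s).2⟩) ∧
    -- right incoming end
    (∀ m : D.M, Y.inc (Sum.inr (), D.plus m) = jM 2 ⟨(m.1, -1), m.2, by simp⟩) ∧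
    (∀ m : D.M, Y.inc (Sum.inr (), D.minus m) = jM 0 ⟨(m.1, 1), m.2, by simp⟩) ∧
    (∀ (n : D.N) (s : Icc (-1 : ℝ) 1),
      Y.inc (Sum.inr (), D.neck n s) = jN ⟨(n.1, hexEnd 1 s), n.2, (hexEnd 1 s).2⟩) ∧
    -- outgoing end, where the neck runs backwards
    (∀ m : D.M, Y.out ((), D.plus m) = jM 2 ⟨(m.1, 1), m.2, by simp⟩) ∧
    (∀ m : D.M, Y.out ((), D.minus m) = jM 1 ⟨(m.1, -1), m.2, by simp⟩) ∧
    (∀ (n : D.N) (s t : Icc (-1 : ℝ) 1), t.1 = -s.1 →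
      Y.out ((), D.neck n s) = jN ⟨(n.1, hexEnd 0 t), n.2, (hexEnd 0 t).2⟩)

/-! ### The two presentations of the solid torus as a double -/

/-- The point of `X` with longitudinal angle `θ` and meridional coordinate `v`. -/
def angle (θ : ℝ) (v : ℂ) (hv : ‖v‖ ≤ 1) : X :=
  ⟨(Complex.exp (θ * Complex.I), v), Complex.norm_exp_ofReal_mul_I θ, hv⟩

/-- `X` as the double of `M = [0, 1] × D²` along `N = {0, 1} × D²`: `M` is the part of `X` with
longitudinal angle in `[π/4, 3π/4]`, centred at angle `π/2`, the necks are centred at the angles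
`0` and `π`, and `M̄` is the image of `M` under the reflection of the longitude. -/
def double₁ : Double (ℝ × ℂ) where
  M := Icc 0 1 ×ˢ {v | ‖v‖ ≤ 1}
  N := {0, 1} ×ˢ {v | ‖v‖ ≤ 1}
  sub := by
    rintro ⟨t, v⟩ ⟨ht, hv⟩
    refine ⟨?_, hv⟩
    rcases ht with rfl | rfl <;> simp
  plus m := angle (Real.pi / 4 + m.1.1 * (Real.pi / 2)) m.1.2 m.2.2
  minus m := angle (-(Real.pi / 4 + m.1.1 * (Real.pi / 2))) m.1.2 m.2.2
  neck n s := angle (n.1.1 * Real.pi + (1 - 2 * n.1.1) * (s.1 * (Real.pi / 4))) n.1.2 n.2.2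
  plus_eq := by
    rintro ⟨⟨t, v⟩, ht, hv⟩
    have ht' : t = 0 ∨ t = 1 := ht
    congr 1
    rcases ht' with h | h <;> simp only [h] <;> ring
  minus_eq := by
    rintro ⟨⟨t, v⟩, ht, hv⟩
    have ht' : t = 0 ∨ t = 1 := ht
    rcases ht' with h | h
    · congr 1
      simp only [h]
      ring
    · apply Subtype.ext
      refine Prod.ext ?_ rfl
      refine Complex.exp_eq_exp_iff_exists_int.2 ⟨-1, ?_⟩
      simp only [h]
      push_cast
      ring

/-- The diffeomorphism from the half-disc `|z| ≤ 1`, `Im z ≥ 0` to the circular segment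
`|z| ≤ 1`, `Im z ≥ 1/2` that maps half-circle to arc and diameter to chord. -/
def cap (z : ℂ) : ℂ := ⟨z.re * √((3 + z.im) / (4 * (1 + z.im))), (1 + z.im) / 2⟩

lemma norm_cap_le {z : ℂ} (hz : ‖z‖ ≤ 1) (h : 0 ≤ z.im) : ‖cap z‖ ≤ 1 := by
  have h1 : z.re * z.re + z.im * z.im ≤ 1 := by
    rw [← Complex.normSq_apply, Complex.normSq_eq_norm_sq]
    nlinarith [norm_nonneg z]
  rw [← sq_le_one_iff₀ (norm_nonneg _), ← Complex.normSq_eq_norm_sq, Complex.normSq_apply]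
  have h2 : √((3 + z.im) / (4 * (1 + z.im))) * √((3 + z.im) / (4 * (1 + z.im))) =
      (3 + z.im) / (4 * (1 + z.im)) := Real.mul_self_sqrt (by positivity)
  have h3 : (1 - z.im * z.im) * ((3 + z.im) / (4 * (1 + z.im))) = (1 - z.im) * (3 + z.im) / 4 := by
    field_simp
    ring
  have h4 : 0 ≤ (3 + z.im) / (4 * (1 + z.im)) := by positivity
  have h5 : z.re * z.re * ((3 + z.im) / (4 * (1 + z.im))) ≤
      (1 - z.im * z.im) * ((3 + z.im) / (4 * (1 + z.im))) :=
    mul_le_mul_of_nonneg_right (by linarith) h4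
  simp only [cap]
  nlinarith

lemma norm_neck_le {x s : ℝ} (hx : x * x ≤ 1) (hs : s ∈ Icc (-1 : ℝ) 1) :
    ‖(⟨x * √(1 - s ^ 2 / 4), -(s / 2)⟩ : ℂ)‖ ≤ 1 := by
  have h0 : s ^ 2 ≤ 1 := by nlinarith [hs.1, hs.2]
  have h2 : √(1 - s ^ 2 / 4) * √(1 - s ^ 2 / 4) = 1 - s ^ 2 / 4 :=
    Real.mul_self_sqrt (by linarith)
  rw [← sq_le_one_iff₀ (norm_nonneg _), ← Complex.normSq_eq_norm_sq, Complex.normSq_apply]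
  nlinarith

/-- `X` as the double of `M = S¹ × (half-disc)` along `N = S¹ × (diameter)`: `M` is the part of `X`
with meridional coordinate in the lower segment `Im v ≤ -1/2`, centred at the meridional angle
`3π/2`, the neck is the part with `|Im v| ≤ 1/2`, and `M̄` is the image of `M` under complex
conjugation of `v`. -/
def double₂ : Double (ℂ × ℂ) where
  M := {p | ‖p.1‖ = 1 ∧ ‖p.2‖ ≤ 1 ∧ 0 ≤ p.2.im}
  N := {p | ‖p.1‖ = 1 ∧ ‖p.2‖ ≤ 1 ∧ p.2.im = 0}
  sub := fun p hp => ⟨hp.1, hp.2.1, hp.2.2.ge⟩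
  plus m := ⟨(m.1.1, conj (cap m.1.2)), m.2.1, by
    simpa using norm_cap_le m.2.2.1 m.2.2.2⟩
  minus m := ⟨(m.1.1, cap m.1.2), m.2.1, norm_cap_le m.2.2.1 m.2.2.2⟩
  neck n s := ⟨(n.1.1, ⟨n.1.2.re * √(1 - s.1 ^ 2 / 4), -(s.1 / 2)⟩), n.2.1, norm_neck_le (by
    have h := Complex.abs_re_le_norm n.1.2
    have h' := n.2.2.1
    nlinarith [abs_mul_abs_self n.1.2.re, abs_nonneg n.1.2.re]) s.2⟩
  plus_eq := by
    rintro ⟨⟨u, z⟩, hu, hz, h⟩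
    apply Subtype.ext
    refine Prod.ext rfl (Complex.ext ?_ ?_)
    · simp only [cap, Complex.conj_re, show z.im = 0 from h]
      norm_num
    · simp [cap, show z.im = 0 from h]
  minus_eq := by
    rintro ⟨⟨u, z⟩, hu, hz, h⟩
    apply Subtype.ext
    refine Prod.ext rfl (Complex.ext ?_ ?_)
    · simp only [cap, show z.im = 0 from h]
      norm_num
    · simp [cap, show z.im = 0 from h]
      norm_num

/-! ### Classes of relative cobordisms

Gluing determines a smooth manifold only up to diffeomorphism relative to the incoming and outgoing
boundary. All constructions below are therefore given by the set of their representatives, which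
lie in a single isomorphism class, and two of them are equal when these isomorphism classes are,
that is, when the two sides have isomorphic representatives. -/

/-- A relative cobordism up to isomorphism, given by representatives. -/
abbrev CobClass (ι κ : Type) : Type 1 := Set (RelCob ι κ)

/-- The cobordism `Ψ : X → X`. -/
def Psi : CobClass Unit Unit := {A | IsHandleCobordism beltPhi A}

/-- The cobordism `Ψ̄ : X → X`. -/
def PsiBar : CobClass Unit Unit := {A | IsHandleCobordism beltPhiBar A}

/-- The first Y-product on the solid torus. -/
def Y₁ : CobClass (Unit ⊕ Unit) Unit := {A | IsYProduct double₁ A}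

/-- The second Y-product on the solid torus. -/
def Y₂ : CobClass (Unit ⊕ Unit) Unit := {A | IsYProduct double₂ A}

/-- Composition `S ∘ T`. -/
def CobClass.comp {ι κ ρ : Type} (S : CobClass κ ρ) (T : CobClass ι κ) : CobClass ι ρ :=
  {W | ∃ B ∈ S, ∃ A ∈ T, IsComposite B A W}

/-- Disjoint union `S ⊔ T`. -/
def CobClass.disjUnion {ι κ ι' κ' : Type} (S : CobClass ι κ) (T : CobClass ι' κ') :
    CobClass (ι ⊕ ι') (κ ⊕ κ') :=
  {W | ∃ A ∈ S, ∃ B ∈ T, IsDisjointUnion A B W}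

/-- Precomposition `S ∘ P` with the swap `P` of the two copies of `X`. -/
def CobClass.swap {ι κ : Type} (S : CobClass (ι ⊕ ι) κ) : CobClass (ι ⊕ ι) κ :=
  {W | ∃ A ∈ S, IsSwap A W}

/-- Equality of relative cobordisms: there are representatives of the two sides that are
diffeomorphic relative to the identifications of their incoming and outgoing boundaries. -/
def CobClass.Same {ι κ : Type} (S T : CobClass ι κ) : Prop :=
  ∃ V ∈ S, ∃ W ∈ T, Nonempty (V.Iso W)

end YProd

end

/-! Both composites are one and the same 4-manifold, cut in two ways. On `ℂ²`, with points `(z, w)`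
and `q = |w|`, use the functions `x₀ = 7 - q`, `x₁ = lev (-1) z q`, `x₂ = lev 1 z q`, with sum `9`,
and `ξ = q * z.re`. The set `body` is bounded by the wall `ξ² = x₀ x₁ x₂ / 5`, by the incoming faces
`x₂ = 5 + eps` and `x₁ = 5 + eps`, and by the outgoing face `|z| = 1`.

Cut along `q = 2 + eps`. On the outer part `(x, ξ)` runs through a thickened Y whose cross sections
are discs, and `w / |w|` runs through the circle. This is the Y-product that doubles the disc
(`waistData`). The inner part is a collar `2 ≤ q ≤ 2 + eps` together with the bidisc `|z| ≤ 1`, `|w|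
≤ 2`, that is, a cylinder with a 2-handle (`beltData`).

Now cut by a condition on `z`. The wall function divided by `q²` decreases along each ray of fixed
`z` and fixed argument of `w` (`wallFun_strictAnti`), so `body` is a union of discs in `w` over the
disc `|z| ≤ 1`. The shadows of the sections `x₂ = 5` and `x₁ = 5` are two disjoint ellipses `cone σ
z ≤ 0`. Away from them the base is a pair of pants, the radius of the `w`-disc is fixed by the wall,
and `(x, ξ)` runs through the lateral surface of the thickened Y. This is the Y-product that doubles
the circle (`coneData`). Over each ellipse lies a collar `5 ≤ lev σ ≤ 5 + eps` with a bidisc below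
it, again a cylinder with a 2-handle (`sideData`). The first identity is `isComposite_sides`
compared with `isComposite_belt`.

The second identity is obtained from the first by complex conjugation. Conjugating the incoming
identification turns `Ψ̄` into `Ψ`, and the second Y-product is invariant under conjugation of all
its ends combined with the exchange of the two inputs (`IsYProduct.conjSwap`).

Two adjustments make the parametrizations agree. The isotopy `twist` of the disc converts angles,
used for the circle, into heights, used for the disc. The diffeomorphism `stretch` absorbs the
collars of thickness `eps`. For subsets of `ℂ²` to serve as manifolds with corners, their smooth
functions have to be the restrictions of ambient ones (`CornerSet.smoothFun_eq`). This rests on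
Seeley's extension theorem for the orthant. -/

open Set Topology Filter
open scoped Manifold ContDiff ComplexConjugate

noncomputable section

namespace YProd

/-! ### Seeley's coefficients. -/

/-- Finite stages of the Seeley coefficients: values at `-1` of the Lagrange basis for the nodes
`2 ^ j`, `j < N`. -/
def seeleyStage (N k : ℕ) : ℝ :=
  if k < N then ∏ j ∈ (Finset.range N).erase k, (-1 - (2 : ℝ) ^ j) / (2 ^ k - 2 ^ j) else 0

/-- Lagrange interpolation at `N` nodes reproduces the monomial of degree `n < N`, and this is
evaluated at `-1`. -/
lemma sum_seeleyStage {N n : ℕ} (h : n < N) :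
    ∑ k ∈ Finset.range N, seeleyStage N k * ((2 : ℝ) ^ k) ^ n = (-1) ^ n := by
  have hinj : Set.InjOn (fun j : ℕ => (2 : ℝ) ^ j) (Finset.range N : Set ℕ) :=
    fun a _ b _ hab => pow_right_injective₀ (by norm_num) (by norm_num) hab
  have hX : (Polynomial.X ^ n : Polynomial ℝ).degree < (Finset.range N).card := by
    simpa using h
  have key := Lagrange.eq_interpolate hinj hX
  have := congrArg (Polynomial.eval (-1)) key
  rw [Lagrange.interpolate_apply, Polynomial.eval_finsetSum] at this
  simp only [Polynomial.eval_pow, Polynomial.eval_X] at this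
  rw [this]
  refine Finset.sum_congr rfl fun k hk => ?_
  have hk' : k < N := Finset.mem_range.1 hk
  simp only [seeleyStage, hk', if_true, Lagrange.basis, Polynomial.eval_mul, Polynomial.eval_C,
    Polynomial.eval_prod, Lagrange.basisDivisor, Polynomial.eval_sub, Polynomial.eval_X]
  rw [mul_comm]
  congr 1
  exact Finset.prod_congr rfl fun j _ => by rw [div_eq_mul_inv, mul_comm]

/-- Rapidly decreasing upper bound for the Seeley coefficients. -/
def seeleyBound (k : ℕ) : ℝ := Real.exp 3 * ∏ j ∈ Finset.range k, (4 * 2 ^ j / 2 ^ k : ℝ)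

lemma seeleyBound_pos (k : ℕ) : 0 < seeleyBound k := by
  unfold seeleyBound; positivity

/-- Passing from `k` to `k + 1` halves each of the `k` old factors and adds the new factor `4 * 2 ^
k / 2 ^ (k + 1) = 2`. The ratio tends to zero, so the bound decays faster than any power of `2 ^ k`
grows. -/
lemma seeleyBound_succ (k : ℕ) : seeleyBound (k + 1) = 2 * (1 / 2) ^ k * seeleyBound k := by
  have h : ∀ j ∈ Finset.range k, (4 * 2 ^ j / 2 ^ (k + 1) : ℝ) = (1 / 2) * (4 * 2 ^ j / 2 ^ k) := by
    intro j _
    rw [pow_succ]; field_simp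
  unfold seeleyBound
  rw [Finset.prod_range_succ, Finset.prod_congr rfl h, Finset.prod_mul_distrib, Finset.prod_const,
    Finset.card_range, pow_succ (2 : ℝ) k]
  field_simp
  norm_num

lemma summable_seeleyBound (n : ℕ) : Summable fun k => seeleyBound k * ((2 : ℝ) ^ k) ^ n := by
  have hp := seeleyBound_pos
  refine summable_of_ratio_test_tendsto_lt_one (l := 0) (by norm_num)
    (Eventually.of_forall fun k => ?_) ?_
  · have := hp k; positivity
  · have h : ∀ k, ‖seeleyBound (k + 1) * ((2 : ℝ) ^ (k + 1)) ^ n‖ /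
        ‖seeleyBound k * ((2 : ℝ) ^ k) ^ n‖ = 2 * 2 ^ n * (1 / 2) ^ k := by
      intro k
      have := hp k
      rw [seeleyBound_succ, Real.norm_of_nonneg (by positivity), Real.norm_of_nonneg (by positivity),
        pow_succ (2 : ℝ) k, mul_pow]
      field_simp
    simp_rw [h]
    simpa using (tendsto_pow_atTop_nhds_zero_of_lt_one (by norm_num : (0 : ℝ) ≤ 1 / 2)
      (by norm_num)).const_mul (2 * 2 ^ n)

/-- The product is split at `k`. For `j < k` the numerator is at most `2 * 2 ^ j` and the
denominator at least half of `2 ^ k`. For `j > k` the factor is at most `(1 + x) / (1 - x) ≤ exp (3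
* x)` with `x = 2 ^ (k - j)`. These `x` add up to at most `1`, which gives the constant `exp 3`. -/
lemma abs_seeleyStage_le (N k : ℕ) : |seeleyStage N k| ≤ seeleyBound k := by
  unfold seeleyStage
  split_ifs with hk
  swap
  · simpa using (seeleyBound_pos k).le
  have hsplit : (Finset.range N).erase k = Finset.range k ∪ Finset.Ico (k + 1) N := by
    ext j
    simp only [Finset.mem_erase, Finset.mem_range, Finset.mem_union, Finset.mem_Ico]
    omega
  have hdisj : Disjoint (Finset.range k) (Finset.Ico (k + 1) N) := by
    rw [Finset.disjoint_left]
    intro j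
    simp only [Finset.mem_range, Finset.mem_Ico]
    omega
  rw [hsplit, Finset.prod_union hdisj, abs_mul, Finset.abs_prod, Finset.abs_prod, mul_comm]
  unfold seeleyBound
  refine mul_le_mul ?_ ?_ (by positivity) (by positivity)
  · have hterm : ∀ j ∈ Finset.Ico (k + 1) N,
        |(-1 - (2 : ℝ) ^ j) / (2 ^ k - 2 ^ j)| ≤ Real.exp (3 * (1 / 2) ^ (j - k)) := by
      intro j hj
      rw [Finset.mem_Ico] at hj
      obtain ⟨i, rfl⟩ : ∃ i, j = k + (i + 1) := ⟨j - k - 1, by omega⟩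
      rw [Nat.add_sub_cancel_left]
      -- With `y = 2 ^ j` below, `y * x = 2 ^ k ≥ 1`, and this absorbs the summand `1` of the
      -- numerator `1 + y`.
      set x : ℝ := (1 / 2) ^ (i + 1) with hx
      have hx0 : 0 < x := by positivity
      have hx1 : x ≤ 1 / 2 := by
        have : (1 / 2 : ℝ) ^ i ≤ 1 := pow_le_one₀ (by norm_num) (by norm_num)
        rw [hx, pow_succ]; linarith
      have h2 : (2 : ℝ) ^ (k + (i + 1)) * x = 2 ^ k := by
        rw [hx, pow_add, mul_assoc, ← mul_pow]; norm_num
      have hk1 : (1 : ℝ) ≤ 2 ^ k := one_le_pow₀ (by norm_num)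
      set y : ℝ := 2 ^ (k + (i + 1)) with hy
      have hy0 : 0 < y := by positivity
      have : |(-1 - y) / (2 ^ k - y)| = (1 + y) / (y - 2 ^ k) := by
        rw [abs_div, abs_of_neg (by linarith), abs_of_neg (by rw [← h2]; nlinarith)]
        congr 1 <;> ring
      rw [this, ← h2, div_le_iff₀ (by nlinarith)]
      have e1 : 1 + x ≤ Real.exp x := by linarith [Real.add_one_le_exp x]
      have e2 : 1 ≤ Real.exp (2 * x) * (1 - x) := by
        have := Real.add_one_le_exp (2 * x)
        nlinarith
      have e3 : Real.exp (3 * x) = Real.exp x * Real.exp (2 * x) := by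
        rw [← Real.exp_add]; ring_nf
      have hxy : 1 ≤ y * x := by rw [h2]; exact hk1
      calc 1 + y ≤ y * (1 + x) := by nlinarith
        _ ≤ y * Real.exp x := by gcongr
        _ = y * Real.exp x * 1 := by ring
        _ ≤ y * Real.exp x * (Real.exp (2 * x) * (1 - x)) := by gcongr
        _ = Real.exp (3 * x) * (y - y * x) := by rw [e3]; ring
    refine (Finset.prod_le_prod (fun _ _ => abs_nonneg _) hterm).trans ?_
    rw [← Real.exp_sum, Real.exp_le_exp, ← Finset.mul_sum]
    have : ∑ i ∈ Finset.Ico (k + 1) N, (1 / 2 : ℝ) ^ (i - k) ≤ 1 := by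
      rw [Finset.sum_Ico_eq_sum_range]
      have h : ∀ i ∈ Finset.range (N - (k + 1)), (1 / 2 : ℝ) ^ (k + 1 + i - k) =
          (1 / 2) * (1 / 2) ^ i := by
        intro i _
        rw [show k + 1 + i - k = i + 1 by omega, pow_succ]; ring
      rw [Finset.sum_congr rfl h, ← Finset.mul_sum]
      have := (summable_geometric_two).sum_le_tsum (Finset.range (N - (k + 1)))
        (fun i _ => by positivity)
      rw [tsum_geometric_two] at this
      linarith
    linarith
  · refine Finset.prod_le_prod (fun _ _ => abs_nonneg _) fun j hj => ?_
    have hj' : j + 1 ≤ k := Finset.mem_range.1 hj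
    have h1 : (2 : ℝ) ^ j * 2 ≤ 2 ^ k := by
      rw [← pow_succ]; exact pow_le_pow_right₀ (by norm_num) hj'
    have h2 : (1 : ℝ) ≤ 2 ^ j := one_le_pow₀ (by norm_num)
    rw [abs_div, abs_of_neg (by linarith), abs_of_pos (by linarith), div_le_div_iff₀ (by linarith)
      (by positivity)]
    nlinarith

/-- Seeley's coefficients: a rapidly decreasing sequence with `∑ a k * (-2 ^ k) ^ n = 1` for
all `n`. -/
lemma exists_seeley : ∃ a : ℕ → ℝ, (∀ n : ℕ, Summable fun k => |a k| * ((2 : ℝ) ^ k) ^ n) ∧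
    ∀ n : ℕ, ∑' k, a k * (-(2 : ℝ) ^ k) ^ n = 1 := by
  -- A free ultrafilter provides limits of the bounded sequences for all `k` at once, so convergence
  -- in the ordinary sense is not needed. The moment identities pass to the limit by dominated
  -- convergence.
  have hlim : ∀ k, ∃ x ∈ Icc (-seeleyBound k) (seeleyBound k),
      Tendsto (fun N => seeleyStage N k) (hyperfilter ℕ) (𝓝 x) := by
    intro k
    have := isCompact_Icc.ultrafilter_le_nhds
      ((hyperfilter ℕ).map fun N => seeleyStage N k) (s := Icc (-seeleyBound k) (seeleyBound k))
      (by
        rw [le_principal_iff]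
        exact Eventually.of_forall (p := fun N => seeleyStage N k ∈ Icc _ _)
          fun N => abs_le.1 (abs_seeleyStage_le N k))
    exact this
  choose a ha hlim using hlim
  have hab : ∀ k, |a k| ≤ seeleyBound k := fun k => abs_le.2 (ha k)
  refine ⟨a, fun n => ?_, fun n => ?_⟩
  · exact (summable_seeleyBound n).of_nonneg_of_le (fun k => by positivity)
      fun k => by gcongr; exact hab k
  · have h1 : Tendsto (fun N => ∑' k, seeleyStage N k * ((2 : ℝ) ^ k) ^ n) (hyperfilter ℕ)
        (𝓝 (∑' k, a k * ((2 : ℝ) ^ k) ^ n)) := by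
      refine tendsto_tsum_of_dominated_convergence (summable_seeleyBound n)
        (fun k => (hlim k).mul_const _) (Eventually.of_forall fun N k => ?_)
      rw [norm_mul, Real.norm_eq_abs, Real.norm_of_nonneg (by positivity : (0 : ℝ) ≤ (2 ^ k) ^ n)]
      gcongr
      exact abs_seeleyStage_le N k
    have h2 : ∀ᶠ N in (hyperfilter ℕ : Filter ℕ),
        ∑' k, seeleyStage N k * ((2 : ℝ) ^ k) ^ n = (-1) ^ n := by
      have : ∀ᶠ N in (hyperfilter ℕ : Filter ℕ), n < N :=
        (Nat.hyperfilter_le_atTop) (eventually_gt_atTop n)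
      filter_upwards [this] with N hN
      rw [← sum_seeleyStage hN]
      refine tsum_eq_sum fun k hk => ?_
      have : ¬ k < N := by simpa using hk
      simp [seeleyStage, this]
    have h3 : ∑' k, a k * ((2 : ℝ) ^ k) ^ n = (-1) ^ n :=
      tendsto_nhds_unique h1 (tendsto_const_nhds.congr' (h2.mono fun _ h => h.symm))
    have h4 : ∀ k, a k * (-(2 : ℝ) ^ k) ^ n = (-1) ^ n * (a k * ((2 : ℝ) ^ k) ^ n) := by
      intro k; rw [neg_pow]; ring
    simp_rw [h4]
    rw [tsum_mul_left, h3, ← mul_pow]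
    norm_num

/-- Dominated convergence is applied to the remainders divided by `‖y - x‖`. Each tends to zero, and
on a convex set the mean value inequality bounds the `n`-th one by `2 * u n`. -/
lemma hasFDerivWithinAt_tsum_of_convex {E F : Type*} [NormedAddCommGroup E] [NormedSpace ℝ E]
    [NormedAddCommGroup F] [NormedSpace ℝ F] [CompleteSpace F] {s : Set E} (hs : Convex ℝ s)
    {f : ℕ → E → F} {f' : ℕ → E → E →L[ℝ] F} {u : ℕ → ℝ} (hu : Summable u)
    (hf : ∀ n, ∀ x ∈ s, HasFDerivWithinAt (f n) (f' n x) s x)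
    (hb : ∀ n, ∀ x ∈ s, ‖f' n x‖ ≤ u n) (hsum : ∀ x ∈ s, Summable fun n => f n x)
    {x : E} (hx : x ∈ s) :
    HasFDerivWithinAt (fun y => ∑' n, f n y) (∑' n, f' n x) s x := by
  have hsum' : Summable fun n => f' n x := Summable.of_norm_bounded hu fun n => hb n x hx
  set r : E → ℕ → F := fun y n => ‖y - x‖⁻¹ • (f n y - f n x - f' n x (y - x)) with hr
  have hlim : Tendsto (fun y => ∑' n, r y n) (𝓝[s] x) (𝓝 (∑' _ : ℕ, (0 : F))) := by
    refine tendsto_tsum_of_dominated_convergence (bound := fun n => 2 * u n) (hu.mul_left 2)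
      (fun n => ?_) ?_
    · have := hasFDerivWithinAt_iff_tendsto.1 (hf n x hx)
      refine tendsto_zero_iff_norm_tendsto_zero.2 (this.congr fun y => ?_)
      rw [hr, norm_smul, norm_inv, norm_norm]
    · filter_upwards [self_mem_nhdsWithin] with y hy n
      have h1 : ‖f n y - f n x‖ ≤ u n * ‖y - x‖ :=
        hs.norm_image_sub_le_of_norm_hasFDerivWithin_le (hf n) (hb n) hx hy
      have h2 : ‖f' n x (y - x)‖ ≤ u n * ‖y - x‖ :=
        ((f' n x).le_opNorm _).trans (by gcongr; exact hb n x hx)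
      rw [hr, norm_smul, norm_inv, norm_norm]
      rcases eq_or_ne y x with rfl | hne
      · simpa using (norm_nonneg _).trans (hb n y hx)
      · have hpos : 0 < ‖y - x‖ := norm_pos_iff.2 (sub_ne_zero.2 hne)
        rw [inv_mul_le_iff₀ hpos]
        exact (norm_sub_le _ _).trans (by linarith)
  rw [tsum_zero] at hlim
  refine hasFDerivWithinAt_iff_tendsto.2 ((tendsto_zero_iff_norm_tendsto_zero.1 hlim).congr' ?_)
  filter_upwards [self_mem_nhdsWithin] with y hy
  have e1 : (∑' n, f' n x) (y - x) = ∑' n, f' n x (y - x) :=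
    ContinuousLinearMap.map_tsum (ContinuousLinearMap.apply ℝ F (y - x)) hsum'
  have s1 : Summable fun n => f' n x (y - x) :=
    (ContinuousLinearMap.apply ℝ F (y - x)).summable hsum'
  have e2 : ∑' n, r y n = ‖y - x‖⁻¹ • (∑' n, f n y - ∑' n, f n x - (∑' n, f' n x) (y - x)) := by
    rw [e1, ← (hsum y hy).tsum_sub (hsum x hx), ← ((hsum y hy).sub (hsum x hx)).tsum_sub s1,
      ← ((((hsum y hy).sub (hsum x hx)).sub s1).tsum_const_smul _)]
  rw [e2, norm_smul, norm_inv, norm_norm]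

/-! ### Seeley's extension across a hyperplane. -/

section Seeley

variable {E : Type*} [NormedAddCommGroup E] [NormedSpace ℝ E]

/-- The linear map that multiplies the `e`-component by `c`, where `ℓ e = 1`. -/
def stretchAlong (ℓ : E →L[ℝ] ℝ) (e : E) (c : ℝ) : E →L[ℝ] E :=
  ContinuousLinearMap.id ℝ E + (c - 1) • ℓ.smulRight e

lemma stretchAlong_apply (ℓ : E →L[ℝ] ℝ) (e : E) (c : ℝ) (x : E) :
    stretchAlong ℓ e c x = x + ((c - 1) * ℓ x) • e := by
  simp [stretchAlong, smul_smul]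

lemma norm_stretchAlong_le (ℓ : E →L[ℝ] ℝ) (e : E) (k : ℕ) :
    ‖stretchAlong ℓ e (-2 ^ k)‖ ≤ (1 + 2 * ‖ℓ.smulRight e‖) * 2 ^ k := by
  have h1 : (1 : ℝ) ≤ 2 ^ k := one_le_pow₀ (by norm_num)
  have h2 : ‖(-2 ^ k - 1 : ℝ)‖ ≤ 2 * 2 ^ k := by
    rw [Real.norm_eq_abs, abs_of_neg (by linarith)]; linarith
  calc ‖stretchAlong ℓ e (-2 ^ k)‖ ≤ ‖ContinuousLinearMap.id ℝ E‖ +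
        ‖(-2 ^ k - 1 : ℝ) • ℓ.smulRight e‖ := norm_add_le _ _
    _ ≤ 1 + 2 * 2 ^ k * ‖ℓ.smulRight e‖ := by
        gcongr
        · exact ContinuousLinearMap.norm_id_le
        · rw [norm_smul]; gcongr
    _ ≤ _ := by nlinarith

/-- One step of Seeley's extension: a function with bounded derivatives of all orders on the part
`ℓ ≥ 0` of a convex set that is invariant under translation in a direction `e` transverse to
`ℓ = 0` extends to the whole set. -/
theorem exists_extension_across {ℓ : E →L[ℝ] ℝ} {e : E} (he : ℓ e = 1) {K : Set E}
    (hK : Convex ℝ K) (hKe : ∀ x ∈ K, ∀ c : ℝ, x + c • e ∈ K)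
    {f : E → ℝ} {p : E → FormalMultilinearSeries ℝ E ℝ}
    (hp : HasFTaylorSeriesUpToOn ∞ f p (K ∩ {x | 0 ≤ ℓ x}))
    (hb : ∀ m, ∃ C, ∀ x ∈ K ∩ {x | 0 ≤ ℓ x}, ‖p x m‖ ≤ C) :
    ∃ (g : E → ℝ) (q : E → FormalMultilinearSeries ℝ E ℝ),
      HasFTaylorSeriesUpToOn ∞ g q K ∧ (∀ m, ∃ C, ∀ x ∈ K, ‖q x m‖ ≤ C) ∧
      EqOn g f (K ∩ {x | 0 ≤ ℓ x}) := by
  classical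
  obtain ⟨a, ha, ha1⟩ := exists_seeley
  set L : ℕ → E →L[ℝ] E := fun k => stretchAlong ℓ e (-2 ^ k) with hL
  set Kp : Set E := K ∩ {x | 0 ≤ ℓ x} with hKp
  set Km : Set E := K ∩ {x | ℓ x ≤ 0} with hKm
  have hℓL : ∀ k x, ℓ (L k x) = -2 ^ k * ℓ x := by
    intro k x
    rw [hL, stretchAlong_apply, map_add, map_smul, he, smul_eq_mul]
    ring
  have hmaps : ∀ k, Km ⊆ L k ⁻¹' Kp := by
    intro k x hx
    refine ⟨?_, ?_⟩
    · rw [hL, stretchAlong_apply]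
      exact hKe x hx.1 _
    · change 0 ≤ ℓ (L k x)
      rw [hℓL]
      have := hx.2
      have h2 : (0 : ℝ) < 2 ^ k := by positivity
      simp only [mem_ofPred_eq] at this
      nlinarith
  have hKmc : Convex ℝ Km := hK.inter (convex_halfSpace_le ℓ.isLinear 0)
  -- These are the Taylor coefficients of `a k • f ∘ L k`. On the side `ℓ ≤ 0`, which every `L k`
  -- maps to the side where `f` is given, the extension is the sum of these functions.
  set T : ℕ → E → FormalMultilinearSeries ℝ E ℝ := fun k x m =>
    a k • (p (L k x) m).compContinuousLinearMap fun _ => L k with hT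
  set A : ℝ := 1 + 2 * ‖ℓ.smulRight e‖ with hA
  have hA0 : 0 ≤ A := by positivity
  choose C hC using hb
  have hTb : ∀ m k, ∀ x ∈ Km, ‖T k x m‖ ≤ C m * A ^ m * (|a k| * (2 ^ k) ^ m) := by
    intro m k x hx
    have h1 : ‖p (L k x) m‖ ≤ C m := hC m _ (hmaps k hx)
    have h2 : ‖L k‖ ≤ A * 2 ^ k := norm_stretchAlong_le ℓ e k
    calc ‖T k x m‖ = |a k| * ‖(p (L k x) m).compContinuousLinearMap fun _ => L k‖ := by
          rw [hT, norm_smul, Real.norm_eq_abs]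
      _ ≤ |a k| * (‖p (L k x) m‖ * ∏ _i : Fin m, ‖L k‖) := by
          gcongr
          exact ContinuousMultilinearMap.norm_compContinuousLinearMap_le _ _
      _ ≤ |a k| * (C m * (A * 2 ^ k) ^ m) := by
          rw [Finset.prod_const, Finset.card_univ, Fintype.card_fin]
          have := (norm_nonneg _).trans h1
          gcongr
      _ = _ := by rw [mul_pow]; ring
  have hTs : ∀ m, Summable fun k => C m * A ^ m * (|a k| * ((2 : ℝ) ^ k) ^ m) :=
    fun m => (ha m).mul_left _
  have hTsum : ∀ m, ∀ x ∈ Km, Summable fun k => T k x m := fun m x hx =>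
    Summable.of_norm_bounded (hTs m) fun k => hTb m k x hx
  -- on the hyperplane both definitions agree
  have hmatch : ∀ m, ∀ x ∈ Km, 0 ≤ ℓ x → ∑' k, T k x m = p x m := by
    intro m x hx hx0
    have hx00 : ℓ x = 0 := le_antisymm hx.2 hx0
    have hLx : ∀ k, L k x = x := by
      intro k; rw [hL, stretchAlong_apply, hx00]; simp
    ext v
    have happ : (∑' k, T k x m) v = ∑' k, T k x m v :=
      ContinuousLinearMap.map_tsum (ContinuousMultilinearMap.apply ℝ (fun _ : Fin m => E) ℝ v)
        (hTsum m x hx)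
    rw [happ]
    -- Each vector is split into its component along `e`, which `L k` multiplies by `-2 ^ k`, and a
    -- component that `L k` fixes. In the multilinear expansion the term with the `e`-components in
    -- the slots `s` acquires the factor `(-2 ^ k) ^ s.card`, and these factors sum to `1` against
    -- `a k`.
    have hLv : ∀ k, (fun i => L k (v i)) =
        (fun i => (-2 ^ k : ℝ) • (ℓ (v i) • e)) + fun i => v i - ℓ (v i) • e := by
      intro k
      funext i
      rw [hL, stretchAlong_apply, Pi.add_apply, smul_smul, sub_mul, one_mul, sub_smul]
      abel
    have hexp : ∀ k, T k x m v = ∑ s : Finset (Fin m), a k * (-2 ^ k : ℝ) ^ s.card *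
        p x m (s.piecewise (fun i => ℓ (v i) • e) fun i => v i - ℓ (v i) • e) := by
      intro k
      change a k • (p (L k x) m) (fun i => L k (v i)) = _
      rw [hLx, hLv, ContinuousMultilinearMap.map_add_univ, Finset.smul_sum]
      refine Finset.sum_congr rfl fun s _ => ?_
      have : s.piecewise (fun i => (-2 ^ k : ℝ) • (ℓ (v i) • e)) (fun i => v i - ℓ (v i) • e) =
          s.piecewise (fun i => (fun _ => (-2 ^ k : ℝ)) i • s.piecewise (fun i => ℓ (v i) • e)
            (fun i => v i - ℓ (v i) • e) i)
            (s.piecewise (fun i => ℓ (v i) • e) fun i => v i - ℓ (v i) • e) := by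
        funext i
        by_cases hi : i ∈ s <;> simp [hi]
      rw [this]
      erw [ContinuousMultilinearMap.map_piecewise_smul]
      rw [Finset.prod_const, smul_smul, smul_eq_mul]
    simp_rw [hexp]
    have hsm : ∀ s : Finset (Fin m), Summable fun k => a k * (-2 ^ k : ℝ) ^ s.card := by
      intro s
      refine Summable.of_norm_bounded (ha s.card) fun k => ?_
      rw [norm_mul, norm_pow, norm_neg, norm_pow, Real.norm_eq_abs]
      simp
    rw [Summable.tsum_finsetSum (fun s _ => (hsm s).mul_right _)]
    simp_rw [tsum_mul_right, ha1, one_mul]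
    have := ContinuousMultilinearMap.map_add_univ (p x m) (fun i => ℓ (v i) • e)
      (fun i => v i - ℓ (v i) • e)
    rw [← this]
    congr 1
    funext i
    simp
  set q : E → FormalMultilinearSeries ℝ E ℝ := fun x m =>
    if 0 ≤ ℓ x then p x m else ∑' k, T k x m with hq
  have hqp : ∀ m, ∀ x ∈ Kp, q x m = p x m := fun m x hx => if_pos hx.2
  have hqm : ∀ m, ∀ x ∈ Km, q x m = ∑' k, T k x m := by
    intro m x hx
    by_cases h : 0 ≤ ℓ x
    · rw [hmatch m x hx h]; exact if_pos h
    · exact if_neg h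
  have hunion : K = Kp ∪ Km := by
    ext x
    constructor
    · intro hx
      rcases le_total 0 (ℓ x) with h | h
      · exact Or.inl ⟨hx, h⟩
      · exact Or.inr ⟨hx, h⟩
    · rintro (h | h) <;> exact h.1
  have hclp : IsClosed {x : E | 0 ≤ ℓ x} := isClosed_le continuous_const ℓ.continuous
  have hclm : IsClosed {x : E | ℓ x ≤ 0} := isClosed_le ℓ.continuous continuous_const
  have hderp : ∀ m, ∀ x ∈ Kp, HasFDerivWithinAt (fun y => q y m) (q x (m + 1)).curryLeft Kp x := by
    intro m x hx
    rw [hqp _ x hx]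
    exact (hp.fderivWithin m (by exact_mod_cast WithTop.coe_lt_top _) x hx).congr
      (fun y hy => hqp m y hy) (hqp m x hx)
  have hTser : ∀ k m, ∀ x ∈ Km,
      HasFDerivWithinAt (fun y => T k y m) (T k x (m + 1)).curryLeft Km x := by
    intro k m x hx
    have h := ((hp.compContinuousLinearMap (L k)).mono (hmaps k)).fderivWithin m
      (by exact_mod_cast WithTop.coe_lt_top _) x hx
    exact h.const_smul (a k)
  have hderm : ∀ m, ∀ x ∈ Km, HasFDerivWithinAt (fun y => q y m) (q x (m + 1)).curryLeft Km x := by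
    intro m x hx
    rw [hqm _ x hx]
    have hcur : (∑' k, T k x (m + 1)).curryLeft = ∑' k, (T k x (m + 1)).curryLeft :=
      ContinuousLinearMap.map_tsum
        (continuousMultilinearCurryLeftEquiv ℝ (fun _ : Fin (m + 1) => E)
          ℝ).toContinuousLinearEquiv.toContinuousLinearMap (hTsum (m + 1) x hx)
    rw [hcur]
    refine HasFDerivWithinAt.congr ?_ (fun y hy => hqm m y hy) (hqm m x hx)
    refine hasFDerivWithinAt_tsum_of_convex hKmc (hTs (m + 1)) (fun k y hy => hTser k m y hy)
      (fun k y hy => ?_) (fun y hy => hTsum m y hy) hx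
    rw [ContinuousMultilinearMap.curryLeft_norm]
    exact hTb (m + 1) k y hy
  refine ⟨fun x => (q x 0).curry0, q, ?_, ?_, ?_⟩
  · refine (hasFTaylorSeriesUpToOn_top_iff' le_rfl).2 ⟨fun _ _ => rfl, fun m x hx => ?_⟩
    -- The derivative on `K` is assembled from the derivatives within the two closed halves. At a
    -- point outside the closure of a half, the derivative within that half is no condition.
    have hP : HasFDerivWithinAt (fun y => q y m) (q x (m + 1)).curryLeft Kp x := by
      by_cases h : 0 ≤ ℓ x
      · exact hderp m x ⟨hx, h⟩
      · refine HasFDerivWithinAt.of_notMem_closure fun hc => h ?_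
        exact (closure_minimal inter_subset_right hclp) hc
    have hM : HasFDerivWithinAt (fun y => q y m) (q x (m + 1)).curryLeft Km x := by
      by_cases h : ℓ x ≤ 0
      · exact hderm m x ⟨hx, h⟩
      · refine HasFDerivWithinAt.of_notMem_closure fun hc => h ?_
        exact (closure_minimal inter_subset_right hclm) hc
    rw [hunion]
    exact hP.union hM
  · intro m
    refine ⟨max (C m) (∑' k, C m * A ^ m * (|a k| * ((2 : ℝ) ^ k) ^ m)), fun x hx => ?_⟩
    by_cases h : 0 ≤ ℓ x
    · rw [hqp m x ⟨hx, h⟩]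
      exact (hC m x ⟨hx, h⟩).trans (le_max_left _ _)
    · have hxm : x ∈ Km := ⟨hx, (not_le.1 h).le⟩
      rw [hqm m x hxm]
      exact (tsum_of_norm_bounded (hTs m).hasSum fun k => hTb m k x hxm).trans (le_max_right _ _)
  · intro x hx
    change (q x 0).curry0 = f x
    rw [hqp 0 x hx]
    exact hp.zero_eq x hx

end Seeley

/-! ### Extension of smooth functions from the orthant. -/

/-- The closed positive orthant of `ℝ⁴`. -/
def orthant : Set (EuclideanSpace ℝ (Fin 4)) := {x | ∀ i, 0 ≤ x i}

lemma convex_orthantFrom (n : ℕ) :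
    Convex ℝ {x : EuclideanSpace ℝ (Fin 4) | ∀ i : Fin 4, n ≤ i.1 → 0 ≤ x i} := by
  intro x hx y hy a b ha hb _ i hi
  have h1 := hx i hi
  have h2 := hy i hi
  simp only [PiLp.add_apply, PiLp.smul_apply, smul_eq_mul]
  positivity

lemma uniqueDiffOn_orthant : UniqueDiffOn ℝ orthant := by
  have h := (modelWithCornersEuclideanQuadrant 4).uniqueDiffOn
  rwa [show range (modelWithCornersEuclideanQuadrant 4) = orthant from range_euclideanQuadrant 4] at h

/-- A function with bounded derivatives of all orders on the orthant extends to a smooth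
function. -/
lemma exists_extension_of_taylor {f : EuclideanSpace ℝ (Fin 4) → ℝ}
    {p : EuclideanSpace ℝ (Fin 4) → FormalMultilinearSeries ℝ (EuclideanSpace ℝ (Fin 4)) ℝ}
    (hp : HasFTaylorSeriesUpToOn ∞ f p orthant) (hb : ∀ m, ∃ C, ∀ x ∈ orthant, ‖p x m‖ ≤ C) :
    ∃ g : EuclideanSpace ℝ (Fin 4) → ℝ, ContDiff ℝ ∞ g ∧ EqOn g f orthant := by
  -- At stage `n` only the inequalities with index at least `n` are left. Each step crosses one
  -- coordinate hyperplane in the direction of that coordinate, which the remaining inequalities do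
  -- not see.
  have key : ∀ n : ℕ, n ≤ 4 → ∃ (g : EuclideanSpace ℝ (Fin 4) → ℝ)
      (q : EuclideanSpace ℝ (Fin 4) → FormalMultilinearSeries ℝ (EuclideanSpace ℝ (Fin 4)) ℝ),
      HasFTaylorSeriesUpToOn ∞ g q {x | ∀ i : Fin 4, n ≤ i.1 → 0 ≤ x i} ∧
      (∀ m, ∃ C, ∀ x ∈ {x : EuclideanSpace ℝ (Fin 4) | ∀ i : Fin 4, n ≤ i.1 → 0 ≤ x i},
        ‖q x m‖ ≤ C) ∧ EqOn g f orthant := by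
    intro n
    induction n with
    | zero =>
      intro _
      have : {x : EuclideanSpace ℝ (Fin 4) | ∀ i : Fin 4, 0 ≤ i.1 → 0 ≤ x i} = orthant := by
        ext x; simp [orthant]
      rw [this]
      exact ⟨f, p, hp, hb, fun _ _ => rfl⟩
    | succ n ih =>
      intro hn
      obtain ⟨g, q, hg, hq, hgf⟩ := ih (by omega)
      have hset : {x : EuclideanSpace ℝ (Fin 4) | ∀ i : Fin 4, n ≤ i.1 → 0 ≤ x i} =
          {x : EuclideanSpace ℝ (Fin 4) | ∀ i : Fin 4, n + 1 ≤ i.1 → 0 ≤ x i} ∩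
            {x | 0 ≤ EuclideanSpace.proj (𝕜 := ℝ) (⟨n, by omega⟩ : Fin 4) x} := by
        ext x
        constructor
        · intro h
          exact ⟨fun i hi => h i (by omega), h ⟨n, by omega⟩ le_rfl⟩
        · rintro ⟨h1, h2⟩ i hi
          rcases hi.eq_or_lt with h | h
          · have : i = ⟨n, by omega⟩ := Fin.ext h.symm
            rw [this]; exact h2
          · exact h1 i h
      rw [hset] at hg hq
      obtain ⟨g', q', h1, h2, h3⟩ := exists_extension_across
        (e := EuclideanSpace.single (⟨n, by omega⟩ : Fin 4) (1 : ℝ)) (by simp)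
        (convex_orthantFrom (n + 1)) (by
          intro x hx c i hi
          have hne : i ≠ ⟨n, by omega⟩ := by
            intro h; rw [h] at hi; simp at hi
          have := hx i hi
          simpa [hne] using this) hg hq
      refine ⟨g', q', h1, h2, fun x hx => ?_⟩
      rw [h3 ⟨fun i _ => hx i, hx _⟩, hgf hx]
  obtain ⟨g, q, hg, _, hgf⟩ := key 4 le_rfl
  have : {x : EuclideanSpace ℝ (Fin 4) | ∀ i : Fin 4, 4 ≤ i.1 → 0 ≤ x i} = univ := by
    ext x
    simp only [mem_univ, iff_true]
    intro i hi
    omega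
  rw [this] at hg
  exact ⟨g, contDiffOn_univ.1 (HasFTaylorSeriesUpToOn.contDiffOn (n := ⊤) hg), hgf⟩

/-- A function that is smooth on the orthant near a point extends, near this point, to a smooth
function. -/
theorem exists_contDiff_of_contDiffOn_orthant {f : EuclideanSpace ℝ (Fin 4) → ℝ}
    {U : Set (EuclideanSpace ℝ (Fin 4))} (hU : IsOpen U) {x : EuclideanSpace ℝ (Fin 4)}
    (hx : x ∈ U) (hf : ContDiffOn ℝ ∞ f (orthant ∩ U)) :
    ∃ g : EuclideanSpace ℝ (Fin 4) → ℝ, ContDiff ℝ ∞ g ∧ ∀ᶠ y in 𝓝[orthant] x, g y = f y := by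
  obtain ⟨r, hr, hrU⟩ := Metric.isOpen_iff.1 hU x hx
  -- After the cut-off all derivatives within the orthant are continuous and vanish outside a
  -- compact set, hence are bounded, as the extension requires.
  let φ : ContDiffBump x := ⟨r / 4, r / 2, by positivity, by linarith⟩
  have hcb : Metric.closedBall x (r / 2) ⊆ U :=
    (Metric.closedBall_subset_ball (by linarith)).trans hrU
  have hzero : ∀ y, y ∉ Metric.closedBall x (r / 2) → (fun z => φ z * f z) =ᶠ[𝓝 y] 0 := by
    intro y hy
    filter_upwards [Metric.isClosed_closedBall.isOpen_compl.mem_nhds hy] with z hz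
    have : φ z = 0 := φ.zero_of_le_dist (by
      have : ¬ dist z x ≤ r / 2 := hz
      exact (not_le.1 this).le)
    simp [this]
  have hsm : ContDiffOn ℝ ∞ (fun z => φ z * f z) orthant := by
    intro y hy
    by_cases hyc : y ∈ Metric.closedBall x (r / 2)
    · have h1 : ContDiffWithinAt ℝ ∞ f orthant y :=
        (hf y ⟨hy, hcb hyc⟩).mono_of_mem_nhdsWithin
          (inter_mem self_mem_nhdsWithin (mem_nhdsWithin_of_mem_nhds (hU.mem_nhds (hcb hyc))))
      exact φ.contDiff.contDiffAt.contDiffWithinAt.mul h1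
    · exact (contDiffAt_const (c := (0 : ℝ))).contDiffWithinAt.congr_of_eventuallyEq
        (mem_nhdsWithin_of_mem_nhds (hzero y hyc)) (hzero y hyc).self_of_nhds
  have hclosed : IsClosed orthant := by
    have : orthant = ⋂ i, {x : EuclideanSpace ℝ (Fin 4) | 0 ≤ x i} := by
      ext y; simp [orthant]
    rw [this]
    exact isClosed_iInter fun i => isClosed_le continuous_const (by fun_prop)
  have hb : ∀ m : ℕ, ∃ C, ∀ y ∈ orthant,
      ‖ftaylorSeriesWithin ℝ (fun z => φ z * f z) orthant y m‖ ≤ C := by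
    intro m
    have hcont := hsm.continuousOn_iteratedFDerivWithin (m := m)
      (by exact_mod_cast le_top) uniqueDiffOn_orthant
    obtain ⟨C, hC⟩ := ((isCompact_closedBall x (r / 2)).inter_left hclosed).exists_bound_of_continuousOn
      (hcont.mono inter_subset_left)
    refine ⟨max C 0, fun y hy => ?_⟩
    by_cases hyc : y ∈ Metric.closedBall x (r / 2)
    · exact (hC y ⟨hy, hyc⟩).trans (le_max_left _ _)
    · have h0 : iteratedFDerivWithin ℝ m (fun z => φ z * f z) orthant y =
          iteratedFDerivWithin ℝ m (0 : EuclideanSpace ℝ (Fin 4) → ℝ) orthant y :=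
        Filter.EventuallyEq.iteratedFDerivWithin_eq (mem_nhdsWithin_of_mem_nhds (hzero y hyc))
          (hzero y hyc).self_of_nhds m
      have h00 : iteratedFDerivWithin ℝ m (0 : EuclideanSpace ℝ (Fin 4) → ℝ) orthant y = 0 := by
        rw [iteratedFDerivWithin_zero]; rfl
      change ‖iteratedFDerivWithin ℝ m (fun z => φ z * f z) orthant y‖ ≤ _
      rw [h0, h00, norm_zero]
      exact le_max_right _ _
  obtain ⟨g, hg, hgf⟩ := exists_extension_of_taylor (hsm.ftaylorSeriesWithin uniqueDiffOn_orthant) hb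
  refine ⟨g, hg, ?_⟩
  have h1 : ∀ᶠ y in 𝓝[orthant] x, φ y = 1 := mem_nhdsWithin_of_mem_nhds φ.eventuallyEq_one
  filter_upwards [h1, self_mem_nhdsWithin] with y hy hyQ
  rw [hgf hyQ]
  change φ y * f y = f y
  rw [hy, one_mul]

/-! ### Smoothness on a whole neighbourhood, which is stronger than `ContDiffAt ℝ ∞` at the point.
-/

section SmoothNear

variable {E F G : Type*} [NormedAddCommGroup E] [NormedSpace ℝ E] [NormedAddCommGroup F]
  [NormedSpace ℝ F] [NormedAddCommGroup G] [NormedSpace ℝ G]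

/-- `f` is smooth in a neighbourhood of `x`. -/
def SmoothNear (f : E → F) (x : E) : Prop := ∀ᶠ y in 𝓝 x, ContDiffAt ℝ ∞ f y

lemma SmoothNear.contDiffAt {f : E → F} {x : E} (h : SmoothNear f x) : ContDiffAt ℝ ∞ f x :=
  h.self_of_nhds

lemma SmoothNear.continuousAt {f : E → F} {x : E} (h : SmoothNear f x) : ContinuousAt f x :=
  h.contDiffAt.continuousAt

lemma ContDiff.smoothNear {f : E → F} (h : ContDiff ℝ ∞ f) (x : E) : SmoothNear f x :=
  Eventually.of_forall fun _ => h.contDiffAt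

lemma SmoothNear.of_isOpen {f : E → F} {U : Set E} (hU : IsOpen U)
    (h : ∀ y ∈ U, ContDiffAt ℝ ∞ f y) {x : E} (hx : x ∈ U) : SmoothNear f x := by
  filter_upwards [hU.mem_nhds hx] with y hy using h y hy

lemma SmoothNear.comp {g : F → G} {f : E → F} {x : E} (hg : SmoothNear g (f x))
    (hf : SmoothNear f x) : SmoothNear (g ∘ f) x := by
  filter_upwards [hf, hf.continuousAt.eventually hg] with y h1 h2 using h2.comp y h1

lemma SmoothNear.prodMk {f : E → F} {g : E → G} {x : E} (hf : SmoothNear f x)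
    (hg : SmoothNear g x) : SmoothNear (fun y => (f y, g y)) x := by
  filter_upwards [hf, hg] with y h1 h2 using h1.prodMk h2

lemma SmoothNear.congr {f g : E → F} {x : E} (hf : SmoothNear f x) (h : g =ᶠ[𝓝 x] f) :
    SmoothNear g x := by
  filter_upwards [hf, eventually_eventually_nhds.2 h] with y h1 h2 using h1.congr_of_eventuallyEq h2

/-- A function that is smooth near a point agrees there with a globally smooth function. -/
lemma SmoothNear.exists_contDiff [FiniteDimensional ℝ E] {f : E → ℝ} {x : E}
    (hf : SmoothNear f x) : ∃ g : E → ℝ, ContDiff ℝ ∞ g ∧ g =ᶠ[𝓝 x] f := by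
  obtain ⟨r, hr, hb⟩ := Metric.eventually_nhds_iff_ball.1 hf
  let φ : ContDiffBump x := ⟨r / 4, r / 2, by positivity, by linarith⟩
  refine ⟨fun y => φ y * f y, contDiff_iff_contDiffAt.2 fun y => ?_, ?_⟩
  · by_cases hy : y ∈ Metric.ball x r
    · exact φ.contDiff.contDiffAt.mul (hb y hy)
    · have hy' : r ≤ dist y x := not_lt.1 hy
      have : (fun z => φ z * f z) =ᶠ[𝓝 y] fun _ => 0 := by
        have hy'' : y ∈ (Metric.closedBall x (r / 2))ᶜ := by
          simp only [mem_compl_iff, Metric.mem_closedBall, not_le]; linarith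
        filter_upwards [Metric.isClosed_closedBall.isOpen_compl.mem_nhds hy''] with z hz
        have : φ z = 0 := φ.zero_of_le_dist (by
          have : ¬ dist z x ≤ r / 2 := hz
          exact (not_le.1 this).le)
        simp [this]
      exact contDiffAt_const.congr_of_eventuallyEq this
  · filter_upwards [φ.eventuallyEq_one] with y hy
    rw [hy, Pi.one_apply, one_mul]

/-- Inverse function theorem, with smoothness on the whole source and target. -/
lemma SmoothNear.exists_openPartialHomeomorph [CompleteSpace E] {f : E → F} {x : E}
    (hf : SmoothNear f x) {e : E ≃L[ℝ] F} (he : HasFDerivAt f (e : E →L[ℝ] F) x) {V : Set E}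
    (hV : V ∈ 𝓝 x) :
    ∃ Φ : OpenPartialHomeomorph E F, (Φ : E → F) = f ∧ x ∈ Φ.source ∧ Φ.source ⊆ V ∧
      ContDiffOn ℝ ∞ Φ Φ.source ∧ ContDiffOn ℝ ∞ Φ.symm Φ.target := by
  have h0 : (∞ : WithTop ℕ∞) ≠ 0 := by simp
  let Ψ := hf.contDiffAt.toOpenPartialHomeomorph f he h0
  -- Invertibility of the differential is an open condition. On a small enough source the inverse is
  -- therefore smooth on all of the target.
  have hinv : ∀ᶠ y in 𝓝 x, fderiv ℝ f y ∈ range ((↑) : (E ≃L[ℝ] F) → E →L[ℝ] F) := by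
    have hc : ContinuousAt (fderiv ℝ f) x :=
      (hf.contDiffAt.fderiv_right (m := 0) (by simp)).continuousAt
    apply hc.eventually
    rw [he.fderiv]
    exact ContinuousLinearEquiv.nhds e
  obtain ⟨U, hUsub, hUo, hxU⟩ := mem_nhds_iff.1 (inter_mem (inter_mem hf hinv) hV)
  refine ⟨Ψ.restrOpen U hUo, rfl,
    ⟨hf.contDiffAt.mem_toOpenPartialHomeomorph_source he h0, hxU⟩, fun y hy => (hUsub hy.2).2,
    fun y hy => ?_, fun z hz => ?_⟩
  · have h : ContDiffAt ℝ ∞ f y := (hUsub hy.2).1.1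
    exact h.contDiffWithinAt
  have hzs : (Ψ.restrOpen U hUo).symm z ∈ (Ψ.restrOpen U hUo).source :=
    (Ψ.restrOpen U hUo).map_target hz
  obtain ⟨e', he'⟩ := (hUsub hzs.2).1.2
  have hcd : ContDiffAt ℝ ∞ f ((Ψ.restrOpen U hUo).symm z) := (hUsub hzs.2).1.1
  refine ((Ψ.restrOpen U hUo).contDiffAt_symm hz (f₀' := e') ?_ hcd).contDiffWithinAt
  rw [he']
  exact (hcd.differentiableAt h0).hasFDerivAt

end SmoothNear

/-! ### Subsets locally diffeomorphic to the orthant, as manifolds with corners. -/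

section CornerSets

variable {E : Type} [NormedAddCommGroup E] [NormedSpace ℝ E]

/-- Near `x`, the set `S` looks like the orthant near a point with `d` vanishing coordinates. -/
def CornerAt (S : Set E) (x : E) (d : ℕ) : Prop :=
  ∃ Φ : OpenPartialHomeomorph E (EuclideanSpace ℝ (Fin 4)), x ∈ Φ.source ∧
    ContDiffOn ℝ ∞ Φ Φ.source ∧ ContDiffOn ℝ ∞ Φ.symm Φ.target ∧
    (∀ y ∈ Φ.source, y ∈ S ↔ Φ y ∈ orthant) ∧ Set.ncard {i : Fin 4 | Φ x i = 0} = d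

open Classical in
/-- The chart of `S` induced by an ambient chart that straightens `S`. -/
def restrictChart {S : Set E} (Φ : OpenPartialHomeomorph E (EuclideanSpace ℝ (Fin 4)))
    (hS : ∀ y ∈ Φ.source, y ∈ S ↔ Φ y ∈ orthant) (x₀ : S) :
    OpenPartialHomeomorph S (EuclideanQuadrant 4) where
  -- The origin here, and `x₀` in the inverse, are default values. They are never taken on the
  -- source and on the target.
  toFun y := if h : Φ y ∈ orthant then ⟨Φ y, fun i => h i⟩ else ⟨0, by simp⟩
  invFun q := if h : Φ.symm q.1 ∈ S then ⟨Φ.symm q.1, h⟩ else x₀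
  source := Subtype.val ⁻¹' Φ.source
  target := Subtype.val ⁻¹' Φ.target
  map_source' y hy := by
    have h : Φ y ∈ orthant := (hS y hy).1 y.2
    simp only [h, dif_pos, mem_preimage]
    exact Φ.map_source hy
  map_target' q hq := by
    have h1 : Φ.symm q.1 ∈ Φ.source := Φ.map_target hq
    have h : Φ.symm q.1 ∈ S := (hS _ h1).2 (by rw [Φ.right_inv hq]; exact q.2)
    simp only [h, dif_pos, mem_preimage]
    exact h1
  left_inv' y hy := by
    have h : Φ y ∈ orthant := (hS y hy).1 y.2
    have h2 : Φ.symm (Φ y) = y := Φ.left_inv hy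
    simp only [h, dif_pos]
    rw [dif_pos (by rw [h2]; exact y.2)]
    exact Subtype.ext h2
  right_inv' q hq := by
    have h1 : Φ.symm q.1 ∈ Φ.source := Φ.map_target hq
    have h2 : Φ (Φ.symm q.1) = q.1 := Φ.right_inv hq
    have h : Φ.symm q.1 ∈ S := (hS _ h1).2 (by rw [h2]; exact q.2)
    simp only [h, dif_pos]
    rw [dif_pos (by rw [h2]; exact q.2)]
    exact Subtype.ext h2
  open_source := Φ.open_source.preimage continuous_subtype_val
  open_target := Φ.open_target.preimage continuous_subtype_val
  continuousOn_toFun := by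
    have hind : Topology.IsInducing (Subtype.val : EuclideanQuadrant 4 → _) := .subtypeVal
    refine hind.continuousOn_iff.2 ?_
    refine (Φ.continuousOn.comp continuous_subtype_val.continuousOn fun y hy => hy).congr
      fun y hy => ?_
    have h : Φ y ∈ orthant := (hS y hy).1 y.2
    simp [h]
  continuousOn_invFun := by
    rw [Topology.IsInducing.subtypeVal.continuousOn_iff]
    refine (Φ.continuousOn_symm.comp continuous_subtype_val.continuousOn fun y hy => hy).congr
      fun q hq => ?_
    have h1 : Φ.symm q.1 ∈ Φ.source := Φ.map_target hq
    have h : Φ.symm q.1 ∈ S := (hS _ h1).2 (by rw [Φ.right_inv hq]; exact q.2)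
    simp [h]

lemma restrictChart_val {S : Set E} (Φ : OpenPartialHomeomorph E (EuclideanSpace ℝ (Fin 4)))
    (hS : ∀ y ∈ Φ.source, y ∈ S ↔ Φ y ∈ orthant) (x₀ : S) {y : S} (hy : (y : E) ∈ Φ.source) :
    (restrictChart Φ hS x₀ y).1 = Φ y := by
  have h : Φ y ∈ orthant := (hS y hy).1 y.2
  simp [restrictChart, h]

lemma restrictChart_symm_val {S : Set E} (Φ : OpenPartialHomeomorph E (EuclideanSpace ℝ (Fin 4)))
    (hS : ∀ y ∈ Φ.source, y ∈ S ↔ Φ y ∈ orthant) (x₀ : S) {q : EuclideanQuadrant 4}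
    (hq : q.1 ∈ Φ.target) : ((restrictChart Φ hS x₀).symm q : E) = Φ.symm q.1 := by
  have h1 : Φ.symm q.1 ∈ Φ.source := Φ.map_target hq
  have h : Φ.symm q.1 ∈ S := (hS _ h1).2 (by rw [Φ.right_inv hq]; exact q.2)
  have h3 : (restrictChart Φ hS x₀).symm q = (⟨Φ.symm q.1, h⟩ : S) := dif_pos h
  rw [h3]

variable (E) in
/-- A subset of a normed space that is locally diffeomorphic to the orthant of `ℝ⁴`, together with
the number `dep x` of boundary faces through every point `x`. -/
structure CornerSet where
  S : Set E
  dep : E → ℕ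
  corner : ∀ x ∈ S, CornerAt S x (dep x)

namespace CornerSet

variable (C : CornerSet E)

/-- The chosen straightening of `C.S` near `x`. -/
def straighten (x : C.S) : OpenPartialHomeomorph E (EuclideanSpace ℝ (Fin 4)) :=
  (C.corner x x.2).choose

lemma straighten_spec (x : C.S) : (x : E) ∈ (C.straighten x).source ∧
    ContDiffOn ℝ ∞ (C.straighten x) (C.straighten x).source ∧
    ContDiffOn ℝ ∞ (C.straighten x).symm (C.straighten x).target ∧
    (∀ y ∈ (C.straighten x).source, y ∈ C.S ↔ C.straighten x y ∈ orthant) ∧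
    Set.ncard {i : Fin 4 | C.straighten x x i = 0} = C.dep x :=
  (C.corner x x.2).choose_spec

/-- The chart of `C.S` at `x`. -/
def chart (x : C.S) : OpenPartialHomeomorph C.S (EuclideanQuadrant 4) :=
  restrictChart (C.straighten x) (C.straighten_spec x).2.2.2.1 x

instance : ChartedSpace (EuclideanQuadrant 4) C.S where
  atlas := range C.chart
  chartAt := C.chart
  mem_chart_source x := (C.straighten_spec x).1
  chart_mem_atlas x := mem_range_self x

lemma chart_val {x y : C.S} (hy : (y : E) ∈ (C.straighten x).source) :
    (C.chart x y).1 = C.straighten x y := restrictChart_val _ _ _ hy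

lemma chart_symm_val {x : C.S} {q : EuclideanQuadrant 4} (hq : q.1 ∈ (C.straighten x).target) :
    ((C.chart x).symm q : E) = (C.straighten x).symm q.1 := restrictChart_symm_val _ _ _ hq

lemma depth_eq (x : C.S) : depth x = C.dep x := by
  rw [← (C.straighten_spec x).2.2.2.2]
  unfold depth
  congr 1
  ext i
  change (C.chart x x).1 i = 0 ↔ _
  rw [C.chart_val (C.straighten_spec x).1]
  rfl

/-- Every coordinate change is a restriction of a composite of smooth ambient straightenings. -/
instance : IsManifold (modelWithCornersEuclideanQuadrant 4) ∞ C.S := by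
  refine isManifold_of_contDiffOn _ _ _ ?_
  rintro _ _ ⟨x, rfl⟩ ⟨x', rfl⟩
  have hsymm : ∀ v ∈ (modelWithCornersEuclideanQuadrant 4).symm ⁻¹'
      ((C.chart x).symm ≫ₕ C.chart x').source ∩ range (modelWithCornersEuclideanQuadrant 4),
      ((modelWithCornersEuclideanQuadrant 4).symm v).1 = v := by
    rintro v ⟨_, hv⟩
    exact (modelWithCornersEuclideanQuadrant 4).right_inv hv
  have hmem : ∀ v ∈ (modelWithCornersEuclideanQuadrant 4).symm ⁻¹'
      ((C.chart x).symm ≫ₕ C.chart x').source ∩ range (modelWithCornersEuclideanQuadrant 4),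
      v ∈ (C.straighten x).target ∧ (C.straighten x).symm v ∈ (C.straighten x').source := by
    intro v hv
    have hv1 := hv.1
    rw [mem_preimage, OpenPartialHomeomorph.trans_source] at hv1
    obtain ⟨h1, h2⟩ := hv1
    have h1' : ((modelWithCornersEuclideanQuadrant 4).symm v).1 ∈ (C.straighten x).target := h1
    have h2' : ((C.chart x).symm ((modelWithCornersEuclideanQuadrant 4).symm v) : E) ∈
      (C.straighten x').source := h2
    rw [C.chart_symm_val h1', hsymm v hv] at h2'
    rw [hsymm v hv] at h1'
    exact ⟨h1', h2'⟩
  refine ContDiffOn.congr (f := C.straighten x' ∘ (C.straighten x).symm) ?_ ?_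
  · exact (C.straighten_spec x').2.1.comp ((C.straighten_spec x).2.2.1.mono fun v hv => (hmem v hv).1)
      fun v hv => (hmem v hv).2
  · intro v hv
    obtain ⟨h1, h2⟩ := hmem v hv
    have h1' : ((modelWithCornersEuclideanQuadrant 4).symm v).1 ∈ (C.straighten x).target := by
      rw [hsymm v hv]; exact h1
    change (C.chart x' ((C.chart x).symm ((modelWithCornersEuclideanQuadrant 4).symm v))).1 = _
    have h3 : ((C.chart x).symm ((modelWithCornersEuclideanQuadrant 4).symm v) : E) =
        (C.straighten x).symm v := by rw [C.chart_symm_val h1', hsymm v hv]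
    rw [C.chart_val (by rw [h3]; exact h2), h3]
    rfl

/-- On a corner set, the smooth functions of the manifold structure are those that extend locally
to smooth functions on the ambient space. -/
theorem smoothFun_eq [FiniteDimensional ℝ E] : smoothFun C.S = smoothOn C.S := by
  ext f
  constructor
  · intro hf x
    have hf' : ContMDiff (modelWithCornersEuclideanQuadrant 4) 𝓘(ℝ, ℝ) ∞ f := hf
    have h := (contMDiff_iff.1 hf').2 x 0
    obtain ⟨hx, hs1, hs2, hs3, -⟩ := C.straighten_spec x
    have hmem : ∀ v ∈ orthant ∩ (C.straighten x).target,
        v ∈ (extChartAt (modelWithCornersEuclideanQuadrant 4) x).target := by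
      rintro v ⟨hv1, hv2⟩
      rw [extChartAt_target]
      have hr : v ∈ range (modelWithCornersEuclideanQuadrant 4) := by
        rw [show range (modelWithCornersEuclideanQuadrant 4) = orthant from
          range_euclideanQuadrant 4]; exact hv1
      refine ⟨?_, hr⟩
      change ((modelWithCornersEuclideanQuadrant 4).symm v).1 ∈ (C.straighten x).target
      have : ((modelWithCornersEuclideanQuadrant 4).symm v).1 = v :=
        (modelWithCornersEuclideanQuadrant 4).right_inv hr
      rwa [this]
    have h' : ContDiffOn ℝ ∞ (f ∘ (extChartAt (modelWithCornersEuclideanQuadrant 4) x).symm)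
        (orthant ∩ (C.straighten x).target) := by
      refine ContDiffOn.mono ?_ hmem
      simpa only [extChartAt_model_space_eq_id, PartialEquiv.refl_coe, PartialEquiv.refl_source,
        preimage_univ, inter_univ, Function.id_comp] using h
    -- In a chart `f` is only known to be smooth within the orthant. Seeley's theorem turns it into
    -- a smooth function on `ℝ⁴`, which the straightening pulls back to the ambient space.
    obtain ⟨g, hg, hgf⟩ := exists_contDiff_of_contDiffOn_orthant (C.straighten x).open_target
      ((C.straighten x).map_source hx) h'
    have hΦ : SmoothNear (C.straighten x) (x : E) := by
      filter_upwards [(C.straighten x).open_source.mem_nhds hx] with y hy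
      exact hs1.contDiffAt ((C.straighten x).open_source.mem_nhds hy)
    obtain ⟨F, hF, hFg⟩ := ((ContDiff.smoothNear hg _).comp hΦ).exists_contDiff
    refine ⟨F, hF, ?_⟩
    have e1 : ∀ᶠ y : C.S in 𝓝 x, F y = g (C.straighten x y) :=
      continuous_subtype_val.continuousAt.eventually hFg
    have e2 : ∀ᶠ y : C.S in 𝓝 x, (y : E) ∈ (C.straighten x).source :=
      continuous_subtype_val.continuousAt.eventually ((C.straighten x).open_source.mem_nhds hx)
    have e3 : ∀ᶠ y in 𝓝 (x : E), C.straighten x y ∈ orthant →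
        g (C.straighten x y) =
          (f ∘ (extChartAt (modelWithCornersEuclideanQuadrant 4) x).symm) (C.straighten x y) :=
      hΦ.continuousAt.eventually (eventually_nhdsWithin_iff.1 hgf)
    have e4 := continuous_subtype_val.continuousAt.eventually e3
    filter_upwards [e1, e2, e4] with y h1 h2 h3
    rw [h1, h3 ((hs3 y h2).1 y.2)]
    have : (extChartAt (modelWithCornersEuclideanQuadrant 4) x).symm (C.straighten x y) = y := by
      have h4 : extChartAt (modelWithCornersEuclideanQuadrant 4) x y = C.straighten x y :=
        C.chart_val h2
      rw [← h4]
      exact (extChartAt (modelWithCornersEuclideanQuadrant 4) x).left_inv (by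
        rw [extChartAt_source]; exact h2)
    rw [Function.comp_apply, this]
  · intro hf
    change ContMDiff (modelWithCornersEuclideanQuadrant 4) 𝓘(ℝ, ℝ) ∞ f
    have hcont : Continuous f := by
      rw [continuous_iff_continuousAt]
      intro x
      obtain ⟨F, hF, h⟩ := hf x
      exact (hF.continuous.continuousAt.comp continuous_subtype_val.continuousAt).congr
        (h.mono fun _ h => h.symm)
    refine contMDiff_iff.2 ⟨hcont, fun x y => ?_⟩
    obtain ⟨hx, hs1, hs2, hs3, -⟩ := C.straighten_spec x
    have hsym : ∀ v ∈ (extChartAt (modelWithCornersEuclideanQuadrant 4) x).target,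
        v ∈ (C.straighten x).target ∧
        (((extChartAt (modelWithCornersEuclideanQuadrant 4) x).symm v : C.S) : E) =
          (C.straighten x).symm v := by
      intro v hv
      rw [extChartAt_target] at hv
      have e : ((modelWithCornersEuclideanQuadrant 4).symm v).1 = v :=
        (modelWithCornersEuclideanQuadrant 4).right_inv hv.2
      have h1 : ((modelWithCornersEuclideanQuadrant 4).symm v).1 ∈ (C.straighten x).target := hv.1
      refine ⟨by rwa [e] at h1, ?_⟩
      have h2 := C.chart_symm_val h1
      rw [e] at h2
      exact h2
    intro v hv
    have hvt := hv.1
    obtain ⟨F, hF, h⟩ := hf ((extChartAt (modelWithCornersEuclideanQuadrant 4) x).symm v)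
    have hFs : ContDiffWithinAt ℝ ∞ (F ∘ (C.straighten x).symm)
        ((extChartAt (modelWithCornersEuclideanQuadrant 4) x).target ∩
          (extChartAt (modelWithCornersEuclideanQuadrant 4) x).symm ⁻¹'
            (f ⁻¹' (extChartAt 𝓘(ℝ, ℝ) y).source)) v :=
      hF.contDiffAt.comp_contDiffWithinAt v
        ((hs2 v (hsym v hvt).1).mono fun w hw => (hsym w hw.1).1)
    have hc : ContinuousWithinAt (extChartAt (modelWithCornersEuclideanQuadrant 4) x).symm
        ((extChartAt (modelWithCornersEuclideanQuadrant 4) x).target ∩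
          (extChartAt (modelWithCornersEuclideanQuadrant 4) x).symm ⁻¹'
            (f ⁻¹' (extChartAt 𝓘(ℝ, ℝ) y).source)) v :=
      ((continuousOn_extChartAt_symm x) v hvt).mono inter_subset_left
    refine hFs.congr_of_eventuallyEq ?_ ?_
    · filter_upwards [hc.eventually h, self_mem_nhdsWithin] with w hw hw2
      simp only [Function.comp_apply, extChartAt_model_space_eq_id, PartialEquiv.refl_coe, id]
      rw [hw, (hsym w hw2.1).2]
    · simp only [Function.comp_apply, extChartAt_model_space_eq_id, PartialEquiv.refl_coe, id]
      rw [h.self_of_nhds, (hsym v hvt).2]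

end CornerSet

end CornerSets

/-! ### Corners from inequalities with independent differentials. -/

section LocalFaces

variable {E : Type} [NormedAddCommGroup E] [NormedSpace ℝ E]

lemma exists_extend_linearIndependent {V : Type*} [AddCommGroup V] [Module ℝ V]
    (hV : Module.finrank ℝ V = 4) : ∀ (k n : ℕ) (h : n + k = 4) (v : Fin n → V),
    LinearIndependent ℝ v → ∃ w : Fin 4 → V, LinearIndependent ℝ w ∧
      ∀ i : Fin n, w ⟨i, by omega⟩ = v i := by
  intro k
  induction k with
  | zero =>
    intro n h v hv
    obtain rfl : n = 4 := by omega
    exact ⟨v, hv, fun _ => rfl⟩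
  | succ k ih =>
    intro n h v hv
    obtain ⟨x, hx⟩ := exists_linearIndependent_snoc_of_lt_finrank hv (by omega)
    obtain ⟨w, hw, hwv⟩ := ih (n + 1) (by omega) _ hx
    refine ⟨w, hw, fun i => ?_⟩
    have := hwv i.castSucc
    rw [Fin.snoc_castSucc] at this
    exact this

/-- A set that is given near `x` by `n` inequalities `g i ≥ 0` with `g i x = 0` and linearly
independent differentials has a corner of depth `n` at `x`. -/
lemma cornerAt_of_linearIndependent [FiniteDimensional ℝ E] (hE : Module.finrank ℝ E = 4)
    {S : Set E} {x : E} {n : ℕ} (hn : n ≤ 4) {g : Fin n → E → ℝ}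
    (hg : ∀ i, SmoothNear (g i) x) (hgx : ∀ i, g i x = 0)
    (hli : LinearIndependent ℝ fun i => fderiv ℝ (g i) x)
    (hS : ∀ᶠ y in 𝓝 x, y ∈ S ↔ ∀ i, 0 ≤ g i y) : CornerAt S x n := by
  have : CompleteSpace E := FiniteDimensional.complete ℝ E
  have hV : Module.finrank ℝ (E →L[ℝ] ℝ) = 4 := by
    rw [← (LinearMap.toContinuousLinearMap (𝕜 := ℝ) (E := E) (F' := ℝ)).finrank_eq,
      Module.finrank_linearMap, hE, Module.finrank_self]
  obtain ⟨w, hw, hwv⟩ := exists_extend_linearIndependent hV (4 - n) n (by omega) _ hli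
  have hspan := hw.span_eq_top_of_card_eq_finrank (by simp [hV])
  let A : E →L[ℝ] EuclideanSpace ℝ (Fin 4) :=
    (EuclideanSpace.equiv (Fin 4) ℝ).symm.toContinuousLinearMap.comp (ContinuousLinearMap.pi w)
  have hA : ∀ v i, A v i = w i v := fun v i => rfl
  have hinj : Function.Injective A := by
    refine (injective_iff_map_eq_zero A).2 fun v hv => ?_
    have h1 : ∀ l ∈ Submodule.span ℝ (range w), l v = 0 := by
      intro l hl
      refine Submodule.span_induction ?_ ?_ ?_ ?_ hl
      · rintro _ ⟨i, rfl⟩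
        rw [← hA, hv]; rfl
      · rfl
      · intro a b _ _ ha hb
        rw [_root_.add_apply, ha, hb, add_zero]
      · intro c a _ ha
        rw [_root_.smul_apply, ha, smul_zero]
    rw [hspan] at h1
    by_contra hne
    obtain ⟨f, _, hf⟩ := exists_dual_vector ℝ v (norm_ne_zero_iff.2 hne)
    have h2 := h1 f trivial
    rw [hf] at h2
    simp [hne] at h2
  let e : E ≃L[ℝ] EuclideanSpace ℝ (Fin 4) :=
    (LinearEquiv.ofInjectiveOfFinrankEq A.toLinearMap hinj
      (by rw [hE, finrank_euclideanSpace, Fintype.card_fin])).toContinuousLinearEquiv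
  have heA : (e : E →L[ℝ] EuclideanSpace ℝ (Fin 4)) = A := by ext v; rfl
  -- The differentials of the `g i` are completed to a basis of the dual space. The coordinates
  -- added for this purpose take the value `1` at `x`. Near `x` they therefore impose no condition,
  -- and they do not count for the depth.
  let c : Fin 4 → E → ℝ := fun i y =>
    if h : i.1 < n then g ⟨i, h⟩ y else 1 + w i (y - x)
  let F : E → EuclideanSpace ℝ (Fin 4) := fun y => (EuclideanSpace.equiv (Fin 4) ℝ).symm fun i => c i y
  have hF : ∀ y i, F y i = c i y := fun _ _ => rfl
  have hcs : ∀ i, SmoothNear (c i) x := by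
    intro i
    by_cases h : i.1 < n
    · have : c i = g ⟨i, h⟩ := by funext y; simp [c, h]
      rw [this]; exact hg _
    · have : c i = fun y => 1 + w i (y - x) := by funext y; simp [c, h]
      rw [this]; exact ContDiff.smoothNear (by fun_prop) x
  have hcd : ∀ i, HasFDerivAt (c i) (w i) x := by
    intro i
    by_cases h : i.1 < n
    · have : c i = g ⟨i, h⟩ := by funext y; simp [c, h]
      have e2 : w i = fderiv ℝ (g ⟨i, h⟩) x := hwv ⟨i, h⟩
      rw [this, e2]
      exact ((hg _).contDiffAt.differentiableAt (by simp)).hasFDerivAt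
    · have : c i = fun y => 1 + w i (y - x) := by funext y; simp [c, h]
      rw [this]
      exact (((w i).hasFDerivAt).comp x ((hasFDerivAt_id x).sub_const x)).const_add 1
  have hFs : SmoothNear F x := by
    have h1 : SmoothNear (fun y i => c i y) x := by
      have := eventually_all.2 hcs
      filter_upwards [this] with y hy using contDiffAt_pi.2 hy
    exact (ContDiff.smoothNear (EuclideanSpace.equiv (Fin 4) ℝ).symm.contDiff _).comp h1
  have hFd : HasFDerivAt F (e : E →L[ℝ] EuclideanSpace ℝ (Fin 4)) x := by
    rw [heA]
    exact ((EuclideanSpace.equiv (Fin 4) ℝ).symm.toContinuousLinearMap.hasFDerivAt).comp x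
      (hasFDerivAt_pi.2 hcd)
  have hpos : ∀ᶠ y in 𝓝 x, ∀ i : Fin 4, ¬ i.1 < n → 0 < c i y := by
    refine eventually_all.2 fun i => ?_
    by_cases h : i.1 < n
    · exact Eventually.of_forall fun y hy => absurd h hy
    · have hc0 : 0 < c i x := by simp [c, h]
      filter_upwards [(hcs i).continuousAt.eventually (lt_mem_nhds hc0)] with y hy _ using hy
  obtain ⟨Φ, hΦ, hx, hsub, h1, h2⟩ := hFs.exists_openPartialHomeomorph hFd (inter_mem hS hpos)
  refine ⟨Φ, hx, h1, h2, fun y hy => ?_, ?_⟩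
  · obtain ⟨hy1, hy2⟩ := hsub hy
    have hy1' : y ∈ S ↔ ∀ i, 0 ≤ g i y := hy1
    have hy2' : ∀ i : Fin 4, ¬ i.1 < n → 0 < c i y := hy2
    rw [hy1', hΦ]
    constructor
    · intro h i
      rw [hF]
      by_cases hi : i.1 < n
      · simpa [c, hi] using h ⟨i, hi⟩
      · exact (hy2' i hi).le
    · intro h i
      have := h ⟨i, by omega⟩
      rw [hF] at this
      simpa [c] using this
  · rw [hΦ]
    have : {i : Fin 4 | F x i = 0} = (fun i : Fin n => (⟨i, by omega⟩ : Fin 4)) '' univ := by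
      ext i
      simp only [image_univ, mem_range]
      change F x i = 0 ↔ _
      rw [hF]
      constructor
      · intro h
        by_cases hi : i.1 < n
        · exact ⟨⟨i, hi⟩, rfl⟩
        · simp [c, hi] at h
      · rintro ⟨k, rfl⟩
        simp [c, hgx]
    rw [this, ncard_image_of_injective _ (fun a b h => by simpa [Fin.ext_iff] using h), ncard_univ]
    simp

lemma cornerAt_zero [FiniteDimensional ℝ E] (hE : Module.finrank ℝ E = 4) {S : Set E} {x : E}
    (hS : ∀ᶠ y in 𝓝 x, y ∈ S) : CornerAt S x 0 :=
  cornerAt_of_linearIndependent hE (g := fun i : Fin 0 => i.elim0) (by omega) (fun i => i.elim0)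
    (fun i => i.elim0) linearIndependent_empty_type (hS.mono fun y hy => by simp [hy])

lemma cornerAt_one [FiniteDimensional ℝ E] (hE : Module.finrank ℝ E = 4) {S : Set E} {x : E}
    {g : E → ℝ} (hg : SmoothNear g x) (hgx : g x = 0) {e : E} (he : fderiv ℝ g x e ≠ 0)
    (hS : ∀ᶠ y in 𝓝 x, y ∈ S ↔ 0 ≤ g y) : CornerAt S x 1 := by
  refine cornerAt_of_linearIndependent hE (g := fun _ : Fin 1 => g) (by omega) (fun _ => hg)
    (fun _ => hgx) ?_ (hS.mono fun y hy => by simp [hy])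
  refine LinearIndependent.of_subsingleton 0 fun h => he ?_
  rw [h]; rfl

/-- Evaluating a linear relation at `e`, then at `e'`, gives a triangular system, so the two
differentials are independent. -/
lemma cornerAt_two [FiniteDimensional ℝ E] (hE : Module.finrank ℝ E = 4) {S : Set E} {x : E}
    {g f : E → ℝ} (hg : SmoothNear g x) (hf : SmoothNear f x) (hgx : g x = 0) (hfx : f x = 0)
    {e e' : E} (he : fderiv ℝ g x e ≠ 0) (hef : fderiv ℝ f x e = 0) (he' : fderiv ℝ f x e' ≠ 0)
    (hS : ∀ᶠ y in 𝓝 x, y ∈ S ↔ 0 ≤ g y ∧ 0 ≤ f y) : CornerAt S x 2 := by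
  refine cornerAt_of_linearIndependent hE (g := ![g, f]) (by omega) ?_ ?_ ?_
    (hS.mono fun y hy => by simp [hy, Fin.forall_fin_two])
  · intro i; fin_cases i <;> assumption
  · intro i; fin_cases i <;> assumption
  · have : (fun i => fderiv ℝ ((![g, f] : Fin 2 → E → ℝ) i) x) =
        ![fderiv ℝ g x, fderiv ℝ f x] := by
      funext i; fin_cases i <;> rfl
    rw [this, LinearIndependent.pair_iff]
    intro s t hst
    have h1 := congrArg (fun l : E →L[ℝ] ℝ => l e) hst
    simp only [_root_.add_apply, _root_.smul_apply, hef, smul_eq_mul,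
      mul_zero, add_zero, _root_.zero_apply] at h1
    have hs : s = 0 := (mul_eq_zero.1 h1).resolve_right he
    have h2 := congrArg (fun l : E →L[ℝ] ℝ => l e') hst
    simp only [_root_.add_apply, _root_.smul_apply, hs, smul_eq_mul,
      zero_mul, zero_add, _root_.zero_apply] at h2
    exact ⟨hs, (mul_eq_zero.1 h2).resolve_right he'⟩

end LocalFaces

/-! ### Smooth embeddings by means of local left inverses. -/

section Embeddings

variable {E E' E'' : Type} [NormedAddCommGroup E] [NormedSpace ℝ E] [NormedAddCommGroup E']
  [NormedSpace ℝ E'] [NormedAddCommGroup E''] [NormedSpace ℝ E'']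

/-- `j` is injective on `A`, smooth near `A`, and has local smooth left inverses along `A`. -/
def EmbOn (j : E → E') (A : Set E) : Prop :=
  InjOn j A ∧ ∀ x ∈ A, SmoothNear j x ∧
    ∃ r : E' → E, SmoothNear r (j x) ∧ ∀ᶠ y in 𝓝[A] x, r (j y) = y

/-- A left inverse is asked for only along `A`, so `j` may be far from injective elsewhere. The map
`place` below, for instance, goes from a space of dimension 6 to one of dimension 4. -/
lemma EmbOn.of_leftInvOn {j : E → E'} {A : Set E} (r : E' → E) (hj : ∀ x ∈ A, SmoothNear j x)
    (hr : ∀ x ∈ A, SmoothNear r (j x)) (h : ∀ x ∈ A, r (j x) = x) : EmbOn j A :=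
  ⟨fun x hx y hy hxy => by rw [← h x hx, ← h y hy, hxy], fun x hx => ⟨hj x hx, r, hr x hx,
    eventually_nhdsWithin_of_forall h⟩⟩

lemma EmbOn.mono {j : E → E'} {A B : Set E} (h : EmbOn j A) (hB : B ⊆ A) : EmbOn j B :=
  ⟨h.1.mono hB, fun x hx => ⟨(h.2 x (hB hx)).1, by
    obtain ⟨r, h1, h2⟩ := (h.2 x (hB hx)).2
    exact ⟨r, h1, h2.filter_mono (nhdsWithin_mono x hB)⟩⟩⟩

lemma EmbOn.comp {j : E → E'} {j' : E' → E''} {A : Set E} {A' : Set E'} (h' : EmbOn j' A')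
    (h : EmbOn j A) (hA : MapsTo j A A') : EmbOn (j' ∘ j) A := by
  refine ⟨h'.1.comp h.1 hA, fun x hx => ?_⟩
  obtain ⟨hj, r, hr, hrj⟩ := h.2 x hx
  obtain ⟨hj', r', hr', hrj'⟩ := h'.2 (j x) (hA hx)
  refine ⟨hj'.comp hj, r ∘ r', ?_, ?_⟩
  · have e : r' (j' (j x)) = j x := hrj'.self_of_nhdsWithin (hA hx)
    refine SmoothNear.comp ?_ hr'
    change SmoothNear r (r' (j' (j x)))
    rw [e]; exact hr
  · have hcont : Tendsto j (𝓝[A] x) (𝓝[A'] (j x)) :=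
      tendsto_nhdsWithin_iff.2 ⟨hj.continuousAt.tendsto.mono_left nhdsWithin_le_nhds,
        eventually_nhdsWithin_of_forall hA⟩
    filter_upwards [hrj, hcont.eventually hrj'] with y h1 h2
    simp only [Function.comp_apply]
    rw [h2, h1]

lemma embOn_id (A : Set E) : EmbOn (fun x : E => x) A :=
  EmbOn.of_leftInvOn id (fun x _ => ContDiff.smoothNear contDiff_id x)
    (fun x _ => ContDiff.smoothNear contDiff_id x) fun _ _ => rfl

/-- Functions that are locally pulled back, along `c`, from smooth functions. -/
def localFun {D : Type} [TopologicalSpace D] (c : D → E) : Set (D → ℝ) :=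
  {g | ∀ x, ∃ G : E → ℝ, ContDiff ℝ ∞ G ∧ ∀ᶠ y in 𝓝 x, g y = G (c y)}

/-- Near a point of the image, `G ∘ r` extends a given smooth function. The image is closed since
`D` is compact, so a partition of unity glues these local extensions. The domain `D` is not required
to be a subset of `E`, so that disjoint copies of `X` are covered as well. -/
theorem isSmoothEmb_of_local [FiniteDimensional ℝ E] [FiniteDimensional ℝ E'] {D : Type}
    [TopologicalSpace D] [CompactSpace D] {c : D → E} (hc : Continuous c) {S : Set E'} {j : D → S}
    (hj : Function.Injective j)
    (hJ : ∀ x, ∃ J : E → E', SmoothNear J (c x) ∧ ∀ᶠ y in 𝓝 x, (j y : E') = J (c y))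
    (hR : ∀ x, ∃ r : E' → E, SmoothNear r (j x) ∧ ∀ᶠ y in 𝓝 x, r (j y) = c y) :
    IsSmoothEmb (localFun c) (smoothOn S) j := by
  have hcont : Continuous fun x => (j x : E') := by
    rw [continuous_iff_continuousAt]
    intro x
    obtain ⟨J, h1, h2⟩ := hJ x
    exact (h1.continuousAt.comp hc.continuousAt).congr (h2.mono fun _ h => h.symm)
  have hjc : Continuous j := continuous_induced_rng.2 hcont
  have hinj : Function.Injective fun x => (j x : E') := Subtype.val_injective.comp hj
  have hemb : IsClosedEmbedding fun x => (j x : E') := hcont.isClosedEmbedding hinj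
  intro g
  constructor
  · intro hg
    -- A point of the image prescribes the value of the extension and any other point leaves it
    -- free. Both conditions are convex, hence survive averaging by a partition of unity.
    let t : E' → Set ℝ := fun y => {a | ∀ x, (j x : E') = y → a = g x}
    have ht : ∀ y, Convex ℝ (t y) := by
      intro y
      by_cases hy : ∃ x, (j x : E') = y
      · obtain ⟨x, rfl⟩ := hy
        have : t (j x) = {g x} := by
          ext a
          refine ⟨fun h => h x rfl, fun h x' hx' => ?_⟩
          rw [hinj hx']; exact h
        rw [this]; exact convex_singleton _
      · have : t y = univ := by
          ext a
          refine ⟨fun _ => trivial, fun _ x hx => (hy ⟨x, hx⟩).elim⟩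
        rw [this]; exact convex_univ
    have hloc : ∀ y : E', ∃ U ∈ 𝓝 y, ∃ f : E' → ℝ,
        ContMDiffOn 𝓘(ℝ, E') 𝓘(ℝ, ℝ) ((⊤ : ℕ∞) : WithTop ℕ∞) f U ∧ ∀ z ∈ U, f z ∈ t z := by
      intro y
      by_cases hy : ∃ x, (j x : E') = y
      · obtain ⟨x, rfl⟩ := hy
        obtain ⟨G, hG, hGg⟩ := hg x
        obtain ⟨r, hr, hrj⟩ := hR x
        have hGr : SmoothNear (G ∘ r) (j x : E') := (ContDiff.smoothNear hG _).comp hr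
        have hev : ∀ᶠ z in 𝓝 (j x : E'), ∀ x', (j x' : E') = z → g x' = G (r z) := by
          have h1 : ∀ᶠ x' in 𝓝 x, g x' = G (r (j x')) := by
            filter_upwards [hGg, hrj] with x' h1 h2
            rw [h2, h1]
          rw [hemb.isInducing.nhds_eq_comap, eventually_comap] at h1
          filter_upwards [h1] with z hz x' hx'
          rw [hz x' hx', hx']
        refine ⟨_, inter_mem hGr hev, G ∘ r, ?_, ?_⟩
        · intro z hz
          have hz1 : ContDiffAt ℝ ∞ (G ∘ r) z := hz.1
          exact hz1.contMDiffAt.contMDiffWithinAt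
        · intro z hz x' hx'
          have hz2 : ∀ x', (j x' : E') = z → g x' = G (r z) := hz.2
          exact (hz2 x' hx').symm
      · refine ⟨(range fun x => (j x : E'))ᶜ, hemb.isClosed_range.isOpen_compl.mem_nhds hy,
          fun _ => 0, contMDiffOn_const, fun z hz x hx => (hz ⟨x, hx⟩).elim⟩
    obtain ⟨f, hf⟩ := exists_contMDiffMap_forall_mem_convex_of_local 𝓘(ℝ, E') ht hloc
    refine ⟨fun s => f s, fun s => ⟨f, f.contMDiff.contDiff, Eventually.of_forall fun _ => rfl⟩, ?_⟩
    funext x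
    exact hf (j x) x rfl
  · rintro ⟨f, hf, rfl⟩ x
    obtain ⟨F, hF, hFf⟩ := hf (j x)
    obtain ⟨J, hJ1, hJ2⟩ := hJ x
    have hjx : (j x : E') = J (c x) := hJ2.self_of_nhds
    obtain ⟨H, hH, hHF⟩ := ((ContDiff.smoothNear hF _).comp hJ1).exists_contDiff
    refine ⟨H, hH, ?_⟩
    filter_upwards [hJ2, hjc.continuousAt.eventually hFf, hc.continuousAt.eventually hHF]
      with y h1 h2 h3
    rw [h3, Function.comp_apply, h2, h1]
    rfl

/-- An embedding of a compact set in the sense of `EmbOn` is a smooth embedding. -/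
theorem EmbOn.isSmoothEmb [FiniteDimensional ℝ E] [FiniteDimensional ℝ E'] {j : E → E'} {A : Set E}
    (h : EmbOn j A) (hA : IsCompact A) {S : Set E'} {f : A → S} (hf : ∀ x, (f x : E') = j x) :
    IsSmoothEmb (smoothOn A) (smoothOn S) f := by
  have : CompactSpace A := isCompact_iff_compactSpace.1 hA
  refine isSmoothEmb_of_local continuous_subtype_val ?_ (fun x => ?_) fun x => ?_
  · intro x y hxy
    refine Subtype.ext (h.1 x.2 y.2 ?_)
    rw [← hf, ← hf, hxy]
  · exact ⟨j, (h.2 x x.2).1, Eventually.of_forall hf⟩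
  · obtain ⟨r, hr, hrj⟩ := (h.2 x x.2).2
    refine ⟨r, by rw [hf]; exact hr, ?_⟩
    have := (eventually_nhds_subtype_iff A x (fun y => r (j y) = y)).2 hrj
    filter_upwards [this] with y hy
    rw [hf, hy]

lemma isCompact_solidTorus : IsCompact solidTorus := by
  have : solidTorus = Metric.sphere (0 : ℂ) 1 ×ˢ Metric.closedBall (0 : ℂ) 1 := by
    ext p
    rw [mem_prod, mem_sphere_zero_iff_norm, mem_closedBall_zero_iff]
    rfl
  rw [this]
  exact (isCompact_sphere _ _).prod (isCompact_closedBall _ _)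

instance : CompactSpace X := isCompact_iff_compactSpace.1 isCompact_solidTorus

/-- Finitely many embeddings of `X` with disjoint images form a smooth embedding of the copies
of `X`. -/
theorem isSmoothEmb_copies [FiniteDimensional ℝ E'] {ι : Type} [Finite ι] {j : ι → ℂ × ℂ → E'}
    (h : ∀ i, EmbOn (j i) solidTorus) {S : Set E'} {f : ι × X → S}
    (hf : ∀ i x, (f (i, x) : E') = j i x)
    (hdisj : ∀ i i' x x', f (i, x) = f (i', x') → i = i') :
    IsSmoothEmb (smoothCopies ι) (smoothOn S) f := by
  -- With the discrete topology on `ι`, being local on `ι × X` means being local on each copy.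
  let _ : TopologicalSpace ι := ⊥
  have : DiscreteTopology ι := ⟨rfl⟩
  have hnhds : ∀ (i : ι) (x : X), 𝓝 (i, x) = map (Prod.mk i) (𝓝 x) := by
    intro i x
    rw [nhds_prod_eq, nhds_discrete, pure_prod]
  have hco : smoothCopies ι = localFun fun p : ι × X => (p.2 : ℂ × ℂ) := by
    ext g
    constructor
    · rintro hg ⟨i, x⟩
      obtain ⟨G, hG, h⟩ := hg i x
      refine ⟨G, hG, ?_⟩
      rw [hnhds]
      exact h
    · intro hg i x
      obtain ⟨G, hG, h⟩ := hg (i, x)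
      rw [hnhds] at h
      exact ⟨G, hG, h⟩
  rw [hco]
  refine isSmoothEmb_of_local (by fun_prop) ?_ ?_ ?_
  · rintro ⟨i, x⟩ ⟨i', x'⟩ hxy
    obtain rfl := hdisj i i' x x' hxy
    have : j i x = j i x' := by rw [← hf, ← hf, hxy]
    rw [Subtype.ext ((h i).1 x.2 x'.2 this)]
  · rintro ⟨i, x⟩
    refine ⟨j i, ((h i).2 x x.2).1, ?_⟩
    rw [hnhds]
    exact eventually_map.2 (Eventually.of_forall fun y => hf i y)
  · rintro ⟨i, x⟩
    obtain ⟨r, hr, hrj⟩ := ((h i).2 x x.2).2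
    refine ⟨r, by rw [hf]; exact hr, ?_⟩
    rw [hnhds]
    have := (eventually_nhds_subtype_iff solidTorus x (fun y => r (j i y) = y)).2 hrj
    refine eventually_map.2 ?_
    filter_upwards [this] with y hy
    rw [hf, hy]

end Embeddings

/-! ### Relative cobordisms as domains in `ℂ²`. -/

section Faces

lemma finrank_complex_prod : Module.finrank ℝ (ℂ × ℂ) = 4 := by
  rw [Module.finrank_prod, Complex.finrank_real_complex]

/-- A domain in `ℂ²` cut out by a wall function `G` and face functions `f j`, whose faces
`f j = 0` are parametrized by the solid torus. -/
structure FaceData (ι κ : Type) where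
  U : Set (ℂ × ℂ)
  G : ℂ × ℂ → ℝ
  f : ι ⊕ κ → ℂ × ℂ → ℝ
  emb : ι ⊕ κ → ℂ × ℂ → ℂ × ℂ
  isOpen_U : IsOpen U
  isCompact : IsCompact {y | y ∈ U ∧ 0 ≤ G y ∧ ∀ j, 0 ≤ f j y}
  continuousAt_G : ∀ y ∈ U, ContinuousAt G y
  continuousAt_f : ∀ j, ∀ y ∈ U, ContinuousAt (f j) y
  face_unique : ∀ y, y ∈ U → 0 ≤ G y → (∀ j, 0 ≤ f j y) → ∀ j j', f j y = 0 → f j' y = 0 → j = j'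
  wall_smooth : ∀ y, y ∈ U → (∀ j, 0 ≤ f j y) → G y = 0 →
    SmoothNear G y ∧ ∃ e, fderiv ℝ G y e ≠ 0
  face_smooth : ∀ y, y ∈ U → 0 ≤ G y → (∀ j, 0 ≤ f j y) → ∀ j, f j y = 0 →
    SmoothNear (f j) y ∧ ∃ e, fderiv ℝ (f j) y e ≠ 0
  indep : ∀ y, y ∈ U → (∀ j, 0 ≤ f j y) → G y = 0 → ∀ j, f j y = 0 →
    ∃ e, fderiv ℝ (f j) y e = 0 ∧ fderiv ℝ G y e ≠ 0
  emb_embOn : ∀ j, EmbOn (emb j) solidTorus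
  emb_mem : ∀ j, ∀ x ∈ solidTorus, emb j x ∈ U ∧ 0 ≤ G (emb j x) ∧ (∀ j', 0 ≤ f j' (emb j x)) ∧
    f j (emb j x) = 0
  emb_surj : ∀ y, y ∈ U → 0 ≤ G y → (∀ j, 0 ≤ f j y) → ∀ j, f j y = 0 →
    ∃ x ∈ solidTorus, emb j x = y
  emb_wall : ∀ j, ∀ x ∈ solidTorus, G (emb j x) = 0 ↔ ‖x.2‖ = 1

namespace FaceData

variable {ι κ : Type} (D : FaceData ι κ)

/-- The domain itself. -/
def carrier : Set (ℂ × ℂ) := {y | y ∈ D.U ∧ 0 ≤ D.G y ∧ ∀ j, 0 ≤ D.f j y}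

open Classical in
/-- The domain as a corner set. -/
def cornerSet [Finite ι] [Finite κ] : CornerSet (ℂ × ℂ) where
  S := D.carrier
  dep y := (if D.G y = 0 then 1 else 0) + if ∃ j, D.f j y = 0 then 1 else 0
  corner := by
    rintro y ⟨hU, hG, hf⟩
    have hUe : ∀ᶠ z in 𝓝 y, z ∈ D.U := D.isOpen_U.mem_nhds hU
    have hGe : D.G y ≠ 0 → ∀ᶠ z in 𝓝 y, 0 < D.G z := fun h =>
      (D.continuousAt_G y hU).eventually (lt_mem_nhds (lt_of_le_of_ne hG (Ne.symm h)))
    -- Face functions that are nonzero at `y` stay positive nearby, and by `face_unique` at most one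
    -- of them vanishes. Near `y` the domain is thus given by at most two inequalities, the wall and
    -- one face.
    have hfe : ∀ᶠ z in 𝓝 y, ∀ j, D.f j y ≠ 0 → 0 < D.f j z := by
      refine eventually_all.2 fun j => ?_
      by_cases h : D.f j y = 0
      · exact Eventually.of_forall fun z hz => absurd h hz
      · filter_upwards [(D.continuousAt_f j y hU).eventually
          (lt_mem_nhds (lt_of_le_of_ne (hf j) (Ne.symm h)))] with z hz _ using hz
    by_cases h1 : D.G y = 0
    · obtain ⟨hGs, e, he⟩ := D.wall_smooth y hU hf h1
      by_cases h2 : ∃ j, D.f j y = 0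
      · obtain ⟨j, hj⟩ := h2
        obtain ⟨hfs, e', he'⟩ := D.face_smooth y hU hG hf j hj
        obtain ⟨e'', h3, h4⟩ := D.indep y hU hf h1 j hj
        rw [if_pos h1, if_pos ⟨j, hj⟩]
        refine cornerAt_two finrank_complex_prod hGs hfs h1 hj h4 h3 he' ?_
        filter_upwards [hUe, hfe] with z hz1 hz2
        refine ⟨fun h => ⟨h.2.1, h.2.2 j⟩, fun h => ⟨hz1, h.1, fun j' => ?_⟩⟩
        by_cases hj' : D.f j' y = 0
        · rw [D.face_unique y hU hG hf j' j hj' hj]; exact h.2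
        · exact (hz2 j' hj').le
      · rw [if_pos h1, if_neg h2]
        refine cornerAt_one finrank_complex_prod hGs h1 he ?_
        filter_upwards [hUe, hfe] with z hz1 hz2
        exact ⟨fun h => h.2.1, fun h => ⟨hz1, h, fun j => (hz2 j fun hj => h2 ⟨j, hj⟩).le⟩⟩
    · by_cases h2 : ∃ j, D.f j y = 0
      · obtain ⟨j, hj⟩ := h2
        obtain ⟨hfs, e', he'⟩ := D.face_smooth y hU hG hf j hj
        rw [if_neg h1, if_pos ⟨j, hj⟩]
        refine cornerAt_one finrank_complex_prod hfs hj he' ?_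
        filter_upwards [hUe, hfe, hGe h1] with z hz1 hz2 hz3
        refine ⟨fun h => h.2.2 j, fun h => ⟨hz1, hz3.le, fun j' => ?_⟩⟩
        by_cases hj' : D.f j' y = 0
        · rw [D.face_unique y hU hG hf j' j hj' hj]; exact h
        · exact (hz2 j' hj').le
      · rw [if_neg h1, if_neg h2]
        refine cornerAt_zero finrank_complex_prod ?_
        filter_upwards [hUe, hfe, hGe h1] with z hz1 hz2 hz3
        exact ⟨hz1, hz3.le, fun j => (hz2 j fun hj => h2 ⟨j, hj⟩).le⟩

lemma emb_mem_carrier (j : ι ⊕ κ) (x : X) : D.emb j x ∈ D.carrier := by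
  obtain ⟨h1, h2, h3, -⟩ := D.emb_mem j x x.2
  exact ⟨h1, h2, h3⟩

/-- The parametrization of the face `j`. -/
def face (j : ι ⊕ κ) (x : X) : D.carrier := ⟨D.emb j x, D.emb_mem_carrier j x⟩

lemma face_inj {j j' : ι ⊕ κ} {x x' : X} (h : D.face j x = D.face j' x') : j = j' := by
  obtain ⟨h1, h2, h3, h4⟩ := D.emb_mem j x x.2
  obtain ⟨-, -, -, h4'⟩ := D.emb_mem j' x' x'.2
  have h' : D.emb j x = D.emb j' x' := congrArg Subtype.val h
  rw [← h'] at h4'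
  exact D.face_unique _ h1 h2 h3 j j' h4 h4'

variable [Finite ι] [Finite κ]

open Classical in
lemma depth_face (j : ι ⊕ κ) (x : X) :
    (‖x.1.2‖ < 1 → depth (W := D.cornerSet.S) (D.face j x) = 1) ∧
      (‖x.1.2‖ = 1 → depth (W := D.cornerSet.S) (D.face j x) = 2) := by
  have h4 : D.f j (D.emb j x) = 0 := (D.emb_mem j x x.2).2.2.2
  have hw := D.emb_wall j x x.2
  constructor
  · intro h
    refine (CornerSet.depth_eq D.cornerSet _).trans ?_
    have : ¬ D.G (D.emb j x) = 0 := fun h' => h.ne (hw.1 h')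
    change (if D.G (D.emb j x) = 0 then 1 else 0) + (if ∃ j', D.f j' (D.emb j x) = 0 then 1 else 0) = 1
    rw [if_neg this, if_pos ⟨j, h4⟩]
  · intro h
    refine (CornerSet.depth_eq D.cornerSet _).trans ?_
    change (if D.G (D.emb j x) = 0 then 1 else 0) + (if ∃ j', D.f j' (D.emb j x) = 0 then 1 else 0) = 2
    rw [if_pos (hw.2 h), if_pos ⟨j, h4⟩]

open Classical in
/-- The relative cobordism given by the domain. -/
def relCob : RelCob ι κ where
  W := D.cornerSet.S
  compact := isCompact_iff_compactSpace.1 D.isCompact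
  inc p := D.face (Sum.inl p.1) p.2
  out p := D.face (Sum.inr p.1) p.2
  inc_emb := by
    rw [CornerSet.smoothFun_eq]
    exact isSmoothEmb_copies (j := fun i => D.emb (Sum.inl i)) (fun i => D.emb_embOn _)
      (fun _ _ => rfl) fun i i' x x' h => Sum.inl_injective (D.face_inj h)
  out_emb := by
    rw [CornerSet.smoothFun_eq]
    exact isSmoothEmb_copies (j := fun i => D.emb (Sum.inr i)) (fun i => D.emb_embOn _)
      (fun _ _ => rfl) fun i i' x x' h => Sum.inr_injective (D.face_inj h)
  disj p q h := by cases D.face_inj h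
  depth_inc p := D.depth_face _ _
  depth_out p := D.depth_face _ _
  depth_else w h1 h2 := by
    rw [CornerSet.depth_eq]
    obtain ⟨hU, hG, hf⟩ := w.2
    have : ¬ ∃ j, D.f j w = 0 := by
      rintro ⟨j, hj⟩
      obtain ⟨x, hx, hxw⟩ := D.emb_surj w hU hG hf j hj
      rcases j with i | k
      · exact h1 ⟨(i, ⟨x, hx⟩), Subtype.ext hxw⟩
      · exact h2 ⟨(k, ⟨x, hx⟩), Subtype.ext hxw⟩
    change (if D.G w = 0 then 1 else 0) + (if ∃ j, D.f j w = 0 then 1 else 0) ≤ 1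
    rw [if_neg this]
    split_ifs <;> omega

lemma relCob_smooth : D.relCob.smooth = smoothOn D.carrier := D.cornerSet.smoothFun_eq

/-- The inclusion of a smaller domain is a smooth embedding. -/
lemma isSmoothEmb_inclusion {ι' κ' : Type} [Finite ι'] [Finite κ'] {D' : FaceData ι' κ'}
    (h : D.carrier ⊆ D'.carrier) :
    IsSmoothEmb D.relCob.smooth D'.relCob.smooth (Set.inclusion h) := by
  rw [relCob_smooth, relCob_smooth]
  exact (embOn_id D.carrier).isSmoothEmb D.isCompact fun _ => rfl

end FaceData

end Faces

/-! ### Rules of calculus for `SmoothNear`. -/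

section SmoothCalculus

variable {E F G : Type*} [NormedAddCommGroup E] [NormedSpace ℝ E] [NormedAddCommGroup F]
  [NormedSpace ℝ F] [NormedAddCommGroup G] [NormedSpace ℝ G]

attribute [fun_prop] SmoothNear

@[fun_prop]
lemma smoothNear_id (x : E) : SmoothNear (fun y : E => y) x := ContDiff.smoothNear contDiff_id x

@[fun_prop]
lemma smoothNear_const (c : F) (x : E) : SmoothNear (fun _ : E => c) x :=
  ContDiff.smoothNear contDiff_const x

@[fun_prop]
lemma SmoothNear.comp_fun {g : F → G} {f : E → F} {x : E} (hg : SmoothNear g (f x))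
    (hf : SmoothNear f x) : SmoothNear (fun y => g (f y)) x := hg.comp hf

@[fun_prop]
lemma SmoothNear.prodMk_fun {f : E → F} {g : E → G} {x : E} (hf : SmoothNear f x)
    (hg : SmoothNear g x) : SmoothNear (fun y => (f y, g y)) x := hf.prodMk hg

@[fun_prop]
lemma SmoothNear.fst {f : E → F × G} {x : E} (hf : SmoothNear f x) :
    SmoothNear (fun y => (f y).1) x := (ContDiff.smoothNear contDiff_fst _).comp hf

@[fun_prop]
lemma SmoothNear.snd {f : E → F × G} {x : E} (hf : SmoothNear f x) :
    SmoothNear (fun y => (f y).2) x := (ContDiff.smoothNear contDiff_snd _).comp hf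

@[fun_prop]
lemma SmoothNear.pi {ι : Type*} [Fintype ι] {F' : ι → Type*} [∀ i, NormedAddCommGroup (F' i)]
    [∀ i, NormedSpace ℝ (F' i)] {f : E → ∀ i, F' i} {x : E}
    (hf : ∀ i, SmoothNear (fun y => f y i) x) : SmoothNear f x := by
  filter_upwards [eventually_all.2 hf] with y hy using contDiffAt_pi.2 hy

@[fun_prop]
lemma smoothNear_apply {ι : Type*} [Fintype ι] (i : ι) (v : ι → F) :
    SmoothNear (fun f : ι → F => f i) v := ContDiff.smoothNear (contDiff_apply ℝ F i) _

@[fun_prop]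
lemma SmoothNear.add {f g : E → F} {x : E} (hf : SmoothNear f x) (hg : SmoothNear g x) :
    SmoothNear (fun y => f y + g y) x := by
  filter_upwards [hf, hg] with y h1 h2 using h1.add h2

@[fun_prop]
lemma SmoothNear.sub {f g : E → F} {x : E} (hf : SmoothNear f x) (hg : SmoothNear g x) :
    SmoothNear (fun y => f y - g y) x := by
  filter_upwards [hf, hg] with y h1 h2 using h1.sub h2

@[fun_prop]
lemma SmoothNear.neg {f : E → F} {x : E} (hf : SmoothNear f x) :
    SmoothNear (fun y => -f y) x := by
  filter_upwards [hf] with y h1 using h1.neg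

@[fun_prop]
lemma SmoothNear.smul {f : E → ℝ} {g : E → F} {x : E} (hf : SmoothNear f x) (hg : SmoothNear g x) :
    SmoothNear (fun y => f y • g y) x := by
  filter_upwards [hf, hg] with y h1 h2 using h1.smul h2

@[fun_prop]
lemma SmoothNear.mul {A : Type*} [NormedRing A] [NormedAlgebra ℝ A] {f g : E → A} {x : E}
    (hf : SmoothNear f x) (hg : SmoothNear g x) : SmoothNear (fun y => f y * g y) x := by
  filter_upwards [hf, hg] with y h1 h2 using h1.mul h2

@[fun_prop]
lemma SmoothNear.pow {f : E → ℝ} {x : E} (hf : SmoothNear f x) (n : ℕ) :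
    SmoothNear (fun y => f y ^ n) x := by
  filter_upwards [hf] with y h1 using h1.pow n

@[fun_prop]
lemma SmoothNear.div {f g : E → ℝ} {x : E} (hf : SmoothNear f x) (hg : SmoothNear g x)
    (h0 : g x ≠ 0) : SmoothNear (fun y => f y / g y) x := by
  filter_upwards [hf, hg, hg.continuousAt.eventually_ne h0] with y h1 h2 h3 using h1.div h2 h3

@[fun_prop]
lemma SmoothNear.sqrt {f : E → ℝ} {x : E} (hf : SmoothNear f x) (h0 : f x ≠ 0) :
    SmoothNear (fun y => √(f y)) x := by
  filter_upwards [hf, hf.continuousAt.eventually_ne h0] with y h1 h3 using h1.sqrt h3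

@[fun_prop]
lemma SmoothNear.norm {f : E → ℂ} {x : E} (hf : SmoothNear f x) (h0 : f x ≠ 0) :
    SmoothNear (fun y => ‖f y‖) x := by
  filter_upwards [hf, hf.continuousAt.eventually_ne h0] with y h1 h3 using h1.norm ℝ h3

@[fun_prop]
lemma SmoothNear.re {f : E → ℂ} {x : E} (hf : SmoothNear f x) : SmoothNear (fun y => (f y).re) x :=
  (ContDiff.smoothNear Complex.reCLM.contDiff _).comp hf

@[fun_prop]
lemma SmoothNear.im {f : E → ℂ} {x : E} (hf : SmoothNear f x) : SmoothNear (fun y => (f y).im) x :=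
  (ContDiff.smoothNear Complex.imCLM.contDiff _).comp hf

@[fun_prop]
lemma SmoothNear.ofReal {f : E → ℝ} {x : E} (hf : SmoothNear f x) :
    SmoothNear (fun y => (f y : ℂ)) x :=
  (ContDiff.smoothNear Complex.ofRealCLM.contDiff _).comp hf

@[fun_prop]
lemma SmoothNear.conj {f : E → ℂ} {x : E} (hf : SmoothNear f x) :
    SmoothNear (fun y => conj (f y)) x :=
  (ContDiff.smoothNear Complex.conjCLE.contDiff _).comp hf

@[fun_prop]
lemma SmoothNear.complexMk {f g : E → ℝ} {x : E} (hf : SmoothNear f x) (hg : SmoothNear g x) :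
    SmoothNear (fun y => (⟨f y, g y⟩ : ℂ)) x := by
  have : (fun y => (⟨f y, g y⟩ : ℂ)) = fun y => (f y : ℂ) + (g y : ℂ) * Complex.I := by
    ext y; exact Complex.mk_eq_add_mul_I _ _
  rw [this]
  fun_prop

/-- A smooth function of a parameter and a real variable with nonvanishing derivative in the
latter can be solved for it. -/
lemma SmoothNear.exists_solve [CompleteSpace E] {f : E × ℝ → ℝ} {p : E} {s d : ℝ}
    (hf : SmoothNear f (p, s)) (hd : HasDerivAt (fun s' => f (p, s')) d s) (h0 : d ≠ 0) :
    ∃ h : E × ℝ → ℝ, SmoothNear h (p, f (p, s)) ∧ ∀ᶠ y in 𝓝 (p, s), h (y.1, f y) = y.2 := by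
  have hL : HasFDerivAt f (fderiv ℝ f (p, s)) (p, s) :=
    (hf.contDiffAt.differentiableAt (by simp)).hasFDerivAt
  set L := fderiv ℝ f (p, s) with hLdef
  have hLs : L (0, 1) = d := by
    have h1 : HasDerivAt (fun s' : ℝ => (p, s')) (0, 1) s :=
      (hasDerivAt_const s p).prodMk (hasDerivAt_id s)
    exact (hL.comp_hasDerivAt s h1).unique hd
  have hLe : ∀ v : E × ℝ, L v = L (v.1, 0) + v.2 * d := by
    intro v
    have : v = (v.1, (0 : ℝ)) + v.2 • ((0 : E), (1 : ℝ)) := by ext <;> simp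
    conv_lhs => rw [this]
    rw [map_add, map_smul, hLs, smul_eq_mul]
  -- This is the differential of `(p, s) ↦ (p, f (p, s))`. It is block triangular with diagonal
  -- entries the identity and `d ≠ 0`, so the inverse function theorem applies.
  let e : (E × ℝ) ≃L[ℝ] (E × ℝ) := ContinuousLinearEquiv.equivOfInverse
    ((ContinuousLinearMap.fst ℝ E ℝ).prod L)
    ((ContinuousLinearMap.fst ℝ E ℝ).prod
      (d⁻¹ • (ContinuousLinearMap.snd ℝ E ℝ -
        L.comp ((ContinuousLinearMap.fst ℝ E ℝ).prod 0))))
    (fun v => by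
      refine Prod.ext rfl ?_
      change d⁻¹ * (L v - L (v.1, 0)) = v.2
      rw [hLe v]; field_simp; ring)
    (fun v => by
      refine Prod.ext rfl ?_
      change L (v.1, d⁻¹ * (v.2 - L (v.1, 0))) = v.2
      rw [hLe]; field_simp; ring)
  have he : HasFDerivAt (fun y : E × ℝ => (y.1, f y)) (e : (E × ℝ) →L[ℝ] E × ℝ) (p, s) :=
    hasFDerivAt_fst.prodMk hL
  have hs : SmoothNear (fun y : E × ℝ => (y.1, f y)) (p, s) := by fun_prop
  obtain ⟨Φ, h1, h2, -, -, h5⟩ := hs.exists_openPartialHomeomorph he univ_mem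
  refine ⟨fun y => (Φ.symm y).2, ?_, ?_⟩
  · have : SmoothNear Φ.symm (p, f (p, s)) := by
      refine SmoothNear.of_isOpen Φ.open_target
        (fun y hy => (h5 y hy).contDiffAt (Φ.open_target.mem_nhds hy)) ?_
      have := Φ.map_source h2
      rwa [h1] at this
    fun_prop
  · filter_upwards [Φ.open_source.mem_nhds h2] with y hy
    have := Φ.left_inv hy
    rw [h1] at this
    rw [this]

end SmoothCalculus

/-! ### An isotopy of the disc that takes angles to heights. -/

section Twist

/-- A smooth even cut-off function, `1` for `y² ≤ 1/2` and `0` for `y² ≥ 3/4`. -/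
def cut (y : ℝ) : ℝ := Real.smoothTransition (3 - 4 * y ^ 2)

/-- The difference between `y` and `(2/π) arcsin y`, cut off near `±1`. -/
def bend (y : ℝ) : ℝ := cut y * (y - 2 / Real.pi * Real.arcsin y)

/-- A reparametrization of `[-1, 1]`, the identity for `t = 0`, and given for `t = 1` by
`(2/π) arcsin y` near `0`. -/
def twistIm (t y : ℝ) : ℝ := y - t * bend y

/-- The factor with `1 - (twistIm t y)² = (1 - y²) * twistFactor t y`. -/
def twistFactor (t y : ℝ) : ℝ := 1 + bend y / (1 - y ^ 2) * (2 * t * y - t ^ 2 * bend y)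

/-- An isotopy of the disc that reparametrizes the imaginary part. -/
def twist (t : ℝ) (v : ℂ) : ℂ := ⟨v.re * √(twistFactor t v.im), twistIm t v.im⟩

lemma contDiff_cut : ContDiff ℝ ∞ cut := by
  unfold cut
  have : ContDiff ℝ ∞ Real.smoothTransition := Real.smoothTransition.contDiff
  fun_prop

lemma cut_eq_zero {y : ℝ} (h : 3 / 4 ≤ y ^ 2) : cut y = 0 :=
  Real.smoothTransition.zero_of_nonpos (by linarith)

lemma cut_eq_one {y : ℝ} (h : y ^ 2 ≤ 1 / 2) : cut y = 1 :=
  Real.smoothTransition.one_of_one_le (by linarith)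

lemma cut_nonneg (y : ℝ) : 0 ≤ cut y := Real.smoothTransition.nonneg _

lemma cut_le_one (y : ℝ) : cut y ≤ 1 := Real.smoothTransition.le_one _

lemma bend_eq_zero {y : ℝ} (h : 3 / 4 ≤ y ^ 2) : bend y = 0 := by
  rw [bend, cut_eq_zero h, zero_mul]

lemma bend_neg (y : ℝ) : bend (-y) = -bend y := by
  simp only [bend, cut, Real.arcsin_neg, even_two.neg_pow]; ring

lemma bend_eventually_zero {y : ℝ} (h : 3 / 4 < y ^ 2) : bend =ᶠ[𝓝 y] fun _ => 0 := by
  have : ∀ᶠ z : ℝ in 𝓝 y, 3 / 4 < z ^ 2 :=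
    (continuous_pow 2).continuousAt.eventually (lt_mem_nhds h)
  filter_upwards [this] with z hz using bend_eq_zero hz.le

/-- The arcsine fails to be smooth only at `±1`, and there the cut-off makes `bend` vanish locally.
-/
lemma contDiff_bend : ContDiff ℝ ∞ bend := by
  refine contDiff_iff_contDiffAt.2 fun y => ?_
  by_cases h : 3 / 4 < y ^ 2
  · exact contDiffAt_const.congr_of_eventuallyEq (bend_eventually_zero h)
  · have h1 : y ≠ -1 := by rintro rfl; norm_num at h
    have h2 : y ≠ 1 := by rintro rfl; norm_num at h
    exact contDiff_cut.contDiffAt.mul (contDiffAt_id.sub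
      (contDiffAt_const.mul (Real.contDiffAt_arcsin h1 h2)))

lemma contDiff_bend_div : ContDiff ℝ ∞ fun y => bend y / (1 - y ^ 2) := by
  refine contDiff_iff_contDiffAt.2 fun y => ?_
  by_cases h : 3 / 4 < y ^ 2
  · refine (contDiffAt_const (c := (0 : ℝ))).congr_of_eventuallyEq ?_
    filter_upwards [bend_eventually_zero h] with z hz
    rw [hz, zero_div]
  · refine contDiff_bend.contDiffAt.div (by fun_prop) ?_
    nlinarith

/-- Jordan's inequality `2 / π * θ ≤ sin θ` at `θ = arcsin y`. -/
lemma bend_bounds {y : ℝ} (h0 : 0 ≤ y) (h1 : y ≤ 1) : 0 ≤ bend y ∧ bend y ≤ y := by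
  have ha := Real.arcsin_nonneg.2 h0
  have hj : 2 / Real.pi * Real.arcsin y ≤ y := by
    have := Real.mul_le_sin ha (Real.arcsin_le_pi_div_two y)
    rwa [Real.sin_arcsin (by linarith) h1] at this
  have hp : 0 ≤ 2 / Real.pi * Real.arcsin y := by positivity
  refine ⟨mul_nonneg (cut_nonneg y) (by linarith), ?_⟩
  calc bend y ≤ 1 * (y - 2 / Real.pi * Real.arcsin y) :=
        mul_le_mul_of_nonneg_right (cut_le_one y) (by linarith)
    _ ≤ y := by linarith

lemma mul_sub_sq_bend_nonneg {t y : ℝ} (ht : t ∈ Icc (0 : ℝ) 1) (hy : y ∈ Icc (-1 : ℝ) 1) :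
    0 ≤ bend y * (2 * t * y - t ^ 2 * bend y) := by
  have key : ∀ y, 0 ≤ y → y ≤ 1 → 0 ≤ bend y * (2 * t * y - t ^ 2 * bend y) := by
    intro y h0 h1
    obtain ⟨h2, h3⟩ := bend_bounds h0 h1
    refine mul_nonneg h2 ?_
    nlinarith [ht.1, ht.2, mul_nonneg ht.1 h0, mul_nonneg ht.1 h2, mul_nonneg (mul_nonneg ht.1 h2)
      (sub_nonneg.2 ht.2), mul_nonneg ht.1 (sub_nonneg.2 h3)]
  rcases le_total 0 y with h | h
  · exact key y h hy.2
  · have := key (-y) (by linarith) (by linarith [hy.1])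
    rw [bend_neg] at this
    linarith

/-- On the disc the square root in `twist` is taken away from zero, so it is smooth and invertible
there. -/
lemma one_le_twistFactor {t y : ℝ} (ht : t ∈ Icc (0 : ℝ) 1) (hy : y ∈ Icc (-1 : ℝ) 1) :
    1 ≤ twistFactor t y := by
  have h : 0 ≤ bend y * (2 * t * y - t ^ 2 * bend y) / (1 - y ^ 2) :=
    div_nonneg (mul_sub_sq_bend_nonneg ht hy) (by nlinarith [hy.1, hy.2])
  unfold twistFactor
  rw [div_mul_eq_mul_div]
  linarith

lemma one_sub_twistIm_sq (t y : ℝ) : 1 - twistIm t y ^ 2 = (1 - y ^ 2) * twistFactor t y := by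
  unfold twistIm twistFactor
  by_cases h : 3 / 4 ≤ y ^ 2
  · rw [bend_eq_zero h]; ring
  · have : 1 - y ^ 2 ≠ 0 := by linarith
    field_simp
    ring

/-- The derivative of `cut` has the sign opposite to `y`, while `y - 2 / π * arcsin y` has the sign
of `y`, so the term with the derivative of `cut` is not positive. The other term is `cut y` times a
number smaller than `1`. In consequence `twistIm t` is strictly increasing for every `t` between `0`
and `1`. -/
lemma exists_hasDerivAt_bend {y : ℝ} (hy : y ∈ Icc (-1 : ℝ) 1) : ∃ d < 1, HasDerivAt bend d y := by
  by_cases h : 3 / 4 < y ^ 2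
  · exact ⟨0, one_pos, (hasDerivAt_const y (0 : ℝ)).congr_of_eventuallyEq (bend_eventually_zero h)⟩
  have h1 : y ≠ -1 := by rintro rfl; norm_num at h
  have h2 : y ≠ 1 := by rintro rfl; norm_num at h
  have hst : DifferentiableAt ℝ Real.smoothTransition (3 - 4 * y ^ 2) :=
    (Real.smoothTransition.contDiff (n := 1)).contDiffAt.differentiableAt (by simp)
  have hst0 : 0 ≤ deriv Real.smoothTransition (3 - 4 * y ^ 2) :=
    Real.smoothTransition.monotone.deriv_nonneg
  set D := deriv Real.smoothTransition (3 - 4 * y ^ 2)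
  have hc : HasDerivAt cut (D * (-(8 * y))) y := by
    have h3 : HasDerivAt (fun y : ℝ => 3 - 4 * y ^ 2) (-(8 * y)) y := by
      refine (((hasDerivAt_pow 2 y).const_mul 4).const_sub 3).congr_deriv ?_
      norm_num
      ring
    exact HasDerivAt.comp y hst.hasDerivAt h3
  have hg : HasDerivAt (fun y => y - 2 / Real.pi * Real.arcsin y)
      (1 - 2 / Real.pi * (1 / √(1 - y ^ 2))) y :=
    (hasDerivAt_id y).sub ((Real.hasDerivAt_arcsin h1 h2).const_mul _)
  refine ⟨_, ?_, hc.mul hg⟩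
  have hpos : 0 < 2 / Real.pi * (1 / √(1 - y ^ 2)) := by
    have : 0 < 1 - y ^ 2 := by linarith
    positivity
  have hsign : 0 ≤ y * (y - 2 / Real.pi * Real.arcsin y) := by
    have key : ∀ y : ℝ, 0 ≤ y → y ≤ 1 → 0 ≤ y - 2 / Real.pi * Real.arcsin y := by
      intro y h0 h1
      have := Real.mul_le_sin (Real.arcsin_nonneg.2 h0) (Real.arcsin_le_pi_div_two y)
      rw [Real.sin_arcsin (by linarith) h1] at this
      linarith
    rcases le_total 0 y with h | h
    · exact mul_nonneg h (key y h hy.2)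
    · have := key (-y) (by linarith) (by linarith [hy.1])
      rw [Real.arcsin_neg] at this
      nlinarith
  have e1 : cut y * (1 - 2 / Real.pi * (1 / √(1 - y ^ 2))) < 1 := by
    set r := 2 / Real.pi * (1 / √(1 - y ^ 2))
    calc cut y * (1 - r) = cut y - cut y * r := by ring
      _ < 1 := by
        rcases (cut_nonneg y).eq_or_lt with h | h
        · rw [← h]; norm_num
        · linarith [cut_le_one y, mul_pos h hpos]
  nlinarith [mul_nonneg hst0 hsign]

lemma exists_hasDerivAt_twistIm {t y : ℝ} (ht : t ∈ Icc (0 : ℝ) 1) (hy : y ∈ Icc (-1 : ℝ) 1) :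
    ∃ d > 0, HasDerivAt (twistIm t) d y := by
  obtain ⟨d, hd, h⟩ := exists_hasDerivAt_bend hy
  refine ⟨1 - t * d, ?_, (hasDerivAt_id y).sub (h.const_mul t)⟩
  rcases ht.1.eq_or_lt with h | h
  · rw [← h]; norm_num
  · nlinarith [ht.2]

lemma continuous_twistIm (t : ℝ) : Continuous (twistIm t) :=
  continuous_id.sub (continuous_const.mul contDiff_bend.continuous)

lemma strictMonoOn_twistIm {t : ℝ} (ht : t ∈ Icc (0 : ℝ) 1) :
    StrictMonoOn (twistIm t) (Icc (-1) 1) := by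
  refine strictMonoOn_of_deriv_pos (convex_Icc _ _) (continuous_twistIm t).continuousOn ?_
  intro y hy
  obtain ⟨d, hd, h⟩ := exists_hasDerivAt_twistIm ht (interior_subset hy)
  rwa [h.deriv]

lemma twistIm_one (t : ℝ) : twistIm t 1 = 1 := by
  rw [twistIm, bend_eq_zero (by norm_num)]; ring

lemma twistIm_neg (t y : ℝ) : twistIm t (-y) = -twistIm t y := by
  rw [twistIm, twistIm, bend_neg]; ring

lemma twistFactor_neg (t y : ℝ) : twistFactor t (-y) = twistFactor t y := by
  rw [twistFactor, twistFactor, bend_neg, even_two.neg_pow]; ring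

lemma twistIm_surj (t : ℝ) {y : ℝ} (hy : y ∈ Icc (-1 : ℝ) 1) :
    ∃ y' ∈ Icc (-1 : ℝ) 1, twistIm t y' = y := by
  have := intermediate_value_Icc (by norm_num : (-1 : ℝ) ≤ 1) (continuous_twistIm t).continuousOn
  rw [twistIm_neg, twistIm_one] at this
  exact this hy

lemma twistIm_of_sq_le {y : ℝ} (h : y ^ 2 ≤ 1 / 2) : twistIm 1 y = 2 / Real.pi * Real.arcsin y := by
  rw [twistIm, bend, cut_eq_one h]; ring

lemma twist_zero (v : ℂ) : twist 0 v = v := by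
  apply Complex.ext <;> simp [twist, twistFactor, twistIm]

lemma twist_conj (t : ℝ) (v : ℂ) : twist t (conj v) = conj (twist t v) := by
  apply Complex.ext <;> simp [twist, twistFactor_neg, twistIm_neg]

lemma norm_le_one_iff (v : ℂ) : ‖v‖ ≤ 1 ↔ v.re ^ 2 + v.im ^ 2 ≤ 1 := by
  rw [← sq_le_one_iff₀ (norm_nonneg _), ← Complex.normSq_eq_norm_sq, Complex.normSq_apply]
  ring_nf

lemma norm_eq_one_iff (v : ℂ) : ‖v‖ = 1 ↔ v.re ^ 2 + v.im ^ 2 = 1 := by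
  rw [← sq_eq_sq₀ (norm_nonneg _) zero_le_one, ← Complex.normSq_eq_norm_sq, Complex.normSq_apply]
  ring_nf

lemma im_mem_Icc {v : ℂ} (hv : ‖v‖ ≤ 1) : v.im ∈ Icc (-1 : ℝ) 1 :=
  abs_le.1 ((Complex.abs_im_le_norm v).trans hv)

/-- `twistFactor` is made for this identity. The defect `1 - |v|²` is multiplied by a positive
factor, so `twist t` preserves the disc and its boundary circle. -/
lemma one_sub_twist_sq {t : ℝ} (ht : t ∈ Icc (0 : ℝ) 1) {v : ℂ} (hv : v.im ∈ Icc (-1 : ℝ) 1) :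
    1 - ((twist t v).re ^ 2 + (twist t v).im ^ 2) =
      twistFactor t v.im * (1 - (v.re ^ 2 + v.im ^ 2)) := by
  have h1 := one_le_twistFactor ht hv
  have h2 : √(twistFactor t v.im) ^ 2 = twistFactor t v.im := Real.sq_sqrt (by linarith)
  have h3 := one_sub_twistIm_sq t v.im
  simp only [twist, mul_pow, h2]
  linear_combination h3

lemma norm_twist_le {t : ℝ} (ht : t ∈ Icc (0 : ℝ) 1) {v : ℂ} (hv : ‖v‖ ≤ 1) : ‖twist t v‖ ≤ 1 := by
  have h := one_sub_twist_sq ht (im_mem_Icc hv)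
  have h1 := one_le_twistFactor ht (im_mem_Icc hv)
  rw [norm_le_one_iff] at hv ⊢
  nlinarith

lemma norm_twist_eq_one_iff {t : ℝ} (ht : t ∈ Icc (0 : ℝ) 1) {v : ℂ} (hv : ‖v‖ ≤ 1) :
    ‖twist t v‖ = 1 ↔ ‖v‖ = 1 := by
  have h := one_sub_twist_sq ht (im_mem_Icc hv)
  have h1 := one_le_twistFactor ht (im_mem_Icc hv)
  rw [norm_eq_one_iff, norm_eq_one_iff]
  constructor
  · intro h2
    rw [h2, sub_self, eq_comm, mul_eq_zero] at h
    rcases h with h | h <;> linarith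
  · intro h2
    rw [h2, sub_self, mul_zero] at h
    linarith

lemma twist_surj {t : ℝ} (ht : t ∈ Icc (0 : ℝ) 1) {v : ℂ} (hv : ‖v‖ ≤ 1) :
    ∃ v', ‖v'‖ ≤ 1 ∧ twist t v' = v := by
  obtain ⟨y, hy, h⟩ := twistIm_surj t (im_mem_Icc hv)
  have h1 := one_le_twistFactor ht hy
  have h0 : √(twistFactor t y) ≠ 0 := (Real.sqrt_pos.2 (by linarith)).ne'
  have he : twist t ⟨v.re / √(twistFactor t y), y⟩ = v :=
    Complex.ext (div_mul_cancel₀ _ h0) h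
  refine ⟨_, ?_, he⟩
  have h2 := one_sub_twist_sq ht (v := ⟨v.re / √(twistFactor t y), y⟩) hy
  rw [he] at h2
  rw [norm_le_one_iff] at hv ⊢
  by_contra! h3
  dsimp only at h2 h3
  nlinarith

/-- The imaginary part is transformed by itself and monotonically, so it is recovered first, by the
implicit function theorem with parameter `t`. The real part then follows by division. -/
lemma embOn_twist :
    EmbOn (fun p : ℂ × ℝ => (twist p.2 p.1, p.2)) ({v | ‖v‖ ≤ 1} ×ˢ Icc (0 : ℝ) 1) := by
  have hb : ∀ y, SmoothNear bend y := fun y => ContDiff.smoothNear contDiff_bend y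
  have hbd : ∀ y, SmoothNear (fun y => bend y / (1 - y ^ 2)) y :=
    fun y => ContDiff.smoothNear contDiff_bend_div y
  have hTI : ∀ p : ℝ × ℝ, SmoothNear (fun p : ℝ × ℝ => twistIm p.1 p.2) p := by
    intro p; unfold twistIm; fun_prop
  have hTF : ∀ p : ℝ × ℝ, SmoothNear (fun p : ℝ × ℝ => twistFactor p.1 p.2) p := by
    intro p
    unfold twistFactor
    have : SmoothNear (fun p : ℝ × ℝ => bend p.2 / (1 - p.2 ^ 2)) p :=
      SmoothNear.comp_fun (g := fun y => bend y / (1 - y ^ 2)) (f := fun p : ℝ × ℝ => p.2)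
        (hbd _) (by fun_prop)
    fun_prop
  refine ⟨?_, ?_⟩
  · rintro ⟨v, t⟩ ⟨hv, ht⟩ ⟨v', t'⟩ ⟨hv', -⟩ h
    have h2 : t = t' := congrArg Prod.snd h
    subst h2
    have h1 : twist t v = twist t v' := congrArg Prod.fst h
    have hi : v.im = v'.im := (strictMonoOn_twistIm ht).injOn (im_mem_Icc hv) (im_mem_Icc hv')
      (congrArg Complex.im h1)
    have hr : v.re * √(twistFactor t v.im) = v'.re * √(twistFactor t v'.im) :=
      congrArg Complex.re h1
    have h3 := one_le_twistFactor ht (im_mem_Icc hv)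
    have h0 : √(twistFactor t v.im) ≠ 0 := (Real.sqrt_pos.2 (by linarith)).ne'
    rw [← hi] at hr
    rw [Complex.ext (mul_right_cancel₀ h0 hr) hi]
  · rintro ⟨v, t⟩ ⟨hv, ht⟩
    have h3 := one_le_twistFactor ht (im_mem_Icc hv)
    have h0 : twistFactor t v.im ≠ 0 := by linarith
    have h0' : √(twistFactor t v.im) ≠ 0 := (Real.sqrt_pos.2 (by linarith)).ne'
    have hF : SmoothNear (fun p : ℂ × ℝ => twistFactor p.2 p.1.im) (v, t) :=
      SmoothNear.comp_fun (g := fun p : ℝ × ℝ => twistFactor p.1 p.2)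
        (f := fun p : ℂ × ℝ => (p.2, p.1.im)) (hTF _) (by fun_prop)
    have hI : SmoothNear (fun p : ℂ × ℝ => twistIm p.2 p.1.im) (v, t) :=
      SmoothNear.comp_fun (g := fun p : ℝ × ℝ => twistIm p.1 p.2)
        (f := fun p : ℂ × ℝ => (p.2, p.1.im)) (hTI _) (by fun_prop)
    obtain ⟨d, hd, hder⟩ := exists_hasDerivAt_twistIm ht (im_mem_Icc hv)
    obtain ⟨g, hg, hge⟩ := SmoothNear.exists_solve (hTI (t, v.im)) hder hd.ne'
    have hgv : g (t, twistIm t v.im) = v.im := hge.self_of_nhds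
    refine ⟨by unfold twist; fun_prop (disch := assumption), fun p =>
      (⟨p.1.re / √(twistFactor p.2 (g (p.2, p.1.im))), g (p.2, p.1.im)⟩, p.2), ?_, ?_⟩
    · have hg' : SmoothNear (fun p : ℂ × ℝ => g (p.2, p.1.im)) (twist t v, t) :=
        SmoothNear.comp_fun (g := g) (f := fun p : ℂ × ℝ => (p.2, p.1.im)) hg (by fun_prop)
      have hF' : SmoothNear (fun p : ℂ × ℝ => twistFactor p.2 (g (p.2, p.1.im))) (twist t v, t) :=
        SmoothNear.comp_fun (g := fun p : ℝ × ℝ => twistFactor p.1 p.2)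
          (f := fun p : ℂ × ℝ => (p.2, g (p.2, p.1.im))) (hTF _) (by fun_prop)
      have e1 : twistFactor t (g (t, (twist t v).im)) ≠ 0 := by
        change twistFactor t (g (t, twistIm t v.im)) ≠ 0
        rwa [hgv]
      have e2 : √(twistFactor t (g (t, (twist t v).im))) ≠ 0 := by
        change √(twistFactor t (g (t, twistIm t v.im))) ≠ 0
        rwa [hgv]
      fun_prop (disch := assumption)
    · have hcont : Tendsto (fun p : ℂ × ℝ => (p.2, p.1.im)) (𝓝 (v, t)) (𝓝 (t, v.im)) :=
        Continuous.tendsto (by fun_prop) (v, t)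
      refine Filter.Eventually.filter_mono nhdsWithin_le_nhds ?_
      have hne : ∀ᶠ p : ℂ × ℝ in 𝓝 (v, t), √(twistFactor p.2 p.1.im) ≠ 0 :=
        (SmoothNear.sqrt hF h0).continuousAt.eventually_ne h0'
      filter_upwards [hcont.eventually hge, hne] with p hp hp'
      have hp1 : g (p.2, (twist p.2 p.1).im) = p.1.im := hp
      refine Prod.ext (Complex.ext ?_ hp1) rfl
      change (twist p.2 p.1).re / √(twistFactor p.2 (g (p.2, (twist p.2 p.1).im))) = p.1.re
      rw [hp1]
      exact mul_div_cancel_right₀ _ hp'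

end Twist

/-! ### The thickness of the collars. -/

section Stretch

/-- The transition rises from `0` at `a = 9 / 2` to `1` at `a = 5`, and `κ` is small compared with
the derivative of `a` times the transition on `[0, 5]`. The stretched coordinate thus remains
strictly increasing. The end `a = 5` moves to `5 + 5 * c`, which is why the collars have thickness
`5 * κ`. -/
lemma exists_stretch_const : ∃ κ : ℝ, 0 < κ ∧ κ ≤ 1 / 100 ∧ ∀ c : ℝ, |c| ≤ κ → ∀ a ∈ Icc (0 : ℝ) 5,
    ∃ d > 0, HasDerivAt (fun a => a * (1 + c * Real.smoothTransition (2 * a - 9))) d a := by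
  have hs : ContDiff ℝ 1 fun a : ℝ => a * Real.smoothTransition (2 * a - 9) := by
    have : ContDiff ℝ 1 Real.smoothTransition := Real.smoothTransition.contDiff
    fun_prop
  have hc : Continuous (deriv fun a : ℝ => a * Real.smoothTransition (2 * a - 9)) :=
    hs.continuous_deriv le_rfl
  obtain ⟨C, hC⟩ := isCompact_Icc.exists_bound_of_continuousOn (s := Icc (0 : ℝ) 5) hc.continuousOn
  have hC0 : 0 ≤ C := (norm_nonneg _).trans (hC 0 (by norm_num))
  refine ⟨1 / (100 * (C + 1)), by positivity, ?_, fun c hc a ha => ?_⟩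
  · exact one_div_le_one_div_of_le (by norm_num) (by linarith)
  · have h1 := ((hs.differentiable (by simp)) a).hasDerivAt
    refine ⟨1 + c * deriv (fun a : ℝ => a * Real.smoothTransition (2 * a - 9)) a, ?_, ?_⟩
    · have h2 : |c * deriv (fun a : ℝ => a * Real.smoothTransition (2 * a - 9)) a| ≤
          1 / (100 * (C + 1)) * C := by
        rw [abs_mul]
        exact mul_le_mul hc (hC a ha) (abs_nonneg _) (by positivity)
      have h3 : 1 / (100 * (C + 1)) * C < 1 := by
        rw [one_div, inv_mul_lt_iff₀ (by positivity)]
        linarith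
      have := (abs_le.1 h2).1
      linarith
    · refine ((hasDerivAt_id a).add (h1.const_mul c)).congr_of_eventuallyEq
        (Eventually.of_forall fun b => ?_)
      simp only [Pi.add_apply, id]
      ring

/-- The relative size of the collars. -/
def stretchConst : ℝ := exists_stretch_const.choose

/-- The thickness of the collars. -/
def eps : ℝ := 5 * stretchConst

lemma stretchConst_pos : 0 < stretchConst := exists_stretch_const.choose_spec.1

lemma stretchConst_le : stretchConst ≤ 1 / 100 := exists_stretch_const.choose_spec.2.1

lemma eps_pos : 0 < eps := mul_pos (by norm_num) stretchConst_pos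

lemma eps_le : eps ≤ 1 / 20 := by
  have := stretchConst_le
  unfold eps
  linarith

end Stretch

/-! ### The wall function along rays and the two ellipses. -/

section WallFunction

/-- The coordinates `x₂` (for `σ = 1`) and `x₁` (for `σ = -1`) of the point at height `q` over
`z`. -/
def lev (σ : ℝ) (z : ℂ) (q : ℝ) : ℝ := (2 + q) / 2 - σ * (q * z.im)

/-- The wall function `x₀ x₁ x₂ / 5 - ξ²`. -/
def wallFun (z : ℂ) (q : ℝ) : ℝ := (7 - q) * (lev 1 z q * lev (-1) z q) / 5 - (q * z.re) ^ 2

/-- The function that cuts out the cone over the section `lev σ = 5`. -/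
def cone (σ : ℝ) (z : ℂ) : ℝ :=
  z.re ^ 2 + 21 * ((1 - 2 * σ * z.im) / 8) ^ 2 - 10 * ((1 - 2 * σ * z.im) / 8) + 1

lemma lev_add (z : ℂ) (q : ℝ) : lev 1 z q + lev (-1) z q = 2 + q := by
  unfold lev; ring

lemma lev_add' (σ : ℝ) (z : ℂ) (q : ℝ) :
    lev σ z q + lev (-σ) z q = 2 + q := by
  unfold lev; ring

lemma lev_mul {σ : ℝ} (hσ : σ = 1 ∨ σ = -1) (z : ℂ) (q : ℝ) :
    lev 1 z q * lev (-1) z q = lev σ z q * lev (-σ) z q := by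
  rcases hσ with rfl | rfl
  · rfl
  · rw [neg_neg, mul_comm]

/-- Along rays, the wall function divided by `q²` is strictly decreasing. -/
lemma wallFun_strictAnti {z : ℂ} {q q' : ℝ} (hq : 0 < q) (hqq : q < q') (h0 : 0 ≤ 7 - q')
    (h1 : 0 ≤ lev 1 z q') (h2 : 0 ≤ lev (-1) z q') :
    q ^ 2 * wallFun z q' < q' ^ 2 * wallFun z q := by
  have hq' : 0 < q' := hq.trans hqq
  have hp : 0 ≤ lev 1 z q' * lev (-1) z q' := mul_nonneg h1 h2
  -- Divided by `q²`, the product becomes `(1 / q + 1 / 2) ^ 2 - z.im ^ 2`, which decreases in `q`.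
  -- The factor `7 - q` decreases as well, and `(q * z.re) ^ 2` contributes a constant.
  have e : ∀ q, lev 1 z q * lev (-1) z q = (1 + q / 2) ^ 2 - q ^ 2 * z.im ^ 2 := by
    intro q; unfold lev; ring
  have hP : q ^ 2 * (lev 1 z q' * lev (-1) z q') < q' ^ 2 * (lev 1 z q * lev (-1) z q) := by
    rw [e, e]
    nlinarith [mul_pos hq hq', mul_pos hq (sub_pos.2 hqq), mul_pos hq' (sub_pos.2 hqq),
      mul_pos (mul_pos hq hq') (sub_pos.2 hqq)]
  unfold wallFun
  have h3 : (7 - q') * (q ^ 2 * (lev 1 z q' * lev (-1) z q')) ≤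
      (7 - q') * (q' ^ 2 * (lev 1 z q * lev (-1) z q)) := mul_le_mul_of_nonneg_left hP.le h0
  have h4 : 0 < q' ^ 2 * (lev 1 z q * lev (-1) z q) :=
    lt_of_le_of_lt (by positivity) hP
  nlinarith [mul_pos (sub_pos.2 hqq) h4]

/-- The three coordinates add up to `9` and have a nonnegative product. If one of them were
negative, another would be nonpositive and the third would exceed `9`, against the bounds. -/
lemma nonneg_of_wallFun_nonneg {z : ℂ} {q : ℝ} (hq : 0 ≤ q) (h1 : lev 1 z q < 11 / 2)
    (h2 : lev (-1) z q < 11 / 2) (hg : 0 ≤ wallFun z q) :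
    0 ≤ 7 - q ∧ 0 ≤ lev 1 z q ∧ 0 ≤ lev (-1) z q := by
  have hs := lev_add z q
  have hp : 0 ≤ (7 - q) * (lev 1 z q * lev (-1) z q) := by
    unfold wallFun at hg
    nlinarith [sq_nonneg (q * z.re)]
  generalize lev 1 z q = a at *
  generalize lev (-1) z q = b at *
  refine ⟨?_, ?_, ?_⟩ <;> by_contra! h
  · have : 0 < a * b := mul_pos (by linarith) (by linarith)
    nlinarith
  · have : a * b < 0 := mul_neg_of_neg_of_pos h (by linarith)
    nlinarith
  · have : a * b < 0 := mul_neg_of_pos_of_neg (by linarith) h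
    nlinarith

lemma wallFun_two (z : ℂ) : wallFun z 2 = 4 * (1 - (z.re ^ 2 + z.im ^ 2)) := by
  unfold wallFun lev; ring

/-- At the height `q` where `lev σ = 5`, the other two coordinates are `7 - q` and `q - 3`, so the
wall function is `-q² + 10 q - 21 - q² z.re²`. Division by `-q²` leaves a quadratic polynomial in `1
/ q = (1 - 2 σ z.im) / 8`, and this is `cone`. -/
lemma wallFun_cone {σ : ℝ} (hσ : σ = 1 ∨ σ = -1) {z : ℂ} (hz : 0 < 1 - 2 * σ * z.im) :
    wallFun z (8 / (1 - 2 * σ * z.im)) = -(8 / (1 - 2 * σ * z.im)) ^ 2 * cone σ z := by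
  unfold wallFun
  rw [lev_mul hσ]
  unfold lev cone
  have hσ2 : σ ^ 2 = 1 := by rcases hσ with rfl | rfl <;> norm_num
  obtain ⟨m, hm⟩ : ∃ m, 1 - 2 * σ * z.im = m := ⟨_, rfl⟩
  have hb : σ * z.im = (1 - m) / 2 := by linarith
  rw [hm] at hz ⊢
  have e1 : σ * (8 / m * z.im) = 8 / m * ((1 - m) / 2) := by rw [← hb]; ring
  have e2 : -σ * (8 / m * z.im) = -(8 / m * ((1 - m) / 2)) := by rw [← hb]; ring
  rw [e1, e2]
  field_simp
  ring

lemma lev_section {σ : ℝ} {z : ℂ} (hz : 0 < 1 - 2 * σ * z.im) :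
    lev σ z (8 / (1 - 2 * σ * z.im)) = 5 := by
  unfold lev
  field_simp
  ring

/-- With `c = (1 - 2 σ z.im) / 8` the terms without `z.re` factor as `(3 c - 1) (7 c - 1)`, so `c`
lies between `1 / 7` and `1 / 3`. In particular the two ellipses lie in opposite open half-planes,
inside the unit disc. -/
lemma cone_nonpos {σ : ℝ} (hσ : σ = 1 ∨ σ = -1) {z : ℂ} (h : cone σ z ≤ 0) :
    σ * z.im ≤ -1 / 14 ∧ -5 / 6 ≤ σ * z.im ∧ z.re ^ 2 + z.im ^ 2 < 1 := by
  have hb : z.im ^ 2 = (σ * z.im) ^ 2 := by rcases hσ with rfl | rfl <;> ring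
  have e : 2 * σ * z.im = 2 * (σ * z.im) := by ring
  unfold cone at h
  rw [hb]
  rw [e] at h
  generalize σ * z.im = b at *
  have h1 : b ≤ -1 / 14 := by nlinarith [sq_nonneg z.re]
  have h2 : -5 / 6 ≤ b := by nlinarith [sq_nonneg z.re]
  exact ⟨h1, h2, by nlinarith⟩

end WallFunction

/-! ### Slabs, from which the 2-handle cobordisms are built. -/

section Slabs

lemma norm_smul_unit {a : ℝ} (ha : 0 < a) {u : ℂ} (hu : ‖u‖ = 1) : ‖a • u‖ = a := by
  rw [norm_smul, hu, mul_one, Real.norm_of_nonneg ha.le]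

lemma one_mem_Icc : (1 : ℝ) ∈ Icc (0 : ℝ) 1 := by norm_num

lemma twist_inj {t : ℝ} (ht : t ∈ Icc (0 : ℝ) 1) {v v' : ℂ} (hv : ‖v‖ ≤ 1) (hv' : ‖v'‖ ≤ 1)
    (h : twist t v = twist t v') : v = v' :=
  congrArg Prod.fst (embOn_twist.1 (x₁ := (v, t)) (x₂ := (v', t)) ⟨hv, ht⟩ ⟨hv', ht⟩
    (Prod.ext h rfl))

lemma embOn_twist_one : EmbOn (twist 1) {v | ‖v‖ ≤ 1} := by
  refine ⟨fun v hv v' hv' h => ?_, fun v hv => ?_⟩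
  · exact twist_inj one_mem_Icc hv hv' h
  · obtain ⟨hs, r, hr, hre⟩ := embOn_twist.2 (v, 1) ⟨hv, one_mem_Icc⟩
    refine ⟨SmoothNear.comp_fun (g := fun p : ℂ × ℝ => twist p.2 p.1) (f := fun v : ℂ => (v, (1 : ℝ)))
      hs.fst (by fun_prop), fun v => (r (v, 1)).1, ?_, ?_⟩
    · exact (SmoothNear.comp_fun (g := r) (f := fun v : ℂ => (v, (1 : ℝ))) hr (by fun_prop)).fst
    · have : Tendsto (fun v : ℂ => (v, (1 : ℝ))) (𝓝[{v | ‖v‖ ≤ 1}] v)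
          (𝓝[{v | ‖v‖ ≤ 1} ×ˢ Icc (0 : ℝ) 1] (v, 1)) := by
        refine tendsto_nhdsWithin_iff.2 ⟨?_, eventually_nhdsWithin_of_forall ?_⟩
        · exact (Continuous.tendsto (by fun_prop) v).mono_left nhdsWithin_le_nhds
        · exact fun p hp => ⟨hp, one_mem_Icc⟩
      filter_upwards [this.eventually hre] with p hp
      exact congrArg Prod.fst hp

/-- A family, parametrized by `t`, of planar sections `v ↦ (Z (v, t), Q (v, t))` of the region
`wallFun ≥ 0`, with a left inverse `R`; the section for `t = 1` is a graph of the function `P`. -/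
structure Slab where
  Z : ℂ × ℝ → ℂ
  Q : ℂ × ℝ → ℝ
  R : ℂ × ℝ → ℂ × ℝ
  P : ℂ → ℝ
  c : ℝ → ℝ
  smooth_Z : ∀ v t, ‖v‖ ≤ 1 → t ∈ Icc (0 : ℝ) 1 → SmoothNear Z (v, t)
  smooth_Q : ∀ v t, ‖v‖ ≤ 1 → t ∈ Icc (0 : ℝ) 1 → SmoothNear Q (v, t)
  Q_pos : ∀ v t, ‖v‖ ≤ 1 → t ∈ Icc (0 : ℝ) 1 → 0 < Q (v, t)
  smooth_R : ∀ v t, ‖v‖ ≤ 1 → t ∈ Icc (0 : ℝ) 1 → SmoothNear R (Z (v, t), Q (v, t))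
  left_inv : ∀ v t, ‖v‖ ≤ 1 → t ∈ Icc (0 : ℝ) 1 → R (Z (v, t), Q (v, t)) = (v, t)
  smooth_P : ∀ v, ‖v‖ ≤ 1 → SmoothNear P (Z (v, 1))
  P_eq : ∀ v, ‖v‖ ≤ 1 → P (Z (v, 1)) = Q (v, 1)
  P_le : ∀ v t, ‖v‖ ≤ 1 → t ∈ Icc (0 : ℝ) 1 → P (Z (v, t)) ≤ Q (v, t)
  c_pos : ∀ t ∈ Icc (0 : ℝ) 1, 0 < c t
  wall : ∀ v t, ‖v‖ ≤ 1 → t ∈ Icc (0 : ℝ) 1 →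
    wallFun (Z (v, t)) (Q (v, t)) = c t * (1 - (v.re ^ 2 + v.im ^ 2))

namespace Slab

variable (S : Slab)

/-- The embedding of the cylinder on the solid torus. -/
def cyl (p : (ℂ × ℂ) × ℝ) : ℂ × ℂ :=
  (S.Z (twist p.2 p.1.2, p.2), S.Q (twist p.2 p.1.2, p.2) • p.1.1)

/-- The embedding of the handle. -/
def hand (p : ℂ × ℂ) : ℂ × ℂ := (S.Z (twist 1 p.2, 1), S.Q (twist 1 p.2, 1) • p.1)

lemma injOn_section {v v' : ℂ} {t t' : ℝ} (hv : ‖v‖ ≤ 1) (hv' : ‖v'‖ ≤ 1)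
    (ht : t ∈ Icc (0 : ℝ) 1) (ht' : t' ∈ Icc (0 : ℝ) 1) (hZ : S.Z (v, t) = S.Z (v', t'))
    (hQ : S.Q (v, t) = S.Q (v', t')) : v = v' ∧ t = t' := by
  have := S.left_inv v t hv ht
  rw [hZ, hQ, S.left_inv v' t' hv' ht'] at this
  exact ⟨(congrArg Prod.fst this).symm, (congrArg Prod.snd this).symm⟩

/-- After `twist` these are polar coordinates in `w`. The direction of `w` gives `u`, its length
gives the height, and `R` recovers `(v, t)` from `z` and the height. -/
lemma embOn_cyl : EmbOn S.cyl (solidTorus ×ˢ Icc (0 : ℝ) 1) := by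
  have h1 : EmbOn (fun p : (ℂ × ℂ) × ℝ => ((p.1.1, twist p.2 p.1.2), p.2))
      (solidTorus ×ˢ Icc (0 : ℝ) 1) := by
    refine ⟨?_, ?_⟩
    · rintro ⟨⟨u, v⟩, t⟩ ⟨⟨-, hv⟩, ht⟩ ⟨⟨u', v'⟩, t'⟩ ⟨⟨-, hv'⟩, ht'⟩ h
      simp only [Prod.mk.injEq] at h
      obtain ⟨⟨rfl, h⟩, rfl⟩ := h
      exact Prod.ext (Prod.ext rfl (twist_inj ht hv hv' h)) rfl
    · rintro ⟨⟨u, v⟩, t⟩ ⟨⟨hu, hv⟩, ht⟩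
      obtain ⟨hs, r, hr, hre⟩ := embOn_twist.2 (v, t) ⟨hv, ht⟩
      have hs' : SmoothNear (fun p : (ℂ × ℂ) × ℝ => twist p.2 p.1.2) ((u, v), t) :=
        SmoothNear.comp_fun (g := fun p : ℂ × ℝ => twist p.2 p.1)
          (f := fun p : (ℂ × ℂ) × ℝ => (p.1.2, p.2)) hs.fst (by fun_prop)
      refine ⟨by fun_prop, fun p => ((p.1.1, (r (p.1.2, p.2)).1), p.2), ?_, ?_⟩
      · have : SmoothNear (fun p : (ℂ × ℂ) × ℝ => r (p.1.2, p.2)) ((u, twist t v), t) :=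
          SmoothNear.comp_fun (g := r) (f := fun p : (ℂ × ℂ) × ℝ => (p.1.2, p.2)) hr
            (by fun_prop)
        fun_prop
      · have : Tendsto (fun p : (ℂ × ℂ) × ℝ => (p.1.2, p.2)) (𝓝[solidTorus ×ˢ Icc (0 : ℝ) 1] ((u, v), t))
            (𝓝[{v | ‖v‖ ≤ 1} ×ˢ Icc (0 : ℝ) 1] (v, t)) := by
          refine tendsto_nhdsWithin_iff.2 ⟨?_, eventually_nhdsWithin_of_forall ?_⟩
          · exact (Continuous.tendsto (by fun_prop) ((u, v), t)).mono_left nhdsWithin_le_nhds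
          · rintro p ⟨hp1, hp2⟩
            exact ⟨hp1.2, hp2⟩
        filter_upwards [this.eventually hre] with p hp
        have hp' : (r (twist p.2 p.1.2, p.2)).1 = p.1.2 := congrArg Prod.fst hp
        simp only [hp']
  have h2 : EmbOn (fun p : (ℂ × ℂ) × ℝ => (S.Z (p.1.2, p.2), S.Q (p.1.2, p.2) • p.1.1))
      (solidTorus ×ˢ Icc (0 : ℝ) 1) := by
    refine EmbOn.of_leftInvOn (fun y => (((1 / ‖y.2‖) • y.2, (S.R (y.1, ‖y.2‖)).1),
      (S.R (y.1, ‖y.2‖)).2)) ?_ ?_ ?_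
    · rintro ⟨⟨u, v⟩, t⟩ ⟨⟨hu, hv⟩, ht⟩
      have hZ : SmoothNear (fun p : (ℂ × ℂ) × ℝ => S.Z (p.1.2, p.2)) ((u, v), t) :=
        SmoothNear.comp_fun (g := S.Z) (f := fun p : (ℂ × ℂ) × ℝ => (p.1.2, p.2))
          (S.smooth_Z v t hv ht) (by fun_prop)
      have hQ : SmoothNear (fun p : (ℂ × ℂ) × ℝ => S.Q (p.1.2, p.2)) ((u, v), t) :=
        SmoothNear.comp_fun (g := S.Q) (f := fun p : (ℂ × ℂ) × ℝ => (p.1.2, p.2))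
          (S.smooth_Q v t hv ht) (by fun_prop)
      fun_prop
    · rintro ⟨⟨u, v⟩, t⟩ ⟨⟨hu, hv⟩, ht⟩
      have hQ := S.Q_pos v t hv ht
      have hn : ‖S.Q (v, t) • u‖ = S.Q (v, t) := norm_smul_unit hQ hu
      have h0 : S.Q (v, t) • u ≠ 0 := by rw [← norm_ne_zero_iff, hn]; exact hQ.ne'
      have h0' : ‖S.Q (v, t) • u‖ ≠ 0 := norm_ne_zero_iff.2 h0
      have hR : SmoothNear (fun y : ℂ × ℂ => S.R (y.1, ‖y.2‖))
          (S.Z (v, t), S.Q (v, t) • u) := by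
        refine SmoothNear.comp_fun (g := S.R) (f := fun y : ℂ × ℂ => (y.1, ‖y.2‖)) ?_
          (by fun_prop (disch := assumption))
        change SmoothNear S.R (S.Z (v, t), ‖S.Q (v, t) • u‖)
        rw [hn]
        exact S.smooth_R v t hv ht
      fun_prop (disch := assumption)
    · rintro ⟨⟨u, v⟩, t⟩ ⟨⟨hu, hv⟩, ht⟩
      have hQ := S.Q_pos v t hv ht
      have hn : ‖S.Q (v, t) • u‖ = S.Q (v, t) := norm_smul_unit hQ hu
      dsimp only
      rw [hn, S.left_inv v t hv ht, smul_smul, one_div, inv_mul_cancel₀ hQ.ne', one_smul]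
  refine h2.comp h1 ?_
  rintro ⟨⟨u, v⟩, t⟩ ⟨⟨hu, hv⟩, ht⟩
  exact ⟨⟨hu, norm_twist_le ht hv⟩, ht⟩

/-- Here `w` fills a whole disc, so its length no longer gives the height of the section. That
height is read off from `z` by means of `P` instead. -/
lemma embOn_hand : EmbOn S.hand handle := by
  have h1 : EmbOn (fun p : ℂ × ℂ => (p.1, twist 1 p.2)) handle := by
    refine ⟨?_, ?_⟩
    · rintro ⟨a, b⟩ ⟨-, hb⟩ ⟨a', b'⟩ ⟨-, hb'⟩ h
      simp only [Prod.mk.injEq] at h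
      exact Prod.ext h.1 (twist_inj one_mem_Icc hb hb' h.2)
    · rintro ⟨a, b⟩ ⟨ha, hb⟩
      obtain ⟨hs, r, hr, hre⟩ := embOn_twist_one.2 b hb
      have hs' : SmoothNear (fun p : ℂ × ℂ => twist 1 p.2) (a, b) :=
        SmoothNear.comp_fun (g := twist 1) (f := fun p : ℂ × ℂ => p.2) hs (by fun_prop)
      refine ⟨by fun_prop, fun p => (p.1, r p.2), ?_, ?_⟩
      · have : SmoothNear (fun p : ℂ × ℂ => r p.2) (a, twist 1 b) :=
          SmoothNear.comp_fun (g := r) (f := fun p : ℂ × ℂ => p.2) hr (by fun_prop)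
        fun_prop
      · have : Tendsto (fun p : ℂ × ℂ => p.2) (𝓝[handle] (a, b)) (𝓝[{v | ‖v‖ ≤ 1}] b) := by
          refine tendsto_nhdsWithin_iff.2 ⟨?_, eventually_nhdsWithin_of_forall ?_⟩
          · exact (Continuous.tendsto (by fun_prop) (a, b)).mono_left nhdsWithin_le_nhds
          · exact fun p hp => hp.2
        filter_upwards [this.eventually hre] with p hp
        rw [hp]
  have h2 : EmbOn (fun p : ℂ × ℂ => (S.Z (p.2, 1), S.Q (p.2, 1) • p.1)) handle := by
    refine EmbOn.of_leftInvOn (fun y => ((1 / S.P y.1) • y.2, (S.R (y.1, S.P y.1)).1)) ?_ ?_ ?_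
    · rintro ⟨a, b⟩ ⟨ha, hb⟩
      have hZ : SmoothNear (fun p : ℂ × ℂ => S.Z (p.2, 1)) (a, b) :=
        SmoothNear.comp_fun (g := S.Z) (f := fun p : ℂ × ℂ => (p.2, (1 : ℝ)))
          (S.smooth_Z b 1 hb one_mem_Icc) (by fun_prop)
      have hQ : SmoothNear (fun p : ℂ × ℂ => S.Q (p.2, 1)) (a, b) :=
        SmoothNear.comp_fun (g := S.Q) (f := fun p : ℂ × ℂ => (p.2, (1 : ℝ)))
          (S.smooth_Q b 1 hb one_mem_Icc) (by fun_prop)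
      fun_prop
    · rintro ⟨a, b⟩ ⟨ha, hb⟩
      have hQ := S.Q_pos b 1 hb one_mem_Icc
      have h0 : S.P (S.Z (b, 1)) ≠ 0 := by rw [S.P_eq b hb]; exact hQ.ne'
      have hP : SmoothNear (fun y : ℂ × ℂ => S.P y.1) (S.Z (b, 1), S.Q (b, 1) • a) :=
        SmoothNear.comp_fun (g := S.P) (f := fun y : ℂ × ℂ => y.1) (S.smooth_P b hb) (by fun_prop)
      have hR : SmoothNear (fun y : ℂ × ℂ => S.R (y.1, S.P y.1))
          (S.Z (b, 1), S.Q (b, 1) • a) := by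
        refine SmoothNear.comp_fun (g := S.R) (f := fun y : ℂ × ℂ => (y.1, S.P y.1)) ?_
          (by fun_prop)
        change SmoothNear S.R (S.Z (b, 1), S.P (S.Z (b, 1)))
        rw [S.P_eq b hb]
        exact S.smooth_R b 1 hb one_mem_Icc
      fun_prop (disch := assumption)
    · rintro ⟨a, b⟩ ⟨ha, hb⟩
      have hQ := S.Q_pos b 1 hb one_mem_Icc
      dsimp only
      rw [S.P_eq b hb, S.left_inv b 1 hb one_mem_Icc, smul_smul, one_div,
        inv_mul_cancel₀ hQ.ne', one_smul]
  refine h2.comp h1 ?_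
  rintro ⟨a, b⟩ ⟨ha, hb⟩
  exact ⟨ha, norm_twist_le one_mem_Icc hb⟩

end Slab

end Slabs

/-! ### The collars of the incoming faces and of the outgoing face. -/

section SlabExamples

/-- Half the sum of the two smaller coordinates on the section of a side slab. -/
def halfSum (t : ℝ) : ℝ := (4 - (1 - t) * eps) / 2

/-- The level of a section of a side slab. -/
def sideLevel (t : ℝ) : ℝ := 5 + (1 - t) * eps

/-- The height function of a side slab. -/
def sideQ (σ : ℝ) (p : ℂ × ℝ) : ℝ := 7 - halfSum p.2 * (1 + σ * p.1.im)

/-- The base coordinate of a side slab. -/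
def sideZ (σ : ℝ) (p : ℂ × ℝ) : ℂ :=
  ⟨√(sideLevel p.2 / 5) * halfSum p.2 * p.1.re / sideQ σ p,
    σ * (halfSum p.2 * (1 - σ * p.1.im) - sideLevel p.2) / 2 / sideQ σ p⟩

/-- The inverse of a side slab. -/
def sideR (σ : ℝ) (y : ℂ × ℝ) : ℂ × ℝ :=
  (⟨y.2 * y.1.re / (√(lev σ y.1 y.2 / 5) * ((9 - lev σ y.1 y.2) / 2)),
    σ * ((7 - y.2) / ((9 - lev σ y.1 y.2) / 2) - 1)⟩, 1 - (lev σ y.1 y.2 - 5) / eps)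

lemma halfSum_bounds {t : ℝ} (ht : t ∈ Icc (0 : ℝ) 1) : 79 / 40 ≤ halfSum t ∧ halfSum t ≤ 2 := by
  have h1 := eps_pos
  have h2 := eps_le
  obtain ⟨h3, h4⟩ := ht
  unfold halfSum
  constructor <;> nlinarith

lemma sideLevel_bounds {t : ℝ} (ht : t ∈ Icc (0 : ℝ) 1) :
    5 ≤ sideLevel t ∧ sideLevel t ≤ 5 + eps := by
  have h1 := eps_pos
  obtain ⟨h3, h4⟩ := ht
  unfold sideLevel
  constructor <;> nlinarith

lemma sideLevel_add (t : ℝ) : sideLevel t + 2 * halfSum t = 9 := by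
  unfold sideLevel halfSum; ring

lemma sideQ_bounds {σ : ℝ} (hσ : σ = 1 ∨ σ = -1) {v : ℂ} {t : ℝ} (hv : ‖v‖ ≤ 1)
    (ht : t ∈ Icc (0 : ℝ) 1) : 3 ≤ sideQ σ (v, t) ∧ sideQ σ (v, t) ≤ 7 := by
  have h1 := halfSum_bounds ht
  have h2 := im_mem_Icc hv
  have h3 : σ * v.im ∈ Icc (-1 : ℝ) 1 := by
    rcases hσ with rfl | rfl
    · simpa using h2
    · constructor <;> linarith [h2.1, h2.2]
  unfold sideQ
  constructor <;> nlinarith [h3.1, h3.2]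

lemma mul_sideZ {σ : ℝ} {v : ℂ} {t : ℝ} (h : sideQ σ (v, t) ≠ 0) :
    sideQ σ (v, t) * (sideZ σ (v, t)).re = √(sideLevel t / 5) * halfSum t * v.re ∧
    sideQ σ (v, t) * (sideZ σ (v, t)).im =
      σ * (halfSum t * (1 - σ * v.im) - sideLevel t) / 2 := by
  unfold sideZ
  constructor <;> simp only [] <;> field_simp

lemma lev_sideZ {σ : ℝ} (hσ : σ = 1 ∨ σ = -1) {v : ℂ} {t : ℝ} (h : sideQ σ (v, t) ≠ 0) :
    lev σ (sideZ σ (v, t)) (sideQ σ (v, t)) = sideLevel t ∧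
    lev (-σ) (sideZ σ (v, t)) (sideQ σ (v, t)) = halfSum t * (1 - σ * v.im) := by
  have hs : σ * σ = 1 := by rcases hσ with rfl | rfl <;> norm_num
  have h2 := sideLevel_add t
  unfold lev
  rw [(mul_sideZ h).2]
  have e : sideQ σ (v, t) = 7 - halfSum t * (1 + σ * v.im) := rfl
  rw [e]
  constructor
  · linear_combination (-1 / 2) * h2 -
      (halfSum t * (1 - σ * v.im) - sideLevel t) / 2 * hs
  · linear_combination (-1 / 2) * h2 +
      (halfSum t * (1 - σ * v.im) - sideLevel t) / 2 * hs

lemma sqrt_five_sq {a : ℝ} (ha : 0 ≤ a) : √(a / 5) ^ 2 = a / 5 := Real.sq_sqrt (by positivity)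

/-- The two smaller coordinates are `h (1 ± σ v.im)` with `h = halfSum t`, and `ξ² = L / 5 * h² *
v.re²` with `L = sideLevel t`. The wall function is thus a positive multiple of `1 - |v|²`, and the
sections are discs bounded by the wall. -/
lemma wallFun_side {σ : ℝ} (hσ : σ = 1 ∨ σ = -1) {v : ℂ} {t : ℝ} (ht : t ∈ Icc (0 : ℝ) 1)
    (h0 : sideQ σ (v, t) ≠ 0) : wallFun (sideZ σ (v, t)) (sideQ σ (v, t)) =
      sideLevel t / 5 * halfSum t ^ 2 * (1 - (v.re ^ 2 + v.im ^ 2)) := by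
  have hL := sideLevel_bounds ht
  have hs : σ * σ = 1 := by rcases hσ with rfl | rfl <;> norm_num
  have h1 := sqrt_five_sq (a := sideLevel t) (by linarith)
  unfold wallFun
  rw [lev_mul hσ, (lev_sideZ hσ h0).1, (lev_sideZ hσ h0).2, (mul_sideZ h0).1]
  have e : 7 - sideQ σ (v, t) = halfSum t * (1 + σ * v.im) := by unfold sideQ; ring
  rw [e]
  linear_combination (-halfSum t ^ 2 * v.re ^ 2) * h1 -
    (sideLevel t / 5 * halfSum t ^ 2 * v.im ^ 2) * hs

/-- The collar of an incoming face. -/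
def sideSlab (σ : ℝ) (hσ : σ = 1 ∨ σ = -1) : Slab where
  Z := sideZ σ
  Q := sideQ σ
  R := sideR σ
  P z := 8 / (1 - 2 * σ * z.im)
  c t := sideLevel t / 5 * halfSum t ^ 2
  smooth_Z v t hv ht := by
    have h1 := (sideQ_bounds hσ hv ht).1
    have h2 := (sideLevel_bounds ht).1
    have h3 : 7 - halfSum t * (1 + σ * v.im) ≠ 0 := by
      have : sideQ σ (v, t) = 7 - halfSum t * (1 + σ * v.im) := rfl
      linarith
    have h4 : sideLevel t / 5 ≠ 0 := by positivity
    unfold sideZ sideQ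
    unfold sideLevel halfSum at *
    fun_prop (disch := first | assumption | norm_num)
  smooth_Q v t hv ht := by
    unfold sideQ halfSum
    fun_prop (disch := norm_num)
  Q_pos v t hv ht := by linarith [(sideQ_bounds hσ hv ht).1]
  smooth_R v t hv ht := by
    have h0 : sideQ σ (v, t) ≠ 0 := by linarith [(sideQ_bounds hσ hv ht).1]
    have hl := (lev_sideZ hσ h0).1
    have h2 := sideLevel_bounds ht
    have he := eps_le
    have he0 := eps_pos.ne'
    have h3 : lev σ (sideZ σ (v, t)) (sideQ σ (v, t)) / 5 ≠ 0 := by rw [hl]; linarith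
    have h4 : (9 - lev σ (sideZ σ (v, t)) (sideQ σ (v, t))) / 2 ≠ 0 := by rw [hl]; linarith
    have h5 : √(lev σ (sideZ σ (v, t)) (sideQ σ (v, t)) / 5) *
        ((9 - lev σ (sideZ σ (v, t)) (sideQ σ (v, t))) / 2) ≠ 0 := by
      refine mul_ne_zero (Real.sqrt_pos.2 ?_).ne' h4
      rw [hl]; linarith
    unfold sideR
    unfold lev at *
    fun_prop (disch := first | assumption | norm_num)
  left_inv v t hv ht := by
    have h0 : sideQ σ (v, t) ≠ 0 := by linarith [(sideQ_bounds hσ hv ht).1]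
    have hl := (lev_sideZ hσ h0).1
    have hh := halfSum_bounds ht
    have hL := sideLevel_bounds ht
    have hs : σ * σ = 1 := by rcases hσ with rfl | rfl <;> norm_num
    have h1 : (9 - sideLevel t) / 2 = halfSum t := by linarith [sideLevel_add t]
    have h2 : √(sideLevel t / 5) ≠ 0 := (Real.sqrt_pos.2 (by linarith)).ne'
    have h3 : halfSum t ≠ 0 := by linarith
    have he0 := eps_pos.ne'
    unfold sideR
    simp only [hl, h1, (mul_sideZ h0).1]
    refine Prod.ext (Complex.ext ?_ ?_) ?_
    · simp only []
      field_simp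
    · simp only []
      have e : 7 - sideQ σ (v, t) = halfSum t * (1 + σ * v.im) := by unfold sideQ; ring
      rw [e, mul_div_cancel_left₀ _ h3]
      linear_combination v.im * hs
    · simp only [sideLevel]
      field_simp
      ring
  smooth_P v hv := by
    have hb := sideQ_bounds hσ hv one_mem_Icc
    have h0 : sideQ σ (v, 1) ≠ 0 := by linarith
    have hl := (lev_sideZ hσ h0).1
    have h1 : 1 - 2 * σ * (sideZ σ (v, 1)).im ≠ 0 := by
      intro h
      unfold lev sideLevel at hl
      have : σ * (sideQ σ (v, 1) * (sideZ σ (v, 1)).im) = sideQ σ (v, 1) / 2 := by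
        linear_combination (-sideQ σ (v, 1) / 2) * h
      rw [this] at hl
      linarith
    fun_prop (disch := assumption)
  P_eq v hv := by
    have hb := sideQ_bounds hσ hv one_mem_Icc
    have h0 : sideQ σ (v, 1) ≠ 0 := by linarith
    have hl := (lev_sideZ hσ h0).1
    have e : sideQ σ (v, 1) * (1 - 2 * σ * (sideZ σ (v, 1)).im) = 8 := by
      unfold lev sideLevel at hl
      linear_combination 2 * hl
    have h1 : 1 - 2 * σ * (sideZ σ (v, 1)).im ≠ 0 := by
      intro h; rw [h] at e; norm_num at e
    rw [div_eq_iff h1, e]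
  P_le v t hv ht := by
    have hb := sideQ_bounds hσ hv ht
    have h0 : sideQ σ (v, t) ≠ 0 := by linarith
    have hl := (lev_sideZ hσ h0).1
    have hL := sideLevel_bounds ht
    -- The inequality `5 ≤ lev σ` says that the point is not below the last section.
    have e : 8 ≤ sideQ σ (v, t) * (1 - 2 * σ * (sideZ σ (v, t)).im) := by
      rw [← hl] at hL
      unfold lev at hL
      linarith [hL.1]
    have h1 : 0 < 1 - 2 * σ * (sideZ σ (v, t)).im := by
      by_contra! h
      nlinarith
    rwa [div_le_iff₀ h1]
  c_pos t ht := by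
    have h1 := sideLevel_bounds ht
    have h2 := halfSum_bounds ht
    have : 0 < halfSum t := by linarith
    have : 0 < sideLevel t := by linarith
    positivity
  wall v t hv ht := wallFun_side hσ ht (by linarith [(sideQ_bounds hσ hv ht).1])

/-- The height of a section of the belt slab. -/
def beltHeight (t : ℝ) : ℝ := 2 + (1 - t) * eps

lemma beltHeight_bounds {t : ℝ} (ht : t ∈ Icc (0 : ℝ) 1) :
    2 ≤ beltHeight t ∧ beltHeight t ≤ 2 + eps := by
  have h1 := eps_pos
  obtain ⟨h3, h4⟩ := ht
  unfold beltHeight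
  constructor <;> nlinarith

/-- The base coordinate of the belt slab. -/
def beltZ (p : ℂ × ℝ) : ℂ :=
  ⟨√((7 - beltHeight p.2) / 5) * ((2 + beltHeight p.2) / 2) * p.1.re / beltHeight p.2,
    -((2 + beltHeight p.2) / 2 * p.1.im) / beltHeight p.2⟩

/-- The inverse of the belt slab. -/
def beltR (y : ℂ × ℝ) : ℂ × ℝ :=
  (⟨y.2 * y.1.re / (√((7 - y.2) / 5) * ((2 + y.2) / 2)), -(y.2 * y.1.im) / ((2 + y.2) / 2)⟩,
    1 - (y.2 - 2) / eps)

lemma wallFun_belt (v : ℂ) {t : ℝ} (ht : t ∈ Icc (0 : ℝ) 1) :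
    wallFun (beltZ (v, t)) (beltHeight t) =
      (7 - beltHeight t) / 5 * ((2 + beltHeight t) / 2) ^ 2 * (1 - (v.re ^ 2 + v.im ^ 2)) := by
  have h1 := beltHeight_bounds ht
  have he := eps_le
  have h2 := sqrt_five_sq (a := 7 - beltHeight t) (by linarith)
  have h4 : beltHeight t ≠ 0 := by linarith
  have e1 : beltHeight t * (beltZ (v, t)).re =
      √((7 - beltHeight t) / 5) * ((2 + beltHeight t) / 2) * v.re := by
    simp only [beltZ]; field_simp
  have e2 : beltHeight t * (beltZ (v, t)).im = -((2 + beltHeight t) / 2 * v.im) := by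
    simp only [beltZ]; field_simp
  unfold wallFun lev
  rw [e1, e2]
  linear_combination (-((2 + beltHeight t) / 2) ^ 2 * v.re ^ 2) * h2

/-- The collar of the outgoing face. -/
def beltSlab : Slab where
  Z := beltZ
  Q p := beltHeight p.2
  R := beltR
  P _ := 2
  c t := (7 - beltHeight t) / 5 * ((2 + beltHeight t) / 2) ^ 2
  smooth_Z v t hv ht := by
    have h1 := beltHeight_bounds ht
    have he := eps_le
    have h2 : (7 - beltHeight t) / 5 ≠ 0 := by linarith
    have h3 : beltHeight t ≠ 0 := by linarith
    unfold beltZ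
    unfold beltHeight at *
    fun_prop (disch := first | assumption | norm_num)
  smooth_Q v t hv ht := by
    unfold beltHeight
    fun_prop
  Q_pos v t hv ht := by linarith [(beltHeight_bounds ht).1]
  smooth_R v t hv ht := by
    have h1 := beltHeight_bounds ht
    have he := eps_le
    have he0 := eps_pos.ne'
    have h2 : 0 < (7 - beltHeight t) / 5 := by linarith
    have h3 : 0 < (2 + beltHeight t) / 2 := by linarith
    have h4 : √((7 - beltHeight t) / 5) * ((2 + beltHeight t) / 2) ≠ 0 := by positivity
    have h2' := h2.ne'
    have h3' := h3.ne'
    unfold beltR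
    fun_prop (disch := first | assumption | norm_num)
  left_inv v t hv ht := by
    have h1 := beltHeight_bounds ht
    have he := eps_le
    have he0 := eps_pos.ne'
    have h2 : √((7 - beltHeight t) / 5) ≠ 0 := (Real.sqrt_pos.2 (by linarith)).ne'
    have h3 : 2 + beltHeight t ≠ 0 := by linarith
    have h4 : beltHeight t ≠ 0 := by linarith
    unfold beltR beltZ
    refine Prod.ext (Complex.ext ?_ ?_) ?_
    · simp only []
      field_simp
    · simp only []
      field_simp
    · simp only [beltHeight]
      field_simp
      ring
  smooth_P v hv := by fun_prop
  P_eq v hv := by simp [beltHeight]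
  P_le v t hv ht := (beltHeight_bounds ht).1
  c_pos t ht := by
    have h1 := beltHeight_bounds ht
    have he := eps_le
    have : 0 < 7 - beltHeight t := by linarith
    have : 0 < 2 + beltHeight t := by linarith
    positivity
  wall v t _ ht := wallFun_belt v ht

/-- The section is inverted explicitly. By `wallFun_side`, `‖v‖ ≤ 1` is the same as nonnegativity of
the wall function. -/
lemma exists_side {σ : ℝ} (hσ : σ = 1 ∨ σ = -1) {z : ℂ} {q : ℝ} (hq : 0 < q)
    (h5 : 5 ≤ lev σ z q) (h6 : lev σ z q ≤ 5 + eps) (hw : 0 ≤ wallFun z q) :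
    ∃ v t, ‖v‖ ≤ 1 ∧ t ∈ Icc (0 : ℝ) 1 ∧ sideLevel t = lev σ z q ∧ sideZ σ (v, t) = z ∧
      sideQ σ (v, t) = q := by
  have he := eps_pos
  have hs : σ * σ = 1 := by rcases hσ with rfl | rfl <;> norm_num
  obtain ⟨t, ht⟩ : ∃ t, t = 1 - (lev σ z q - 5) / eps := ⟨_, rfl⟩
  have htI : t ∈ Icc (0 : ℝ) 1 := by
    have h1 : (lev σ z q - 5) / eps ≤ 1 := (div_le_one he).2 (by linarith)
    have h2 : 0 ≤ (lev σ z q - 5) / eps := div_nonneg (by linarith) he.le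
    rw [ht]
    constructor <;> linarith
  have hL : sideLevel t = lev σ z q := by
    unfold sideLevel
    rw [ht]
    field_simp
    ring
  have hh := halfSum_bounds htI
  have h3 : halfSum t ≠ 0 := by linarith
  have h2 : √(sideLevel t / 5) ≠ 0 := (Real.sqrt_pos.2 (by rw [hL]; linarith)).ne'
  have hsum := sideLevel_add t
  obtain ⟨v, hv⟩ : ∃ v : ℂ, v = ⟨q * z.re / (√(sideLevel t / 5) * halfSum t),
      σ * ((7 - q) / halfSum t - 1)⟩ := ⟨_, rfl⟩
  have him : σ * v.im = (7 - q) / halfSum t - 1 := by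
    rw [hv]; simp only []; rw [← mul_assoc, hs, one_mul]
  have hQ : sideQ σ (v, t) = q := by
    unfold sideQ
    simp only [him]
    field_simp
    ring
  have hZ : sideZ σ (v, t) = z := by
    unfold sideZ
    rw [hQ]
    refine Complex.ext ?_ ?_
    · simp only [hv]
      field_simp
    · simp only [him]
      have e : halfSum t * (1 - ((7 - q) / halfSum t - 1)) = 2 * halfSum t - (7 - q) := by
        field_simp
        ring
      rw [e, div_eq_iff hq.ne']
      rw [hL] at hsum ⊢
      have e2 : 2 * halfSum t - (7 - q) - lev σ z q = 2 * σ * (q * z.im) := by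
        unfold lev at hsum ⊢
        linear_combination hsum
      rw [e2]
      linear_combination (q * z.im) * hs
  refine ⟨v, t, ?_, htI, hL, hZ, hQ⟩
  have hwall := wallFun_side hσ htI (v := v) (by rw [hQ]; exact hq.ne')
  rw [hZ, hQ] at hwall
  have hc := (sideSlab σ hσ).c_pos t htI
  rw [norm_le_one_iff]
  by_contra! h
  have : sideLevel t / 5 * halfSum t ^ 2 * (1 - (v.re ^ 2 + v.im ^ 2)) < 0 :=
    mul_neg_of_pos_of_neg hc (by linarith)
  linarith

lemma exists_belt {z : ℂ} {q : ℝ} (h2 : 2 ≤ q) (h3 : q ≤ 2 + eps) (hw : 0 ≤ wallFun z q) :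
    ∃ v t, ‖v‖ ≤ 1 ∧ t ∈ Icc (0 : ℝ) 1 ∧ beltZ (v, t) = z ∧ beltHeight t = q := by
  have he := eps_pos
  have he' := eps_le
  obtain ⟨t, ht⟩ : ∃ t, t = 1 - (q - 2) / eps := ⟨_, rfl⟩
  have htI : t ∈ Icc (0 : ℝ) 1 := by
    have h1 : (q - 2) / eps ≤ 1 := (div_le_one he).2 (by linarith)
    have h2 : 0 ≤ (q - 2) / eps := div_nonneg (by linarith) he.le
    rw [ht]
    constructor <;> linarith
  have hL : beltHeight t = q := by
    unfold beltHeight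
    rw [ht]
    field_simp
    ring
  have h4 : √((7 - q) / 5) ≠ 0 := (Real.sqrt_pos.2 (by linarith)).ne'
  have h5 : 2 + q ≠ 0 := by linarith
  have h6 : q ≠ 0 := by linarith
  obtain ⟨v, hv⟩ : ∃ v : ℂ, v = ⟨q * z.re / (√((7 - q) / 5) * ((2 + q) / 2)),
      -(q * z.im) / ((2 + q) / 2)⟩ := ⟨_, rfl⟩
  have hZ : beltZ (v, t) = z := by
    unfold beltZ
    simp only [hL, hv]
    refine Complex.ext ?_ ?_
    · simp only []
      field_simp
    · simp only []
      field_simp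
  refine ⟨v, t, ?_, htI, hZ, hL⟩
  have hwall := wallFun_belt v htI
  have hc := beltSlab.c_pos t htI
  rw [hZ, hL] at hwall
  change 0 < (7 - beltHeight t) / 5 * ((2 + beltHeight t) / 2) ^ 2 at hc
  rw [hL] at hc
  rw [norm_le_one_iff]
  by_contra! h
  have : (7 - q) / 5 * ((2 + q) / 2) ^ 2 * (1 - (v.re ^ 2 + v.im ^ 2)) < 0 :=
    mul_neg_of_pos_of_neg hc (by linarith)
  linarith

end SlabExamples

/-! ### The total space and its rays. -/

section Body

/-- The wall function on `ℂ²`. -/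
def wallAt (y : ℂ × ℂ) : ℝ := wallFun y.1 ‖y.2‖

/-- The total space of the composite cobordism. -/
def body : Set (ℂ × ℂ) :=
  {y | 0 ≤ wallAt y ∧ lev 1 y.1 ‖y.2‖ ≤ 5 + eps ∧ lev (-1) y.1 ‖y.2‖ ≤ 5 + eps ∧ ‖y.1‖ ≤ 1}

/-- A neighbourhood of the body in which the wall function controls the other coordinates. -/
def nbhd : Set (ℂ × ℂ) := {y | lev 1 y.1 ‖y.2‖ < 11 / 2 ∧ lev (-1) y.1 ‖y.2‖ < 11 / 2}

lemma continuous_lev (σ : ℝ) : Continuous fun y : ℂ × ℂ => lev σ y.1 ‖y.2‖ := by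
  unfold lev; fun_prop

lemma continuous_wallAt : Continuous wallAt := by
  unfold wallAt wallFun lev; fun_prop

lemma continuous_cone (σ : ℝ) : Continuous (cone σ) := by
  unfold cone; fun_prop

lemma isOpen_nbhd : IsOpen nbhd :=
  (isOpen_lt (continuous_lev 1) continuous_const).inter
    (isOpen_lt (continuous_lev (-1)) continuous_const)

lemma body_subset_nbhd : body ⊆ nbhd := by
  rintro y ⟨-, h1, h2, -⟩
  have := eps_le
  exact ⟨by linarith, by linarith⟩

lemma nbhd_nonneg {y : ℂ × ℂ} (hy : y ∈ nbhd) (hw : 0 ≤ wallAt y) :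
    0 ≤ 7 - ‖y.2‖ ∧ 0 ≤ lev 1 y.1 ‖y.2‖ ∧ 0 ≤ lev (-1) y.1 ‖y.2‖ :=
  nonneg_of_wallFun_nonneg (norm_nonneg _) hy.1 hy.2 hw

lemma body_nonneg {y : ℂ × ℂ} (hy : y ∈ body) :
    0 ≤ 7 - ‖y.2‖ ∧ 0 ≤ lev 1 y.1 ‖y.2‖ ∧ 0 ≤ lev (-1) y.1 ‖y.2‖ :=
  nbhd_nonneg (body_subset_nbhd hy) hy.1

lemma lev_le_of_mem_body {y : ℂ × ℂ} (hy : y ∈ body) {σ : ℝ} (hσ : σ = 1 ∨ σ = -1) :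
    lev σ y.1 ‖y.2‖ ≤ 5 + eps := by
  rcases hσ with rfl | rfl
  exacts [hy.2.1, hy.2.2.1]

lemma isCompact_body : IsCompact body := by
  have hcl : IsClosed body := by
    have e : body = {y : ℂ × ℂ | 0 ≤ wallAt y} ∩ ({y | lev 1 y.1 ‖y.2‖ ≤ 5 + eps} ∩
        ({y | lev (-1) y.1 ‖y.2‖ ≤ 5 + eps} ∩ {y | ‖y.1‖ ≤ 1})) := rfl
    rw [e]
    exact (isClosed_le continuous_const continuous_wallAt).inter
      ((isClosed_le (continuous_lev 1) continuous_const).inter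
      ((isClosed_le (continuous_lev (-1)) continuous_const).inter
      (isClosed_le (by fun_prop) continuous_const)))
  refine Metric.isCompact_of_isClosed_isBounded hcl ?_
  refine (Metric.isBounded_closedBall (x := (0 : ℂ × ℂ)) (r := 7)).subset fun y hy => ?_
  rw [mem_closedBall_zero_iff]
  have h1 := (body_nonneg hy).1
  have h2 : ‖y.1‖ ≤ 1 := hy.2.2.2
  exact max_le (by linarith) (by linarith)

/-- Points closer to the axis than a point of the body. -/
lemma body_down {z w w' : ℂ} (h : (z, w') ∈ body) (hw : ‖w‖ ≤ ‖w'‖) :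
    (z, w) ∈ body ∧ (‖w‖ < ‖w'‖ → 0 < wallAt (z, w)) := by
  obtain ⟨h0, h1, h2⟩ := body_nonneg h
  obtain ⟨hg, hl1, hl2, hz⟩ := h
  have he := eps_pos
  have hpos : ‖w‖ < ‖w'‖ → 0 < wallAt (z, w) := by
    intro hlt
    rcases (norm_nonneg w).eq_or_lt with h | h
    · change 0 < wallFun z ‖w‖
      rw [← h]
      unfold wallFun lev
      norm_num
    · have := wallFun_strictAnti h hlt h0 h1 h2
      have hg' : 0 ≤ wallFun z ‖w'‖ := hg
      have h3 : 0 < ‖w'‖ ^ 2 * wallFun z ‖w‖ := lt_of_le_of_lt (by positivity) this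
      exact pos_of_mul_pos_right h3 (by positivity)
  -- Along a ray `lev σ` is affine in the height and equals `1` at height `0`, so moving inwards
  -- keeps it below any bound that is at least `1`.
  have hlev : ∀ σ, lev σ z ‖w'‖ ≤ 5 + eps → lev σ z ‖w‖ ≤ 5 + eps := by
    intro σ h
    have e : ∀ q, lev σ z q = 1 + q * (1 / 2 - σ * z.im) := by intro q; unfold lev; ring
    rw [e] at h ⊢
    rcases le_total 0 (1 / 2 - σ * z.im) with h' | h'
    · linarith [mul_le_mul_of_nonneg_right hw h']
    · linarith [mul_nonpos_of_nonneg_of_nonpos (norm_nonneg w) h']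
  refine ⟨⟨?_, hlev 1 hl1, hlev (-1) hl2, hz⟩, hpos⟩
  rcases hw.eq_or_lt with h | h
  · change 0 ≤ wallFun z ‖w‖
    rw [h]; exact hg
  · exact (hpos h).le

/-- If the wall function is nonnegative at some height above `2`, then it is positive at height `2`
on the same ray, where it equals `4 (1 - |z|²)`. The condition `‖z‖ ≤ 1` in `body` therefore matters
only below height `2`. -/
lemma norm_sq_lt_one_of_two_lt {y : ℂ × ℂ} (hy : y ∈ nbhd) (hw : 0 ≤ wallAt y) (hq : 2 < ‖y.2‖) :
    ‖y.1‖ < 1 := by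
  obtain ⟨h0, h1, h2⟩ := nbhd_nonneg hy hw
  have := wallFun_strictAnti two_pos hq h0 h1 h2
  have hw' : 0 ≤ wallFun y.1 ‖y.2‖ := hw
  have h3 : 0 < ‖y.2‖ ^ 2 * wallFun y.1 2 := lt_of_le_of_lt (by positivity) this
  have h4 := pos_of_mul_pos_right h3 (by positivity)
  rw [wallFun_two] at h4
  have h5 : ‖y.1‖ ≤ 1 := (norm_le_one_iff _).2 (by linarith)
  refine lt_of_le_of_ne h5 fun h => ?_
  have := (norm_eq_one_iff _).1 h
  linarith

lemma norm_sq_le_one_of_two_le {y : ℂ × ℂ} (hy : y ∈ nbhd) (hw : 0 ≤ wallAt y) (hq : 2 ≤ ‖y.2‖) :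
    ‖y.1‖ ≤ 1 := by
  rcases hq.eq_or_lt with h | h
  · have hw' : 0 ≤ wallFun y.1 ‖y.2‖ := hw
    rw [← h, wallFun_two] at hw'
    exact (norm_le_one_iff _).2 (by linarith)
  · exact (norm_sq_lt_one_of_two_lt hy hw h).le

lemma abs_sigma_im_le {σ : ℝ} (hσ : σ = 1 ∨ σ = -1) {z : ℂ} (hz : ‖z‖ ≤ 1) :
    -1 ≤ σ * z.im ∧ σ * z.im ≤ 1 := by
  have h2 := im_mem_Icc hz
  rcases hσ with rfl | rfl
  · simpa using h2
  · constructor <;> linarith [h2.1, h2.2]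

lemma lev_le_of_norm_le {σ : ℝ} (hσ : σ = 1 ∨ σ = -1) {y : ℂ × ℂ} (hz : ‖y.1‖ ≤ 1) :
    lev σ y.1 ‖y.2‖ ≤ 1 + 3 / 2 * ‖y.2‖ := by
  unfold lev
  nlinarith [(abs_sigma_im_le hσ hz).1, norm_nonneg y.2]

/-- Where a ray reaches `lev σ = 5`, the wall function is `-q² cone σ z ≤ 0`, and beyond that height
it is negative by monotonicity. -/
lemma lev_le_five {σ : ℝ} (hσ : σ = 1 ∨ σ = -1) {y : ℂ × ℂ} (hy : y ∈ nbhd) (hw : 0 ≤ wallAt y)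
    (hc : 0 ≤ cone σ y.1) : lev σ y.1 ‖y.2‖ ≤ 5 := by
  by_contra! h
  obtain ⟨h0, h1, h2⟩ := nbhd_nonneg hy hw
  have hq := norm_nonneg y.2
  have hm : 8 < ‖y.2‖ * (1 - 2 * σ * y.1.im) := by unfold lev at h; linarith
  have hm0 : 0 < 1 - 2 * σ * y.1.im := by
    by_contra! h'
    nlinarith
  have hlt : 8 / (1 - 2 * σ * y.1.im) < ‖y.2‖ := (div_lt_iff₀ hm0).2 hm
  have := wallFun_strictAnti (by positivity) hlt h0 h1 h2
  rw [wallFun_cone hσ hm0] at this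
  have hw' : 0 ≤ wallFun y.1 ‖y.2‖ := hw
  have h3 : 0 < ‖y.2‖ ^ 2 * (-(8 / (1 - 2 * σ * y.1.im)) ^ 2 * cone σ y.1) :=
    lt_of_le_of_lt (by positivity) this
  have h4 : 0 ≤ ‖y.2‖ ^ 2 * ((8 / (1 - 2 * σ * y.1.im)) ^ 2 * cone σ y.1) := by positivity
  linarith

lemma side_mem_body {σ : ℝ} (hσ : σ = 1 ∨ σ = -1) {v w : ℂ} {t : ℝ} (hv : ‖v‖ ≤ 1)
    (ht : t ∈ Icc (0 : ℝ) 1) (hw : ‖w‖ = sideQ σ (v, t)) : (sideZ σ (v, t), w) ∈ body := by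
  have hb := sideQ_bounds hσ hv ht
  have h0 : sideQ σ (v, t) ≠ 0 := by linarith
  obtain ⟨h1, h2⟩ := lev_sideZ hσ h0
  have hL := sideLevel_bounds ht
  have hH := halfSum_bounds ht
  have him := abs_sigma_im_le hσ hv
  have he := eps_le
  have he' := eps_pos
  have h2' : lev (-σ) (sideZ σ (v, t)) (sideQ σ (v, t)) ≤ 4 := by rw [h2]; nlinarith
  have hw0 : 0 ≤ wallAt (sideZ σ (v, t), w) := by
    change 0 ≤ wallFun (sideZ σ (v, t)) ‖w‖
    rw [hw, wallFun_side hσ ht h0]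
    have := (norm_le_one_iff v).1 hv
    exact mul_nonneg ((sideSlab σ hσ).c_pos t ht).le (by linarith)
  have hl : lev 1 (sideZ σ (v, t)) ‖w‖ ≤ 5 + eps ∧ lev (-1) (sideZ σ (v, t)) ‖w‖ ≤ 5 + eps := by
    rw [hw]
    rcases hσ with rfl | rfl
    · exact ⟨by linarith, by linarith⟩
    · rw [neg_neg] at h2'
      exact ⟨by linarith, by linarith⟩
  refine ⟨hw0, hl.1, hl.2, ?_⟩
  refine norm_sq_le_one_of_two_le (y := (sideZ σ (v, t), w)) ⟨?_, ?_⟩ hw0 ?_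
  · exact lt_of_le_of_lt hl.1 (by linarith)
  · exact lt_of_le_of_lt hl.2 (by linarith)
  · change 2 ≤ ‖w‖
    linarith

lemma belt_mem_body {v w : ℂ} {t : ℝ} (hv : ‖v‖ ≤ 1) (ht : t ∈ Icc (0 : ℝ) 1)
    (hw : ‖w‖ = beltHeight t) : (beltZ (v, t), w) ∈ body := by
  have hb := beltHeight_bounds ht
  have he := eps_le
  have he' := eps_pos
  have hw0 : 0 ≤ wallAt (beltZ (v, t), w) := by
    change 0 ≤ wallFun (beltZ (v, t)) ‖w‖
    rw [hw, wallFun_belt v ht]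
    have := (norm_le_one_iff v).1 hv
    exact mul_nonneg (beltSlab.c_pos t ht).le (by linarith)
  have him := im_mem_Icc hv
  have e2 : beltHeight t * (beltZ (v, t)).im = -((2 + beltHeight t) / 2 * v.im) := by
    have : beltHeight t ≠ 0 := by linarith
    simp only [beltZ]; field_simp
  have hl : lev 1 (beltZ (v, t)) ‖w‖ ≤ 5 ∧ lev (-1) (beltZ (v, t)) ‖w‖ ≤ 5 := by
    rw [hw]
    unfold lev
    rw [e2]
    constructor <;> nlinarith [him.1, him.2]
  refine ⟨hw0, hl.1.trans (by linarith), hl.2.trans (by linarith), ?_⟩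
  refine norm_sq_le_one_of_two_le (y := (beltZ (v, t), w)) ⟨?_, ?_⟩ hw0 ?_
  · exact lt_of_le_of_lt hl.1 (by linarith)
  · exact lt_of_le_of_lt hl.2 (by linarith)
  · change 2 ≤ ‖w‖
    linarith

end Body

/-! ### Derivatives of functions of `z` and `|w|`. -/

section Derivatives

/-- Differentials are tested only on vectors `(c, k • w)`. Along such a line `|w|` changes linearly
near the point, so functions of `z` and `|w|` reduce to one real variable. -/
lemma fderiv_eq_of_line {f : ℂ × ℂ → ℝ} {y : ℂ × ℂ} (hf : SmoothNear f y) {c : ℂ} {k d : ℝ}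
    (h : HasDerivAt (fun s : ℝ => f (y.1 + s • c, (1 + s * k) • y.2)) d 0) :
    fderiv ℝ f y (c, k • y.2) = d := by
  have h1 : HasFDerivAt f (fderiv ℝ f y) y :=
    (hf.contDiffAt.differentiableAt (by simp)).hasFDerivAt
  have h2 : HasDerivAt (fun s : ℝ => y + s • (c, k • y.2)) (c, k • y.2) 0 := by
    simpa using ((hasDerivAt_id (0 : ℝ)).smul_const (c, k • y.2)).const_add y
  have h3 : HasFDerivAt f (fderiv ℝ f y) (y + (0 : ℝ) • (c, k • y.2)) := by simpa using h1
  have h4 := h3.comp_hasDerivAt (0 : ℝ) h2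
  refine h4.unique ?_
  have e : (f ∘ fun s : ℝ => y + s • (c, k • y.2)) =
      fun s : ℝ => f (y.1 + s • c, (1 + s * k) • y.2) := by
    funext s
    refine congrArg f (Prod.ext rfl ?_)
    simp only [Prod.snd_add, Prod.smul_snd, add_smul, one_smul, smul_smul]
  rw [e]
  exact h

lemma norm_line {w : ℂ} (k : ℝ) :
    (fun s : ℝ => ‖(1 + s * k) • w‖) =ᶠ[𝓝 0] fun s => (1 + s * k) * ‖w‖ := by
  have : ∀ᶠ s : ℝ in 𝓝 0, 0 < 1 + s * k := by
    have hc : ContinuousAt (fun s : ℝ => 1 + s * k) 0 := by fun_prop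
    exact hc.eventually (lt_mem_nhds (by norm_num))
  filter_upwards [this] with s hs
  rw [norm_smul, Real.norm_of_nonneg hs.le]

/-- The derivative of a function of `z` and `|w|`. -/
lemma fderiv_radial {F : ℂ → ℝ → ℝ} {y : ℂ × ℂ} (hf : SmoothNear (fun y : ℂ × ℂ => F y.1 ‖y.2‖) y)
    {c : ℂ} {k d : ℝ}
    (h : HasDerivAt (fun s : ℝ => F (y.1 + s • c) ((1 + s * k) * ‖y.2‖)) d 0) :
    fderiv ℝ (fun y : ℂ × ℂ => F y.1 ‖y.2‖) y (c, k • y.2) = d := by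
  refine fderiv_eq_of_line hf (h.congr_of_eventuallyEq ?_)
  filter_upwards [norm_line (w := y.2) k] with s hs
  rw [hs]

lemma hasDerivAt_re_line (z c : ℂ) : HasDerivAt (fun s : ℝ => (z + s • c).re) c.re 0 := by
  simpa using ((hasDerivAt_id (0 : ℝ)).mul_const c.re).const_add z.re

lemma hasDerivAt_im_line (z c : ℂ) : HasDerivAt (fun s : ℝ => (z + s • c).im) c.im 0 := by
  simpa using ((hasDerivAt_id (0 : ℝ)).mul_const c.im).const_add z.im

lemma hasDerivAt_mul_line (k q : ℝ) : HasDerivAt (fun s : ℝ => (1 + s * k) * q) (k * q) 0 := by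
  simpa using (((hasDerivAt_id (0 : ℝ)).mul_const k).const_add 1).mul_const q

lemma hasDerivAt_lev_line (σ : ℝ) (z c : ℂ) (k q : ℝ) :
    HasDerivAt (fun s : ℝ => lev σ (z + s • c) ((1 + s * k) * q))
      (k * q / 2 - σ * (k * q * z.im + q * c.im)) 0 := by
  have hb := hasDerivAt_im_line z c
  have hq := hasDerivAt_mul_line k q
  refine (((hq.const_add 2).div_const 2).sub ((hq.mul hb).const_mul σ)).congr_deriv ?_
  simp

lemma hasDerivAt_wallFun_line (z c : ℂ) (k q : ℝ) :
    HasDerivAt (fun s : ℝ => wallFun (z + s • c) ((1 + s * k) * q))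
      ((-(k * q) * (lev 1 z q * lev (-1) z q) + (7 - q) *
        ((k * q / 2 - 1 * (k * q * z.im + q * c.im)) * lev (-1) z q +
          lev 1 z q * (k * q / 2 - (-1) * (k * q * z.im + q * c.im)))) / 5
        - 2 * (q * z.re) * (k * q * z.re + q * c.re)) 0 := by
  have ha := hasDerivAt_re_line z c
  have hq := hasDerivAt_mul_line k q
  have h1 := hasDerivAt_lev_line 1 z c k q
  have h2 := hasDerivAt_lev_line (-1) z c k q
  refine (((hq.const_sub 7).mul (h1.mul h2)).div_const 5 |>.sub ((hq.mul ha).pow 2)).congr_deriv ?_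
  simp

lemma smoothNear_lev (σ : ℝ) {y : ℂ × ℂ} (hy : y.2 ≠ 0) :
    SmoothNear (fun y : ℂ × ℂ => lev σ y.1 ‖y.2‖) y := by
  unfold lev
  fun_prop (disch := first | assumption | norm_num)

lemma smoothNear_wallAt {y : ℂ × ℂ} (hy : y.2 ≠ 0) : SmoothNear wallAt y := by
  unfold wallAt wallFun lev
  fun_prop (disch := first | assumption | norm_num)

lemma fderiv_wallAt {y : ℂ × ℂ} (hy : y.2 ≠ 0) (c : ℂ) (k : ℝ) :
    fderiv ℝ wallAt y (c, k • y.2) =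
      (-(k * ‖y.2‖) * (lev 1 y.1 ‖y.2‖ * lev (-1) y.1 ‖y.2‖) + (7 - ‖y.2‖) *
        ((k * ‖y.2‖ / 2 - 1 * (k * ‖y.2‖ * y.1.im + ‖y.2‖ * c.im)) * lev (-1) y.1 ‖y.2‖ +
          lev 1 y.1 ‖y.2‖ * (k * ‖y.2‖ / 2 - (-1) * (k * ‖y.2‖ * y.1.im + ‖y.2‖ * c.im)))) / 5
        - 2 * (‖y.2‖ * y.1.re) * (k * ‖y.2‖ * y.1.re + ‖y.2‖ * c.re) :=
  fderiv_radial (F := wallFun) (smoothNear_wallAt hy) (hasDerivAt_wallFun_line y.1 c k ‖y.2‖)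

lemma snd_ne_zero_of_wallAt {y : ℂ × ℂ} (h : wallAt y = 0) : y.2 ≠ 0 := by
  intro h0
  unfold wallAt wallFun lev at h
  rw [h0, norm_zero] at h
  norm_num at h

/-- The wall is transverse to the rays. -/
lemma fderiv_wallAt_ray {y : ℂ × ℂ} (hy : y ∈ nbhd) (h : wallAt y = 0) :
    fderiv ℝ wallAt y (0, (1 : ℝ) • y.2) ≠ 0 := by
  have h0 := snd_ne_zero_of_wallAt h
  have hq : 0 < ‖y.2‖ := norm_pos_iff.2 h0
  rw [fderiv_wallAt h0]
  obtain ⟨h1, h2, h3⟩ := nbhd_nonneg hy h.ge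
  have hs := lev_add y.1 ‖y.2‖
  have h' : wallFun y.1 ‖y.2‖ = 0 := h
  -- If `7 - q` vanishes, the two other coordinates add up to `9` and are both below `11 / 2`, hence
  -- positive.
  have h4 : 0 < ‖y.2‖ * (lev 1 y.1 ‖y.2‖ * lev (-1) y.1 ‖y.2‖) + (7 - ‖y.2‖) * (2 + ‖y.2‖) := by
    rcases h1.eq_or_lt with h5 | h5
    · rw [← h5, zero_mul, add_zero]
      exact mul_pos hq (mul_pos (by linarith [hy.2]) (by linarith [hy.1]))
    · have : 0 < (7 - ‖y.2‖) * (2 + ‖y.2‖) := by positivity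
      have : 0 ≤ ‖y.2‖ * (lev 1 y.1 ‖y.2‖ * lev (-1) y.1 ‖y.2‖) := by positivity
      linarith
  refine ne_of_lt ?_
  have e : ((-(1 * ‖y.2‖) * (lev 1 y.1 ‖y.2‖ * lev (-1) y.1 ‖y.2‖) + (7 - ‖y.2‖) *
        ((1 * ‖y.2‖ / 2 - 1 * (1 * ‖y.2‖ * y.1.im + ‖y.2‖ * (0 : ℂ).im)) * lev (-1) y.1 ‖y.2‖ +
          lev 1 y.1 ‖y.2‖ * (1 * ‖y.2‖ / 2 - (-1) * (1 * ‖y.2‖ * y.1.im + ‖y.2‖ * (0 : ℂ).im)))) / 5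
        - 2 * (‖y.2‖ * y.1.re) * (1 * ‖y.2‖ * y.1.re + ‖y.2‖ * (0 : ℂ).re)) =
      -(‖y.2‖ * (lev 1 y.1 ‖y.2‖ * lev (-1) y.1 ‖y.2‖) + (7 - ‖y.2‖) * (2 + ‖y.2‖)) / 5 +
        2 * wallFun y.1 ‖y.2‖ := by
    unfold wallFun lev
    simp only [Complex.zero_re, Complex.zero_im]
    ring
  rw [e, h']
  linarith

/-- A function of `z` alone is constant on the rays. -/
lemma fderiv_base_ray {e : ℂ → ℝ} {y : ℂ × ℂ} (he : SmoothNear (fun y : ℂ × ℂ => e y.1) y) :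
    fderiv ℝ (fun y : ℂ × ℂ => e y.1) y (0, (1 : ℝ) • y.2) = 0 := by
  refine fderiv_eq_of_line he ?_
  simpa using hasDerivAt_const (0 : ℝ) (e y.1)

end Derivatives

/-! ### Regularity and parametrization of the faces. -/

section FacesOfBody

/-- The face `f = 0` of the body is regular, transverse to the wall, and parametrized by the solid
torus by means of `emb`. -/
structure IsFace (f : ℂ × ℂ → ℝ) (emb : ℂ × ℂ → ℂ × ℂ) : Prop where
  smooth : ∀ y ∈ body, f y = 0 → SmoothNear f y ∧ ∃ e, fderiv ℝ f y e ≠ 0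
  indep : ∀ y ∈ body, f y = 0 → wallAt y = 0 → ∃ e, fderiv ℝ f y e = 0 ∧ fderiv ℝ wallAt y e ≠ 0
  embOn : EmbOn emb solidTorus
  mem : ∀ x ∈ solidTorus, emb x ∈ body ∧ f (emb x) = 0 ∧ (wallAt (emb x) = 0 ↔ ‖x.2‖ = 1)
  surj : ∀ y ∈ body, f y = 0 → ∃ x ∈ solidTorus, emb x = y

lemma IsFace.congr {f g : ℂ × ℂ → ℝ} {emb : ℂ × ℂ → ℂ × ℂ} (h : IsFace f emb)
    (h0 : ∀ y ∈ body, g y = 0 ↔ f y = 0) (hg : ∀ y ∈ body, f y = 0 → g =ᶠ[𝓝 y] f) :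
    IsFace g emb where
  smooth y hy hgy := by
    have hf := (h0 y hy).1 hgy
    rw [(hg y hy hf).fderiv_eq]
    exact ⟨(h.smooth y hy hf).1.congr (hg y hy hf), (h.smooth y hy hf).2⟩
  indep y hy hgy hw := by
    have hf := (h0 y hy).1 hgy
    rw [(hg y hy hf).fderiv_eq]
    exact h.indep y hy hf hw
  embOn := h.embOn
  mem x hx := by
    obtain ⟨h1, h2, h3⟩ := h.mem x hx
    exact ⟨h1, (h0 _ h1).2 h2, h3⟩
  surj y hy hgy := h.surj y hy ((h0 y hy).1 hgy)

lemma IsFace.neg {f : ℂ × ℂ → ℝ} {emb : ℂ × ℂ → ℂ × ℂ} (h : IsFace f emb) :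
    IsFace (fun y => -f y) emb where
  smooth y hy hgy := by
    obtain ⟨h1, e, h2⟩ := h.smooth y hy (neg_eq_zero.1 hgy)
    refine ⟨h1.neg, e, ?_⟩
    rw [fderiv_fun_neg]
    exact neg_ne_zero.2 h2
  indep y hy hgy hw := by
    obtain ⟨e, h1, h2⟩ := h.indep y hy (neg_eq_zero.1 hgy) hw
    refine ⟨e, ?_, h2⟩
    rw [fderiv_fun_neg]
    exact neg_eq_zero.2 h1
  embOn := h.embOn
  mem x hx := by
    obtain ⟨h1, h2, h3⟩ := h.mem x hx
    exact ⟨h1, neg_eq_zero.2 h2, h3⟩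
  surj y hy hgy := h.surj y hy (neg_eq_zero.1 hgy)

namespace Slab

variable (S : Slab)

lemma zero_mem_Icc : (0 : ℝ) ∈ Icc (0 : ℝ) 1 := by norm_num

/-- The parametrization of the incoming face of a slab. -/
def start (x : ℂ × ℂ) : ℂ × ℂ := S.cyl (x, 0)

/-- The parametrization of the belt region of the handle attached to a slab. -/
def belt (x : ℂ × ℂ) : ℂ × ℂ := S.hand (x.2, conj x.1)

lemma start_eq (u v : ℂ) : S.start (u, v) = (S.Z (v, 0), S.Q (v, 0) • u) := by
  simp only [start, cyl, twist_zero]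

lemma embOn_start : EmbOn S.start solidTorus := by
  have h : EmbOn (fun x : ℂ × ℂ => (x, (0 : ℝ))) solidTorus :=
    EmbOn.of_leftInvOn Prod.fst (fun x _ => by fun_prop)
      (fun x _ => ContDiff.smoothNear contDiff_fst _) fun _ _ => rfl
  exact S.embOn_cyl.comp h fun x hx => ⟨hx, zero_mem_Icc⟩

lemma embOn_belt : EmbOn S.belt solidTorus := by
  have h : EmbOn (fun x : ℂ × ℂ => (x.2, conj x.1)) solidTorus :=
    EmbOn.of_leftInvOn (fun y => (conj y.2, y.1)) (fun x _ => by fun_prop)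
      (fun x _ => by fun_prop) fun x _ => Prod.ext (Complex.conj_conj _) rfl
  refine S.embOn_hand.comp h fun x hx => ⟨hx.2, ?_⟩
  rw [RCLike.norm_conj]
  exact hx.1.le

lemma wallAt_section {v w : ℂ} {t : ℝ} (hv : ‖v‖ ≤ 1) (ht : t ∈ Icc (0 : ℝ) 1)
    (hw : ‖w‖ = S.Q (v, t)) : wallAt (S.Z (v, t), w) = 0 ↔ ‖v‖ = 1 := by
  change wallFun (S.Z (v, t)) ‖w‖ = 0 ↔ _
  rw [hw, S.wall v t hv ht, mul_eq_zero, or_iff_right (S.c_pos t ht).ne', norm_eq_one_iff]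
  constructor <;> intro h <;> linarith

theorem isFace_start {f : ℂ × ℂ → ℝ}
    (hzero : ∀ y ∈ body, f y = 0 → ∃ v, ‖v‖ ≤ 1 ∧ S.Z (v, 0) = y.1 ∧ S.Q (v, 0) = ‖y.2‖)
    (hmem : ∀ v w, ‖v‖ ≤ 1 → ‖w‖ = S.Q (v, 0) → (S.Z (v, 0), w) ∈ body ∧ f (S.Z (v, 0), w) = 0)
    (hsm : ∀ y ∈ body, f y = 0 → SmoothNear f y ∧ ∃ e, fderiv ℝ f y e ≠ 0)
    (hind : ∀ y ∈ body, f y = 0 → wallAt y = 0 →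
      ∃ e, fderiv ℝ f y e = 0 ∧ fderiv ℝ wallAt y e ≠ 0) : IsFace f S.start where
  smooth := hsm
  indep := hind
  embOn := S.embOn_start
  mem := by
    rintro ⟨u, v⟩ ⟨hu, hv⟩
    rw [start_eq]
    have hn := norm_smul_unit (S.Q_pos v 0 hv zero_mem_Icc) hu
    exact ⟨(hmem v _ hv hn).1, (hmem v _ hv hn).2, S.wallAt_section hv zero_mem_Icc hn⟩
  surj := by
    rintro ⟨z, w⟩ hy hf
    obtain ⟨v, hv, hZ, hQ⟩ := hzero _ hy hf
    have hQ0 := S.Q_pos v 0 hv zero_mem_Icc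
    dsimp only at hZ hQ
    refine ⟨((1 / ‖w‖) • w, v), ⟨?_, hv⟩, ?_⟩
    · change ‖(1 / ‖w‖) • w‖ = 1
      rw [norm_smul, norm_div, norm_one, norm_norm, one_div, inv_mul_cancel₀ (by linarith)]
    · rw [start_eq, hZ, hQ, smul_smul, mul_one_div_cancel (by linarith), one_smul]

theorem isFace_belt {e : ℂ → ℝ}
    (hzero : ∀ y ∈ body, e y.1 = 0 → ∃ v, ‖v‖ = 1 ∧ S.Z (v, 1) = y.1)
    (hmem : ∀ v w, ‖v‖ ≤ 1 → ‖w‖ = S.Q (v, 1) → (S.Z (v, 1), w) ∈ body)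
    (he : ∀ v, ‖v‖ = 1 → e (S.Z (v, 1)) = 0)
    (hsm : ∀ y ∈ body, e y.1 = 0 → SmoothNear (fun y : ℂ × ℂ => e y.1) y ∧
      ∃ e', fderiv ℝ (fun y : ℂ × ℂ => e y.1) y e' ≠ 0) :
    IsFace (fun y => e y.1) S.belt where
  smooth := hsm
  indep y hy hf hw := ⟨_, fderiv_base_ray (hsm y hy hf).1,
    fderiv_wallAt_ray (body_subset_nbhd hy) hw⟩
  embOn := S.embOn_belt
  mem := by
    rintro ⟨x, w⟩ ⟨hx, hw⟩
    have hx' : ‖conj x‖ = 1 := by rw [RCLike.norm_conj]; exact hx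
    have hv : ‖twist 1 (conj x)‖ = 1 := (norm_twist_eq_one_iff one_mem_Icc hx'.le).2 hx'
    have hQ := S.Q_pos _ 1 hv.le one_mem_Icc
    set v := twist 1 (conj x)
    have hn := norm_smul_unit hQ hx
    change (S.Z (v, 1), S.Q (v, 1) • w) ∈ body ∧ e (S.Z (v, 1)) = 0 ∧
      (wallAt (S.Z (v, 1), S.Q (v, 1) • w) = 0 ↔ ‖w‖ = 1)
    have hle : ‖S.Q (v, 1) • w‖ ≤ ‖S.Q (v, 1) • x‖ := by
      rw [hn, norm_smul, Real.norm_of_nonneg hQ.le]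
      exact mul_le_of_le_one_right hQ.le hw
    have hd := body_down (hmem v _ hv.le hn) hle
    refine ⟨hd.1, he v hv, fun h => ?_, fun h => ?_⟩
    · by_contra h1
      have hlt : ‖w‖ < 1 := lt_of_le_of_ne hw h1
      refine (hd.2 ?_).ne' h
      rw [hn, norm_smul, Real.norm_of_nonneg hQ.le]
      exact mul_lt_of_lt_one_right hQ hlt
    · exact (S.wallAt_section hv.le one_mem_Icc (norm_smul_unit hQ h)).2 hv
  surj := by
    rintro ⟨z, w⟩ hy hf
    obtain ⟨v, hv, hZ⟩ := hzero _ hy hf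
    have hQ := S.Q_pos v 1 hv.le one_mem_Icc
    obtain ⟨b, hb, hbv⟩ := twist_surj one_mem_Icc hv.le
    have hb1 : ‖b‖ = 1 := (norm_twist_eq_one_iff one_mem_Icc hb).1 (by rw [hbv, hv])
    dsimp only at hZ
    refine ⟨(conj b, (1 / S.Q (v, 1)) • w), ⟨by rw [RCLike.norm_conj]; exact hb1, ?_⟩, ?_⟩
    · change ‖(1 / S.Q (v, 1)) • w‖ ≤ 1
      have hle : ‖w‖ ≤ S.Q (v, 1) := by
        by_contra! h
        have hn : ‖S.Q (v, 1) • v‖ = S.Q (v, 1) := norm_smul_unit hQ hv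
        have := (body_down hy (by rw [hn]; exact h.le)).2 (by rw [hn]; exact h)
        rw [← hZ] at this
        exact this.ne' ((S.wallAt_section hv.le one_mem_Icc hn).2 hv)
      rw [norm_smul, Real.norm_of_nonneg (by positivity), one_div, inv_mul_le_iff₀ hQ, mul_one]
      exact hle
    · change (S.Z (twist 1 (conj (conj b)), 1),
        S.Q (twist 1 (conj (conj b)), 1) • (1 / S.Q (v, 1)) • w) = (z, w)
      rw [Complex.conj_conj, hbv, hZ, smul_smul, mul_one_div_cancel hQ.ne', one_smul]

end Slab

/-- The function of an incoming face. -/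
def incFun (σ : ℝ) (y : ℂ × ℂ) : ℝ := 5 + eps - lev σ y.1 ‖y.2‖

/-- The function of the waist. -/
def waistFun (y : ℂ × ℂ) : ℝ := ‖y.2‖ - (2 + eps)

/-- The function of the outgoing face. -/
def outFun (y : ℂ × ℂ) : ℝ := 1 - (y.1.re ^ 2 + y.1.im ^ 2)

theorem isFace_inc (σ : ℝ) (hσ : σ = 1 ∨ σ = -1) : IsFace (incFun σ) (sideSlab σ hσ).start := by
  have he := eps_pos
  have he' := eps_le
  have hs : σ * σ = 1 := by rcases hσ with rfl | rfl <;> norm_num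
  have h0 : ∀ y ∈ body, incFun σ y = 0 → y.2 ≠ 0 := by
    intro y _ h h'
    unfold incFun lev at h
    rw [h', norm_zero] at h
    norm_num at h
    linarith
  have hsm : ∀ y : ℂ × ℂ, y.2 ≠ 0 → SmoothNear (incFun σ) y := fun y hy =>
    (smoothNear_const (5 + eps) y).sub (smoothNear_lev σ hy)
  have hd : ∀ y : ℂ × ℂ, y.2 ≠ 0 → ∀ (c : ℂ) (k : ℝ), fderiv ℝ (incFun σ) y (c, k • y.2) =
      -(k * ‖y.2‖ / 2 - σ * (k * ‖y.2‖ * y.1.im + ‖y.2‖ * c.im)) := fun y hy c k =>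
    fderiv_radial (F := fun z q => 5 + eps - lev σ z q) (hsm y hy)
      ((hasDerivAt_lev_line σ y.1 c k ‖y.2‖).const_sub _)
  refine (sideSlab σ hσ).isFace_start ?_ ?_ ?_ ?_
  · intro y hy hf
    have hl : lev σ y.1 ‖y.2‖ = 5 + eps := by unfold incFun at hf; linarith
    obtain ⟨v, t, hv, ht, h1, h2, h3⟩ := exists_side hσ (norm_pos_iff.2 (h0 y hy hf))
      (by linarith) hl.le hy.1
    have : t = 0 := by
      rw [hl] at h1
      unfold sideLevel at h1
      have : t * eps = 0 := by linarith
      exact (mul_eq_zero.1 this).resolve_right he.ne'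
    subst this
    exact ⟨v, hv, h2, h3⟩
  · intro v w hv hw
    refine ⟨side_mem_body hσ hv Slab.zero_mem_Icc hw, ?_⟩
    have hb := sideQ_bounds hσ hv Slab.zero_mem_Icc
    change 5 + eps - lev σ (sideZ σ (v, 0)) ‖w‖ = 0
    rw [hw]
    change 5 + eps - lev σ (sideZ σ (v, 0)) (sideQ σ (v, 0)) = 0
    rw [(lev_sideZ hσ (by linarith)).1]
    unfold sideLevel
    ring
  · intro y hy hf
    have h := h0 y hy hf
    refine ⟨hsm y h, (Complex.I, (0 : ℝ) • y.2), ?_⟩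
    rw [hd y h]
    have : 0 < ‖y.2‖ := norm_pos_iff.2 h
    simp only [Complex.I_im, zero_mul, zero_div, zero_add, mul_one, zero_sub, neg_neg]
    exact mul_ne_zero (by rintro rfl; norm_num at hs) this.ne'
  · intro y hy hf hw
    have h := h0 y hy hf
    have hq : 0 < ‖y.2‖ := norm_pos_iff.2 h
    have hl : lev σ y.1 ‖y.2‖ = 5 + eps := by unfold incFun at hf; linarith
    by_cases ha : y.1.re = 0
    -- In this direction the height grows with speed `1` while `lev σ` stays fixed, so `7 - q`
    -- decreases and `lev (-σ)` increases, both with speed `1`.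
    · refine ⟨(⟨0, σ * (1 / 2 - σ * y.1.im) / ‖y.2‖⟩, (1 / ‖y.2‖) • y.2), ?_, ?_⟩
      · rw [hd y h]
        field_simp
        linear_combination (1 - 2 * σ * y.1.im) * hs
      · rw [fderiv_wallAt h]
        have hw' : wallFun y.1 ‖y.2‖ = 0 := hw
        have hadd := lev_add' σ y.1 ‖y.2‖
        have h1 : (7 - ‖y.2‖) * lev (-σ) y.1 ‖y.2‖ = 0 := by
          unfold wallFun at hw'
          rw [lev_mul hσ, ha, hl] at hw'
          have : (5 + eps) * ((7 - ‖y.2‖) * lev (-σ) y.1 ‖y.2‖) = 0 := by linarith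
          exact (mul_eq_zero.1 this).resolve_left (by linarith)
        have e : (-(1 / ‖y.2‖ * ‖y.2‖) * (lev 1 y.1 ‖y.2‖ * lev (-1) y.1 ‖y.2‖) + (7 - ‖y.2‖) *
            ((1 / ‖y.2‖ * ‖y.2‖ / 2 - 1 * (1 / ‖y.2‖ * ‖y.2‖ * y.1.im +
              ‖y.2‖ * (σ * (1 / 2 - σ * y.1.im) / ‖y.2‖))) * lev (-1) y.1 ‖y.2‖ +
            lev 1 y.1 ‖y.2‖ * (1 / ‖y.2‖ * ‖y.2‖ / 2 - (-1) * (1 / ‖y.2‖ * ‖y.2‖ * y.1.im +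
              ‖y.2‖ * (σ * (1 / 2 - σ * y.1.im) / ‖y.2‖))))) / 5
            - 2 * (‖y.2‖ * y.1.re) * (1 / ‖y.2‖ * ‖y.2‖ * y.1.re + ‖y.2‖ * 0) =
            (5 + eps) / 5 * ((7 - ‖y.2‖) - lev (-σ) y.1 ‖y.2‖) := by
          have e1 : 1 / ‖y.2‖ * ‖y.2‖ = 1 := one_div_mul_cancel hq.ne'
          have e2 : ‖y.2‖ * (σ * (1 / 2 - σ * y.1.im) / ‖y.2‖) = σ / 2 - y.1.im := by
            rw [mul_div_cancel₀ _ hq.ne']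
            linear_combination -y.1.im * hs
          rw [e1, e2, ha, ← hl]
          rcases hσ with rfl | rfl
          · ring
          · rw [neg_neg]; ring
        change (-(1 / ‖y.2‖ * ‖y.2‖) * (lev 1 y.1 ‖y.2‖ * lev (-1) y.1 ‖y.2‖) + (7 - ‖y.2‖) *
            ((1 / ‖y.2‖ * ‖y.2‖ / 2 - 1 * (1 / ‖y.2‖ * ‖y.2‖ * y.1.im +
              ‖y.2‖ * (σ * (1 / 2 - σ * y.1.im) / ‖y.2‖))) * lev (-1) y.1 ‖y.2‖ +
            lev 1 y.1 ‖y.2‖ * (1 / ‖y.2‖ * ‖y.2‖ / 2 - (-1) * (1 / ‖y.2‖ * ‖y.2‖ * y.1.im +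
              ‖y.2‖ * (σ * (1 / 2 - σ * y.1.im) / ‖y.2‖))))) / 5
            - 2 * (‖y.2‖ * y.1.re) * (1 / ‖y.2‖ * ‖y.2‖ * y.1.re + ‖y.2‖ * 0) ≠ 0
        rw [e]
        -- The coordinates `7 - q` and `lev (-σ)` have product zero and sum `4 - eps`. Exactly one
        -- of them vanishes, hence they differ.
        refine mul_ne_zero (by linarith) ?_
        rcases mul_eq_zero.1 h1 with h2 | h2
        · rw [h2]; intro h3; linarith
        · rw [h2]; intro h3; linarith
    · refine ⟨((1 : ℂ), (0 : ℝ) • y.2), ?_, ?_⟩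
      · rw [hd y h]; simp
      · rw [fderiv_wallAt h]
        simp only [Complex.one_im, Complex.one_re, zero_mul, neg_zero, mul_zero, zero_div, add_zero,
          sub_zero, zero_add, mul_one, zero_sub]
        refine neg_ne_zero.2 ?_
        have : ‖y.2‖ ≠ 0 := hq.ne'
        positivity

theorem isFace_waist : IsFace waistFun beltSlab.start := by
  have he := eps_pos
  have he' := eps_le
  have h0 : ∀ y ∈ body, waistFun y = 0 → ‖y.2‖ = 2 + eps := by
    intro y _ h
    unfold waistFun at h
    linarith
  have h0' : ∀ y ∈ body, waistFun y = 0 → y.2 ≠ 0 := by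
    intro y hy h
    rw [← norm_ne_zero_iff, h0 y hy h]
    linarith
  have hsm : ∀ y : ℂ × ℂ, y.2 ≠ 0 → SmoothNear waistFun y := fun y hy => by
    unfold waistFun
    fun_prop (disch := assumption)
  have hd : ∀ y : ℂ × ℂ, y.2 ≠ 0 → ∀ (c : ℂ) (k : ℝ), fderiv ℝ waistFun y (c, k • y.2) =
      k * ‖y.2‖ := fun y hy c k =>
    fderiv_radial (F := fun _ q => q - (2 + eps)) (hsm y hy)
      ((hasDerivAt_mul_line k ‖y.2‖).sub_const _)
  refine beltSlab.isFace_start ?_ ?_ ?_ ?_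
  · intro y hy hf
    have hq := h0 y hy hf
    obtain ⟨v, t, hv, ht, h2, h3⟩ := exists_belt (z := y.1) (q := ‖y.2‖) (by linarith) hq.le hy.1
    have : t = 0 := by
      rw [hq] at h3
      unfold beltHeight at h3
      have : t * eps = 0 := by linarith
      exact (mul_eq_zero.1 this).resolve_right he.ne'
    subst this
    exact ⟨v, hv, h2, h3⟩
  · intro v w hv hw
    refine ⟨belt_mem_body hv Slab.zero_mem_Icc hw, ?_⟩
    change ‖w‖ - (2 + eps) = 0
    rw [hw]
    change beltHeight 0 - (2 + eps) = 0
    unfold beltHeight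
    ring
  · intro y hy hf
    have h := h0' y hy hf
    refine ⟨hsm y h, (0, (1 : ℝ) • y.2), ?_⟩
    rw [hd y h, one_mul]
    exact norm_ne_zero_iff.2 h
  · intro y hy hf hw
    have h := h0' y hy hf
    have hq : 0 < ‖y.2‖ := norm_pos_iff.2 h
    have hq' := h0 y hy hf
    -- At fixed height the wall function is a positive constant minus a positive definite quadratic
    -- form in `z`, so on the wall the radial direction in the `z`-plane is transverse.
    refine ⟨(y.1, (0 : ℝ) • y.2), by rw [hd y h, zero_mul], ?_⟩
    rw [fderiv_wallAt h]
    have hz : 0 < y.1.re ^ 2 + (7 - ‖y.2‖) / 5 * y.1.im ^ 2 := by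
      have hw' : wallFun y.1 ‖y.2‖ = 0 := hw
      have e : wallFun y.1 ‖y.2‖ = (7 - ‖y.2‖) / 5 * ((2 + ‖y.2‖) / 2) ^ 2 -
          ‖y.2‖ ^ 2 * (y.1.re ^ 2 + (7 - ‖y.2‖) / 5 * y.1.im ^ 2) := by
        unfold wallFun lev; ring
      rw [e] at hw'
      have h7 : 0 < 7 - ‖y.2‖ := by linarith
      have h1 : 0 < (7 - ‖y.2‖) / 5 * ((2 + ‖y.2‖) / 2) ^ 2 := by positivity
      exact pos_of_mul_pos_right (a := ‖y.2‖ ^ 2) (by linarith) (by positivity)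
    refine ne_of_lt ?_
    have e : (-(0 * ‖y.2‖) * (lev 1 y.1 ‖y.2‖ * lev (-1) y.1 ‖y.2‖) + (7 - ‖y.2‖) *
        ((0 * ‖y.2‖ / 2 - 1 * (0 * ‖y.2‖ * y.1.im + ‖y.2‖ * y.1.im)) * lev (-1) y.1 ‖y.2‖ +
          lev 1 y.1 ‖y.2‖ * (0 * ‖y.2‖ / 2 - (-1) * (0 * ‖y.2‖ * y.1.im + ‖y.2‖ * y.1.im)))) / 5
        - 2 * (‖y.2‖ * y.1.re) * (0 * ‖y.2‖ * y.1.re + ‖y.2‖ * y.1.re) =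
        -(2 * ‖y.2‖ ^ 2 * (y.1.re ^ 2 + (7 - ‖y.2‖) / 5 * y.1.im ^ 2)) := by
      unfold lev; ring
    rw [e]
    have : 0 < 2 * ‖y.2‖ ^ 2 * (y.1.re ^ 2 + (7 - ‖y.2‖) / 5 * y.1.im ^ 2) := by positivity
    linarith

lemma sideZ_one_mul {σ : ℝ} (hσ : σ = 1 ∨ σ = -1) {v : ℂ} (hv : ‖v‖ ≤ 1) :
    0 < 1 - 2 * σ * (sideZ σ (v, 1)).im ∧
      8 / (1 - 2 * σ * (sideZ σ (v, 1)).im) = sideQ σ (v, 1) := by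
  have h := (sideSlab σ hσ).P_eq v hv
  change 8 / (1 - 2 * σ * (sideZ σ (v, 1)).im) = sideQ σ (v, 1) at h
  refine ⟨?_, h⟩
  have hb := sideQ_bounds hσ hv one_mem_Icc
  by_contra! h'
  have := div_nonpos_of_nonneg_of_nonpos (by norm_num : (0 : ℝ) ≤ 8) h'
  linarith

/-- The cone function is nonpositive exactly on the section. -/
lemma cone_sideZ {σ : ℝ} (hσ : σ = 1 ∨ σ = -1) {v : ℂ} (hv : ‖v‖ ≤ 1) :
    cone σ (sideZ σ (v, 1)) ≤ 0 ∧ (‖v‖ = 1 → cone σ (sideZ σ (v, 1)) = 0) := by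
  obtain ⟨h1, h2⟩ := sideZ_one_mul hσ hv
  have h3 := wallFun_cone hσ h1
  have hb := sideQ_bounds hσ hv one_mem_Icc
  have hQ : 0 < sideQ σ (v, 1) := by linarith
  have hc := (sideSlab σ hσ).c_pos 1 one_mem_Icc
  change 0 < sideLevel 1 / 5 * halfSum 1 ^ 2 at hc
  rw [h2, wallFun_side hσ one_mem_Icc hQ.ne'] at h3
  have h4 := (norm_le_one_iff v).1 hv
  have hQ2 : 0 < sideQ σ (v, 1) ^ 2 := by positivity
  constructor
  · have : 0 ≤ sideLevel 1 / 5 * halfSum 1 ^ 2 * (1 - (v.re ^ 2 + v.im ^ 2)) :=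
      mul_nonneg hc.le (by linarith)
    by_contra! h
    nlinarith
  · intro h5
    rw [(norm_eq_one_iff v).1 h5] at h3
    have : sideQ σ (v, 1) ^ 2 * cone σ (sideZ σ (v, 1)) = 0 := by linarith
    exact (mul_eq_zero.1 this).resolve_left hQ2.ne'

/-- The ray over `z` meets the section `lev σ = 5` at the height `8 / (1 - 2 σ z.im)`, and there the
sign of the wall function is opposite to that of `cone σ z`. -/
lemma exists_side_of_cone {σ : ℝ} (hσ : σ = 1 ∨ σ = -1) {z : ℂ} (h : cone σ z ≤ 0) :
    ∃ v, ‖v‖ ≤ 1 ∧ sideZ σ (v, 1) = z ∧ (cone σ z = 0 → ‖v‖ = 1) := by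
  have he := eps_pos
  obtain ⟨h1, h2, -⟩ := cone_nonpos hσ h
  have hm : 0 < 1 - 2 * σ * z.im := by linarith
  have hw := wallFun_cone hσ hm
  have hl := lev_section hm
  have hq : 0 < 8 / (1 - 2 * σ * z.im) := by positivity
  have hw0 : 0 ≤ wallFun z (8 / (1 - 2 * σ * z.im)) := by
    rw [hw, neg_mul, ← mul_neg]
    exact mul_nonneg (by positivity) (by linarith)
  obtain ⟨v, t, hv, ht, h3, h4, h5⟩ := exists_side hσ hq hl.ge (by linarith) hw0
  have : t = 1 := by
    rw [hl] at h3
    unfold sideLevel at h3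
    have : (1 - t) * eps = 0 := by linarith
    linarith [(mul_eq_zero.1 this).resolve_right he.ne']
  subst this
  refine ⟨v, hv, h4, fun h0 => ?_⟩
  have hwall := wallFun_side hσ one_mem_Icc (v := v) (by rw [h5]; exact hq.ne')
  rw [h4, h5, hw, h0, mul_zero] at hwall
  have hc := (sideSlab σ hσ).c_pos 1 one_mem_Icc
  rw [norm_eq_one_iff]
  have := (mul_eq_zero.1 hwall.symm).resolve_left hc.ne'
  linarith

theorem isFace_mid (σ : ℝ) (hσ : σ = 1 ∨ σ = -1) :
    IsFace (fun y => cone σ y.1) (sideSlab σ hσ).belt := by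
  have hs : σ * σ = 1 := by rcases hσ with rfl | rfl <;> norm_num
  refine (sideSlab σ hσ).isFace_belt ?_ ?_ ?_ ?_
  · intro y hy h
    obtain ⟨v, -, h1, h2⟩ := exists_side_of_cone hσ h.le
    exact ⟨v, h2 h, h1⟩
  · intro v w hv hw
    exact side_mem_body hσ hv one_mem_Icc hw
  · intro v hv
    exact (cone_sideZ hσ hv.le).2 hv
  · intro y hy h
    have hsm : SmoothNear (fun y : ℂ × ℂ => cone σ y.1) y := by
      unfold cone
      fun_prop (disch := norm_num)
    -- The ellipse has its centre at `z = -σ * (19 / 42) * I`, where the gradient of `cone σ`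
    -- vanishes. The direction used is the one from the centre to the point.
    refine ⟨hsm, (⟨y.1.re, y.1.im + σ * (19 / 42)⟩, (0 : ℝ) • y.2), ?_⟩
    have ha := hasDerivAt_re_line y.1 ⟨y.1.re, y.1.im + σ * (19 / 42)⟩
    have hb := hasDerivAt_im_line y.1 ⟨y.1.re, y.1.im + σ * (19 / 42)⟩
    have hm := ((hb.const_mul (2 * σ)).const_sub 1).div_const 8
    have hc := (((ha.pow 2).add ((hm.pow 2).const_mul 21)).sub (hm.const_mul 10)).add_const 1
    rw [fderiv_eq_of_line hsm hc]
    unfold cone at h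
    simp only [zero_smul, add_zero]
    intro h'
    norm_num at h'
    nlinarith

lemma beltZ_one (v : ℂ) : beltZ (v, 1) = conj v := by
  refine Complex.ext ?_ ?_
  · simp only [beltZ, beltHeight, Complex.conj_re]
    norm_num
  · simp only [beltZ, beltHeight, Complex.conj_im]
    norm_num
    ring

theorem isFace_out : IsFace outFun beltSlab.belt := by
  refine beltSlab.isFace_belt (e := fun z => 1 - (z.re ^ 2 + z.im ^ 2)) ?_ ?_ ?_ ?_
  · intro y hy h
    refine ⟨conj y.1, ?_, ?_⟩
    · rw [RCLike.norm_conj, norm_eq_one_iff]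
      linarith
    · exact (beltZ_one _).trans (Complex.conj_conj _)
  · intro v w hv hw
    exact belt_mem_body hv one_mem_Icc hw
  · intro v hv
    change 1 - ((beltZ (v, 1)).re ^ 2 + (beltZ (v, 1)).im ^ 2) = 0
    rw [beltZ_one, Complex.conj_re, Complex.conj_im]
    have := (norm_eq_one_iff v).1 hv
    linarith
  · intro y hy h
    have hsm : SmoothNear (fun y : ℂ × ℂ => 1 - (y.1.re ^ 2 + y.1.im ^ 2)) y := by fun_prop
    refine ⟨hsm, (y.1, (0 : ℝ) • y.2), ?_⟩
    have ha := hasDerivAt_re_line y.1 y.1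
    have hb := hasDerivAt_im_line y.1 y.1
    have hc := ((ha.pow 2).add (hb.pow 2)).const_sub 1
    rw [fderiv_eq_of_line hsm hc]
    simp only [zero_smul, add_zero]
    intro h'
    norm_num at h'
    nlinarith

end FacesOfBody

/-! ### The domains that represent the pieces. -/

section Domains

/-- The domain in the body cut out by regular faces. -/
def FaceData.ofFaces {ι κ : Type} {U C : Set (ℂ × ℂ)} {f : ι ⊕ κ → ℂ × ℂ → ℝ}
    {emb : ι ⊕ κ → ℂ × ℂ → ℂ × ℂ} (hU : IsOpen U) (hface : ∀ j, IsFace (f j) (emb j))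
    (hcont : ∀ j, ∀ y ∈ U, ContinuousAt (f j) y) (hC : IsClosed C)
    (hiff : ∀ y, (y ∈ U ∧ 0 ≤ wallAt y ∧ ∀ j, 0 ≤ f j y) ↔ y ∈ body ∧ y ∈ C)
    (hpos : ∀ y ∈ body, ∀ j j', f j y = 0 → j' ≠ j → 0 < f j' y)
    (hmem : ∀ y ∈ body, ∀ j, f j y = 0 → y ∈ U) : FaceData ι κ where
  U := U
  G := wallAt
  f := f
  emb := emb
  isOpen_U := hU
  isCompact := by
    have : {y | y ∈ U ∧ 0 ≤ wallAt y ∧ ∀ j, 0 ≤ f j y} = body ∩ C := by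
      ext y; exact hiff y
    rw [this]
    exact isCompact_body.inter_right hC
  continuousAt_G y _ := continuous_wallAt.continuousAt
  continuousAt_f := hcont
  face_unique y h1 h2 h3 j j' hj hj' := by
    by_contra h
    exact (hpos y ((hiff y).1 ⟨h1, h2, h3⟩).1 j j' hj (Ne.symm h)).ne' hj'
  wall_smooth y h1 h3 h2 := by
    have hb := ((hiff y).1 ⟨h1, h2.ge, h3⟩).1
    exact ⟨smoothNear_wallAt (snd_ne_zero_of_wallAt h2), _,
      fderiv_wallAt_ray (body_subset_nbhd hb) h2⟩
  face_smooth y h1 h2 h3 j hj := (hface j).smooth y ((hiff y).1 ⟨h1, h2, h3⟩).1 hj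
  indep y h1 h3 h2 j hj := (hface j).indep y ((hiff y).1 ⟨h1, h2.ge, h3⟩).1 hj h2
  emb_embOn j := (hface j).embOn
  emb_mem j x hx := by
    obtain ⟨h1, h2, -⟩ := (hface j).mem x hx
    refine ⟨hmem _ h1 j h2, h1.1, fun j' => ?_, h2⟩
    by_cases h : j' = j
    · rw [h, h2]
    · exact (hpos _ h1 j j' h2 h).le
  emb_surj y h1 h2 h3 j hj := (hface j).surj y ((hiff y).1 ⟨h1, h2, h3⟩).1 hj
  emb_wall j x hx := ((hface j).mem x hx).2.2

lemma FaceData.mem_ofFaces {ι κ : Type} {U C : Set (ℂ × ℂ)} {f : ι ⊕ κ → ℂ × ℂ → ℝ}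
    {emb : ι ⊕ κ → ℂ × ℂ → ℂ × ℂ} (hU : IsOpen U) (hface : ∀ j, IsFace (f j) (emb j))
    (hcont : ∀ j, ∀ y ∈ U, ContinuousAt (f j) y) (hC : IsClosed C)
    (hiff : ∀ y, (y ∈ U ∧ 0 ≤ wallAt y ∧ ∀ j, 0 ≤ f j y) ↔ y ∈ body ∧ y ∈ C)
    (hpos : ∀ y ∈ body, ∀ j j', f j y = 0 → j' ≠ j → 0 < f j' y)
    (hmem : ∀ y ∈ body, ∀ j, f j y = 0 → y ∈ U) {y : ℂ × ℂ} :
    y ∈ (FaceData.ofFaces hU hface hcont hC hiff hpos hmem).carrier ↔ y ∈ body ∧ y ∈ C := hiff y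

lemma continuous_incFun (σ : ℝ) : Continuous (incFun σ) := continuous_const.sub (continuous_lev σ)

lemma continuous_waistFun : Continuous waistFun := by unfold waistFun; fun_prop

lemma continuous_outFun : Continuous outFun := by unfold outFun; fun_prop

lemma continuous_coneFun (σ : ℝ) : Continuous fun y : ℂ × ℂ => cone σ y.1 :=
  (continuous_cone σ).comp continuous_fst

variable {y : ℂ × ℂ} {σ : ℝ}

lemma sigma_one : (1 : ℝ) = 1 ∨ (1 : ℝ) = -1 := Or.inl rfl

lemma sigma_neg_one : (-1 : ℝ) = 1 ∨ (-1 : ℝ) = -1 := Or.inr rfl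

lemma outFun_nonneg_iff : 0 ≤ outFun y ↔ ‖y.1‖ ≤ 1 := by
  rw [norm_le_one_iff]; unfold outFun
  constructor <;> intro h <;> linarith

lemma outFun_pos_iff : 0 < outFun y ↔ ‖y.1‖ < 1 := by
  rw [lt_iff_le_and_ne, lt_iff_le_and_ne, outFun_nonneg_iff, ne_comm, Ne, Ne, norm_eq_one_iff]
  unfold outFun
  refine and_congr_right fun _ => not_congr ⟨fun h => by linarith, fun h => by linarith⟩

lemma mem_body_iff : y ∈ body ↔ y ∈ nbhd ∧ 0 ≤ wallAt y ∧ 0 ≤ incFun 1 y ∧ 0 ≤ incFun (-1) y ∧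
    0 ≤ outFun y := by
  rw [outFun_nonneg_iff]
  unfold incFun
  constructor
  · intro h
    exact ⟨body_subset_nbhd h, h.1, by linarith [h.2.1], by linarith [h.2.2.1], h.2.2.2⟩
  · rintro ⟨-, h1, h2, h3, h4⟩
    exact ⟨h1, by linarith, by linarith, h4⟩

lemma two_lt_of_five_le (hσ : σ = 1 ∨ σ = -1) (hy : y ∈ body) (h : 5 ≤ lev σ y.1 ‖y.2‖) :
    2 + 1 / 2 < ‖y.2‖ := by
  have := lev_le_of_norm_le hσ (y := y) hy.2.2.2
  linarith

lemma outFun_pos_of_two_lt (hy : y ∈ body) (h : 2 < ‖y.2‖) : 0 < outFun y :=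
  outFun_pos_iff.2 (norm_sq_lt_one_of_two_lt (body_subset_nbhd hy) hy.1 h)

lemma outFun_pos_of_five_le (hσ : σ = 1 ∨ σ = -1) (hy : y ∈ body) (h : 5 ≤ lev σ y.1 ‖y.2‖) :
    0 < outFun y :=
  outFun_pos_of_two_lt hy (by linarith [two_lt_of_five_le hσ hy h])

lemma outFun_pos_of_cone (hσ : σ = 1 ∨ σ = -1) (h : cone σ y.1 ≤ 0) : 0 < outFun y := by
  have := (cone_nonpos hσ h).2.2
  unfold outFun
  linarith

/-- The two levels add up to `2 + q ≤ 9`, so they cannot both exceed `9 / 2`. This keeps the two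
incoming ends apart. -/
lemma lev_neg_le (hy : y ∈ body) (h : 0 ≤ lev σ y.1 ‖y.2‖ - 9 / 2 ∨ σ * y.1.im ≤ 0) :
    lev (-σ) y.1 ‖y.2‖ ≤ 9 / 2 := by
  have h1 := (body_nonneg hy).1
  have h2 := lev_add' σ y.1 ‖y.2‖
  rcases h with h | h
  · linarith
  · unfold lev
    nlinarith [norm_nonneg y.2]

lemma incFun_neg_pos (hy : y ∈ body) (h : 0 ≤ lev σ y.1 ‖y.2‖ - 9 / 2 ∨ σ * y.1.im ≤ 0) :
    0 < incFun (-σ) y := by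
  have := lev_neg_le hy h
  have := eps_pos
  unfold incFun
  linarith

lemma cone_neg_of_inc (hσ : σ = 1 ∨ σ = -1) (hy : y ∈ body) (h : 5 < lev σ y.1 ‖y.2‖) :
    cone σ y.1 < 0 := by
  by_contra! h'
  have := lev_le_five hσ (body_subset_nbhd hy) hy.1 h'
  linarith

lemma cone_neg_pos (hσ : σ = 1 ∨ σ = -1) {z : ℂ} (h : cone σ z ≤ 0) : 0 < cone (-σ) z := by
  by_contra! h'
  have h1 := (cone_nonpos hσ h).1
  have h2 := (cone_nonpos (σ := -σ) (by rcases hσ with rfl | rfl <;> norm_num) h').1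
  linarith

lemma incFun_pos_of_waist (hσ : σ = 1 ∨ σ = -1) (hy : y ∈ body) (h : waistFun y ≤ 0) :
    0 < incFun σ y := by
  have := lev_le_of_norm_le hσ (y := y) hy.2.2.2
  have := eps_pos
  have := eps_le
  unfold waistFun at h
  unfold incFun
  linarith

/-- The total space of the composite. -/
def totalData : FaceData (Unit ⊕ Unit) Unit :=
  FaceData.ofFaces (U := nbhd) (C := univ)
    (f := Sum.elim (Sum.elim (fun _ => incFun 1) fun _ => incFun (-1)) fun _ => outFun)
    (emb := Sum.elim (Sum.elim (fun _ => (sideSlab 1 sigma_one).start)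
      fun _ => (sideSlab (-1) sigma_neg_one).start) fun _ => beltSlab.belt)
    isOpen_nbhd
    (by rintro ((_ | _) | _); exacts [isFace_inc _ _, isFace_inc _ _, isFace_out])
    (by
      rintro ((_ | _) | _) y -
      exacts [(continuous_incFun _).continuousAt, (continuous_incFun _).continuousAt,
        continuous_outFun.continuousAt])
    isClosed_univ
    (by
      intro y
      rw [mem_body_iff]
      simp only [Sum.forall, Sum.elim_inl, Sum.elim_inr, mem_univ, and_true]
      tauto)
    (by
      have he := eps_pos
      rintro y hy ((_ | _) | _) ((_ | _) | _) h hne <;> simp only [Sum.elim_inl, Sum.elim_inr] at h ⊢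
      · exact absurd rfl hne
      · exact incFun_neg_pos hy (Or.inl (by unfold incFun at h; linarith))
      · exact outFun_pos_of_five_le sigma_one hy (by unfold incFun at h; linarith)
      · have := incFun_neg_pos (σ := -1) hy (Or.inl (by unfold incFun at h; linarith))
        rwa [neg_neg] at this
      · exact absurd rfl hne
      · exact outFun_pos_of_five_le sigma_neg_one hy (by unfold incFun at h; linarith)
      · by_contra! h'
        exact (outFun_pos_of_five_le sigma_one hy (by unfold incFun at h'; linarith)).ne' h
      · by_contra! h'
        exact (outFun_pos_of_five_le sigma_neg_one hy (by unfold incFun at h'; linarith)).ne' h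
      · exact absurd rfl hne)
    (fun y hy _ _ => body_subset_nbhd hy)

lemma mem_totalData : y ∈ totalData.carrier ↔ y ∈ body :=
  (FaceData.mem_ofFaces ..).trans (and_iff_left (mem_univ y))

/-- The domain of the first Y-product. -/
def coneData : FaceData (Unit ⊕ Unit) Unit :=
  FaceData.ofFaces (U := nbhd) (C := {y | 0 ≤ cone 1 y.1} ∩ {y | 0 ≤ cone (-1) y.1})
    (f := Sum.elim (Sum.elim (fun _ y => cone 1 y.1) fun _ y => cone (-1) y.1) fun _ => outFun)
    (emb := Sum.elim (Sum.elim (fun _ => (sideSlab 1 sigma_one).belt)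
      fun _ => (sideSlab (-1) sigma_neg_one).belt) fun _ => beltSlab.belt)
    isOpen_nbhd
    (by rintro ((_ | _) | _); exacts [isFace_mid _ _, isFace_mid _ _, isFace_out])
    (by
      rintro ((_ | _) | _) y -
      exacts [(continuous_coneFun _).continuousAt, (continuous_coneFun _).continuousAt,
        continuous_outFun.continuousAt])
    ((isClosed_le continuous_const (continuous_coneFun 1)).inter
      (isClosed_le continuous_const (continuous_coneFun (-1))))
    (by
      intro y
      have he := eps_pos
      rw [mem_body_iff]
      simp only [Sum.forall, Sum.elim_inl, Sum.elim_inr]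
      constructor
      · rintro ⟨h1, h2, ⟨h3, h4⟩, h5⟩
        have h3 := h3 ()
        have h4 := h4 ()
        -- Away from the ellipses the bounds `lev σ ≤ 5 + eps` hold by themselves, so they
        -- contribute no faces.
        have e1 := lev_le_five sigma_one h1 h2 h3
        have e2 := lev_le_five sigma_neg_one h1 h2 h4
        exact ⟨⟨h1, h2, by unfold incFun; linarith, by unfold incFun; linarith, h5 ()⟩, h3, h4⟩
      · rintro ⟨⟨h1, h2, -, -, h5⟩, h3, h4⟩
        exact ⟨h1, h2, ⟨fun _ => h3, fun _ => h4⟩, fun _ => h5⟩)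
    (by
      rintro y hy ((_ | _) | _) ((_ | _) | _) h hne <;> simp only [Sum.elim_inl, Sum.elim_inr] at h ⊢
      · exact absurd rfl hne
      · exact cone_neg_pos sigma_one h.le
      · exact outFun_pos_of_cone sigma_one h.le
      · have := cone_neg_pos sigma_neg_one h.le
        rwa [neg_neg] at this
      · exact absurd rfl hne
      · exact outFun_pos_of_cone sigma_neg_one h.le
      · by_contra! h'
        exact (outFun_pos_of_cone sigma_one h').ne' h
      · by_contra! h'
        exact (outFun_pos_of_cone sigma_neg_one h').ne' h
      · exact absurd rfl hne)
    (fun y hy _ _ => body_subset_nbhd hy)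

lemma mem_coneData : y ∈ coneData.carrier ↔ y ∈ body ∧ 0 ≤ cone 1 y.1 ∧ 0 ≤ cone (-1) y.1 :=
  FaceData.mem_ofFaces ..

/-- The domain of the second Y-product. -/
def waistData : FaceData (Unit ⊕ Unit) Unit :=
  FaceData.ofFaces (U := nbhd) (C := {y | 0 ≤ waistFun y})
    (f := Sum.elim (Sum.elim (fun _ => incFun 1) fun _ => incFun (-1)) fun _ => waistFun)
    (emb := Sum.elim (Sum.elim (fun _ => (sideSlab 1 sigma_one).start)
      fun _ => (sideSlab (-1) sigma_neg_one).start) fun _ => beltSlab.start)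
    isOpen_nbhd
    (by rintro ((_ | _) | _); exacts [isFace_inc _ _, isFace_inc _ _, isFace_waist])
    (by
      rintro ((_ | _) | _) y -
      exacts [(continuous_incFun _).continuousAt, (continuous_incFun _).continuousAt,
        continuous_waistFun.continuousAt])
    (isClosed_le continuous_const continuous_waistFun)
    (by
      intro y
      have he := eps_pos
      rw [mem_body_iff]
      simp only [Sum.forall, Sum.elim_inl, Sum.elim_inr]
      constructor
      · rintro ⟨h1, h2, ⟨h3, h4⟩, h5⟩
        have h5 := h5 ()
        -- Above height `2` the condition `‖z‖ ≤ 1` follows from the wall condition.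
        refine ⟨⟨h1, h2, h3 (), h4 (), outFun_nonneg_iff.2
          (norm_sq_le_one_of_two_le h1 h2 ?_)⟩, h5⟩
        unfold waistFun at h5
        linarith
      · rintro ⟨⟨h1, h2, h3, h4, -⟩, h5⟩
        exact ⟨h1, h2, ⟨fun _ => h3, fun _ => h4⟩, fun _ => h5⟩)
    (by
      have he := eps_pos
      have he' := eps_le
      rintro y hy ((_ | _) | _) ((_ | _) | _) h hne <;> simp only [Sum.elim_inl, Sum.elim_inr] at h ⊢
      · exact absurd rfl hne
      · exact incFun_neg_pos hy (Or.inl (by unfold incFun at h; linarith))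
      · by_contra! h'
        exact (incFun_pos_of_waist sigma_one hy h').ne' h
      · have := incFun_neg_pos (σ := -1) hy (Or.inl (by unfold incFun at h; linarith))
        rwa [neg_neg] at this
      · exact absurd rfl hne
      · by_contra! h'
        exact (incFun_pos_of_waist sigma_neg_one hy h').ne' h
      · exact incFun_pos_of_waist sigma_one hy h.le
      · exact incFun_pos_of_waist sigma_neg_one hy h.le
      · exact absurd rfl hne)
    (fun y hy _ _ => body_subset_nbhd hy)

lemma mem_waistData : y ∈ waistData.carrier ↔ y ∈ body ∧ 0 ≤ waistFun y :=
  FaceData.mem_ofFaces ..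

/-- The domain of the handle cobordism at an incoming face. -/
def sideData (σ : ℝ) (hσ : σ = 1 ∨ σ = -1) : FaceData Unit Unit :=
  FaceData.ofFaces (U := nbhd) (C := {y | cone σ y.1 ≤ 0})
    (f := Sum.elim (fun _ => incFun σ) fun _ y => -cone σ y.1)
    (emb := Sum.elim (fun _ => (sideSlab σ hσ).start) fun _ => (sideSlab σ hσ).belt)
    isOpen_nbhd
    (by rintro (_ | _); exacts [isFace_inc _ _, (isFace_mid _ _).neg])
    (by
      rintro (_ | _) y -
      exacts [(continuous_incFun _).continuousAt, (continuous_coneFun _).neg.continuousAt])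
    (isClosed_le (continuous_coneFun σ) continuous_const)
    (by
      intro y
      have he := eps_pos
      simp only [Sum.forall, Sum.elim_inl, Sum.elim_inr]
      constructor
      · rintro ⟨h1, h2, h3, h4⟩
        have h3 := h3 ()
        have h4 : cone σ y.1 ≤ 0 := by linarith [h4 ()]
        obtain ⟨h5, -, h6⟩ := cone_nonpos hσ h4
        have h7 := (nbhd_nonneg h1 h2).1
        -- Over the ellipse of `σ` the product `σ * z.im` is negative, so the bound at the other
        -- incoming end is automatic.
        have h8 : lev (-σ) y.1 ‖y.2‖ ≤ 9 / 2 := by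
          unfold lev
          nlinarith [norm_nonneg y.2]
        refine ⟨?_, h4⟩
        unfold incFun at h3
        have h9 : ‖y.1‖ ≤ 1 := (norm_le_one_iff _).2 h6.le
        rcases hσ with rfl | rfl
        · exact ⟨h2, by linarith, by linarith, h9⟩
        · rw [neg_neg] at h8
          exact ⟨h2, by linarith, by linarith, h9⟩
      · rintro ⟨h1, h2⟩
        have h2 : cone σ y.1 ≤ 0 := h2
        have := lev_le_of_mem_body h1 hσ
        exact ⟨body_subset_nbhd h1, h1.1, fun _ => by unfold incFun; linarith,
          fun _ => by linarith⟩)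
    (by
      have he := eps_pos
      rintro y hy (_ | _) (_ | _) h hne <;> simp only [Sum.elim_inl, Sum.elim_inr] at h ⊢
      · exact absurd rfl hne
      · have := cone_neg_of_inc hσ hy (by unfold incFun at h; linarith)
        linarith
      · have := lev_le_five hσ (body_subset_nbhd hy) hy.1 (by linarith)
        unfold incFun
        linarith
      · exact absurd rfl hne)
    (fun y hy _ _ => body_subset_nbhd hy)

lemma mem_sideData (hσ : σ = 1 ∨ σ = -1) :
    y ∈ (sideData σ hσ).carrier ↔ y ∈ body ∧ cone σ y.1 ≤ 0 :=
  FaceData.mem_ofFaces ..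

/-- The domain of the handle cobordism at the outgoing face. -/
def beltData : FaceData Unit Unit :=
  FaceData.ofFaces (U := nbhd) (C := {y | waistFun y ≤ 0})
    (f := Sum.elim (fun _ y => -waistFun y) fun _ => outFun)
    (emb := Sum.elim (fun _ => beltSlab.start) fun _ => beltSlab.belt)
    isOpen_nbhd
    (by rintro (_ | _); exacts [isFace_waist.neg, isFace_out])
    (by
      rintro (_ | _) y -
      exacts [continuous_waistFun.neg.continuousAt, continuous_outFun.continuousAt])
    (isClosed_le continuous_waistFun continuous_const)
    (by
      intro y
      have he := eps_pos
      have he' := eps_le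
      simp only [Sum.forall, Sum.elim_inl, Sum.elim_inr]
      constructor
      · rintro ⟨h1, h2, h3, h4⟩
        have h3 : waistFun y ≤ 0 := by linarith [h3 ()]
        have h4 := outFun_nonneg_iff.1 (h4 ())
        -- Below height `2 + eps` both levels are at most `1 + 3 / 2 * (2 + eps) < 5`, so the
        -- incoming faces are not reached.
        have h5 := lev_le_of_norm_le sigma_one (y := y) h4
        have h6 := lev_le_of_norm_le sigma_neg_one (y := y) h4
        have h7 := h3
        unfold waistFun at h7
        exact ⟨⟨h2, by linarith, by linarith, h4⟩, h3⟩
      · rintro ⟨h1, h2⟩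
        have h2 : waistFun y ≤ 0 := h2
        exact ⟨body_subset_nbhd h1, h1.1, fun _ => by linarith,
          fun _ => outFun_nonneg_iff.2 h1.2.2.2⟩)
    (by
      have he := eps_pos
      rintro y hy (_ | _) (_ | _) h hne <;> simp only [Sum.elim_inl, Sum.elim_inr] at h ⊢
      · exact absurd rfl hne
      · exact outFun_pos_of_two_lt hy (by unfold waistFun at h; linarith)
      · by_contra! h'
        exact (outFun_pos_of_two_lt hy (by unfold waistFun at h'; linarith)).ne' h
      · exact absurd rfl hne)
    (fun y hy _ _ => body_subset_nbhd hy)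

lemma mem_beltData : y ∈ beltData.carrier ↔ y ∈ body ∧ waistFun y ≤ 0 :=
  FaceData.mem_ofFaces ..

open Classical in
/-- The function of an outgoing face of the disjoint union of the two handle cobordisms. -/
def sideOutFun (σ : ℝ) (y : ℂ × ℂ) : ℝ := if σ * y.1.im < 0 then -cone σ y.1 else 1

lemma sideOutFun_eventually (h : σ * y.1.im < 0) :
    sideOutFun σ =ᶠ[𝓝 y] fun y => -cone σ y.1 := by
  have hc : Continuous fun y : ℂ × ℂ => σ * y.1.im := by fun_prop
  filter_upwards [hc.continuousAt.eventually (gt_mem_nhds h)] with x hx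
  exact if_pos hx

lemma continuousAt_sideOutFun (hσ : σ = 1 ∨ σ = -1) (h : y.1.im ≠ 0) :
    ContinuousAt (sideOutFun σ) y := by
  have h0 : σ * y.1.im ≠ 0 := mul_ne_zero (by rcases hσ with rfl | rfl <;> norm_num) h
  rcases lt_or_gt_of_ne h0 with h1 | h1
  · exact (continuous_coneFun σ).neg.continuousAt.congr (sideOutFun_eventually h1).symm
  · refine (continuousAt_const (y := (1 : ℝ))).congr (EventuallyEq.symm ?_)
    have hc : Continuous fun y : ℂ × ℂ => σ * y.1.im := by fun_prop
    filter_upwards [hc.continuousAt.eventually (lt_mem_nhds h1)] with x hx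
    exact if_neg (not_lt.2 (le_of_lt hx))

lemma sideOutFun_eq_zero (hσ : σ = 1 ∨ σ = -1) : sideOutFun σ y = 0 ↔ cone σ y.1 = 0 := by
  unfold sideOutFun
  split_ifs with h
  · exact neg_eq_zero
  · refine ⟨fun h' => absurd h' one_ne_zero, fun h' => absurd ?_ h⟩
    have := (cone_nonpos hσ h'.le).1
    linarith

lemma isFace_sideOut (σ : ℝ) (hσ : σ = 1 ∨ σ = -1) :
    IsFace (sideOutFun σ) (sideSlab σ hσ).belt := by
  refine (isFace_mid σ hσ).neg.congr (fun y _ => ?_) fun y _ h => sideOutFun_eventually ?_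
  · rw [sideOutFun_eq_zero hσ, neg_eq_zero]
  · have := (cone_nonpos hσ (neg_eq_zero.1 h).le).1
    linarith

lemma sideOutFun_of_nonneg (h : 0 ≤ σ * y.1.im) : sideOutFun σ y = 1 := if_neg (not_lt.2 h)

lemma sideOutFun_of_neg (h : σ * y.1.im < 0) : sideOutFun σ y = -cone σ y.1 := if_pos h

/-- The domain of the disjoint union of the two handle cobordisms at the incoming faces. -/
def sidesData : FaceData (Unit ⊕ Unit) (Unit ⊕ Unit) :=
  -- The ellipses lie in opposite open half-planes. Without the real axis the piecewise defined
  -- `sideOutFun` is continuous, and in the half-plane of the other ellipse its value `1` imposes no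
  -- condition.
  FaceData.ofFaces (U := nbhd ∩ {y | y.1.im ≠ 0})
    (C := {y | cone 1 y.1 ≤ 0} ∪ {y | cone (-1) y.1 ≤ 0})
    (f := Sum.elim (Sum.elim (fun _ => incFun 1) fun _ => incFun (-1))
      (Sum.elim (fun _ => sideOutFun 1) fun _ => sideOutFun (-1)))
    (emb := Sum.elim (Sum.elim (fun _ => (sideSlab 1 sigma_one).start)
      fun _ => (sideSlab (-1) sigma_neg_one).start)
      (Sum.elim (fun _ => (sideSlab 1 sigma_one).belt)
      fun _ => (sideSlab (-1) sigma_neg_one).belt))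
    (isOpen_nbhd.inter (isOpen_ne_fun (by fun_prop) continuous_const))
    (by
      rintro ((_ | _) | (_ | _))
      exacts [isFace_inc _ _, isFace_inc _ _, isFace_sideOut _ _, isFace_sideOut _ _])
    (by
      rintro ((_ | _) | (_ | _)) y ⟨-, hy⟩
      exacts [(continuous_incFun _).continuousAt, (continuous_incFun _).continuousAt,
        continuousAt_sideOutFun sigma_one hy, continuousAt_sideOutFun sigma_neg_one hy])
    ((isClosed_le (continuous_coneFun 1) continuous_const).union
      (isClosed_le (continuous_coneFun (-1)) continuous_const))
    (by
      intro y
      have he := eps_pos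
      simp only [Sum.forall, Sum.elim_inl, Sum.elim_inr]
      constructor
      · rintro ⟨⟨h1, h1'⟩, h2, ⟨h3, h4⟩, h5, h6⟩
        have h1' : y.1.im ≠ 0 := h1'
        have h5 := h5 ()
        have h6 := h6 ()
        rw [mem_body_iff]
        rcases lt_or_gt_of_ne h1' with h7 | h7
        · rw [sideOutFun_of_neg (by linarith)] at h5
          have h8 : cone 1 y.1 ≤ 0 := by linarith
          exact ⟨⟨h1, h2, h3 (), h4 (), (outFun_pos_of_cone sigma_one h8).le⟩, Or.inl h8⟩
        · rw [sideOutFun_of_neg (by linarith)] at h6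
          have h8 : cone (-1) y.1 ≤ 0 := by linarith
          exact ⟨⟨h1, h2, h3 (), h4 (), (outFun_pos_of_cone sigma_neg_one h8).le⟩, Or.inr h8⟩
      · rintro ⟨h1, h2⟩
        have h3 := h1
        rw [mem_body_iff] at h3
        obtain ⟨h3, h4, h5, h6, -⟩ := h3
        rcases h2 with h2 | h2
        · have h2 : cone 1 y.1 ≤ 0 := h2
          have h7 := (cone_nonpos sigma_one h2).1
          have h8 : y.1.im ≠ 0 := by intro h; rw [h] at h7; linarith
          refine ⟨⟨h3, h8⟩, h4, ⟨fun _ => h5, fun _ => h6⟩, fun _ => ?_, fun _ => ?_⟩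
          · rw [sideOutFun_of_neg (by linarith)]; linarith
          · rw [sideOutFun_of_nonneg (by linarith)]; exact zero_le_one
        · have h2 : cone (-1) y.1 ≤ 0 := h2
          have h7 := (cone_nonpos sigma_neg_one h2).1
          have h8 : y.1.im ≠ 0 := by intro h; rw [h] at h7; linarith
          refine ⟨⟨h3, h8⟩, h4, ⟨fun _ => h5, fun _ => h6⟩, fun _ => ?_, fun _ => ?_⟩
          · rw [sideOutFun_of_nonneg (by linarith)]; exact zero_le_one
          · rw [sideOutFun_of_neg (by linarith)]; linarith)
    (by
      have he := eps_pos
      have inc_out : ∀ σ : ℝ, (σ = 1 ∨ σ = -1) → ∀ y ∈ body, incFun σ y = 0 →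
          0 < incFun (-σ) y ∧ 0 < sideOutFun σ y ∧ 0 < sideOutFun (-σ) y := by
        intro σ hσ y hy h
        have h1 : lev σ y.1 ‖y.2‖ = 5 + eps := by unfold incFun at h; linarith
        have h2 := cone_neg_of_inc hσ hy (by linarith)
        have h3 := (cone_nonpos hσ h2.le).1
        refine ⟨incFun_neg_pos hy (Or.inl (by linarith)), ?_, ?_⟩
        · rw [sideOutFun_of_neg (by linarith)]; linarith
        · rw [sideOutFun_of_nonneg (by linarith)]; exact one_pos
      have out_inc : ∀ σ : ℝ, (σ = 1 ∨ σ = -1) → ∀ y ∈ body, sideOutFun σ y = 0 →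
          0 < incFun σ y ∧ 0 < incFun (-σ) y ∧ 0 < sideOutFun (-σ) y := by
        intro σ hσ y hy h
        rw [sideOutFun_eq_zero hσ] at h
        have h3 := (cone_nonpos hσ h.le).1
        have h4 := lev_le_five hσ (body_subset_nbhd hy) hy.1 h.ge
        refine ⟨by unfold incFun; linarith, incFun_neg_pos hy (Or.inr (by linarith)), ?_⟩
        rw [sideOutFun_of_nonneg (by linarith)]; exact one_pos
      rintro y hy ((_ | _) | (_ | _)) ((_ | _) | (_ | _)) h hne <;>
        simp only [Sum.elim_inl, Sum.elim_inr] at h ⊢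
      · exact absurd rfl hne
      · exact (inc_out 1 sigma_one y hy h).1
      · exact (inc_out 1 sigma_one y hy h).2.1
      · exact (inc_out 1 sigma_one y hy h).2.2
      · simpa using (inc_out (-1) sigma_neg_one y hy h).1
      · exact absurd rfl hne
      · simpa using (inc_out (-1) sigma_neg_one y hy h).2.2
      · exact (inc_out (-1) sigma_neg_one y hy h).2.1
      · exact (out_inc 1 sigma_one y hy h).1
      · exact (out_inc 1 sigma_one y hy h).2.1
      · exact absurd rfl hne
      · exact (out_inc 1 sigma_one y hy h).2.2
      · simpa using (out_inc (-1) sigma_neg_one y hy h).2.1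
      · exact (out_inc (-1) sigma_neg_one y hy h).1
      · simpa using (out_inc (-1) sigma_neg_one y hy h).2.2
      · exact absurd rfl hne)
    (by
      have he := eps_pos
      have key : ∀ σ : ℝ, (σ = 1 ∨ σ = -1) → ∀ y ∈ body, cone σ y.1 ≤ 0 →
          y ∈ nbhd ∩ {y : ℂ × ℂ | y.1.im ≠ 0} := by
        intro σ hσ y hy h
        have h3 := (cone_nonpos hσ h).1
        refine ⟨body_subset_nbhd hy, fun h0 => ?_⟩
        have h0 : y.1.im = 0 := h0
        rw [h0] at h3
        linarith
      rintro y hy ((_ | _) | (_ | _)) h <;> simp only [Sum.elim_inl, Sum.elim_inr] at h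
      · exact key 1 sigma_one y hy (cone_neg_of_inc sigma_one hy (by unfold incFun at h; linarith)).le
      · exact key (-1) sigma_neg_one y hy
          (cone_neg_of_inc sigma_neg_one hy (by unfold incFun at h; linarith)).le
      · exact key 1 sigma_one y hy ((sideOutFun_eq_zero sigma_one).1 h).le
      · exact key (-1) sigma_neg_one y hy ((sideOutFun_eq_zero sigma_neg_one).1 h).le)

lemma mem_sidesData :
    y ∈ sidesData.carrier ↔ y ∈ body ∧ (cone 1 y.1 ≤ 0 ∨ cone (-1) y.1 ≤ 0) :=
  FaceData.mem_ofFaces ..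

end Domains

/-! ### Gluing the domains, and the handle cobordisms. -/

section Gluing

namespace FaceData

variable {ι κ ρ ι' κ' : Type} [Finite ι] [Finite κ] [Finite ρ] [Finite ι'] [Finite κ']

/-- All domains lie in the same `ℂ²`, so the gluing maps are inclusions. It remains to see that the
pieces cover and meet in a common face with a common parametrization. -/
lemma isComposite {B : FaceData κ ρ} {A : FaceData ι κ} {W : FaceData ι ρ}
    (hA : A.carrier ⊆ W.carrier) (hB : B.carrier ⊆ W.carrier)
    (hcov : W.carrier ⊆ A.carrier ∪ B.carrier)
    (hint : ∀ y ∈ A.carrier, y ∈ B.carrier → ∃ k, A.f (Sum.inr k) y = 0)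
    (hmid : ∀ k, A.emb (Sum.inr k) = B.emb (Sum.inl k))
    (hinc : ∀ i, W.emb (Sum.inl i) = A.emb (Sum.inl i))
    (hout : ∀ k, W.emb (Sum.inr k) = B.emb (Sum.inr k)) :
    IsComposite B.relCob A.relCob W.relCob := by
  refine ⟨Set.inclusion hA, Set.inclusion hB, A.isSmoothEmb_inclusion hA, B.isSmoothEmb_inclusion hB,
    ?_, ?_, ?_, ?_⟩
  · refine eq_univ_of_forall ?_
    rintro ⟨y, hy⟩
    rcases hcov hy with h | h
    · exact Or.inl ⟨⟨y, h⟩, rfl⟩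
    · exact Or.inr ⟨⟨y, h⟩, rfl⟩
  · rintro ⟨a, ha⟩ ⟨b, hb⟩
    constructor
    · intro h
      have h' : a = b := congrArg Subtype.val h
      obtain ⟨k, hk⟩ := hint a ha (by rw [h']; exact hb)
      obtain ⟨x, hx, hxa⟩ := A.emb_surj a ha.1 ha.2.1 ha.2.2 _ hk
      refine ⟨(k, ⟨x, hx⟩), Subtype.ext hxa, Subtype.ext ?_⟩
      change B.emb (Sum.inl k) x = b
      rw [← hmid, hxa, h']
    · rintro ⟨⟨k, x⟩, h1, h2⟩
      refine Subtype.ext ?_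
      have h1 : A.emb (Sum.inr k) x = a := congrArg Subtype.val h1
      have h2 : B.emb (Sum.inl k) x = b := congrArg Subtype.val h2
      change a = b
      rw [← h1, ← h2, hmid]
  · rintro ⟨i, x⟩
    refine Subtype.ext ?_
    change W.emb (Sum.inl i) x = A.emb (Sum.inl i) x
    rw [hinc]
  · rintro ⟨k, x⟩
    refine Subtype.ext ?_
    change W.emb (Sum.inr k) x = B.emb (Sum.inr k) x
    rw [hout]

lemma isDisjointUnion {A : FaceData ι κ} {B : FaceData ι' κ'} {W : FaceData (ι ⊕ ι') (κ ⊕ κ')}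
    (hA : A.carrier ⊆ W.carrier) (hB : B.carrier ⊆ W.carrier)
    (hcov : W.carrier ⊆ A.carrier ∪ B.carrier) (hdisj : ∀ y ∈ A.carrier, y ∉ B.carrier)
    (h1 : ∀ i, W.emb (Sum.inl (Sum.inl i)) = A.emb (Sum.inl i))
    (h2 : ∀ i, W.emb (Sum.inl (Sum.inr i)) = B.emb (Sum.inl i))
    (h3 : ∀ i, W.emb (Sum.inr (Sum.inl i)) = A.emb (Sum.inr i))
    (h4 : ∀ i, W.emb (Sum.inr (Sum.inr i)) = B.emb (Sum.inr i)) :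
    IsDisjointUnion A.relCob B.relCob W.relCob := by
  refine ⟨Set.inclusion hA, Set.inclusion hB, A.isSmoothEmb_inclusion hA, B.isSmoothEmb_inclusion hB,
    ?_, ?_, fun i x => Subtype.ext ?_, fun i x => Subtype.ext ?_, fun i x => Subtype.ext ?_,
    fun i x => Subtype.ext ?_⟩
  · refine eq_univ_of_forall ?_
    rintro ⟨y, hy⟩
    rcases hcov hy with h | h
    · exact Or.inl ⟨⟨y, h⟩, rfl⟩
    · exact Or.inr ⟨⟨y, h⟩, rfl⟩
  · rintro ⟨a, ha⟩ ⟨b, hb⟩ h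
    have h' : a = b := congrArg Subtype.val h
    exact hdisj a ha (by rw [h']; exact hb)
  · exact congrFun (h1 i) x
  · exact congrFun (h2 i) x
  · exact congrFun (h3 i) x
  · exact congrFun (h4 i) x

end FaceData

lemma isCompact_handle : IsCompact handle := by
  have : handle = Metric.closedBall (0 : ℂ) 1 ×ˢ Metric.closedBall (0 : ℂ) 1 := by
    ext p
    rw [mem_prod, mem_closedBall_zero_iff, mem_closedBall_zero_iff]
    rfl
  rw [this]
  exact (isCompact_closedBall _ _).prod (isCompact_closedBall _ _)

/-- A domain formed by a slab and the cone under its last section is a handle cobordism. -/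
theorem Slab.isHandleCobordism (S : Slab) (D : FaceData Unit Unit)
    (hcar : ∀ y, y ∈ D.carrier ↔
      (∃ v t, ‖v‖ ≤ 1 ∧ t ∈ Icc (0 : ℝ) 1 ∧ S.Z (v, t) = y.1 ∧ S.Q (v, t) = ‖y.2‖) ∨
      (∃ v, ‖v‖ ≤ 1 ∧ S.Z (v, 1) = y.1 ∧ ‖y.2‖ ≤ S.Q (v, 1)))
    (hinc : D.emb (Sum.inl ()) = S.start) (hout : D.emb (Sum.inr ()) = S.belt) :
    IsHandleCobordism beltPhiBar D.relCob := by
  have hC : ∀ c ∈ solidTorus ×ˢ Icc (0 : ℝ) 1, S.cyl c ∈ D.carrier := by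
    rintro ⟨⟨u, v⟩, t⟩ ⟨⟨hu, hv⟩, ht⟩
    have hv' := norm_twist_le ht hv
    exact (hcar _).2 (Or.inl ⟨_, t, hv', ht, rfl, (norm_smul_unit (S.Q_pos _ t hv' ht) hu).symm⟩)
  have hH : ∀ h ∈ handle, S.hand h ∈ D.carrier := by
    rintro ⟨a, b⟩ ⟨ha, hb⟩
    have hb' := norm_twist_le one_mem_Icc hb
    have hQ := S.Q_pos _ 1 hb' one_mem_Icc
    refine (hcar _).2 (Or.inr ⟨_, hb', rfl, ?_⟩)
    change ‖S.Q (twist 1 b, 1) • a‖ ≤ _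
    rw [norm_smul, Real.norm_of_nonneg hQ.le]
    exact mul_le_of_le_one_right hQ.le ha
  refine ⟨fun c => ⟨S.cyl c, hC c c.2⟩, fun h => ⟨S.hand h, hH h h.2⟩, ?_, ?_, ?_, ?_, ?_, ?_⟩
  · rw [D.relCob_smooth]
    exact S.embOn_cyl.isSmoothEmb (isCompact_solidTorus.prod isCompact_Icc) fun _ => rfl
  · rw [D.relCob_smooth]
    exact S.embOn_hand.isSmoothEmb isCompact_handle fun _ => rfl
  · refine eq_univ_of_forall ?_
    rintro ⟨⟨z, w⟩, hy⟩
    rcases (hcar _).1 hy with ⟨v, t, hv, ht, hZ, hQ⟩ | ⟨v, hv, hZ, hQ⟩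
    · left
      have hQ0 := S.Q_pos v t hv ht
      obtain ⟨b, hb, hbv⟩ := twist_surj ht hv
      dsimp only at hZ hQ
      refine ⟨⟨(((1 / ‖w‖) • w, b), t), ⟨?_, hb⟩, ht⟩, Subtype.ext ?_⟩
      · change ‖(1 / ‖w‖) • w‖ = 1
        rw [norm_smul, norm_div, norm_one, norm_norm, one_div, inv_mul_cancel₀ (by linarith)]
      · change (S.Z (twist t b, t), S.Q (twist t b, t) • (1 / ‖w‖) • w) = (z, w)
        rw [hbv, hZ, hQ, smul_smul, mul_one_div_cancel (by linarith), one_smul]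
    · right
      have hQ0 := S.Q_pos v 1 hv one_mem_Icc
      obtain ⟨b, hb, hbv⟩ := twist_surj one_mem_Icc hv
      dsimp only at hZ hQ
      refine ⟨⟨((1 / S.Q (v, 1)) • w, b), ?_, hb⟩, Subtype.ext ?_⟩
      · change ‖(1 / S.Q (v, 1)) • w‖ ≤ 1
        rw [norm_smul, Real.norm_of_nonneg (by positivity), one_div, inv_mul_le_iff₀ hQ0, mul_one]
        exact hQ
      · change (S.Z (twist 1 b, 1), S.Q (twist 1 b, 1) • (1 / S.Q (v, 1)) • w) = (z, w)
        rw [hbv, hZ, smul_smul, mul_one_div_cancel hQ0.ne', one_smul]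
  · rintro ⟨⟨⟨u, v⟩, t⟩, ⟨hu, hv⟩, ht⟩ ⟨⟨a, b⟩, ha, hb⟩
    have hu : ‖u‖ = 1 := hu
    have hv : ‖v‖ ≤ 1 := hv
    have ha : ‖a‖ ≤ 1 := ha
    have hb : ‖b‖ ≤ 1 := hb
    have hv' := norm_twist_le ht hv
    have hb' := norm_twist_le one_mem_Icc hb
    have hQ0 := S.Q_pos _ t hv' ht
    have hQ1 := S.Q_pos _ 1 hb' one_mem_Icc
    constructor
    · intro h
      have h' : (S.Z (twist t v, t), S.Q (twist t v, t) • u) =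
        (S.Z (twist 1 b, 1), S.Q (twist 1 b, 1) • a) := congrArg Subtype.val h
      have hZ : S.Z (twist t v, t) = S.Z (twist 1 b, 1) := congrArg Prod.fst h'
      have hw : S.Q (twist t v, t) • u = S.Q (twist 1 b, 1) • a := congrArg Prod.snd h'
      -- A point of the cylinder over `z` is not below the last section, and a point of the handle
      -- is not above it. A common point therefore lies on that section, with `|a| = 1` and `t = 1`.
      have hle := S.P_le _ t hv' ht
      rw [hZ, S.P_eq _ hb'] at hle
      have hn := congrArg norm hw
      rw [norm_smul_unit hQ0 hu, norm_smul, Real.norm_of_nonneg hQ1.le] at hn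
      have hQQ : S.Q (twist t v, t) = S.Q (twist 1 b, 1) :=
        le_antisymm (hn.trans_le (mul_le_of_le_one_right hQ1.le ha)) hle
      obtain ⟨h1, rfl⟩ := S.injOn_section hv' hb' ht one_mem_Icc hZ hQQ
      have h2 := twist_inj one_mem_Icc hv hb h1
      rw [hQQ] at hw
      exact ⟨rfl, Prod.ext (smul_right_injective ℂ hQ1.ne' hw) h2⟩
    · rintro ⟨h1, h2⟩
      have h1 : t = 1 := h1
      have h2 : (u, v) = (a, b) := h2
      obtain ⟨rfl, rfl⟩ := Prod.mk.inj h2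
      subst h1
      rfl
  · intro x
    refine Subtype.ext ?_
    change D.emb (Sum.inl ()) x = _
    rw [hinc]
    rfl
  · intro x
    refine Subtype.ext ?_
    change D.emb (Sum.inr ()) x = _
    rw [hout]
    rfl

/-- The domain is split at `lev σ = 5`. The part above is the slab, and the part below consists of
the `w`-discs under its last section, which form the handle. -/
lemma isHandleCobordism_sideData (σ : ℝ) (hσ : σ = 1 ∨ σ = -1) :
    IsHandleCobordism beltPhiBar (sideData σ hσ).relCob := by
  have he := eps_pos
  refine (sideSlab σ hσ).isHandleCobordism _ (fun y => ?_) rfl rfl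
  change _ ↔ (∃ v t, ‖v‖ ≤ 1 ∧ t ∈ Icc (0 : ℝ) 1 ∧ sideZ σ (v, t) = y.1 ∧ sideQ σ (v, t) = ‖y.2‖) ∨
      (∃ v, ‖v‖ ≤ 1 ∧ sideZ σ (v, 1) = y.1 ∧ ‖y.2‖ ≤ sideQ σ (v, 1))
  rw [mem_sideData]
  constructor
  · rintro ⟨hy, hc⟩
    rcases le_total 5 (lev σ y.1 ‖y.2‖) with h | h
    · left
      have hq := two_lt_of_five_le hσ hy h
      obtain ⟨v, t, hv, ht, -, h1, h2⟩ := exists_side hσ (by linarith) h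
        (lev_le_of_mem_body hy hσ) hy.1
      exact ⟨v, t, hv, ht, h1, h2⟩
    · right
      obtain ⟨v, hv, hZ, -⟩ := exists_side_of_cone hσ hc
      obtain ⟨hm, hQ⟩ := sideZ_one_mul hσ hv
      refine ⟨v, hv, hZ, ?_⟩
      rw [hZ] at hm hQ
      rw [← hQ, le_div_iff₀ hm]
      unfold lev at h
      linarith
  · rintro (⟨v, t, hv, ht, hZ, hQ⟩ | ⟨v, hv, hZ, hQ⟩)
    · have hb := side_mem_body hσ hv ht hQ.symm
      rw [hZ] at hb
      refine ⟨hb, ?_⟩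
      have hl := (lev_sideZ hσ (v := v) (t := t) (by linarith [(sideQ_bounds hσ hv ht).1])).1
      have hL := (sideLevel_bounds ht).1
      rw [hZ, hQ] at hl
      rcases hL.eq_or_lt with h | h
      · have : t = 1 := by
          unfold sideLevel at h
          have : (1 - t) * eps = 0 := by linarith
          linarith [(mul_eq_zero.1 this).resolve_right he.ne']
        rw [this] at hZ
        rw [← hZ]
        exact (cone_sideZ hσ hv).1
      · exact (cone_neg_of_inc hσ hb (by rw [hl]; exact h)).le
    · have hQ0 : 0 < sideQ σ (v, 1) := by linarith [(sideQ_bounds hσ hv one_mem_Icc).1]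
      have hn : ‖((sideQ σ (v, 1) : ℝ) : ℂ)‖ = sideQ σ (v, 1) := by
        rw [Complex.norm_real, Real.norm_of_nonneg hQ0.le]
      have hb := (body_down (side_mem_body hσ hv one_mem_Icc hn) (hQ.trans hn.ge)).1
      rw [hZ] at hb
      refine ⟨hb, ?_⟩
      rw [← hZ]
      exact (cone_sideZ hσ hv).1

/-- The same splitting at height `2`, with the whole bidisc `|z| ≤ 1`, `|w| ≤ 2` as the handle. -/
lemma isHandleCobordism_beltData : IsHandleCobordism beltPhiBar beltData.relCob := by
  refine beltSlab.isHandleCobordism _ (fun y => ?_) rfl rfl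
  change _ ↔ (∃ v t, ‖v‖ ≤ 1 ∧ t ∈ Icc (0 : ℝ) 1 ∧ beltZ (v, t) = y.1 ∧ beltHeight t = ‖y.2‖) ∨
      (∃ v, ‖v‖ ≤ 1 ∧ beltZ (v, 1) = y.1 ∧ ‖y.2‖ ≤ beltHeight 1)
  have h1 : beltHeight 1 = 2 := by unfold beltHeight; ring
  rw [mem_beltData]
  unfold waistFun
  constructor
  · rintro ⟨hy, hc⟩
    rcases le_total 2 ‖y.2‖ with h | h
    · left
      exact exists_belt h (by linarith) hy.1
    · right
      refine ⟨conj y.1, ?_, ?_, ?_⟩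
      · rw [RCLike.norm_conj]; exact hy.2.2.2
      · rw [beltZ_one, Complex.conj_conj]
      · rw [h1]; exact h
  · rintro (⟨v, t, hv, ht, hZ, hQ⟩ | ⟨v, hv, hZ, hQ⟩)
    · have hb := belt_mem_body hv ht hQ.symm
      rw [hZ] at hb
      refine ⟨hb, ?_⟩
      linarith [(beltHeight_bounds ht).2]
    · have hn : ‖(2 : ℂ)‖ = beltHeight 1 := by rw [h1]; norm_num
      have hb := (body_down (belt_mem_body hv one_mem_Icc hn) (hQ.trans hn.ge)).1
      rw [hZ] at hb
      refine ⟨hb, ?_⟩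
      have := eps_pos
      linarith

lemma isDisjointUnion_sidesData : IsDisjointUnion (sideData 1 sigma_one).relCob
    (sideData (-1) sigma_neg_one).relCob sidesData.relCob := by
  refine FaceData.isDisjointUnion ?_ ?_ ?_ ?_ (fun _ => rfl) (fun _ => rfl) (fun _ => rfl)
    fun _ => rfl
  · intro y hy
    rw [mem_sideData] at hy
    exact mem_sidesData.2 ⟨hy.1, Or.inl hy.2⟩
  · intro y hy
    rw [mem_sideData] at hy
    exact mem_sidesData.2 ⟨hy.1, Or.inr hy.2⟩
  · intro y hy
    rw [mem_sidesData] at hy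
    rcases hy.2 with h | h
    · exact Or.inl ((mem_sideData _).2 ⟨hy.1, h⟩)
    · exact Or.inr ((mem_sideData _).2 ⟨hy.1, h⟩)
  · intro y hy hy'
    rw [mem_sideData] at hy hy'
    have := cone_neg_pos sigma_one hy.2
    linarith [hy'.2]

/-- The cut along the boundaries of the two ellipses in the `z`-plane. Together with the cut of the
same total space along the waist, `isComposite_belt`, it carries the theorem. -/
lemma isComposite_sides : IsComposite coneData.relCob sidesData.relCob totalData.relCob := by
  refine FaceData.isComposite ?_ ?_ ?_ ?_ ?_ ?_ fun _ => rfl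
  · intro y hy
    exact mem_totalData.2 (mem_sidesData.1 hy).1
  · intro y hy
    exact mem_totalData.2 (mem_coneData.1 hy).1
  · intro y hy
    have hy := mem_totalData.1 hy
    by_cases h1 : cone 1 y.1 ≤ 0
    · exact Or.inl (mem_sidesData.2 ⟨hy, Or.inl h1⟩)
    by_cases h2 : cone (-1) y.1 ≤ 0
    · exact Or.inl (mem_sidesData.2 ⟨hy, Or.inr h2⟩)
    · exact Or.inr (mem_coneData.2 ⟨hy, by linarith, by linarith⟩)
  · intro y hy hy'
    have h := (mem_sidesData.1 hy).2
    obtain ⟨-, h1, h2⟩ := mem_coneData.1 hy'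
    rcases h with h | h
    · exact ⟨Sum.inl (), (sideOutFun_eq_zero sigma_one).2 (le_antisymm h h1)⟩
    · exact ⟨Sum.inr (), (sideOutFun_eq_zero sigma_neg_one).2 (le_antisymm h h2)⟩
  · rintro (_ | _) <;> rfl
  · rintro (_ | _) <;> rfl

lemma isComposite_belt : IsComposite beltData.relCob waistData.relCob totalData.relCob := by
  refine FaceData.isComposite ?_ ?_ ?_ ?_ (fun _ => rfl) ?_ fun _ => rfl
  · intro y hy
    exact mem_totalData.2 (mem_waistData.1 hy).1
  · intro y hy
    exact mem_totalData.2 (mem_beltData.1 hy).1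
  · intro y hy
    have hy := mem_totalData.1 hy
    rcases le_total 0 (waistFun y) with h | h
    · exact Or.inl (mem_waistData.2 ⟨hy, h⟩)
    · exact Or.inr (mem_beltData.2 ⟨hy, h⟩)
  · intro y hy hy'
    exact ⟨(), le_antisymm (mem_beltData.1 hy').2 (mem_waistData.1 hy).2⟩
  · rintro (_ | _) <;> rfl

end Gluing

/-! ### The thickened Y with disc fibres, cut into a neck and three caps. -/

section HexagonBody

/-- The product `x₀ x₁ x₂ / 5`. -/
def hexFun (x : Fin 3 → ℝ) : ℝ := x 0 * x 1 * x 2 / 5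

/-- The solid over a hexagon `0 ≤ x k ≤ b k`, `∑ x = 9`, bounded by `ξ² = hexFun x`. -/
def solid (b : Fin 3 → ℝ) : Set ((Fin 3 → ℝ) × ℝ) :=
  {p | (∀ k, 0 ≤ p.1 k ∧ p.1 k ≤ b k) ∧ p.1 0 + p.1 1 + p.1 2 = 9 ∧ p.2 ^ 2 ≤ hexFun p.1}

/-- The part of the solid where all coordinates are at least `1`. -/
def neckMap (p : ℝ × (Fin 3 → ℝ)) : (Fin 3 → ℝ) × ℝ :=
  (fun k => 1 + 4 * p.2 k, p.1 * √(hexFun fun k => 1 + 4 * p.2 k))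

/-- The part of the solid where the coordinate `x i` is at most `1`. -/
def capMap (i : Fin 3) (p : ℂ × ℝ) : (Fin 3 → ℝ) × ℝ :=
  (fun k => if k = i then 2 - 2 * p.1.im else
    if k = i + 1 then (7 + 2 * p.1.im) / 2 + p.2 * (3 - 2 * p.1.im) / 2
    else (7 + 2 * p.1.im) / 2 - p.2 * (3 - 2 * p.1.im) / 2,
    p.1.re * √(2 * (((7 + 2 * p.1.im) / 2 + p.2 * (3 - 2 * p.1.im) / 2) *
      ((7 + 2 * p.1.im) / 2 - p.2 * (3 - 2 * p.1.im) / 2)) / (5 * (1 + p.1.im))))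

/-- The segment of the unit disc above height `1/2`. -/
def segment : Set ℂ := {τ | ‖τ‖ ≤ 1 ∧ 1 / 2 ≤ τ.im}

lemma fin3_ne (i : Fin 3) : i + 1 ≠ i ∧ i + 2 ≠ i ∧ i + 2 ≠ i + 1 := by
  fin_cases i <;> decide

lemma fin3_cases (i k : Fin 3) : k = i ∨ k = i + 1 ∨ k = i + 2 := by
  fin_cases i <;> fin_cases k <;> decide

lemma fin3_sum (i : Fin 3) (x : Fin 3 → ℝ) : x 0 + x 1 + x 2 = x i + x (i + 1) + x (i + 2) := by
  fin_cases i
  · rfl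
  · change x 0 + x 1 + x 2 = x 1 + x 2 + x 0; ring
  · change x 0 + x 1 + x 2 = x 2 + x 0 + x 1; ring

lemma hexFun_eq (i : Fin 3) (x : Fin 3 → ℝ) :
    hexFun x = x i * x (i + 1) * x (i + 2) / 5 := by
  unfold hexFun
  fin_cases i
  · rfl
  · change x 0 * x 1 * x 2 / 5 = x 1 * x 2 * x 0 / 5; ring
  · change x 0 * x 1 * x 2 / 5 = x 2 * x 0 * x 1 / 5; ring

lemma capMap_self (i : Fin 3) (p : ℂ × ℝ) : (capMap i p).1 i = 2 - 2 * p.1.im := if_pos rfl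

lemma capMap_succ (i : Fin 3) (p : ℂ × ℝ) :
    (capMap i p).1 (i + 1) = (7 + 2 * p.1.im) / 2 + p.2 * (3 - 2 * p.1.im) / 2 := by
  have h := fin3_ne i
  simp only [capMap, if_neg h.1, if_true]

lemma capMap_succ_succ (i : Fin 3) (p : ℂ × ℝ) :
    (capMap i p).1 (i + 2) = (7 + 2 * p.1.im) / 2 - p.2 * (3 - 2 * p.1.im) / 2 := by
  have h := fin3_ne i
  simp only [capMap, if_neg h.2.1, if_neg h.2.2]

lemma capMap_snd (i : Fin 3) (p : ℂ × ℝ) : (capMap i p).2 =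
    p.1.re * √(2 * ((capMap i p).1 (i + 1) * (capMap i p).1 (i + 2)) / (5 * (1 + p.1.im))) := by
  rw [capMap_succ, capMap_succ_succ]
  rfl

lemma capMap_pos {i : Fin 3} {τ : ℂ} {s : ℝ} (hτ : τ ∈ segment) (hs : s ∈ Icc (-1 : ℝ) 1) :
    3 ≤ (capMap i (τ, s)).1 (i + 1) ∧ 3 ≤ (capMap i (τ, s)).1 (i + 2) ∧
    (capMap i (τ, s)).1 (i + 1) ≤ 5 ∧ (capMap i (τ, s)).1 (i + 2) ≤ 5 ∧
    0 ≤ (capMap i (τ, s)).1 i ∧ (capMap i (τ, s)).1 i ≤ 1 ∧ 1 / 2 ≤ τ.im ∧ τ.im ≤ 1 := by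
  rw [capMap_succ, capMap_succ_succ, capMap_self]
  have h1 := (im_mem_Icc hτ.1).2
  have h2 := hτ.2
  obtain ⟨h3, h4⟩ := hs
  refine ⟨?_, ?_, ?_, ?_, ?_, ?_, h2, h1⟩ <;> dsimp only <;> nlinarith

/-- The coordinate `x i` equals `2 (1 - τ.im)`. With `c = 2 A B / (5 (1 + τ.im))`, where `A` and `B`
are the other two coordinates, `hexFun` is therefore `c (1 - τ.im²)`, and `ξ² = c τ.re²` by
construction. -/
lemma capMap_defect {i : Fin 3} {τ : ℂ} {s : ℝ} (hτ : τ ∈ segment) (hs : s ∈ Icc (-1 : ℝ) 1) :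
    ∃ c > 0, hexFun (capMap i (τ, s)).1 - (capMap i (τ, s)).2 ^ 2 =
      c * (1 - (τ.re ^ 2 + τ.im ^ 2)) := by
  obtain ⟨h1, h2, -, -, h3, -, h4, h5⟩ := capMap_pos (i := i) hτ hs
  rw [hexFun_eq i, capMap_snd, mul_pow, capMap_self]
  set A := (capMap i (τ, s)).1 (i + 1)
  set B := (capMap i (τ, s)).1 (i + 2)
  have hA : 0 < A := by linarith
  have hB : 0 < B := by linarith
  have hm : 0 < 1 + τ.im := by linarith
  have hpos : 0 < 2 * (A * B) / (5 * (1 + τ.im)) := by positivity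
  refine ⟨2 * (A * B) / (5 * (1 + τ.im)), hpos, ?_⟩
  rw [Real.sq_sqrt hpos.le]
  field_simp
  ring

lemma capMap_mem {i : Fin 3} {τ : ℂ} {s : ℝ} (hτ : τ ∈ segment) (hs : s ∈ Icc (-1 : ℝ) 1) :
    capMap i (τ, s) ∈ solid fun _ => 5 := by
  obtain ⟨h1, h2, h1', h2', h3, h3', h4, h5⟩ := capMap_pos (i := i) hτ hs
  refine ⟨fun k => ?_, ?_, ?_⟩
  · rcases fin3_cases i k with rfl | rfl | rfl <;> constructor <;> linarith
  · rw [fin3_sum i, capMap_self, capMap_succ, capMap_succ_succ]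
    ring
  · obtain ⟨c, hc, h⟩ := capMap_defect (i := i) hτ hs
    have := (norm_le_one_iff τ).1 hτ.1
    have : 0 ≤ c * (1 - (τ.re ^ 2 + τ.im ^ 2)) := mul_nonneg hc.le (by linarith)
    linarith

lemma capMap_wall {i : Fin 3} {τ : ℂ} {s : ℝ} (hτ : τ ∈ segment) (hs : s ∈ Icc (-1 : ℝ) 1) :
    (capMap i (τ, s)).2 ^ 2 = hexFun (capMap i (τ, s)).1 ↔ ‖τ‖ = 1 := by
  obtain ⟨c, hc, h⟩ := capMap_defect (i := i) hτ hs
  rw [norm_eq_one_iff]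
  constructor
  · intro h'
    rw [h', sub_self, eq_comm, mul_eq_zero] at h
    linarith [h.resolve_left hc.ne']
  · intro h'
    rw [h', sub_self, mul_zero] at h
    linarith

lemma hexFun_neck_pos {x : Fin 3 → ℝ} (hx : x ∈ hexagon) :
    0 < hexFun fun k => 1 + 4 * x k := by
  have h := hx.1
  unfold hexFun
  have h0 := (h 0).1
  have h1 := (h 1).1
  have h2 := (h 2).1
  positivity

lemma neckMap_sq {n : ℝ} {x : Fin 3 → ℝ} (hx : x ∈ hexagon) :
    (neckMap (n, x)).2 ^ 2 = n ^ 2 * hexFun (neckMap (n, x)).1 := by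
  change (n * √(hexFun fun k => 1 + 4 * x k)) ^ 2 = n ^ 2 * hexFun fun k => 1 + 4 * x k
  rw [mul_pow, Real.sq_sqrt (hexFun_neck_pos hx).le]

lemma neckMap_mem {n : ℝ} {x : Fin 3 → ℝ} (hn : n ∈ Icc (-1 : ℝ) 1) (hx : x ∈ hexagon) :
    neckMap (n, x) ∈ solid fun _ => 5 := by
  refine ⟨fun k => ?_, ?_, ?_⟩
  · change 0 ≤ 1 + 4 * x k ∧ 1 + 4 * x k ≤ 5
    have := hx.1 k
    constructor <;> linarith
  · change 1 + 4 * x 0 + (1 + 4 * x 1) + (1 + 4 * x 2) = 9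
    linarith [hx.2]
  · rw [neckMap_sq hx]
    have h1 : n ^ 2 ≤ 1 := by nlinarith [hn.1, hn.2]
    exact mul_le_of_le_one_left (hexFun_neck_pos hx).le h1

lemma neckMap_wall {n : ℝ} {x : Fin 3 → ℝ} (hx : x ∈ hexagon) :
    (neckMap (n, x)).2 ^ 2 = hexFun (neckMap (n, x)).1 ↔ n ^ 2 = 1 := by
  rw [neckMap_sq hx]
  exact mul_eq_right₀ (hexFun_neck_pos hx).ne'

@[fun_prop]
lemma smoothNear_hexFun (x : Fin 3 → ℝ) : SmoothNear hexFun x := by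
  unfold hexFun
  fun_prop (disch := norm_num)

lemma embOn_neckMap : EmbOn neckMap (Icc (-1 : ℝ) 1 ×ˢ hexagon) := by
  refine EmbOn.of_leftInvOn (fun p => (p.2 / √(hexFun p.1), fun k => (p.1 k - 1) / 4)) ?_ ?_ ?_
  · rintro ⟨n, x⟩ ⟨hn, hx⟩
    have h := (hexFun_neck_pos hx).ne'
    unfold neckMap
    fun_prop (disch := assumption)
  · rintro ⟨n, x⟩ ⟨hn, hx⟩
    have h : hexFun (neckMap (n, x)).1 ≠ 0 := (hexFun_neck_pos hx).ne'
    have h' : √(hexFun (neckMap (n, x)).1) ≠ 0 := (Real.sqrt_pos.2 (hexFun_neck_pos hx)).ne'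
    fun_prop (disch := first | assumption | norm_num)
  · rintro ⟨n, x⟩ ⟨hn, hx⟩
    refine Prod.ext ?_ (funext fun k => ?_)
    · exact mul_div_cancel_right₀ _ (Real.sqrt_pos.2 (hexFun_neck_pos hx)).ne'
    · change (1 + 4 * x k - 1) / 4 = x k
      ring

/-- The inverse of `capMap`. -/
def capInv (i : Fin 3) (p : (Fin 3 → ℝ) × ℝ) : ℂ × ℝ :=
  (⟨p.2 / √(2 * (p.1 (i + 1) * p.1 (i + 2)) / (5 * (1 + (2 - p.1 i) / 2))), (2 - p.1 i) / 2⟩,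
    (p.1 (i + 1) - p.1 (i + 2)) / (1 + p.1 i))

lemma capInv_capMap {i : Fin 3} {τ : ℂ} {s : ℝ} (hτ : τ ∈ segment) (hs : s ∈ Icc (-1 : ℝ) 1) :
    capInv i (capMap i (τ, s)) = (τ, s) := by
  obtain ⟨h1, h2, -, -, h3, h3', h4, h5⟩ := capMap_pos (i := i) hτ hs
  have e : (2 - (capMap i (τ, s)).1 i) / 2 = τ.im := by rw [capMap_self]; ring
  refine Prod.ext (Complex.ext ?_ e) ?_
  · simp only [capInv, e]
    rw [capMap_snd]
    refine mul_div_cancel_right₀ _ (Real.sqrt_pos.2 ?_).ne'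
    have : 0 < (capMap i (τ, s)).1 (i + 1) := by linarith
    have : 0 < (capMap i (τ, s)).1 (i + 2) := by linarith
    have : 0 < 1 + τ.im := by linarith
    positivity
  · simp only [capInv]
    rw [div_eq_iff (by linarith), capMap_self, capMap_succ, capMap_succ_succ]
    ring

lemma embOn_capMap (i : Fin 3) : EmbOn (capMap i) (segment ×ˢ Icc (-1 : ℝ) 1) := by
  refine EmbOn.of_leftInvOn (capInv i) ?_ ?_ ?_
  · rintro ⟨τ, s⟩ ⟨hτ, hs⟩
    obtain ⟨h1, h2, -, -, h3, h3', h4, h5⟩ := capMap_pos (i := i) hτ hs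
    rw [capMap_succ] at h1
    rw [capMap_succ_succ] at h2
    have h6 : 5 * (1 + τ.im) ≠ 0 := by positivity
    have h7 : 2 * (((7 + 2 * τ.im) / 2 + s * (3 - 2 * τ.im) / 2) *
      ((7 + 2 * τ.im) / 2 - s * (3 - 2 * τ.im) / 2)) / (5 * (1 + τ.im)) ≠ 0 := by
      refine div_ne_zero (mul_ne_zero two_ne_zero (mul_ne_zero ?_ ?_)) h6
      · dsimp only at h1; linarith
      · dsimp only at h2; linarith
    unfold capMap
    refine SmoothNear.prodMk (SmoothNear.pi fun k => ?_) ?_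
    · split_ifs <;> fun_prop (disch := norm_num)
    · fun_prop (disch := first | assumption | norm_num)
  · rintro ⟨τ, s⟩ ⟨hτ, hs⟩
    obtain ⟨h1, h2, -, -, h3, h3', h4, h5⟩ := capMap_pos (i := i) hτ hs
    set p := capMap i (τ, s)
    have h6 : 5 * (1 + (2 - p.1 i) / 2) ≠ 0 := by linarith
    have h7 : 0 < 2 * (p.1 (i + 1) * p.1 (i + 2)) / (5 * (1 + (2 - p.1 i) / 2)) := by
      have : 0 < p.1 (i + 1) := by linarith
      have : 0 < p.1 (i + 2) := by linarith
      have : 0 < 1 + (2 - p.1 i) / 2 := by linarith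
      positivity
    have h7' := h7.ne'
    have h8 := (Real.sqrt_pos.2 h7).ne'
    have h9 : 1 + p.1 i ≠ 0 := by linarith
    unfold capInv
    fun_prop (disch := first | assumption | norm_num)
  · rintro ⟨τ, s⟩ ⟨hτ, hs⟩
    exact capInv_capMap hτ hs

/-- The solid is covered by its neck and its three caps. -/
lemma solid_cover {p : (Fin 3 → ℝ) × ℝ} (hp : p ∈ solid fun _ => 5) :
    (∃ n ∈ Icc (-1 : ℝ) 1, ∃ x ∈ hexagon, neckMap (n, x) = p) ∨
      ∃ i, ∃ τ ∈ segment, ∃ s ∈ Icc (-1 : ℝ) 1, capMap i (τ, s) = p := by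
  obtain ⟨x, ξ⟩ := p
  obtain ⟨h1, h2, h3⟩ := hp
  dsimp only at h1 h2 h3
  by_cases h : ∀ k, 1 ≤ x k
  · left
    have hf : 0 < hexFun x := by
      unfold hexFun
      have := h 0
      have := h 1
      have := h 2
      positivity
    have hs := Real.sqrt_pos.2 hf
    have e : (fun k => 1 + 4 * ((x k - 1) / 4)) = x := by funext k; ring
    refine ⟨ξ / √(hexFun x), ?_, fun k => (x k - 1) / 4, ⟨fun k => ?_, ?_⟩, ?_⟩
    · rw [mem_Icc, ← abs_le, ← sq_le_one_iff_abs_le_one, div_pow, Real.sq_sqrt hf.le]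
      exact div_le_one_of_le₀ h3 hf.le
    · constructor <;> linarith [h k, h1 k]
    · linarith
    · unfold neckMap
      simp only [e]
      rw [div_mul_cancel₀ _ hs.ne']
  · right
    push Not at h
    obtain ⟨i, hi⟩ := h
    have h4 := h1 i
    have h5 := h1 (i + 1)
    have h6 := h1 (i + 2)
    rw [fin3_sum i] at h2
    rw [hexFun_eq i] at h3
    have hpos : 0 < 2 * (x (i + 1) * x (i + 2)) / (5 * (1 + (2 - x i) / 2)) := by
      have : 0 < x (i + 1) := by linarith
      have : 0 < x (i + 2) := by linarith
      have : 0 < 1 + (2 - x i) / 2 := by linarith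
      positivity
    have hsq := Real.sqrt_pos.2 hpos
    have hinv : (capInv i (x, ξ)).1 ∈ segment := by
      refine ⟨(norm_le_one_iff _).2 ?_, ?_⟩
      · have e : (capInv i (x, ξ)).1.re ^ 2 + (capInv i (x, ξ)).1.im ^ 2 =
            ξ ^ 2 / (2 * (x (i + 1) * x (i + 2)) / (5 * (1 + (2 - x i) / 2))) +
              ((2 - x i) / 2) ^ 2 := by
          simp only [capInv, div_pow, Real.sq_sqrt hpos.le]
        rw [e]
        have h7 : ξ ^ 2 / (2 * (x (i + 1) * x (i + 2)) / (5 * (1 + (2 - x i) / 2))) ≤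
            1 - ((2 - x i) / 2) ^ 2 := by
          rw [div_le_iff₀ hpos]
          refine h3.trans (le_of_eq ?_)
          have : 5 * (1 + (2 - x i) / 2) ≠ 0 := by linarith
          rw [mul_div_assoc', eq_div_iff this]
          ring
        linarith
      · change 1 / 2 ≤ (2 - x i) / 2
        linarith
    have h0 : 0 < 1 + x i := by linarith
    have hs : (capInv i (x, ξ)).2 ∈ Icc (-1 : ℝ) 1 := by
      simp only [capInv]
      rw [mem_Icc, le_div_iff₀ h0, div_le_iff₀ h0]
      constructor <;> linarith
    refine ⟨i, _, hinv, _, hs, ?_⟩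
    have hx : (capMap i (capInv i (x, ξ))).1 = x := by
      funext k
      have e1 : (capInv i (x, ξ)).1.im = (2 - x i) / 2 := rfl
      have e2 : (capInv i (x, ξ)).2 * (1 + x i) = x (i + 1) - x (i + 2) :=
        div_mul_cancel₀ _ h0.ne'
      rcases fin3_cases i k with rfl | rfl | rfl
      · rw [capMap_self, e1]; ring
      · rw [capMap_succ, e1]
        linarith
      · rw [capMap_succ_succ, e1]
        linarith
    refine Prod.ext hx ?_
    have e := capMap_snd i (capInv i (x, ξ))
    rw [hx] at e
    change (capMap i (capInv i (x, ξ))).2 = ξ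
    rw [e]
    exact div_mul_cancel₀ _ hsq.ne'

/-- A cap has `x i ≤ 1` and the neck has all coordinates at least `1`, so they meet where `x i = 1`,
that is, over the chord at height `1 / 2` of the unit disc. Half the length of this chord is `√(3 /
4)`. -/
lemma capMap_eq_neckMap_iff {i : Fin 3} {τ : ℂ} {s n : ℝ} {x : Fin 3 → ℝ} (hτ : τ ∈ segment)
    (hs : s ∈ Icc (-1 : ℝ) 1) (hx : x ∈ hexagon) :
    capMap i (τ, s) = neckMap (n, x) ↔
      τ.im = 1 / 2 ∧ τ.re = n * √(3 / 4) ∧ (hexSide i ⟨s, hs⟩ : Fin 3 → ℝ) = x := by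
  have hne := fin3_ne i
  have hside : ∀ x' : Fin 3 → ℝ, (hexSide i ⟨s, hs⟩ : Fin 3 → ℝ) = x' ↔
      x' i = 0 ∧ x' (i + 1) = (3 + s) / 4 ∧ x' (i + 2) = (3 - s) / 4 := by
    intro x'
    constructor
    · rintro rfl
      simp [hexSide, hne.1, hne.2.1, hne.2.2]
    · rintro ⟨h1, h2, h3⟩
      funext k
      rcases fin3_cases i k with rfl | rfl | rfl
      · simp [hexSide, h1]
      · simp [hexSide, hne.1, h2]
      · simp [hexSide, hne.2.1, hne.2.2, h3]
  have hxi : (neckMap (n, x)).1 = fun k => 1 + 4 * x k := rfl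
  have hsqrt : ∀ c : ℝ, 0 ≤ c → √(3 / 4) * √(2 * c / (5 * (1 + 1 / 2))) = √(c / 5) := by
    intro c hc
    rw [← Real.sqrt_mul (by norm_num)]
    congr 1
    ring
  rw [hside]
  constructor
  · intro h
    have h1 := congrFun (congrArg Prod.fst h)
    have e0 := h1 i
    have e1 := h1 (i + 1)
    have e2 := h1 (i + 2)
    rw [capMap_self, hxi] at e0
    rw [capMap_succ, hxi] at e1
    rw [capMap_succ_succ, hxi] at e2
    dsimp only at e0 e1 e2
    have him : τ.im = 1 / 2 := le_antisymm (by linarith [(hx.1 i).1]) hτ.2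
    rw [him] at e0 e1 e2
    refine ⟨him, ?_, by linarith, by linarith, by linarith⟩
    have h2 : (capMap i (τ, s)).2 = (neckMap (n, x)).2 := congrArg Prod.snd h
    rw [capMap_snd, h] at h2
    obtain ⟨p1, p2, -⟩ := capMap_pos (i := i) hτ hs
    rw [h] at p1 p2
    change τ.re * √(2 * ((neckMap (n, x)).1 (i + 1) * (neckMap (n, x)).1 (i + 2)) /
      (5 * (1 + τ.im))) = n * √(hexFun (neckMap (n, x)).1) at h2
    have e3 : (neckMap (n, x)).1 i = 1 := by rw [hxi]; linarith
    rw [hexFun_eq i, e3, him, one_mul] at h2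
    set A := (neckMap (n, x)).1 (i + 1)
    set B := (neckMap (n, x)).1 (i + 2)
    have hAB : 0 < A * B := mul_pos (by linarith) (by linarith)
    rw [← hsqrt _ hAB.le, ← mul_assoc n] at h2
    have hS : 0 < √(2 * (A * B) / (5 * (1 + 1 / 2))) := Real.sqrt_pos.2 (by positivity)
    exact mul_right_cancel₀ hS.ne' h2
  · rintro ⟨h1, h2, h3, h4, h5⟩
    have hx1 : (capMap i (τ, s)).1 = (neckMap (n, x)).1 := by
      rw [hxi]
      funext k
      rcases fin3_cases i k with rfl | rfl | rfl
      · rw [capMap_self, h3]; dsimp only; rw [h1]; norm_num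
      · rw [capMap_succ, h4]; dsimp only; rw [h1]; ring
      · rw [capMap_succ_succ, h5]; dsimp only; rw [h1]; ring
    refine Prod.ext hx1 ?_
    rw [capMap_snd]
    obtain ⟨p1, p2, -⟩ := capMap_pos (i := i) hτ hs
    change τ.re * √(2 * ((capMap i (τ, s)).1 (i + 1) * (capMap i (τ, s)).1 (i + 2)) /
      (5 * (1 + τ.im))) = n * √(hexFun (neckMap (n, x)).1)
    rw [← hx1, hexFun_eq i, capMap_self, h1]
    set A := (capMap i (τ, s)).1 (i + 1)
    set B := (capMap i (τ, s)).1 (i + 2)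
    have hAB : 0 < A * B := mul_pos (by linarith) (by linarith)
    have e : (2 - 2 * (1 / 2)) * A * B / 5 = A * B / 5 := by ring
    rw [e, h2, mul_assoc, hsqrt _ hAB.le]

/-- On the cap `i` the other two coordinates are at least `3`, whereas on their own caps they would
be at most `1`. -/
lemma capMap_ne {i i' : Fin 3} (h : i ≠ i') {τ τ' : ℂ} {s s' : ℝ} (hτ : τ ∈ segment)
    (hs : s ∈ Icc (-1 : ℝ) 1) (hτ' : τ' ∈ segment) (hs' : s' ∈ Icc (-1 : ℝ) 1) :
    capMap i (τ, s) ≠ capMap i' (τ', s') := by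
  intro he
  obtain ⟨h1, h2, -⟩ := capMap_pos (i := i) hτ hs
  obtain ⟨-, -, -, -, -, h3, -⟩ := capMap_pos (i := i') hτ' hs'
  rw [← he] at h3
  rcases fin3_cases i i' with h' | h' | h'
  · exact h h'.symm
  · rw [h'] at h3; linarith
  · rw [h'] at h3; linarith

/-- The three ends of the solid, as sections parametrized by the disc; the end `k` is the section
`x k = 5`. -/
def endMap (k : Fin 3) (v : ℂ) : (Fin 3 → ℝ) × ℝ :=
  (if k = 0 then ![5, 2 - 2 * v.im, 2 + 2 * v.im] else
    if k = 1 then ![2 - 2 * v.im, 5, 2 + 2 * v.im] else ![2 + 2 * v.im, 2 - 2 * v.im, 5],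
    2 * v.re)

/-- At an end of a strip the two larger coordinates are `5` and `2 + 2 τ.im`. The square root then
equals `2`, so that the ends are round discs of radius `2`. -/
lemma capMap_end_aux {τ : ℂ} (hτ : τ ∈ segment) {A B : ℝ} (h : A * B = 5 * (2 + 2 * τ.im)) :
    τ.re * √(2 * (A * B) / (5 * (1 + τ.im))) = 2 * τ.re := by
  have h1 : 0 < 1 + τ.im := by linarith [hτ.2]
  have e : 2 * (A * B) / (5 * (1 + τ.im)) = 2 ^ 2 := by
    rw [h]
    field_simp
  rw [e, Real.sqrt_sq zero_le_two]
  ring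

lemma capMap_end {τ : ℂ} (hτ : τ ∈ segment) :
    capMap 0 (τ, -1) = endMap 2 (conj τ) ∧ capMap 1 (τ, 1) = endMap 2 τ ∧
    capMap 2 (τ, -1) = endMap 1 (conj τ) ∧ capMap 0 (τ, 1) = endMap 1 τ ∧
    capMap 2 (τ, 1) = endMap 0 (conj τ) ∧ capMap 1 (τ, -1) = endMap 0 τ := by
  refine ⟨?_, ?_, ?_, ?_, ?_, ?_⟩ <;> refine Prod.ext (funext fun k => ?_) ?_
  all_goals first
    | (fin_cases k <;> simp [capMap, endMap] <;> ring)
    | (rw [capMap_snd, capMap_end_aux hτ (by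
        rw [capMap_succ, capMap_succ_succ]; dsimp only; ring)]
       simp [endMap])

lemma sqrt_four_sub (s : ℝ) : √(4 - s ^ 2) = 2 * √(1 - s ^ 2 / 4) := by
  have : (4 - s ^ 2) = 2 ^ 2 * (1 - s ^ 2 / 4) := by ring
  rw [this, Real.sqrt_mul (by norm_num), Real.sqrt_sq zero_le_two]

lemma neckMap_end (n : ℝ) (s : Icc (-1 : ℝ) 1) :
    neckMap (n, hexEnd 2 s) = endMap 2 ⟨n * √(1 - s.1 ^ 2 / 4), -(s.1 / 2)⟩ ∧
    neckMap (n, hexEnd 1 s) = endMap 1 ⟨n * √(1 - s.1 ^ 2 / 4), -(s.1 / 2)⟩ ∧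
    ∀ t : Icc (-1 : ℝ) 1, t.1 = -s.1 →
      neckMap (n, hexEnd 0 t) = endMap 0 ⟨n * √(1 - s.1 ^ 2 / 4), -(s.1 / 2)⟩ := by
  have key : ∀ x : Fin 3 → ℝ, hexFun (fun k => 1 + 4 * x k) = 4 - s.1 ^ 2 →
      (neckMap (n, x)).2 = 2 * (n * √(1 - s.1 ^ 2 / 4)) := by
    intro x h
    change n * √(hexFun fun k => 1 + 4 * x k) = _
    rw [h, sqrt_four_sub]
    ring
  refine ⟨?_, ?_, fun t ht => ?_⟩ <;> refine Prod.ext (funext fun k => ?_) ?_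
  · fin_cases k <;> simp [neckMap, endMap, hexEnd] <;> ring
  · rw [key _ (by simp [hexFun, hexEnd]; ring)]; simp [endMap]
  · fin_cases k <;> simp [neckMap, endMap, hexEnd] <;> ring
  · rw [key _ (by simp [hexFun, hexEnd]; ring)]; simp [endMap]
  · fin_cases k <;> simp [neckMap, endMap, hexEnd, ht] <;> ring
  · rw [key _ (by simp [hexFun, hexEnd, ht]; ring)]; simp [endMap]

end HexagonBody

/-! ### A criterion for Y-products, and the map from the solid to `ℂ²`. -/

section YProducts

lemma EmbOn.prodMap {E E' F F' : Type} [NormedAddCommGroup E] [NormedSpace ℝ E]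
    [NormedAddCommGroup E'] [NormedSpace ℝ E'] [NormedAddCommGroup F] [NormedSpace ℝ F]
    [NormedAddCommGroup F'] [NormedSpace ℝ F'] {j : E → E'} {k : F → F'} {A : Set E} {B : Set F}
    (hj : EmbOn j A) (hk : EmbOn k B) :
    EmbOn (fun p : E × F => (j p.1, k p.2)) (A ×ˢ B) := by
  refine ⟨?_, ?_⟩
  · rintro ⟨x, y⟩ ⟨hx, hy⟩ ⟨x', y'⟩ ⟨hx', hy'⟩ h
    exact Prod.ext (hj.1 hx hx' (congrArg Prod.fst h)) (hk.1 hy hy' (congrArg Prod.snd h))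
  · rintro ⟨x, y⟩ ⟨hx, hy⟩
    obtain ⟨h1, r, hr, h2⟩ := hj.2 x hx
    obtain ⟨h1', r', hr', h2'⟩ := hk.2 y hy
    refine ⟨?_, fun p => (r p.1, r' p.2), ?_, ?_⟩
    · exact SmoothNear.prodMk
        (SmoothNear.comp_fun (g := j) (f := Prod.fst) h1 (ContDiff.smoothNear contDiff_fst _))
        (SmoothNear.comp_fun (g := k) (f := Prod.snd) h1' (ContDiff.smoothNear contDiff_snd _))
    · exact SmoothNear.prodMk
        (SmoothNear.comp_fun (g := r) (f := Prod.fst) hr (ContDiff.smoothNear contDiff_fst _))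
        (SmoothNear.comp_fun (g := r') (f := Prod.snd) hr' (ContDiff.smoothNear contDiff_snd _))
    · rw [nhdsWithin_prod_eq]
      filter_upwards [h2.prod_mk h2'] with p hp
      exact Prod.ext hp.1 hp.2

lemma isCompact_hexagon : IsCompact hexagon := by
  have e : hexagon = Icc (0 : Fin 3 → ℝ) 1 ∩ {x | x 0 + x 1 + x 2 = 3 / 2} := by
    ext x
    refine ⟨fun h => ⟨⟨fun k => (h.1 k).1, fun k => (h.1 k).2⟩, h.2⟩,
      fun h => ⟨fun k => ⟨h.1.1 k, h.1.2 k⟩, h.2⟩⟩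
  rw [e]
  exact isCompact_Icc.inter_right (isClosed_eq (by fun_prop) continuous_const)

/-- A domain that is fibred over the solid, or over its boundary, is a Y-product. -/
theorem isYProduct_of {E : Type} [NormedAddCommGroup E] [NormedSpace ℝ E] [FiniteDimensional ℝ E]
    (D : Double E) (F : FaceData (Unit ⊕ Unit) Unit)
    {Φ : ((Fin 3 → ℝ) × ℝ) × ℂ → ℂ × ℂ} {S : Set (((Fin 3 → ℝ) × ℝ) × ℂ)} (hΦ : EmbOn Φ S)
    (hmaps : ∀ p ∈ S, Φ p ∈ F.carrier) (hsurj : ∀ y ∈ F.carrier, ∃ p ∈ S, Φ p = y)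
    (hMc : IsCompact D.M) (hNc : IsCompact D.N) {a : E → ℝ} {b c : E → ℂ}
    (hN : EmbOn (fun e => (a e, c e)) D.N) (hM : EmbOn (fun e => (b e, c e)) D.M)
    (haN : ∀ e ∈ D.N, a e ∈ Icc (-1 : ℝ) 1) (hbM : ∀ e ∈ D.M, b e ∈ segment)
    (hNS : ∀ e ∈ D.N, ∀ x ∈ hexagon, (neckMap (a e, x), c e) ∈ S)
    (hMS : ∀ i, ∀ e ∈ D.M, ∀ s ∈ Icc (-1 : ℝ) 1, (capMap i (b e, s), c e) ∈ S)
    (hcovN : ∀ n ∈ Icc (-1 : ℝ) 1, ∀ x ∈ hexagon, ∀ w, (neckMap (n, x), w) ∈ S →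
      ∃ e ∈ D.N, a e = n ∧ c e = w)
    (hcovM : ∀ i, ∀ τ ∈ segment, ∀ s ∈ Icc (-1 : ℝ) 1, ∀ w, (capMap i (τ, s), w) ∈ S →
      ∃ e ∈ D.M, b e = τ ∧ c e = w)
    (hsolid : ∀ p ∈ S, p.1 ∈ solid fun _ => 5)
    (hcompat : ∀ e ∈ D.M, ∀ e' ∈ D.N, (b e).im = 1 / 2 → (b e).re = a e' * √(3 / 4) →
      c e = c e' → e = e')
    (hcompat' : ∀ e ∈ D.N, (b e).im = 1 / 2 ∧ (b e).re = a e * √(3 / 4))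
    {v f : ℂ × ℂ → ℂ}
    (hL : ∀ x ∈ solidTorus, F.emb (Sum.inl (Sum.inl ())) x = Φ (endMap 2 (v x), f x))
    (hR : ∀ x ∈ solidTorus, F.emb (Sum.inl (Sum.inr ())) x = Φ (endMap 1 (v x), f x))
    (hO : ∀ x ∈ solidTorus, F.emb (Sum.inr ()) x = Φ (endMap 0 (v x), f x))
    (hplus : ∀ m : D.M, v (D.plus m) = conj (b m) ∧ f (D.plus m) = c m)
    (hminus : ∀ m : D.M, v (D.minus m) = b m ∧ f (D.minus m) = c m)
    (hneck : ∀ (n : D.N) (s : Icc (-1 : ℝ) 1),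
      v (D.neck n s) = ⟨a n * √(1 - s.1 ^ 2 / 4), -(s.1 / 2)⟩ ∧ f (D.neck n s) = c n) :
    IsYProduct D F.relCob := by
  -- The maps `a` and `b` place `N` on the neck chord and `M` in the segment of the model disc, and
  -- `c` is the remaining factor of `X`. The position in the hexagon, or along the strip, supplies
  -- the rest.
  have hjN : EmbOn (fun p : E × (Fin 3 → ℝ) => Φ (neckMap (a p.1, p.2), c p.1))
      (D.N ×ˢ hexagon) := by
    have h1 : EmbOn (fun q : (ℝ × ℂ) × (Fin 3 → ℝ) => ((q.1.1, q.2), q.1.2)) univ :=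
      EmbOn.of_leftInvOn (fun r => ((r.1.1, r.2), r.1.2)) (fun _ _ => by fun_prop)
        (fun _ _ => by fun_prop) fun _ _ => rfl
    have h2 := h1.comp (hN.prodMap (embOn_id hexagon)) (mapsTo_univ _ _)
    have h3 := (embOn_neckMap.prodMap (embOn_id (univ : Set ℂ))).comp h2
      (fun p hp => ⟨⟨haN _ hp.1, hp.2⟩, mem_univ _⟩)
    exact hΦ.comp h3 fun p hp => hNS _ hp.1 _ hp.2
  have hjM : ∀ i, EmbOn (fun p : E × ℝ => Φ (capMap i (b p.1, p.2), c p.1))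
      (D.M ×ˢ Icc (-1 : ℝ) 1) := by
    intro i
    have h1 : EmbOn (fun q : (ℂ × ℂ) × ℝ => ((q.1.1, q.2), q.1.2)) univ :=
      EmbOn.of_leftInvOn (fun r => ((r.1.1, r.2), r.1.2)) (fun _ _ => by fun_prop)
        (fun _ _ => by fun_prop) fun _ _ => rfl
    have h2 := h1.comp (hM.prodMap (embOn_id (Icc (-1 : ℝ) 1))) (mapsTo_univ _ _)
    have h3 := ((embOn_capMap i).prodMap (embOn_id (univ : Set ℂ))).comp h2
      (fun p hp => ⟨⟨hbM _ hp.1, hp.2⟩, mem_univ _⟩)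
    exact hΦ.comp h3 fun p hp => hMS i _ hp.1 _ hp.2
  refine ⟨fun p => ⟨Φ (neckMap (a p.1.1, p.1.2), c p.1.1), hmaps _ (hNS _ p.2.1 _ p.2.2)⟩,
    fun i p => ⟨Φ (capMap i (b p.1.1, p.1.2), c p.1.1), hmaps _ (hMS i _ p.2.1 _ p.2.2)⟩,
    ?_, ?_, ?_, ?_, ?_, ?_, ?_, ?_, ?_, ?_, ?_, ?_, ?_, ?_⟩
  · rw [F.relCob_smooth]
    exact hjN.isSmoothEmb (hNc.prod isCompact_hexagon) fun _ => rfl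
  · intro i
    rw [F.relCob_smooth]
    exact (hjM i).isSmoothEmb (hMc.prod isCompact_Icc) fun _ => rfl
  · refine eq_univ_of_forall ?_
    rintro ⟨y, hy⟩
    obtain ⟨⟨p, w⟩, hp, rfl⟩ := hsurj y hy
    rcases solid_cover (hsolid _ hp) with ⟨n, hn, x, hx, rfl⟩ | ⟨i, τ, hτ, s, hs, rfl⟩
    · left
      obtain ⟨e, he, rfl, rfl⟩ := hcovN n hn x hx w hp
      exact ⟨⟨(e, x), he, hx⟩, rfl⟩
    · right
      obtain ⟨e, he, rfl, rfl⟩ := hcovM i τ hτ s hs w hp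
      exact mem_iUnion.2 ⟨i, ⟨(e, s), he, hs⟩, rfl⟩
  · rintro i ⟨⟨e, s⟩, he, hs⟩ ⟨⟨e', x⟩, he', hx⟩
    have he : e ∈ D.M := he
    have he' : e' ∈ D.N := he'
    have hx : x ∈ hexagon := hx
    have hs : s ∈ Icc (-1 : ℝ) 1 := hs
    constructor
    · intro h
      have h' := hΦ.1 (hMS i e he s hs) (hNS e' he' x hx) (congrArg Subtype.val h)
      obtain ⟨h1, h2, h3⟩ := (capMap_eq_neckMap_iff (hbM e he) hs hx).1 (congrArg Prod.fst h')
      exact ⟨hcompat e he e' he' h1 h2 (congrArg Prod.snd h'), h3⟩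
    · rintro ⟨h1, h2⟩
      have h1 : e = e' := h1
      have h2 : (hexSide i ⟨s, hs⟩ : Fin 3 → ℝ) = x := h2
      subst h1
      refine Subtype.ext ?_
      change Φ (capMap i (b e, s), c e) = Φ (neckMap (a e, x), c e)
      rw [(capMap_eq_neckMap_iff (hbM e he) hs hx).2
        ⟨(hcompat' e he').1, (hcompat' e he').2, h2⟩]
  · rintro i i' ⟨⟨e, s⟩, he, hs⟩ ⟨⟨e', s'⟩, he', hs'⟩ hne h
    have h' := hΦ.1 (hMS i e he s hs) (hMS i' e' he' s' hs') (congrArg Subtype.val h)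
    exact capMap_ne hne (hbM e he) hs (hbM e' he') hs' (congrArg Prod.fst h')
  · intro m
    refine Subtype.ext ((hL _ (D.plus m).2).trans ?_)
    rw [(hplus m).1, (hplus m).2, ← (capMap_end (hbM m m.2)).1]
  · intro m
    refine Subtype.ext ((hL _ (D.minus m).2).trans ?_)
    rw [(hminus m).1, (hminus m).2, ← (capMap_end (hbM m m.2)).2.1]
  · intro n s
    refine Subtype.ext ((hL _ (D.neck n s).2).trans ?_)
    rw [(hneck n s).1, (hneck n s).2, ← (neckMap_end (a n) s).1]
  · intro m
    refine Subtype.ext ((hR _ (D.plus m).2).trans ?_)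
    rw [(hplus m).1, (hplus m).2, ← (capMap_end (hbM m m.2)).2.2.1]
  · intro m
    refine Subtype.ext ((hR _ (D.minus m).2).trans ?_)
    rw [(hminus m).1, (hminus m).2, ← (capMap_end (hbM m m.2)).2.2.2.1]
  · intro n s
    refine Subtype.ext ((hR _ (D.neck n s).2).trans ?_)
    rw [(hneck n s).1, (hneck n s).2, ← (neckMap_end (a n) s).2.1]
  · intro m
    refine Subtype.ext ((hO _ (D.plus m).2).trans ?_)
    rw [(hplus m).1, (hplus m).2, ← (capMap_end (hbM m m.2)).2.2.2.2.1]
  · intro m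
    refine Subtype.ext ((hO _ (D.minus m).2).trans ?_)
    rw [(hminus m).1, (hminus m).2, ← (capMap_end (hbM m m.2)).2.2.2.2.2]
  · intro n s t hst
    refine Subtype.ext ((hO _ (D.neck n s).2).trans ?_)
    rw [(hneck n s).1, (hneck n s).2, ← (neckMap_end (a n) s).2.2 t hst]

/-- The point of `ℂ²` with given coordinates `x`, `ξ` and angular coordinate. -/
def place (p : ((Fin 3 → ℝ) × ℝ) × ℂ) : ℂ × ℂ :=
  (⟨p.1.2 / (7 - p.1.1 0), (p.1.1 1 - p.1.1 2) / 2 / (7 - p.1.1 0)⟩, (7 - p.1.1 0) • p.2)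

/-- The coordinates of a point of `ℂ²` at height `q`. -/
def coords (z : ℂ) (q : ℝ) : (Fin 3 → ℝ) × ℝ := (![7 - q, lev (-1) z q, lev 1 z q], q * z.re)

lemma lev_place {x : Fin 3 → ℝ} {ξ : ℝ} (w : ℂ) (hx : x 0 + x 1 + x 2 = 9) (h7 : x 0 ≠ 7) :
    lev 1 (place ((x, ξ), w)).1 (7 - x 0) = x 2 ∧ lev (-1) (place ((x, ξ), w)).1 (7 - x 0) = x 1 ∧
    (7 - x 0) * (place ((x, ξ), w)).1.re = ξ := by
  have h : 7 - x 0 ≠ 0 := sub_ne_zero.2 h7.symm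
  have e : (7 - x 0) * ((x 1 - x 2) / 2 / (7 - x 0)) = (x 1 - x 2) / 2 := by field_simp
  unfold lev place
  refine ⟨?_, ?_, ?_⟩ <;> simp only []
  · rw [e]; linarith
  · rw [e]; linarith
  · field_simp

lemma coords_place {x : Fin 3 → ℝ} {ξ : ℝ} (w : ℂ) (hx : x 0 + x 1 + x 2 = 9) (h7 : x 0 ≠ 7) :
    coords (place ((x, ξ), w)).1 (7 - x 0) = (x, ξ) := by
  obtain ⟨h1, h2, h3⟩ := lev_place (ξ := ξ) w hx h7
  refine Prod.ext (funext fun k => ?_) h3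
  unfold coords
  rw [h1, h2]
  fin_cases k <;> simp

lemma wallFun_place {x : Fin 3 → ℝ} {ξ : ℝ} (w : ℂ) (hx : x 0 + x 1 + x 2 = 9) (h7 : x 0 ≠ 7) :
    wallFun (place ((x, ξ), w)).1 (7 - x 0) = hexFun x - ξ ^ 2 := by
  obtain ⟨h1, h2, h3⟩ := lev_place (ξ := ξ) w hx h7
  unfold wallFun hexFun
  rw [h1, h2, h3]
  ring

lemma place_coords {z w : ℂ} {q : ℝ} (hq : q ≠ 0) : place (coords z q, w) = (z, q • w) := by
  have e0 : (coords z q).1 0 = 7 - q := rfl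
  have e1 : (coords z q).1 1 = lev (-1) z q := rfl
  have e2 : (coords z q).1 2 = lev 1 z q := rfl
  have e3 : (coords z q).2 = q * z.re := rfl
  unfold place
  simp only [e0, e1, e2, e3]
  have h : 7 - (7 - q) = q := by ring
  rw [h]
  refine Prod.ext (Complex.ext ?_ ?_) rfl
  · simp only []
    field_simp
  · simp only [lev]
    field_simp
    ring

lemma coords_sum (z : ℂ) (q : ℝ) :
    (coords z q).1 0 + (coords z q).1 1 + (coords z q).1 2 = 9 := by
  change 7 - q + lev (-1) z q + lev 1 z q = 9
  linarith [lev_add z q]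

lemma hexFun_coords (z : ℂ) (q : ℝ) :
    hexFun (coords z q).1 - (coords z q).2 ^ 2 = wallFun z q := by
  change (7 - q) * lev (-1) z q * lev 1 z q / 5 - (q * z.re) ^ 2 = wallFun z q
  unfold wallFun
  ring

lemma smoothNear_place {p : ((Fin 3 → ℝ) × ℝ) × ℂ} (h : 7 - p.1.1 0 ≠ 0) : SmoothNear place p := by
  unfold place
  fun_prop (disch := first | assumption | norm_num)

lemma smoothNear_coords (p : ℂ × ℝ) : SmoothNear (fun p : ℂ × ℝ => coords p.1 p.2) p := by
  unfold coords lev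
  refine SmoothNear.prodMk (SmoothNear.pi fun k => ?_) (by fun_prop)
  fin_cases k <;> simp <;> fun_prop (disch := norm_num)

/-- Over the solid, the angular coordinate runs through the unit circle. -/
lemma embOn_place_circle : EmbOn place
    ({p : (Fin 3 → ℝ) × ℝ | p.1 0 + p.1 1 + p.1 2 = 9 ∧ p.1 0 < 7} ×ˢ {u : ℂ | ‖u‖ = 1}) := by
  have hn : ∀ (x : Fin 3 → ℝ) (ξ : ℝ) (u : ℂ), x 0 < 7 → ‖u‖ = 1 →
      ‖(place ((x, ξ), u)).2‖ = 7 - x 0 := fun x ξ u hx hu => norm_smul_unit (by linarith) hu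
  refine EmbOn.of_leftInvOn (fun y => (coords y.1 ‖y.2‖, (1 / ‖y.2‖) • y.2)) ?_ ?_ ?_
  · rintro ⟨⟨x, ξ⟩, u⟩ ⟨⟨hs, hx⟩, hu⟩
    exact smoothNear_place (sub_ne_zero.2 (ne_of_gt hx))
  · rintro ⟨⟨x, ξ⟩, u⟩ ⟨⟨hs, hx⟩, hu⟩
    have h := hn x ξ u hx hu
    have hx : x 0 < 7 := hx
    have h0 : ‖(place ((x, ξ), u)).2‖ ≠ 0 := by rw [h]; linarith
    have h0' : (place ((x, ξ), u)).2 ≠ 0 := norm_ne_zero_iff.1 h0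
    have h1 : SmoothNear (fun y : ℂ × ℂ => coords y.1 ‖y.2‖) (place ((x, ξ), u)) :=
      SmoothNear.comp_fun (g := fun p : ℂ × ℝ => coords p.1 p.2)
        (f := fun y : ℂ × ℂ => (y.1, ‖y.2‖)) (smoothNear_coords _)
        (by fun_prop (disch := assumption))
    fun_prop (disch := assumption)
  · rintro ⟨⟨x, ξ⟩, u⟩ ⟨⟨hs, hx⟩, hu⟩
    have h := hn x ξ u hx hu
    have hx : x 0 < 7 := hx
    change (coords (place ((x, ξ), u)).1 ‖(place ((x, ξ), u)).2‖,
      (1 / ‖(place ((x, ξ), u)).2‖) • (place ((x, ξ), u)).2) = ((x, ξ), u)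
    rw [h, coords_place u hs hx.ne]
    refine Prod.ext rfl ?_
    change (1 / (7 - x 0)) • (7 - x 0) • u = u
    rw [smul_smul, one_div, inv_mul_cancel₀ (by linarith), one_smul]

/-- Multiplied by `q`, the derivative is a negative quantity plus twice the wall function, and the
latter vanishes here. -/
lemma exists_hasDerivAt_wallFun {z : ℂ} {q : ℝ} (hq : 0 < q)
    (h : 0 < q * (lev 1 z q * lev (-1) z q) + (7 - q) * (2 + q)) (hw : wallFun z q = 0) :
    ∃ d < 0, HasDerivAt (wallFun z) d q := by
  have hl : ∀ σ : ℝ, HasDerivAt (lev σ z) (1 / 2 - σ * z.im) q := by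
    intro σ
    refine ((((hasDerivAt_id q).const_add 2).div_const 2).sub
      (((hasDerivAt_id q).mul_const z.im).const_mul σ)).congr_deriv ?_
    ring
  have hd := ((((hasDerivAt_id q).const_sub 7).mul ((hl 1).mul (hl (-1)))).div_const 5).sub
    (((hasDerivAt_id q).mul_const z.re).pow 2)
  refine ⟨_, ?_, hd⟩
  have e : q * (((-1) * (lev 1 z q * lev (-1) z q) + (7 - q) *
      ((1 / 2 - 1 * z.im) * lev (-1) z q + lev 1 z q * (1 / 2 - -1 * z.im))) / 5 -
      2 * (q * z.re) * z.re) =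
      -(q * (lev 1 z q * lev (-1) z q) + (7 - q) * (2 + q)) / 5 + 2 * wallFun z q := by
    unfold wallFun lev
    ring
  rw [hw] at e
  simp only [Pi.mul_apply, id, Nat.cast_ofNat, Nat.add_one_sub_one, pow_one, one_mul]
  by_contra! h4
  have h5 := mul_nonneg hq.le h4
  simp only [one_mul] at e
  linarith

/-- Over the boundary of the solid, the angular coordinate runs through the unit disc. -/
lemma embOn_place_disc : EmbOn place
    ({p : (Fin 3 → ℝ) × ℝ | p ∈ solid (fun _ => 5) ∧ p.2 ^ 2 = hexFun p.1} ×ˢ (univ : Set ℂ)) := by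
  have hfact : ∀ (x : Fin 3 → ℝ) (ξ : ℝ) (w : ℂ), (x, ξ) ∈ solid (fun _ => 5) → ξ ^ 2 = hexFun x →
      x 0 ≠ 7 ∧ 0 < 7 - x 0 ∧ wallFun (place ((x, ξ), w)).1 (7 - x 0) = 0 ∧
      0 ≤ lev 1 (place ((x, ξ), w)).1 (7 - x 0) ∧ 0 ≤ lev (-1) (place ((x, ξ), w)).1 (7 - x 0) ∧
      0 ≤ 7 - (7 - x 0) := by
    intro x ξ w hp hw
    have h5 : x 0 ≤ 5 := (hp.1 0).2
    have h7 : x 0 ≠ 7 := by linarith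
    obtain ⟨h1, h2, -⟩ := lev_place (ξ := ξ) w hp.2.1 h7
    refine ⟨h7, by linarith, by rw [wallFun_place w hp.2.1 h7, hw, sub_self], ?_, ?_, ?_⟩
    · rw [h1]; exact (hp.1 2).1
    · rw [h2]; exact (hp.1 1).1
    · linarith [(hp.1 0).1]
  refine ⟨?_, ?_⟩
  · rintro ⟨⟨x, ξ⟩, w⟩ ⟨⟨hp, hξ⟩, -⟩ ⟨⟨x', ξ'⟩, w'⟩ ⟨⟨hp', hξ'⟩, -⟩ h
    obtain ⟨h1, h2, h3, h4, h5, h6⟩ := hfact x ξ w hp hξ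
    obtain ⟨h1', h2', h3', h4', h5', h6'⟩ := hfact x' ξ' w' hp' hξ'
    have hz : (place ((x, ξ), w)).1 = (place ((x', ξ'), w')).1 := congrArg Prod.fst h
    -- Both heights are zeros of the wall function over the same `z`, and by strict monotonicity
    -- along rays there is only one.
    have hq : 7 - x 0 = 7 - x' 0 := by
      rw [← hz] at h3' h4' h5'
      rcases lt_trichotomy (7 - x 0) (7 - x' 0) with h | h | h
      · have := wallFun_strictAnti h2 h h6' h4' h5'
        rw [h3, h3'] at this
        linarith
      · exact h
      · have := wallFun_strictAnti h2' h h6 h4 h5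
        rw [h3, h3'] at this
        linarith
    have hxx : (x, ξ) = (x', ξ') := by
      rw [← coords_place w hp.2.1 h1, ← coords_place w' hp'.2.1 h1', hz, hq]
    refine Prod.ext hxx ?_
    have hw : (7 - x 0) • w = (7 - x' 0) • w' := congrArg Prod.snd h
    rw [hq] at hw
    exact smul_right_injective ℂ h2'.ne' hw
  · rintro ⟨⟨x, ξ⟩, w⟩ ⟨⟨hp, hξ⟩, -⟩
    obtain ⟨h1, h2, h3, h4, h5, h6⟩ := hfact x ξ w hp hξ
    have hsm := smoothNear_place (p := ((x, ξ), w)) h2.ne'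
    refine ⟨hsm, ?_⟩
    obtain ⟨e1, e2, -⟩ := lev_place (ξ := ξ) w hp.2.1 h1
    have hpos : 0 < (7 - x 0) * (lev 1 (place ((x, ξ), w)).1 (7 - x 0) *
        lev (-1) (place ((x, ξ), w)).1 (7 - x 0)) + (7 - (7 - x 0)) * (2 + (7 - x 0)) := by
      rw [e1, e2]
      have b1 : x 1 ≤ 5 := (hp.1 1).2
      have b2 : x 2 ≤ 5 := (hp.1 2).2
      have b3 : x 0 + x 1 + x 2 = 9 := hp.2.1
      have c0 : 0 ≤ x 0 := (hp.1 0).1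
      have c1 : 0 ≤ x 1 := (hp.1 1).1
      have c2 : 0 ≤ x 2 := (hp.1 2).1
      have c3 : 0 ≤ (7 - x 0) * (x 2 * x 1) := by positivity
      rcases c0.eq_or_lt with h0 | h0
      · rw [← h0] at b3 ⊢
        have : 4 ≤ x 1 := by linarith
        have : 4 ≤ x 2 := by linarith
        nlinarith
      · nlinarith
    obtain ⟨d, hd, hd'⟩ := exists_hasDerivAt_wallFun h2 hpos h3
    -- The height is recovered as a smooth function of `z` alone, by solving `wallFun z q = 0` for
    -- `q`. This leaves `w` free to run through a disc.
    obtain ⟨g, hg, hgi⟩ := SmoothNear.exists_solve (f := fun y : ℂ × ℝ => wallFun y.1 y.2)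
      (p := (place ((x, ξ), w)).1) (s := 7 - x 0)
      (by unfold wallFun lev; fun_prop (disch := norm_num)) hd' hd.ne
    change SmoothNear g ((place ((x, ξ), w)).1, wallFun (place ((x, ξ), w)).1 (7 - x 0)) at hg
    rw [h3] at hg
    have hg0 : g ((place ((x, ξ), w)).1, 0) = 7 - x 0 := by
      have h := hgi.self_of_nhds
      change g ((place ((x, ξ), w)).1, wallFun (place ((x, ξ), w)).1 (7 - x 0)) = 7 - x 0 at h
      rwa [h3] at h
    have hG : SmoothNear (fun y : ℂ × ℂ => g (y.1, 0)) (place ((x, ξ), w)) :=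
      SmoothNear.comp_fun (g := g) (f := fun y : ℂ × ℂ => (y.1, (0 : ℝ))) hg (by fun_prop)
    refine ⟨fun y => (coords y.1 (g (y.1, 0)), (1 / g (y.1, 0)) • y.2), ?_, ?_⟩
    · have h1 : SmoothNear (fun y : ℂ × ℂ => coords y.1 (g (y.1, 0))) (place ((x, ξ), w)) :=
        SmoothNear.comp_fun (g := fun p : ℂ × ℝ => coords p.1 p.2)
          (f := fun y : ℂ × ℂ => (y.1, g (y.1, 0))) (smoothNear_coords _)
          (SmoothNear.prodMk (by fun_prop) hG)
      have h0 : g ((place ((x, ξ), w)).1, 0) ≠ 0 := by rw [hg0]; exact h2.ne'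
      fun_prop (disch := assumption)
    · have hc : ContinuousAt (fun p : ((Fin 3 → ℝ) × ℝ) × ℂ => ((place p).1, 7 - p.1.1 0))
          ((x, ξ), w) :=
        (hsm.contDiffAt.continuousAt.fst).prodMk (by fun_prop)
      filter_upwards [nhdsWithin_le_nhds (hc.eventually hgi), self_mem_nhdsWithin] with p hpe hpS
      obtain ⟨⟨x', ξ'⟩, w'⟩ := p
      obtain ⟨k1, k2, k3, -⟩ := hfact x' ξ' w' hpS.1.1 hpS.1.2
      change g ((place ((x', ξ'), w')).1, wallFun (place ((x', ξ'), w')).1 (7 - x' 0)) =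
        7 - x' 0 at hpe
      rw [k3] at hpe
      rw [hpe, coords_place w' hpS.1.1.2.1 k1]
      refine Prod.ext rfl ?_
      change (1 / (7 - x' 0)) • (7 - x' 0) • w' = w'
      rw [smul_smul, one_div, inv_mul_cancel₀ k2.ne', one_smul]

end YProducts

/-! ### Stretching the arms of the solid to absorb the collars. -/

section Stretch

/-- The factor by which an arm is stretched. -/
def stretchFactor (c a : ℝ) : ℝ := 1 + c * Real.smoothTransition (2 * a - 9)

/-- The factor by which the cross sections of an arm are shrunk when it is stretched. -/
def shrinkFactor (c a : ℝ) : ℝ := (9 - a * stretchFactor c a) / (9 - a)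

/-- Stretching the arm of the solid at the end where the coordinate `x k` is large. -/
def armStretch (k : Fin 3) (c : ℝ) (p : (Fin 3 → ℝ) × ℝ) : (Fin 3 → ℝ) × ℝ :=
  (fun l => if l = k then p.1 k * stretchFactor c (p.1 k) else p.1 l * shrinkFactor c (p.1 k),
    p.2 * shrinkFactor c (p.1 k) * √(stretchFactor c (p.1 k)))

lemma stretchFactor_bounds {c : ℝ} (hc : |c| ≤ stretchConst) (a : ℝ) :
    99 / 100 ≤ stretchFactor c a ∧ stretchFactor c a ≤ 101 / 100 := by
  have h := abs_le.1 (hc.trans stretchConst_le)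
  have h1 := Real.smoothTransition.nonneg (2 * a - 9)
  have h2 := Real.smoothTransition.le_one (2 * a - 9)
  unfold stretchFactor
  constructor <;> nlinarith [h.1, h.2]

lemma stretchFactor_of_le {c a : ℝ} (ha : a ≤ 9 / 2) : stretchFactor c a = 1 := by
  unfold stretchFactor
  rw [Real.smoothTransition.zero_of_nonpos (by linarith), mul_zero, add_zero]

lemma stretchFactor_five (c : ℝ) : stretchFactor c 5 = 1 + c := by
  unfold stretchFactor
  rw [Real.smoothTransition.one_of_one_le (by norm_num), mul_one]

lemma shrinkFactor_of_le {c a : ℝ} (ha : a ≤ 9 / 2) : shrinkFactor c a = 1 := by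
  unfold shrinkFactor
  rw [stretchFactor_of_le ha, mul_one, div_self (by linarith)]

lemma exists_hasDerivAt_stretch {c a : ℝ} (hc : |c| ≤ stretchConst) (ha : a ∈ Icc (0 : ℝ) 5) :
    ∃ d > 0, HasDerivAt (fun a => a * stretchFactor c a) d a :=
  exists_stretch_const.choose_spec.2.2 c hc a ha

lemma strictMonoOn_stretch {c : ℝ} (hc : |c| ≤ stretchConst) :
    StrictMonoOn (fun a => a * stretchFactor c a) (Icc 0 5) := by
  refine strictMonoOn_of_deriv_pos (convex_Icc 0 5) (fun a ha => ?_) fun a ha => ?_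
  · obtain ⟨d, -, h⟩ := exists_hasDerivAt_stretch hc ha
    exact h.continuousAt.continuousWithinAt
  · obtain ⟨d, hd, h⟩ := exists_hasDerivAt_stretch hc (interior_subset ha)
    rwa [h.deriv]

lemma shrinkFactor_pos {c a : ℝ} (hc : |c| ≤ stretchConst) (ha : a ∈ Icc (0 : ℝ) 5) :
    0 < shrinkFactor c a := by
  have h := stretchFactor_bounds hc a
  have : 0 < 9 - a * stretchFactor c a := by nlinarith [ha.1, ha.2]
  exact div_pos this (by linarith [ha.2])

@[fun_prop]
lemma smoothNear_stretchFactor (c a : ℝ) : SmoothNear (stretchFactor c) a := by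
  have h : ContDiff ℝ ∞ (stretchFactor c) := by
    unfold stretchFactor
    exact contDiff_const.add (contDiff_const.mul
      (Real.smoothTransition.contDiff.comp (by fun_prop)))
  exact ContDiff.smoothNear h a

lemma smoothNear_shrinkFactor {c a : ℝ} (h : 9 - a ≠ 0) : SmoothNear (shrinkFactor c) a := by
  unfold shrinkFactor
  fun_prop (disch := assumption)

lemma armStretch_self (k : Fin 3) (c : ℝ) (p : (Fin 3 → ℝ) × ℝ) :
    (armStretch k c p).1 k = p.1 k * stretchFactor c (p.1 k) := if_pos rfl

lemma armStretch_ne {k l : Fin 3} (h : l ≠ k) (c : ℝ) (p : (Fin 3 → ℝ) × ℝ) :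
    (armStretch k c p).1 l = p.1 l * shrinkFactor c (p.1 k) := if_neg h

lemma armStretch_of_le {k : Fin 3} {p : (Fin 3 → ℝ) × ℝ} (h : p.1 k ≤ 9 / 2) (c : ℝ) :
    armStretch k c p = p := by
  refine Prod.ext (funext fun l => ?_) ?_
  · by_cases hl : l = k
    · rw [hl, armStretch_self, stretchFactor_of_le h, mul_one]
    · rw [armStretch_ne hl, shrinkFactor_of_le h, mul_one]
  · unfold armStretch
    simp only [shrinkFactor_of_le h, stretchFactor_of_le h, Real.sqrt_one, mul_one]

lemma smoothNear_armStretch {k : Fin 3} {c : ℝ} (hc : |c| ≤ stretchConst) {p : (Fin 3 → ℝ) × ℝ}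
    (h : 9 - p.1 k ≠ 0) : SmoothNear (armStretch k c) p := by
  have h1 : SmoothNear (fun p : (Fin 3 → ℝ) × ℝ => shrinkFactor c (p.1 k)) p :=
    SmoothNear.comp_fun (g := shrinkFactor c) (f := fun p : (Fin 3 → ℝ) × ℝ => p.1 k)
      (smoothNear_shrinkFactor h) (by fun_prop)
  have h2 : SmoothNear (fun p : (Fin 3 → ℝ) × ℝ => stretchFactor c (p.1 k)) p :=
    SmoothNear.comp_fun (g := stretchFactor c) (f := fun p : (Fin 3 → ℝ) × ℝ => p.1 k)
      (smoothNear_stretchFactor c _) (by fun_prop)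
  have h3 : stretchFactor c (p.1 k) ≠ 0 := by linarith [(stretchFactor_bounds hc (p.1 k)).1]
  unfold armStretch
  refine SmoothNear.prodMk (SmoothNear.pi fun l => ?_) (by fun_prop (disch := assumption))
  by_cases hl : l = k
  · simp only [hl, if_true]
    fun_prop
  · simp only [hl, if_false]
    fun_prop

lemma armStretch_sum {k : Fin 3} {c : ℝ} {p : (Fin 3 → ℝ) × ℝ} (h : p.1 k ≠ 9)
    (hs : p.1 0 + p.1 1 + p.1 2 = 9) :
    (armStretch k c p).1 0 + (armStretch k c p).1 1 + (armStretch k c p).1 2 = 9 := by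
  rw [fin3_sum k] at hs ⊢
  have h9 : 9 - p.1 k ≠ 0 := sub_ne_zero.2 h.symm
  rw [armStretch_self, armStretch_ne (fin3_ne k).1, armStretch_ne (fin3_ne k).2.1]
  have e : p.1 (k + 2) = 9 - p.1 k - p.1 (k + 1) := by linarith
  rw [e]
  unfold shrinkFactor
  field_simp
  ring

/-- The coordinate `x k` is multiplied by `m`, the two others by `n`, and `ξ` by `n √m`. Both
`hexFun` and `ξ²` are thus multiplied by `m n²`, and the wall is preserved. The factor `n` itself is
dictated by the condition that the sum stays `9`. -/
lemma hexFun_armStretch {k : Fin 3} {c : ℝ} (hc : |c| ≤ stretchConst) (p : (Fin 3 → ℝ) × ℝ) :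
    hexFun (armStretch k c p).1 - (armStretch k c p).2 ^ 2 =
      stretchFactor c (p.1 k) * shrinkFactor c (p.1 k) ^ 2 * (hexFun p.1 - p.2 ^ 2) := by
  have h := Real.sq_sqrt (show 0 ≤ stretchFactor c (p.1 k) by
    linarith [(stretchFactor_bounds hc (p.1 k)).1])
  rw [hexFun_eq k, hexFun_eq k, armStretch_self, armStretch_ne (fin3_ne k).1,
    armStretch_ne (fin3_ne k).2.1]
  change _ - (p.2 * shrinkFactor c (p.1 k) * √(stretchFactor c (p.1 k))) ^ 2 = _
  linear_combination (-p.2 ^ 2 * shrinkFactor c (p.1 k) ^ 2) * h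

/-- The preimage of a point under `armStretch`, in terms of its coordinate `a` along the arm. -/
def armShrink (k : Fin 3) (c : ℝ) (a : ℝ) (p : (Fin 3 → ℝ) × ℝ) : (Fin 3 → ℝ) × ℝ :=
  (fun l => if l = k then a else p.1 l / shrinkFactor c a,
    p.2 / shrinkFactor c a / √(stretchFactor c a))

lemma armShrink_armStretch {k : Fin 3} {c : ℝ} (hc : |c| ≤ stretchConst) {p : (Fin 3 → ℝ) × ℝ}
    (hp : p.1 k ∈ Icc (0 : ℝ) 5) : armShrink k c (p.1 k) (armStretch k c p) = p := by
  have h1 := (shrinkFactor_pos hc hp).ne'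
  have h2 : √(stretchFactor c (p.1 k)) ≠ 0 :=
    (Real.sqrt_pos.2 (by linarith [(stretchFactor_bounds hc (p.1 k)).1])).ne'
  refine Prod.ext (funext fun l => ?_) ?_
  · by_cases hl : l = k
    · simp only [armShrink, hl, if_true]
    · simp only [armShrink, hl, if_false]
      rw [armStretch_ne hl]
      field_simp
  · simp only [armShrink, armStretch]
    field_simp

lemma armStretch_armShrink {k : Fin 3} {c a : ℝ} (hc : |c| ≤ stretchConst)
    (ha : a ∈ Icc (0 : ℝ) 5) {p : (Fin 3 → ℝ) × ℝ} (hp : a * stretchFactor c a = p.1 k) :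
    armStretch k c (armShrink k c a p) = p := by
  have h1 := (shrinkFactor_pos hc ha).ne'
  have h2 : √(stretchFactor c a) ≠ 0 :=
    (Real.sqrt_pos.2 (by linarith [(stretchFactor_bounds hc a).1])).ne'
  have e : (armShrink k c a p).1 k = a := if_pos rfl
  refine Prod.ext (funext fun l => ?_) ?_
  · by_cases hl : l = k
    · rw [hl, armStretch_self, e, hp]
    · rw [armStretch_ne hl, e]
      simp only [armShrink, hl, if_false]
      field_simp
  · simp only [armStretch, e]
    simp only [armShrink]
    field_simp

lemma embOn_armStretch (k : Fin 3) {c : ℝ} (hc : |c| ≤ stretchConst) :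
    EmbOn (armStretch k c) {p | p.1 k ∈ Icc (0 : ℝ) 5} := by
  refine ⟨?_, ?_⟩
  · intro p hp p' hp' h
    have h1 : p.1 k = p'.1 k := by
      have := congrFun (congrArg Prod.fst h) k
      rw [armStretch_self, armStretch_self] at this
      exact (strictMonoOn_stretch hc).injOn hp hp' this
    rw [← armShrink_armStretch hc hp, ← armShrink_armStretch hc hp', h, h1]
  · intro p hp
    have hp5 : p.1 k ≤ 5 := hp.2
    refine ⟨smoothNear_armStretch hc (by linarith), ?_⟩
    obtain ⟨d, hd, hd'⟩ := exists_hasDerivAt_stretch hc hp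
    -- The equation has no parameter, so a dummy real parameter with value `0` is used.
    obtain ⟨g, hg, hgi⟩ := SmoothNear.exists_solve
      (f := fun y : ℝ × ℝ => y.2 * stretchFactor c y.2) (p := 0) (s := p.1 k)
      (by
        have : SmoothNear (fun y : ℝ × ℝ => stretchFactor c y.2) ((0 : ℝ), p.1 k) :=
          SmoothNear.comp_fun (g := stretchFactor c) (f := fun y : ℝ × ℝ => y.2)
            (smoothNear_stretchFactor c _) (by fun_prop)
        fun_prop) hd' hd.ne'
    have hg0 : g (0, (armStretch k c p).1 k) = p.1 k := by
      rw [armStretch_self]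
      exact hgi.self_of_nhds
    have hG : SmoothNear (fun y : (Fin 3 → ℝ) × ℝ => g (0, y.1 k)) (armStretch k c p) := by
      refine SmoothNear.comp_fun (g := g) (f := fun y : (Fin 3 → ℝ) × ℝ => ((0 : ℝ), y.1 k))
        ?_ (by fun_prop)
      rw [armStretch_self]
      exact hg
    refine ⟨fun y => armShrink k c (g (0, y.1 k)) y, ?_, ?_⟩
    · have h1 : SmoothNear (fun y : (Fin 3 → ℝ) × ℝ => shrinkFactor c (g (0, y.1 k)))
          (armStretch k c p) :=
        SmoothNear.comp_fun (g := shrinkFactor c) (f := fun y : (Fin 3 → ℝ) × ℝ => g (0, y.1 k))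
          (smoothNear_shrinkFactor (by rw [hg0]; linarith)) hG
      have h2 : SmoothNear (fun y : (Fin 3 → ℝ) × ℝ => stretchFactor c (g (0, y.1 k)))
          (armStretch k c p) :=
        SmoothNear.comp_fun (g := stretchFactor c) (f := fun y : (Fin 3 → ℝ) × ℝ => g (0, y.1 k))
          (smoothNear_stretchFactor c _) hG
      have h3 : shrinkFactor c (g (0, (armStretch k c p).1 k)) ≠ 0 := by
        rw [hg0]; exact (shrinkFactor_pos hc hp).ne'
      have h4 : 0 < stretchFactor c (g (0, (armStretch k c p).1 k)) := by
        linarith [(stretchFactor_bounds hc (g (0, (armStretch k c p).1 k))).1]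
      have h5 : √(stretchFactor c (g (0, (armStretch k c p).1 k))) ≠ 0 := (Real.sqrt_pos.2 h4).ne'
      have h4' := h4.ne'
      unfold armShrink
      refine SmoothNear.prodMk (SmoothNear.pi fun l => ?_) (by fun_prop (disch := assumption))
      by_cases hl : l = k
      · simp only [hl, if_true]
        exact hG
      · simp only [hl, if_false]
        fun_prop (disch := assumption)
    · have hcont : ContinuousAt (fun q : (Fin 3 → ℝ) × ℝ => ((0 : ℝ), q.1 k)) p := by fun_prop
      filter_upwards [nhdsWithin_le_nhds (hcont.eventually hgi), self_mem_nhdsWithin] with q hq hqS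
      have e : g (0, (armStretch k c q).1 k) = q.1 k := by
        rw [armStretch_self]; exact hq
      rw [e, armShrink_armStretch hc hqS]

lemma shrinkFactor_mul_le {c a x : ℝ} (hc : |c| ≤ stretchConst) (ha : a ∈ Icc (9 / 2 : ℝ) 5)
    (hx : x ≤ 9 - a) : x * shrinkFactor c a ≤ 9 / 2 := by
  have h0 : a ∈ Icc (0 : ℝ) 5 := ⟨by linarith [ha.1], ha.2⟩
  have h1 := (strictMonoOn_stretch hc).monotoneOn (a := 9 / 2) ⟨by norm_num, by norm_num⟩ h0 ha.1
  simp only [stretchFactor_of_le le_rfl] at h1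
  have h2 : (9 - a) * shrinkFactor c a = 9 - a * stretchFactor c a := by
    unfold shrinkFactor
    have : 9 - a ≠ 0 := by linarith [ha.2]
    field_simp
  have h3 := mul_le_mul_of_nonneg_right hx (shrinkFactor_pos hc h0).le
  linarith

/-- The coordinates add up to `9`, so where the `k`-th stretch is active the other two are at most
`9 / 2` before and after it. It therefore changes only the bound of the `k`-th coordinate, and the
stretches can be performed one after the other. -/
lemma armStretch_mem {k : Fin 3} {c : ℝ} (hc : |c| ≤ stretchConst) {b : Fin 3 → ℝ} (hk : b k = 5)
    (hb : ∀ l, 9 / 2 ≤ b l) {p : (Fin 3 → ℝ) × ℝ} (hp : p ∈ solid b) :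
    armStretch k c p ∈ solid (Function.update b k (5 + 5 * c)) := by
  obtain ⟨h1, h2, h3⟩ := hp
  have ha : p.1 k ∈ Icc (0 : ℝ) 5 := ⟨(h1 k).1, hk ▸ (h1 k).2⟩
  have hn := shrinkFactor_pos hc ha
  have hm := (stretchFactor_bounds hc (p.1 k)).1
  refine ⟨fun l => ?_, armStretch_sum (by linarith [ha.2]) h2, ?_⟩
  · by_cases hl : l = k
    · rw [hl, armStretch_self, Function.update_self]
      refine ⟨mul_nonneg ha.1 (by linarith), ?_⟩
      have := (strictMonoOn_stretch hc).monotoneOn ha ⟨by norm_num, le_rfl⟩ ha.2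
      simp only [stretchFactor_five] at this
      linarith
    · rw [armStretch_ne hl, Function.update_of_ne hl]
      refine ⟨mul_nonneg (h1 l).1 hn.le, ?_⟩
      rcases le_total (p.1 k) (9 / 2) with h | h
      · rw [shrinkFactor_of_le h, mul_one]
        exact (h1 l).2
      · refine (shrinkFactor_mul_le hc ⟨h, ha.2⟩ ?_).trans (hb l)
        rw [fin3_sum k] at h2
        rcases fin3_cases k l with h' | h' | h'
        · exact absurd h' hl
        · rw [h']; linarith [(h1 (k + 2)).1]
        · rw [h']; linarith [(h1 (k + 1)).1]
  · have := hexFun_armStretch (k := k) hc p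
    have h4 : 0 ≤ stretchFactor c (p.1 k) * shrinkFactor c (p.1 k) ^ 2 * (hexFun p.1 - p.2 ^ 2) :=
      mul_nonneg (mul_nonneg (by linarith) (sq_nonneg _)) (by linarith)
    linarith

lemma armStretch_surj {k : Fin 3} {c : ℝ} (hc : |c| ≤ stretchConst) {b : Fin 3 → ℝ} (hk : b k = 5)
    (hb : ∀ l, 9 / 2 ≤ b l) {y : (Fin 3 → ℝ) × ℝ}
    (hy : y ∈ solid (Function.update b k (5 + 5 * c))) : ∃ p ∈ solid b, armStretch k c p = y := by
  obtain ⟨h1, h2, h3⟩ := hy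
  have hyk := h1 k
  rw [Function.update_self] at hyk
  have hcont : ContinuousOn (fun a => a * stretchFactor c a) (Icc 0 5) := fun a _ =>
    (continuousAt_id.mul (smoothNear_stretchFactor c a).continuousAt).continuousWithinAt
  obtain ⟨a, ha, hay⟩ := intermediate_value_Icc (by norm_num : (0 : ℝ) ≤ 5) hcont
    (show y.1 k ∈ Icc _ _ by
      simp only [stretchFactor_five, zero_mul]
      exact ⟨hyk.1, by linarith [hyk.2]⟩)
  have hay : a * stretchFactor c a = y.1 k := hay
  have hn := shrinkFactor_pos hc ha
  have hm := (stretchFactor_bounds hc a).1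
  have e := armStretch_armShrink hc ha hay
  have ek : (armShrink k c a y).1 k = a := if_pos rfl
  have el : ∀ l, l ≠ k → (armShrink k c a y).1 l = y.1 l / shrinkFactor c a :=
    fun l hl => if_neg hl
  refine ⟨armShrink k c a y, ⟨?_, ?_, ?_⟩, e⟩
  · intro l
    by_cases hl : l = k
    · rw [hl, ek, hk]; exact ha
    · rw [el l hl]
      have hyl := h1 l
      rw [Function.update_of_ne hl] at hyl
      refine ⟨div_nonneg hyl.1 hn.le, ?_⟩
      rcases le_total a (9 / 2) with h | h
      · rw [shrinkFactor_of_le h, div_one]; exact hyl.2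
      · refine le_trans ?_ (hb l)
        rw [div_le_iff₀ hn]
        have h4 : (9 - a) * shrinkFactor c a = 9 - y.1 k := by
          rw [← hay]
          unfold shrinkFactor
          have : 9 - a ≠ 0 := by linarith [ha.2]
          field_simp
        have h5 : y.1 l ≤ 9 - y.1 k := by
          rw [fin3_sum k] at h2
          rcases fin3_cases k l with h' | h' | h'
          · exact absurd h' hl
          · rw [h']; linarith [(h1 (k + 2)).1]
          · rw [h']; linarith [(h1 (k + 1)).1]
        nlinarith
  · rw [fin3_sum k] at h2 ⊢
    rw [ek, el _ (fin3_ne k).1, el _ (fin3_ne k).2.1, add_assoc, ← add_div,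
      show y.1 (k + 1) + y.1 (k + 2) = 9 - y.1 k by linarith, ← hay]
    have h9 : 9 - a ≠ 0 := by linarith [ha.2]
    have h10 : 9 - a * stretchFactor c a ≠ 0 := by
      intro h
      unfold shrinkFactor at hn
      rw [h, zero_div] at hn
      exact lt_irrefl _ hn
    unfold shrinkFactor
    field_simp
    ring
  · have h4 := hexFun_armStretch (k := k) hc (armShrink k c a y)
    rw [e, ek] at h4
    have h5 : 0 < stretchFactor c a * shrinkFactor c a ^ 2 :=
      mul_pos (by linarith) (pow_pos hn 2)
    have h6 : 0 ≤ stretchFactor c a * shrinkFactor c a ^ 2 *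
        (hexFun (armShrink k c a y).1 - (armShrink k c a y).2 ^ 2) := by
      rw [← h4]; linarith
    have := nonneg_of_mul_nonneg_right h6 h5
    linarith

/-- The bounds of the stretched solid. -/
def stretchBound : Fin 3 → ℝ := ![5 - eps, 5 + eps, 5 + eps]

/-- Stretching all arms of the solid. -/
def stretch (p : (Fin 3 → ℝ) × ℝ) : (Fin 3 → ℝ) × ℝ :=
  armStretch 2 stretchConst (armStretch 1 stretchConst (armStretch 0 (-stretchConst) p))

lemma abs_stretchConst : |stretchConst| ≤ stretchConst ∧ |-stretchConst| ≤ stretchConst := by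
  rw [abs_neg, abs_of_pos stretchConst_pos]
  exact ⟨le_rfl, le_rfl⟩

lemma update_stretchBound :
    Function.update (Function.update (Function.update (fun _ => 5) 0 (5 + 5 * -stretchConst)) 1
      (5 + 5 * stretchConst)) 2 (5 + 5 * stretchConst) = stretchBound := by
  funext k
  fin_cases k <;> simp [stretchBound, eps, Function.update] <;> ring

lemma stretch_stages : ∀ b : Fin 3 → ℝ,
    (b = (fun _ => 5) ∨ b = Function.update (fun _ => 5) 0 (5 + 5 * -stretchConst) ∨
      b = Function.update (Function.update (fun _ => 5) 0 (5 + 5 * -stretchConst)) 1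
        (5 + 5 * stretchConst)) → ∀ l, 9 / 2 ≤ b l := by
  have h1 := stretchConst_le
  have h2 := stretchConst_pos
  rintro b (rfl | rfl | rfl) l
  · norm_num
  · fin_cases l <;> simp [Function.update] <;> linarith
  · fin_cases l <;> simp [Function.update] <;> linarith

lemma stretch_mem {p : (Fin 3 → ℝ) × ℝ} (hp : p ∈ solid fun _ => 5) :
    stretch p ∈ solid stretchBound := by
  rw [← update_stretchBound]
  have h0 := armStretch_mem (k := 0) abs_stretchConst.2 rfl (stretch_stages _ (Or.inl rfl)) hp
  have h1 := armStretch_mem (k := 1) abs_stretchConst.1 (by simp [Function.update])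
    (stretch_stages _ (Or.inr (Or.inl rfl))) h0
  exact armStretch_mem (k := 2) abs_stretchConst.1 (by simp [Function.update])
    (stretch_stages _ (Or.inr (Or.inr rfl))) h1

lemma stretch_surj {y : (Fin 3 → ℝ) × ℝ} (hy : y ∈ solid stretchBound) :
    ∃ p ∈ solid fun _ => 5, stretch p = y := by
  rw [← update_stretchBound] at hy
  obtain ⟨p2, h2, e2⟩ := armStretch_surj (k := 2) abs_stretchConst.1 (by simp [Function.update])
    (stretch_stages _ (Or.inr (Or.inr rfl))) hy
  obtain ⟨p1, h1, e1⟩ := armStretch_surj (k := 1) abs_stretchConst.1 (by simp [Function.update])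
    (stretch_stages _ (Or.inr (Or.inl rfl))) h2
  obtain ⟨p0, h0, e0⟩ := armStretch_surj (k := 0) abs_stretchConst.2 rfl
    (stretch_stages _ (Or.inl rfl)) h1
  exact ⟨p0, h0, by rw [stretch, e0, e1, e2]⟩

lemma embOn_stretch : EmbOn stretch (solid fun _ => 5) := by
  have hm0 : ∀ p ∈ solid fun _ => 5, armStretch 0 (-stretchConst) p ∈ solid _ := fun p hp =>
    armStretch_mem (k := 0) abs_stretchConst.2 rfl (stretch_stages _ (Or.inl rfl)) hp
  have hm1 : ∀ p ∈ solid fun _ => 5,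
      armStretch 1 stretchConst (armStretch 0 (-stretchConst) p) ∈ solid _ := fun p hp =>
    armStretch_mem (k := 1) abs_stretchConst.1 (by simp [Function.update])
      (stretch_stages _ (Or.inr (Or.inl rfl))) (hm0 p hp)
  have h0 : EmbOn (armStretch 0 (-stretchConst)) (solid fun _ => 5) :=
    (embOn_armStretch 0 abs_stretchConst.2).mono fun p hp => hp.1 0
  have h1 := (embOn_armStretch 1 abs_stretchConst.1).comp h0 fun p hp => by
    have := (hm0 p hp).1 1
    simpa [Function.update] using this
  exact (embOn_armStretch 2 abs_stretchConst.1).comp h1 fun p hp => by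
    have := (hm1 p hp).1 2
    simpa [Function.update] using this

/-- The section of the solid where the coordinate `x k` has the value `ℓ`. -/
def endAt (k : Fin 3) (ℓ : ℝ) (v : ℂ) : (Fin 3 → ℝ) × ℝ :=
  (if k = 0 then ![ℓ, (9 - ℓ) / 2 * (1 - v.im), (9 - ℓ) / 2 * (1 + v.im)] else
    if k = 1 then ![(9 - ℓ) / 2 * (1 - v.im), ℓ, (9 - ℓ) / 2 * (1 + v.im)]
    else ![(9 - ℓ) / 2 * (1 + v.im), (9 - ℓ) / 2 * (1 - v.im), ℓ],
    √(ℓ / 5) * ((9 - ℓ) / 2) * v.re)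

lemma endMap_eq (k : Fin 3) (v : ℂ) : endMap k v = endAt k 5 v := by
  refine Prod.ext (funext fun l => ?_) ?_
  · fin_cases k <;> fin_cases l <;> simp [endMap, endAt] <;> ring
  · simp only [endMap, endAt]
    norm_num

lemma armStretch_endMap (k : Fin 3) (c : ℝ) (v : ℂ) :
    armStretch k c (endMap k v) = endAt k (5 + 5 * c) v := by
  have e : (endMap k v).1 k = 5 := by fin_cases k <;> simp [endMap]
  have hn : shrinkFactor c 5 = (9 - (5 + 5 * c)) / 4 := by
    unfold shrinkFactor
    rw [stretchFactor_five]
    ring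
  refine Prod.ext (funext fun l => ?_) ?_
  · by_cases hl : l = k
    · rw [hl, armStretch_self, e, stretchFactor_five]
      fin_cases k <;> simp [endAt] <;> ring
    · rw [armStretch_ne hl, e, hn]
      fin_cases k <;> fin_cases l <;> simp [endAt, endMap] at hl ⊢ <;> ring
  · simp only [armStretch, e, hn, stretchFactor_five]
    simp only [endAt, endMap]
    rw [show (5 + 5 * c) / 5 = 1 + c by ring]
    ring

lemma endAt_le {k l : Fin 3} (hl : l ≠ k) {ℓ : ℝ} (hℓ : 9 / 2 ≤ ℓ) (hℓ' : ℓ ≤ 9) {v : ℂ}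
    (hv : ‖v‖ ≤ 1) : (endAt k ℓ v).1 l ≤ 9 / 2 := by
  have h := im_mem_Icc hv
  fin_cases k <;> fin_cases l <;> simp [endAt] at hl ⊢ <;> nlinarith [h.1, h.2]

/-- On the end `k` the other coordinates are at most `9 / 2`, so only the stretch of that arm moves
it. -/
lemma stretch_endMap {v : ℂ} (hv : ‖v‖ ≤ 1) :
    stretch (endMap 0 v) = endAt 0 (5 - eps) v ∧ stretch (endMap 1 v) = endAt 1 (5 + eps) v ∧
    stretch (endMap 2 v) = endAt 2 (5 + eps) v := by
  have h1 := eps_pos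
  have h2 := eps_le
  have e : 5 * stretchConst = eps := rfl
  have h5 : ∀ k l, l ≠ k → (endMap k v).1 l ≤ 9 / 2 := fun k l hl => by
    rw [endMap_eq]
    exact endAt_le hl (by norm_num) (by norm_num) hv
  have hm : ∀ k l, l ≠ k → (endAt k (5 - eps) v).1 l ≤ 9 / 2 := fun k l hl =>
    endAt_le hl (by linarith) (by linarith) hv
  have hp : ∀ k l, l ≠ k → (endAt k (5 + eps) v).1 l ≤ 9 / 2 := fun k l hl =>
    endAt_le hl (by linarith) (by linarith) hv
  unfold stretch
  refine ⟨?_, ?_, ?_⟩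
  · rw [armStretch_endMap, mul_neg, e, ← sub_eq_add_neg, armStretch_of_le (hm 0 1 (by decide)),
      armStretch_of_le (hm 0 2 (by decide))]
  · rw [armStretch_of_le (h5 1 0 (by decide)), armStretch_endMap, e,
      armStretch_of_le (hp 1 2 (by decide))]
  · rw [armStretch_of_le (h5 2 0 (by decide)), armStretch_of_le (h5 2 1 (by decide)),
      armStretch_endMap, e]

/-- This identifies the ends of the solid, placed in `ℂ²`, with the sections of the slabs, and
thereby the parametrizations of the faces on the two sides. -/
lemma place_endAt_side (t : ℝ) (v w : ℂ) :
    place (endAt 2 (sideLevel t) v, w) = (sideZ 1 (v, t), sideQ 1 (v, t) • w) ∧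
    place (endAt 1 (sideLevel t) v, w) = (sideZ (-1) (v, t), sideQ (-1) (v, t) • w) := by
  have e : (9 - sideLevel t) / 2 = halfSum t := by linarith [sideLevel_add t]
  constructor
  · simp only [place, endAt, e, sideZ, sideQ]
    refine Prod.ext (Complex.ext ?_ ?_) ?_ <;> simp
  · simp only [place, endAt, e, sideZ, sideQ]
    refine Prod.ext (Complex.ext ?_ ?_) ?_ <;> simp [sub_eq_add_neg, add_comm]

lemma place_endAt_belt (t : ℝ) (v w : ℂ) :
    place (endAt 0 (7 - beltHeight t) v, w) = (beltZ (v, t), beltHeight t • w) := by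
  simp only [place, endAt, beltZ]
  refine Prod.ext (Complex.ext ?_ ?_) ?_ <;> simp <;> ring

end Stretch

/-! ### The second Y-product. -/

section SecondProduct

lemma isCompact_circle_disc : IsCompact {p : ℂ × ℂ | ‖p.1‖ = 1 ∧ ‖p.2‖ ≤ 1} := by
  have e : {p : ℂ × ℂ | ‖p.1‖ = 1 ∧ ‖p.2‖ ≤ 1} =
      Metric.sphere (0 : ℂ) 1 ×ˢ Metric.closedBall (0 : ℂ) 1 := by
    ext p
    simp
  rw [e]
  exact (isCompact_sphere 0 1).prod (isCompact_closedBall 0 1)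

lemma cap_sqrt_pos {y : ℝ} (hy : 0 ≤ y) : 0 < √((3 + y) / (4 * (1 + y))) := by
  positivity

lemma embOn_cap : EmbOn (fun p : ℂ × ℂ => (cap p.2, p.1)) {p | 0 ≤ p.2.im} := by
  refine EmbOn.of_leftInvOn
    (fun q => (q.2, ⟨q.1.re / √((3 + (2 * q.1.im - 1)) / (4 * (1 + (2 * q.1.im - 1)))),
      2 * q.1.im - 1⟩)) ?_ ?_ ?_
  · rintro ⟨u, z⟩ hz
    have hz : 0 ≤ z.im := hz
    have h1 : 4 * (1 + z.im) ≠ 0 := by positivity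
    have h2 : (3 + z.im) / (4 * (1 + z.im)) ≠ 0 := by positivity
    unfold cap
    fun_prop (disch := first | assumption | norm_num)
  · rintro ⟨u, z⟩ hz
    have hz : 0 ≤ z.im := hz
    have e : 2 * (cap z).im - 1 = z.im := by simp only [cap]; ring
    have h1 : 4 * (1 + (2 * (cap z).im - 1)) ≠ 0 := by rw [e]; positivity
    have h2 : (3 + (2 * (cap z).im - 1)) / (4 * (1 + (2 * (cap z).im - 1))) ≠ 0 := by
      rw [e]; positivity
    have h3 : √((3 + (2 * (cap z).im - 1)) / (4 * (1 + (2 * (cap z).im - 1)))) ≠ 0 := by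
      rw [e]; exact (cap_sqrt_pos hz).ne'
    fun_prop (disch := first | assumption | norm_num)
  · rintro ⟨u, z⟩ hz
    have hz : 0 ≤ z.im := hz
    have e : 2 * (cap z).im - 1 = z.im := by simp only [cap]; ring
    have h3 := (cap_sqrt_pos hz).ne'
    refine Prod.ext rfl (Complex.ext ?_ e)
    change (cap z).re / √((3 + (2 * (cap z).im - 1)) / (4 * (1 + (2 * (cap z).im - 1)))) = z.re
    rw [e]
    change z.re * √((3 + z.im) / (4 * (1 + z.im))) / √((3 + z.im) / (4 * (1 + z.im))) = z.re
    field_simp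

lemma cap_surj {τ : ℂ} (hτ : τ ∈ segment) : ∃ z : ℂ, ‖z‖ ≤ 1 ∧ 0 ≤ z.im ∧ cap z = τ := by
  obtain ⟨h1, h2⟩ := hτ
  have hy : 0 ≤ 2 * τ.im - 1 := by linarith
  have h3 := cap_sqrt_pos hy
  have h4 := Real.sq_sqrt (show 0 ≤ (3 + (2 * τ.im - 1)) / (4 * (1 + (2 * τ.im - 1))) by positivity)
  refine ⟨⟨τ.re / √((3 + (2 * τ.im - 1)) / (4 * (1 + (2 * τ.im - 1)))), 2 * τ.im - 1⟩, ?_, hy, ?_⟩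
  · rw [norm_le_one_iff] at h1 ⊢
    simp only []
    rw [div_pow, h4]
    have h5 : 0 < 1 + τ.im := by linarith
    have h6 : 0 < τ.im := by linarith
    have e : τ.re ^ 2 / ((3 + (2 * τ.im - 1)) / (4 * (1 + (2 * τ.im - 1)))) =
        τ.re ^ 2 * (4 * τ.im / (1 + τ.im)) := by
      have : (3 + (2 * τ.im - 1)) ≠ 0 := by linarith
      have : (1 + (2 * τ.im - 1)) ≠ 0 := by linarith
      field_simp
      ring
    have h7 : τ.re ^ 2 * (4 * τ.im / (1 + τ.im)) ≤ (1 - τ.im ^ 2) * (4 * τ.im / (1 + τ.im)) :=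
      mul_le_mul_of_nonneg_right (by linarith) (by positivity)
    have h8 : (1 - τ.im ^ 2) * (4 * τ.im / (1 + τ.im)) = (1 - τ.im) * (4 * τ.im) := by
      field_simp
      ring
    rw [e]
    nlinarith
  · refine Complex.ext ?_ ?_
    · simp only [cap]
      field_simp
    · simp only [cap]
      ring

lemma cap_mem {z : ℂ} (hz : ‖z‖ ≤ 1) (h : 0 ≤ z.im) : cap z ∈ segment :=
  ⟨norm_cap_le hz h, by simp only [cap]; linarith⟩

lemma place_stretched_mem {p : (Fin 3 → ℝ) × ℝ} (hp : p ∈ solid stretchBound) {u : ℂ}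
    (hu : ‖u‖ = 1) : place (p, u) ∈ waistData.carrier := by
  obtain ⟨x, ξ⟩ := p
  obtain ⟨h1, h2, h3⟩ := hp
  have he := eps_pos
  have he' := eps_le
  have h0 : x 0 ≤ 5 - eps := (h1 0).2
  have h7 : x 0 ≠ 7 := by linarith
  have hn : ‖(place ((x, ξ), u)).2‖ = 7 - x 0 := norm_smul_unit (by linarith) hu
  obtain ⟨e1, e2, -⟩ := lev_place (ξ := ξ) u h2 h7
  have l1 : lev 1 (place ((x, ξ), u)).1 ‖(place ((x, ξ), u)).2‖ ≤ 5 + eps := by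
    rw [hn, e1]; exact (h1 2).2
  have l2 : lev (-1) (place ((x, ξ), u)).1 ‖(place ((x, ξ), u)).2‖ ≤ 5 + eps := by
    rw [hn, e2]; exact (h1 1).2
  have hw : 0 ≤ wallAt (place ((x, ξ), u)) := by
    unfold wallAt
    rw [hn, wallFun_place u h2 h7]
    exact sub_nonneg.2 h3
  refine mem_waistData.2 ⟨⟨hw, l1, l2, ?_⟩, ?_⟩
  · exact norm_sq_le_one_of_two_le ⟨by linarith, by linarith⟩ hw (by linarith)
  · unfold waistFun
    linarith

lemma exists_place_stretched {y : ℂ × ℂ} (hy : y ∈ waistData.carrier) :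
    ∃ p ∈ solid stretchBound, ∃ u : ℂ, ‖u‖ = 1 ∧ place (p, u) = y := by
  obtain ⟨hb, hw⟩ := mem_waistData.1 hy
  have he := eps_pos
  have hq : 2 + eps ≤ ‖y.2‖ := by unfold waistFun at hw; linarith
  have hq0 : ‖y.2‖ ≠ 0 := by linarith
  obtain ⟨h0, h1, h2⟩ := body_nonneg hb
  refine ⟨coords y.1 ‖y.2‖, ⟨?_, coords_sum _ _, ?_⟩, (1 / ‖y.2‖) • y.2, ?_, ?_⟩
  · intro k
    fin_cases k
    · exact ⟨h0, show 7 - ‖y.2‖ ≤ 5 - eps by linarith⟩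
    · exact ⟨h2, hb.2.2.1⟩
    · exact ⟨h1, hb.2.1⟩
  · have := hexFun_coords y.1 ‖y.2‖
    have h3 : 0 ≤ wallFun y.1 ‖y.2‖ := hb.1
    linarith
  · rw [norm_smul, Real.norm_of_nonneg (by positivity)]
    field_simp
  · rw [place_coords hq0, smul_smul, mul_one_div_cancel hq0, one_smul]

lemma abs_re_le_one {z : ℂ} (hz : ‖z‖ ≤ 1) : z.re ∈ Icc (-1 : ℝ) 1 :=
  abs_le.1 ((Complex.abs_re_le_norm z).trans hz)

/-- The domain is the stretched solid times the circle of directions of `w`. In each cross section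
`cap` identifies the half-disc with the segment cut off by the neck. -/
theorem isYProduct_waistData : IsYProduct double₂ waistData.relCob := by
  refine isYProduct_of double₂ waistData (Φ := fun p => place (stretch p.1, p.2))
    (S := (solid fun _ => 5) ×ˢ {u : ℂ | ‖u‖ = 1}) (a := fun e => e.2.re) (b := fun e => cap e.2)
    (c := fun e => e.1) (v := fun x => x.2) (f := fun x => x.1) ?_ ?_ ?_ ?_ ?_ ?_ ?_ ?_ ?_ ?_ ?_
    ?_ ?_ ?_ ?_ ?_ ?_ ?_ ?_ ?_ ?_ ?_
  · refine embOn_place_circle.comp (embOn_stretch.prodMap (embOn_id {u : ℂ | ‖u‖ = 1})) ?_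
    rintro ⟨p, u⟩ ⟨hp, hu⟩
    have h := stretch_mem hp
    refine ⟨⟨h.2.1, ?_⟩, hu⟩
    have h0 : (stretch p).1 0 ≤ 5 - eps := (h.1 0).2
    have := eps_pos
    change (stretch p).1 0 < 7
    linarith
  · rintro ⟨p, u⟩ ⟨hp, hu⟩
    exact place_stretched_mem (stretch_mem hp) hu
  · intro y hy
    obtain ⟨p, hp, u, hu, rfl⟩ := exists_place_stretched hy
    obtain ⟨p', hp', rfl⟩ := stretch_surj hp
    exact ⟨(p', u), ⟨hp', hu⟩, rfl⟩
  · have e : double₂.M = {p : ℂ × ℂ | ‖p.1‖ = 1 ∧ ‖p.2‖ ≤ 1} ∩ {p | 0 ≤ p.2.im} := by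
      ext p
      exact ⟨fun h => ⟨⟨h.1, h.2.1⟩, h.2.2⟩, fun h => ⟨h.1.1, h.1.2, h.2⟩⟩
    rw [e]
    exact isCompact_circle_disc.inter_right
      (isClosed_le continuous_const (Complex.continuous_im.comp continuous_snd))
  · have e : double₂.N = {p : ℂ × ℂ | ‖p.1‖ = 1 ∧ ‖p.2‖ ≤ 1} ∩ {p | p.2.im = 0} := by
      ext p
      exact ⟨fun h => ⟨⟨h.1, h.2.1⟩, h.2.2⟩, fun h => ⟨h.1.1, h.1.2, h.2⟩⟩
    rw [e]
    exact isCompact_circle_disc.inter_right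
      (isClosed_eq (Complex.continuous_im.comp continuous_snd) continuous_const)
  · refine EmbOn.of_leftInvOn (fun q => (q.2, ⟨q.1, 0⟩)) (fun _ _ => by fun_prop)
      (fun _ _ => by fun_prop) ?_
    rintro ⟨u, z⟩ ⟨-, -, hz⟩
    exact Prod.ext rfl (Complex.ext rfl hz.symm)
  · exact embOn_cap.mono fun p hp => hp.2.2
  · exact fun e he => abs_re_le_one he.2.1
  · exact fun e he => cap_mem he.2.1 he.2.2
  · exact fun e he x hx => ⟨neckMap_mem (abs_re_le_one he.2.1) hx, he.1⟩
  · exact fun i e he s hs => ⟨capMap_mem (cap_mem he.2.1 he.2.2) hs, he.1⟩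
  · intro n hn x hx w hw
    refine ⟨(w, (n : ℂ)), ⟨hw.2, ?_, Complex.ofReal_im n⟩, Complex.ofReal_re n, rfl⟩
    change ‖(n : ℂ)‖ ≤ 1
    rw [Complex.norm_real]
    exact abs_le.2 hn
  · intro i τ hτ s hs w hw
    obtain ⟨z, hz, hz', rfl⟩ := cap_surj hτ
    exact ⟨(w, z), ⟨hw.2, hz, hz'⟩, rfl, rfl⟩
  · exact fun p hp => hp.1
  · rintro ⟨u, z⟩ ⟨-, -, -⟩ ⟨u', z'⟩ ⟨-, -, hz'⟩ h1 h2 h3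
    have h0 : z.im = 0 := by simp only [cap] at h1; linarith
    refine Prod.ext h3 (Complex.ext ?_ (h0.trans hz'.symm))
    simp only [cap, h0] at h2
    norm_num at h2
    exact h2
  · rintro ⟨u, z⟩ ⟨-, -, hz⟩
    have hz : z.im = 0 := hz
    simp only [cap, hz]
    norm_num
  · rintro ⟨u, v⟩ ⟨hu, hv⟩
    refine ((sideSlab 1 sigma_one).start_eq u v).trans ?_
    have h := (place_endAt_side 0 v u).1
    rw [show sideLevel 0 = 5 + eps by unfold sideLevel; ring, ← (stretch_endMap hv).2.2] at h
    exact h.symm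
  · rintro ⟨u, v⟩ ⟨hu, hv⟩
    refine ((sideSlab (-1) sigma_neg_one).start_eq u v).trans ?_
    have h := (place_endAt_side 0 v u).2
    rw [show sideLevel 0 = 5 + eps by unfold sideLevel; ring, ← (stretch_endMap hv).2.1] at h
    exact h.symm
  · rintro ⟨u, v⟩ ⟨hu, hv⟩
    refine (beltSlab.start_eq u v).trans ?_
    have h := place_endAt_belt 0 v u
    rw [show 7 - beltHeight 0 = 5 - eps by unfold beltHeight; ring, ← (stretch_endMap hv).1] at h
    exact h.symm
  · exact fun m => ⟨rfl, rfl⟩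
  · exact fun m => ⟨rfl, rfl⟩
  · exact fun n s => ⟨rfl, rfl⟩

end SecondProduct

/-! ### The first Y-product. -/

section FirstProduct

/-- The arc of the circle that parametrizes half of the longitude. -/
def arc (t : ℝ) : ℂ := Complex.exp ((Real.pi / 4 + t * (Real.pi / 2) : ℝ) * Complex.I)

lemma exp_mul_I_eq (θ : ℝ) : Complex.exp (θ * Complex.I) = ⟨Real.cos θ, Real.sin θ⟩ :=
  Complex.ext (Complex.exp_ofReal_mul_I_re θ) (Complex.exp_ofReal_mul_I_im θ)

lemma norm_arc (t : ℝ) : ‖arc t‖ = 1 := Complex.norm_exp_ofReal_mul_I _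

lemma sqrt_two_div_two_sq : (√2 / 2) ^ 2 = (1 / 2 : ℝ) := by
  rw [div_pow, Real.sq_sqrt zero_le_two]; norm_num

/-- The angle `π / 4`, where the arcs of the circle end, goes to the height `1 / 2`, where the
segments of the disc end. -/
lemma twistIm_sqrt : twistIm 1 (√2 / 2) = 1 / 2 := by
  have hp := Real.pi_pos
  rw [twistIm_of_sq_le sqrt_two_div_two_sq.le, ← Real.sin_pi_div_four,
    Real.arcsin_sin (by linarith) (by linarith)]
  field_simp
  norm_num

lemma twistIm_ge_iff {y : ℝ} (hy : y ∈ Icc (-1 : ℝ) 1) : 1 / 2 ≤ twistIm 1 y ↔ √2 / 2 ≤ y := by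
  have h : √2 / 2 ∈ Icc (-1 : ℝ) 1 := by
    have := sqrt_two_div_two_sq
    constructor <;> nlinarith [Real.sqrt_nonneg 2]
  rw [← twistIm_sqrt]
  exact (strictMonoOn_twistIm one_mem_Icc).le_iff_le h hy

/-- Near the real axis, the twist takes angles to heights. -/
lemma twist_near {θ : ℝ} (hθ : |θ| ≤ Real.pi / 4) (ε : ℝ) :
    twist 1 ⟨ε * Real.cos θ, Real.sin θ⟩ = ⟨ε * √(1 - (2 / Real.pi * θ) ^ 2), 2 / Real.pi * θ⟩ := by
  have hp := Real.pi_pos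
  obtain ⟨h1, h2⟩ := abs_le.1 hθ
  have hc : √2 / 2 ≤ Real.cos θ := by
    rw [← Real.cos_pi_div_four, ← Real.cos_abs θ]
    exact Real.cos_le_cos_of_nonneg_of_le_pi (abs_nonneg _) (by linarith) hθ
  have hs : Real.sin θ ^ 2 ≤ 1 / 2 := by
    have h3 := Real.sin_sq_add_cos_sq θ
    have h4 := sqrt_two_div_two_sq
    nlinarith [Real.sqrt_nonneg 2]
  have him : twistIm 1 (Real.sin θ) = 2 / Real.pi * θ := by
    rw [twistIm_of_sq_le hs, Real.arcsin_sin (by linarith) (by linarith)]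
  refine Complex.ext ?_ him
  have hy : Real.sin θ ∈ Icc (-1 : ℝ) 1 := ⟨Real.neg_one_le_sin θ, Real.sin_le_one θ⟩
  change ε * Real.cos θ * √(twistFactor 1 (Real.sin θ)) = ε * √(1 - (2 / Real.pi * θ) ^ 2)
  rw [← him, one_sub_twistIm_sq, mul_assoc, ← Real.cos_sq', Real.sqrt_mul (sq_nonneg _),
    Real.sqrt_sq (by linarith [Real.sqrt_nonneg 2])]

lemma twist_arc_end {t : ℝ} (ht : t = 0 ∨ t = 1) :
    twist 1 (arc t) = ⟨(1 - 2 * t) * √(3 / 4), 1 / 2⟩ := by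
  have hp := Real.pi_pos
  have e : 2 / Real.pi * (Real.pi / 4) = 1 / 2 := by field_simp; norm_num
  have h0 : |Real.pi / 4| ≤ Real.pi / 4 := (abs_of_pos (by positivity)).le
  rcases ht with rfl | rfl
  · have h := twist_near h0 1
    rw [e, one_mul] at h
    rw [arc, exp_mul_I_eq, zero_mul, add_zero, h]
    norm_num
  · have h := twist_near h0 (-1)
    rw [e] at h
    rw [arc, exp_mul_I_eq, show Real.pi / 4 + 1 * (Real.pi / 2) = Real.pi - Real.pi / 4 by ring,
      Real.cos_pi_sub, Real.sin_pi_sub, ← neg_one_mul, h]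
    norm_num

lemma arc_angle_mem {t : ℝ} (ht : t ∈ Icc (0 : ℝ) 1) :
    Real.pi / 4 ≤ Real.pi / 4 + t * (Real.pi / 2) ∧
    Real.pi / 4 + t * (Real.pi / 2) ≤ Real.pi - Real.pi / 4 := by
  have hp := Real.pi_pos
  constructor <;> nlinarith [ht.1, ht.2]

lemma arc_im {t : ℝ} (ht : t ∈ Icc (0 : ℝ) 1) : √2 / 2 ≤ (arc t).im := by
  obtain ⟨h1, h2⟩ := arc_angle_mem ht
  have hp := Real.pi_pos
  rw [arc, Complex.exp_ofReal_mul_I_im, ← Real.sin_pi_div_four]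
  rcases le_total (Real.pi / 4 + t * (Real.pi / 2)) (Real.pi / 2) with h | h
  · exact Real.sin_le_sin_of_le_of_le_pi_div_two (by linarith) h h1
  · rw [← Real.sin_pi_sub (Real.pi / 4 + t * (Real.pi / 2))]
    exact Real.sin_le_sin_of_le_of_le_pi_div_two (by linarith) (by linarith) (by linarith)

lemma arc_surj {v : ℂ} (hv : ‖v‖ = 1) (him : √2 / 2 ≤ v.im) : ∃ t ∈ Icc (0 : ℝ) 1, arc t = v := by
  have hp := Real.pi_pos
  rw [norm_eq_one_iff] at hv
  have hre : v.re ^ 2 ≤ (√2 / 2) ^ 2 := by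
    have := sqrt_two_div_two_sq
    nlinarith [Real.sqrt_nonneg 2]
  obtain ⟨h1, h2⟩ := abs_le.1 (abs_le_of_sq_le_sq hre (by positivity))
  have h1' : -1 ≤ v.re := by nlinarith [sq_nonneg v.im]
  have h2' : v.re ≤ 1 := by nlinarith [sq_nonneg v.im]
  have a1 : Real.pi / 4 ≤ Real.arccos v.re := by
    rw [← Real.arccos_cos (x := Real.pi / 4) (by linarith) (by linarith), Real.cos_pi_div_four]
    exact Real.antitone_arccos h2
  have a2 : Real.arccos v.re ≤ Real.pi - Real.pi / 4 := by
    rw [← Real.arccos_cos (x := Real.pi - Real.pi / 4) (by linarith) (by linarith),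
      Real.cos_pi_sub, Real.cos_pi_div_four]
    exact Real.antitone_arccos h1
  refine ⟨(Real.arccos v.re - Real.pi / 4) / (Real.pi / 2), ⟨?_, ?_⟩, ?_⟩
  · exact div_nonneg (by linarith) (by linarith)
  · rw [div_le_one (by linarith)]; linarith
  · rw [arc, exp_mul_I_eq, div_mul_cancel₀ _ (by linarith : Real.pi / 2 ≠ 0),
      add_sub_cancel]
    refine Complex.ext (Real.cos_arccos h1' h2') ?_
    change Real.sin (Real.arccos v.re) = v.im
    rw [Real.sin_arccos, show 1 - v.re ^ 2 = v.im ^ 2 by linarith,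
      Real.sqrt_sq (by linarith [Real.sqrt_nonneg 2])]

lemma embOn_arc : EmbOn arc (Icc 0 1) := by
  have hp := Real.pi_pos
  refine EmbOn.of_leftInvOn
    (fun v : ℂ => (Real.arccos v.re - Real.pi / 4) / (Real.pi / 2)) ?_ ?_ ?_
  · intro t _
    refine ContDiff.smoothNear ?_ t
    unfold arc
    refine ContDiff.cexp (ContDiff.mul ?_ contDiff_const)
    have h : ContDiff ℝ ∞ fun t : ℝ => Real.pi / 4 + t * (Real.pi / 2) := by fun_prop
    exact Complex.ofRealCLM.contDiff.comp h
  · intro t ht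
    have h1 := arc_im ht
    have h2 := (norm_eq_one_iff _).1 (norm_arc t)
    have h3 := sqrt_two_div_two_sq
    have h4 := Real.sqrt_nonneg 2
    have h5 : SmoothNear Real.arccos (arc t).re := by
      have hne : (arc t).re ^ 2 < 1 := by nlinarith
      have ho : IsOpen {x : ℝ | x ^ 2 < 1} := isOpen_lt (by fun_prop) continuous_const
      filter_upwards [ho.mem_nhds hne] with x hx
      have hx : x ^ 2 < 1 := hx
      exact Real.contDiffAt_arccos (by rintro rfl; norm_num at hx) (by rintro rfl; norm_num at hx)
    have h6 : SmoothNear (fun v : ℂ => Real.arccos v.re) (arc t) :=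
      SmoothNear.comp_fun (g := Real.arccos) (f := fun v : ℂ => v.re) h5 (by fun_prop)
    have h7 : Real.pi / 2 ≠ 0 := by positivity
    fun_prop (disch := assumption)
  · intro t ht
    obtain ⟨h1, h2⟩ := arc_angle_mem ht
    rw [arc, Complex.exp_ofReal_mul_I_re, Real.arccos_cos (by linarith) (by linarith),
      add_sub_cancel_left]
    field_simp

lemma twist_arc_mem {t : ℝ} (ht : t ∈ Icc (0 : ℝ) 1) :
    twist 1 (arc t) ∈ segment ∧ ‖twist 1 (arc t)‖ = 1 := by
  have h := (norm_twist_eq_one_iff one_mem_Icc (norm_arc t).le).2 (norm_arc t)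
  exact ⟨⟨h.le, (twistIm_ge_iff (im_mem_Icc (norm_arc t).le)).2 (arc_im ht)⟩, h⟩

lemma twist_arc_surj {τ : ℂ} (hτ : τ ∈ segment) (h : ‖τ‖ = 1) :
    ∃ t ∈ Icc (0 : ℝ) 1, twist 1 (arc t) = τ := by
  obtain ⟨v, hv, rfl⟩ := twist_surj one_mem_Icc hτ.1
  have hv1 := (norm_twist_eq_one_iff one_mem_Icc hv).1 h
  obtain ⟨t, ht, rfl⟩ := arc_surj hv1 ((twistIm_ge_iff (im_mem_Icc hv)).1 hτ.2)
  exact ⟨t, ht, rfl⟩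

/-- Inside the ellipse the wall function is positive at the section `lev σ = 5`. By monotonicity it
is positive at all smaller heights on the ray, so it could not vanish at `q`. -/
lemma cone_nonneg_of_wall {σ : ℝ} (hσ : σ = 1 ∨ σ = -1) {z : ℂ} {q : ℝ} (hq : 0 < q)
    (hw : wallFun z q = 0) (hl : lev σ z q ≤ 5) : 0 ≤ cone σ z := by
  by_contra! h
  obtain ⟨h1, h2, -⟩ := cone_nonpos hσ h.le
  have hm : 0 < 1 - 2 * σ * z.im := by linarith
  have l1 := lev_section hm
  have l2 := lev_add' σ z (8 / (1 - 2 * σ * z.im))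
  have hc := wallFun_cone hσ hm
  set Q := 8 / (1 - 2 * σ * z.im) with hQ
  have hQ0 : 0 < Q := by positivity
  have hQ7 : 0 ≤ 7 - Q := by
    rw [sub_nonneg, hQ, div_le_iff₀ hm]; linarith
  have hQ3 : 3 ≤ Q := by rw [hQ, le_div_iff₀ hm]; linarith
  have hpos : 0 < wallFun z Q := by
    rw [hc]
    have : 0 < Q ^ 2 * -cone σ z := mul_pos (by positivity) (by linarith)
    linarith
  have hqQ : q ≤ Q := by
    rw [hQ, le_div_iff₀ hm]
    unfold lev at hl
    linarith
  rcases hqQ.eq_or_lt with e | hlt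
  · rw [e] at hw; linarith
  · have hlev : 0 ≤ lev 1 z Q ∧ 0 ≤ lev (-1) z Q := by
      rcases hσ with rfl | rfl
      · exact ⟨by linarith, by linarith⟩
      · rw [neg_neg] at l2
        exact ⟨by linarith, by linarith⟩
    have := wallFun_strictAnti hq hlt hQ7 hlev.1 hlev.2
    rw [hw, mul_zero] at this
    have : 0 < q ^ 2 * wallFun z Q := by positivity
    linarith

lemma place_boundary_mem {p : (Fin 3 → ℝ) × ℝ} (hp : p ∈ solid fun _ => 5)
    (hw : p.2 ^ 2 = hexFun p.1) {w : ℂ} (hw1 : ‖w‖ ≤ 1) : place (p, w) ∈ coneData.carrier := by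
  obtain ⟨x, ξ⟩ := p
  obtain ⟨h1, h2, -⟩ := hp
  have he := eps_pos
  have h0 : x 0 ≤ 5 := (h1 0).2
  have h7 : x 0 ≠ 7 := by linarith
  have hq : 0 < 7 - x 0 := by linarith
  have hn : ‖(place ((x, ξ), (1 : ℂ))).2‖ = 7 - x 0 := norm_smul_unit hq norm_one
  have ez : (place ((x, ξ), (1 : ℂ))).1 = (place ((x, ξ), w)).1 := rfl
  obtain ⟨e1, e2, -⟩ := lev_place (ξ := ξ) w h2 h7
  have hwall := wallFun_place (ξ := ξ) w h2 h7
  rw [← show ξ ^ 2 = hexFun x from hw, sub_self] at hwall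
  have l1 : lev 1 (place ((x, ξ), w)).1 (7 - x 0) ≤ 5 := by rw [e1]; exact (h1 2).2
  have l2 : lev (-1) (place ((x, ξ), w)).1 (7 - x 0) ≤ 5 := by rw [e2]; exact (h1 1).2
  have hw0 : 0 ≤ wallAt (place ((x, ξ), (1 : ℂ))) := by
    unfold wallAt
    rw [hn, ez, hwall]
  have hb : place ((x, ξ), (1 : ℂ)) ∈ body := by
    refine ⟨hw0, ?_, ?_, ?_⟩
    · rw [hn, ez]; linarith
    · rw [hn, ez]; linarith
    · refine norm_sq_le_one_of_two_le ⟨?_, ?_⟩ hw0 (by linarith)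
      · rw [hn, ez]; linarith
      · rw [hn, ez]; linarith
  refine mem_coneData.2 ⟨?_, cone_nonneg_of_wall sigma_one hq hwall l1,
    cone_nonneg_of_wall sigma_neg_one hq hwall l2⟩
  refine (body_down (z := (place ((x, ξ), w)).1) (w' := (place ((x, ξ), (1 : ℂ))).2) hb ?_).1
  rw [hn]
  change ‖(7 - x 0) • w‖ ≤ 7 - x 0
  rw [norm_smul, Real.norm_of_nonneg hq.le]
  exact mul_le_of_le_one_right hq.le hw1

lemma lev_le_of_le {σ q q' c : ℝ} {z : ℂ} (hq : 0 ≤ q) (hqq : q ≤ q') (hc : 1 ≤ c)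
    (h : lev σ z q' ≤ c) : lev σ z q ≤ c := by
  have e : ∀ q, lev σ z q = 1 + q * (1 / 2 - σ * z.im) := by intro q; unfold lev; ring
  rw [e] at h ⊢
  rcases le_total 0 (1 / 2 - σ * z.im) with h' | h'
  · linarith [mul_le_mul_of_nonneg_right hqq h']
  · linarith [mul_nonpos_of_nonneg_of_nonpos hq h']

/-- Far out on a ray that stays clear of the cones, the wall function is not positive. -/
lemma exists_wallFun_nonpos {z : ℂ} {q : ℝ} (hq : q ≤ 7)
    (hl : ∀ σ : ℝ, σ = 1 ∨ σ = -1 → lev σ z q ≤ 5 ∧ 0 ≤ cone σ z) :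
    ∃ Q, q ≤ Q ∧ Q ≤ 7 ∧ wallFun z Q ≤ 0 ∧ lev 1 z Q ≤ 5 ∧ lev (-1) z Q ≤ 5 := by
  -- If a level exceeds `5` at height `7`, the height where it equals `5` serves as `Q`, since there
  -- the wall function is `-Q² cone σ z`. Otherwise `Q = 7` does, where the factor `7 - q` vanishes.
  have key : ∀ σ : ℝ, σ = 1 ∨ σ = -1 → 5 < lev σ z 7 →
      ∃ Q, q ≤ Q ∧ Q ≤ 7 ∧ wallFun z Q ≤ 0 ∧ lev σ z Q ≤ 5 ∧ lev (-σ) z Q ≤ 5 := by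
    intro σ hσ h
    obtain ⟨h1, h2⟩ := hl σ hσ
    have hm : 0 < 1 - 2 * σ * z.im := by unfold lev at h; linarith
    have l1 := lev_section hm
    have l2 := lev_add' σ z (8 / (1 - 2 * σ * z.im))
    have hQ7 : 8 / (1 - 2 * σ * z.im) ≤ 7 := by
      rw [div_le_iff₀ hm]
      unfold lev at h
      linarith
    refine ⟨8 / (1 - 2 * σ * z.im), ?_, hQ7, ?_, ?_, ?_⟩
    · rw [le_div_iff₀ hm]
      unfold lev at h1
      linarith
    · rw [wallFun_cone hσ hm]
      have := mul_nonneg (sq_nonneg (8 / (1 - 2 * σ * z.im))) h2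
      linarith
    · linarith
    · linarith
  by_cases h1 : 5 < lev 1 z 7
  · exact key 1 sigma_one h1
  by_cases h2 : 5 < lev (-1) z 7
  · obtain ⟨Q, a, b, c, d, e⟩ := key (-1) sigma_neg_one h2
    rw [neg_neg] at e
    exact ⟨Q, a, b, c, e, d⟩
  · refine ⟨7, hq, le_rfl, ?_, not_lt.1 h1, not_lt.1 h2⟩
    unfold wallFun
    nlinarith [sq_nonneg (7 * z.re)]

/-- The ray through the point is followed outwards until the wall function vanishes, with all levels
still at most `5`. The search starts at height `2` at least, so that also `7 - q ≤ 5` at the point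
found. -/
lemma exists_place_boundary {y : ℂ × ℂ} (hy : y ∈ coneData.carrier) :
    ∃ p ∈ solid fun _ => 5, p.2 ^ 2 = hexFun p.1 ∧ ∃ w : ℂ, ‖w‖ ≤ 1 ∧ place (p, w) = y := by
  obtain ⟨hb, hc1, hc2⟩ := mem_coneData.1 hy
  have hcone : ∀ σ : ℝ, σ = 1 ∨ σ = -1 → 0 ≤ cone σ y.1 := by
    rintro σ (rfl | rfl)
    exacts [hc1, hc2]
  have hz : ‖y.1‖ ≤ 1 := hb.2.2.2
  have hw0 : 0 ≤ wallFun y.1 ‖y.2‖ := hb.1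
  have h7 : ‖y.2‖ ≤ 7 := by linarith [(body_nonneg hb).1]
  obtain ⟨q, hq2, hqn, hq7, hqw, hql⟩ : ∃ q, 2 ≤ q ∧ ‖y.2‖ ≤ q ∧ q ≤ 7 ∧ 0 ≤ wallFun y.1 q ∧
      ∀ σ : ℝ, σ = 1 ∨ σ = -1 → lev σ y.1 q ≤ 5 := by
    rcases le_total 2 ‖y.2‖ with h | h
    · exact ⟨‖y.2‖, h, le_rfl, h7, hw0, fun σ hσ =>
        lev_le_five hσ (body_subset_nbhd hb) hb.1 (hcone σ hσ)⟩
    · refine ⟨2, le_rfl, h, by norm_num, ?_, fun σ hσ => ?_⟩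
      · rw [wallFun_two]
        linarith [(norm_le_one_iff _).1 hz]
      · unfold lev
        linarith [(abs_sigma_im_le hσ hz).1]
  obtain ⟨Q, hQ, hQ7, hQw, hQ1, hQ2⟩ := exists_wallFun_nonpos (z := y.1) hq7
    fun σ hσ => ⟨hql σ hσ, hcone σ hσ⟩
  have hcont : Continuous (wallFun y.1) := by unfold wallFun lev; fun_prop
  obtain ⟨s, ⟨hs1, hs2⟩, hs⟩ := intermediate_value_Icc' hQ hcont.continuousOn ⟨hQw, hqw⟩
  have l1 := lev_le_of_le (by linarith) hs2 (by norm_num) hQ1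
  have l2 := lev_le_of_le (by linarith) hs2 (by norm_num) hQ2
  obtain ⟨n0, n1, n2⟩ := nonneg_of_wallFun_nonneg (z := y.1) (q := s) (by linarith) (by linarith)
    (by linarith) hs.ge
  have hs0 : 0 < s := by linarith
  have hhex := hexFun_coords y.1 s
  refine ⟨coords y.1 s, ⟨?_, coords_sum _ _, by linarith⟩, by linarith, (1 / s) • y.2, ?_, ?_⟩
  · intro k
    fin_cases k
    · exact ⟨n0, show 7 - s ≤ 5 by linarith⟩
    · exact ⟨n2, l2⟩
    · exact ⟨n1, l1⟩
  · rw [norm_smul, Real.norm_of_nonneg (by positivity), one_div, inv_mul_le_iff₀ hs0]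
    linarith
  · rw [place_coords hs0.ne', smul_smul, mul_one_div_cancel hs0.ne', one_smul]

lemma twist_neck {t s : ℝ} (ht : t = 0 ∨ t = 1) (hs : s ∈ Icc (-1 : ℝ) 1) :
    conj (twist 1 (Complex.exp
      ((t * Real.pi + (1 - 2 * t) * (s * (Real.pi / 4)) : ℝ) * Complex.I))) =
      ⟨(1 - 2 * t) * √(1 - s ^ 2 / 4), -(s / 2)⟩ := by
  have hp := Real.pi_pos
  have hθ : |s * (Real.pi / 4)| ≤ Real.pi / 4 := by
    rw [abs_mul, abs_of_pos (by positivity : 0 < Real.pi / 4)]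
    exact mul_le_of_le_one_left (by positivity) (abs_le.2 hs)
  have e : 2 / Real.pi * (s * (Real.pi / 4)) = s / 2 := by field_simp; ring
  have e2 : (s / 2) ^ 2 = s ^ 2 / 4 := by ring
  rw [exp_mul_I_eq]
  rcases ht with rfl | rfl
  · have h := twist_near hθ 1
    rw [e, e2, one_mul] at h
    rw [show 0 * Real.pi + (1 - 2 * 0) * (s * (Real.pi / 4)) = s * (Real.pi / 4) by ring, h]
    exact Complex.ext (by simp) (by simp)
  · have h := twist_near hθ (-1)
    rw [e, e2] at h
    rw [show 1 * Real.pi + (1 - 2 * 1) * (s * (Real.pi / 4)) = Real.pi - s * (Real.pi / 4) by ring,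
      Real.cos_pi_sub, Real.sin_pi_sub, ← neg_one_mul, h]
    refine Complex.ext ?_ (by simp)
    change -1 * √(1 - s ^ 2 / 4) = (1 - 2 * 1) * √(1 - s ^ 2 / 4)
    norm_num

/-- Over the lateral surface of the solid, a pair of pants, lies a disc bundle in the direction of
`w`. In each cross section the surface is a circle, which the neck meets in the two ends of a chord
and the caps in two arcs. -/
theorem isYProduct_coneData : IsYProduct double₁ coneData.relCob := by
  have hdisc : IsCompact {v : ℂ | ‖v‖ ≤ 1} := by
    have e : {v : ℂ | ‖v‖ ≤ 1} = Metric.closedBall (0 : ℂ) 1 := by ext; simp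
    rw [e]
    exact isCompact_closedBall 0 1
  have hM : EmbOn (fun e : ℝ × ℂ => (twist 1 (arc e.1), e.2)) double₁.M := by
    have h := embOn_twist_one.comp embOn_arc fun t _ => (norm_arc t).le
    exact h.prodMap (embOn_id {v : ℂ | ‖v‖ ≤ 1})
  have hN01 : ∀ e ∈ double₁.N, e.1 = 0 ∨ e.1 = 1 := fun e he => he.1
  have hend : ∀ e ∈ double₁.N, (twist 1 (arc e.1)).im = 1 / 2 ∧
      (twist 1 (arc e.1)).re = (1 - 2 * e.1) * √(3 / 4) := by
    intro e he
    rw [twist_arc_end (hN01 e he)]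
    exact ⟨rfl, rfl⟩
  have ha1 : ∀ e ∈ double₁.N, (1 - 2 * e.1) ^ 2 = 1 := by
    intro e he
    rcases hN01 e he with h | h <;> rw [h] <;> norm_num
  have ha : ∀ e ∈ double₁.N, 1 - 2 * e.1 ∈ Icc (-1 : ℝ) 1 := fun e he =>
    abs_le.1 ((sq_le_one_iff_abs_le_one _).1 (ha1 e he).le)
  refine isYProduct_of double₁ coneData (Φ := place)
    (S := {p : (Fin 3 → ℝ) × ℝ | p ∈ solid (fun _ => 5) ∧ p.2 ^ 2 = hexFun p.1} ×ˢ
      {w : ℂ | ‖w‖ ≤ 1}) (a := fun e => 1 - 2 * e.1)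
    (b := fun e => twist 1 (arc e.1)) (c := fun e => e.2) (v := fun x => conj (twist 1 x.1))
    (f := fun x => x.2) (embOn_place_disc.mono (prod_mono le_rfl (subset_univ _))) ?_ ?_
    (isCompact_Icc.prod hdisc) ((Set.toFinite {(0 : ℝ), 1}).isCompact.prod hdisc) ?_ hM
    ha ?_ ?_ ?_ ?_ ?_ ?_ ?_ hend ?_ ?_ ?_ ?_ ?_ ?_
  · rintro ⟨p, w⟩ ⟨⟨hp, hpw⟩, hw⟩
    exact place_boundary_mem hp hpw hw
  · intro y hy
    obtain ⟨p, hp, hpw, w, hw, rfl⟩ := exists_place_boundary hy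
    exact ⟨(p, w), ⟨⟨hp, hpw⟩, hw⟩, rfl⟩
  · refine EmbOn.of_leftInvOn (fun q => ((1 - q.1) / 2, q.2))
      (fun _ _ => by fun_prop) (fun _ _ => by fun_prop (disch := norm_num)) ?_
    rintro ⟨t, v⟩ -
    exact Prod.ext (by ring) rfl
  · exact fun e he => (twist_arc_mem he.1).1
  · exact fun e he x hx => ⟨⟨neckMap_mem (ha e he) hx, (neckMap_wall hx).2 (ha1 e he)⟩, he.2⟩
  · intro i e he s hs
    obtain ⟨h1, h2⟩ := twist_arc_mem he.1
    exact ⟨⟨capMap_mem h1 hs, (capMap_wall h1 hs).2 h2⟩, he.2⟩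
  · intro n hn x hx w hw
    have h := (neckMap_wall hx).1 hw.1.2
    refine ⟨((1 - n) / 2, w), ⟨?_, hw.2⟩, by ring, rfl⟩
    rcases mul_self_eq_one_iff.1 ((sq n).symm.trans h) with rfl | rfl
    · left; norm_num
    · right; norm_num
  · intro i τ hτ s hs w hw
    obtain ⟨t, ht, rfl⟩ := twist_arc_surj hτ ((capMap_wall hτ hs).1 hw.1.2)
    exact ⟨(t, w), ⟨ht, hw.2⟩, rfl, rfl⟩
  · exact fun p hp => hp.1.1
  · intro e he e' he' h1 h2 h3
    refine hM.1 he (double₁.sub he') (Prod.ext (Complex.ext ?_ ?_) h3)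
    · exact h2.trans (hend e' he').2.symm
    · exact h1.trans (hend e' he').1.symm
  · rintro ⟨u, v⟩ ⟨hu, hv⟩
    have h := (place_endAt_side 1 (twist 1 (conj u)) v).1
    rw [show sideLevel 1 = 5 by unfold sideLevel; ring, ← endMap_eq] at h
    dsimp only
    rw [← twist_conj]
    exact h.symm
  · rintro ⟨u, v⟩ ⟨hu, hv⟩
    have h := (place_endAt_side 1 (twist 1 (conj u)) v).2
    rw [show sideLevel 1 = 5 by unfold sideLevel; ring, ← endMap_eq] at h
    dsimp only
    rw [← twist_conj]
    exact h.symm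
  · rintro ⟨u, v⟩ ⟨hu, hv⟩
    have h := place_endAt_belt 1 (twist 1 (conj u)) v
    rw [show 7 - beltHeight 1 = 5 by unfold beltHeight; ring, ← endMap_eq] at h
    dsimp only
    rw [← twist_conj]
    exact h.symm
  · exact fun m => ⟨rfl, rfl⟩
  · rintro ⟨⟨t, v⟩, ht, hv⟩
    refine ⟨?_, rfl⟩
    change conj (twist 1 (Complex.exp ((-(Real.pi / 4 + t * (Real.pi / 2)) : ℝ) * Complex.I))) =
      twist 1 (arc t)
    rw [← twist_conj, ← Complex.exp_conj, arc]
    rw [map_mul, Complex.conj_ofReal, Complex.conj_I]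
    push_cast
    ring_nf
  · intro n s
    exact ⟨twist_neck (hN01 n n.2) s.2, rfl⟩

end FirstProduct

/-! ### Complex conjugation, which leads from the first identity to the second. -/

section Symmetry

variable {ι κ ρ ι' κ' : Type}

lemma smoothOn_comp {E F : Type} [NormedAddCommGroup E] [NormedSpace ℝ E] [NormedAddCommGroup F]
    [NormedSpace ℝ F] {S : Set E} {T : Set F} {φ : E → F} (hφ : ContDiff ℝ ∞ φ)
    (hST : MapsTo φ S T) {g : T → ℝ} (hg : g ∈ smoothOn T) :
    (fun x : S => g ⟨φ x, hST x.2⟩) ∈ smoothOn S := by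
  intro x
  obtain ⟨G, hG, h⟩ := hg ⟨φ x, hST x.2⟩
  have hc : Continuous fun x : S => (⟨φ x, hST x.2⟩ : T) :=
    (hφ.continuous.comp continuous_subtype_val).subtype_mk _
  exact ⟨G ∘ φ, hG.comp hφ, hc.continuousAt.eventually h⟩

lemma IsSmoothEmb.comp {A B W : Type} {CA : Set (A → ℝ)} {CB : Set (B → ℝ)} {CW : Set (W → ℝ)}
    {j : B → W} {k : A → B} (hj : IsSmoothEmb CB CW j) (hk : IsSmoothEmb CA CB k) :
    IsSmoothEmb CA CW fun x => j (k x) := by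
  intro g
  rw [hk g]
  constructor
  · rintro ⟨h, hh, rfl⟩
    obtain ⟨f, hf, rfl⟩ := (hj h).1 hh
    exact ⟨f, hf, rfl⟩
  · rintro ⟨f, hf, rfl⟩
    exact ⟨f ∘ j, (hj _).2 ⟨f, hf, rfl⟩, rfl⟩

lemma isSmoothEmb_involution {E : Type} [NormedAddCommGroup E] [NormedSpace ℝ E] {S : Set E}
    {φ : E → E} (hφ : ContDiff ℝ ∞ φ) (hS : MapsTo φ S S) (hinv : ∀ x ∈ S, φ (φ x) = x) :
    IsSmoothEmb (smoothOn S) (smoothOn S) fun x => ⟨φ x, hS x.2⟩ := by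
  intro g
  constructor
  · intro hg
    refine ⟨_, smoothOn_comp hφ hS hg, funext fun x => congrArg g (Subtype.ext (hinv x x.2))⟩
  · rintro ⟨f, hf, rfl⟩
    exact smoothOn_comp hφ hS hf

/-- Complex conjugation of both coordinates. -/
def conjPair (p : ℂ × ℂ) : ℂ × ℂ := (conj p.1, conj p.2)

lemma contDiff_conj : ContDiff ℝ ∞ (conj : ℂ → ℂ) := Complex.conjCLE.contDiff

lemma contDiff_conjPair : ContDiff ℝ ∞ conjPair :=
  (contDiff_conj.comp contDiff_fst).prodMk (contDiff_conj.comp contDiff_snd)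

lemma conjPair_conjPair (p : ℂ × ℂ) : conjPair (conjPair p) = p :=
  Prod.ext (Complex.conj_conj _) (Complex.conj_conj _)

lemma mapsTo_conjPair_solidTorus : MapsTo conjPair solidTorus solidTorus := fun _ hp =>
  ⟨(Complex.norm_conj _).trans hp.1, (Complex.norm_conj _).le.trans hp.2⟩

lemma mapsTo_conjPair_handle : MapsTo conjPair handle handle := fun _ hp =>
  ⟨(Complex.norm_conj _).le.trans hp.1, (Complex.norm_conj _).le.trans hp.2⟩

/-- Complex conjugation on the solid torus. -/
def conjX (x : X) : X := ⟨conjPair x, mapsTo_conjPair_solidTorus x.2⟩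

lemma conjX_conjX (x : X) : conjX (conjX x) = x := Subtype.ext (conjPair_conjPair x)

/-- A diffeomorphism of a disjoint union of solid tori that can be used to change the
identification of a boundary. -/
structure IsReparam (a : ι × X → ι × X) : Prop where
  surj : Function.Surjective a
  smooth : IsSmoothEmb (smoothCopies ι) (smoothCopies ι) a
  norm : ∀ p, ‖(a p).2.1.2‖ = ‖p.2.1.2‖

lemma isReparam_id : IsReparam (id : ι × X → ι × X) where
  surj := Function.surjective_id
  smooth g := ⟨fun h => ⟨g, h, rfl⟩, by rintro ⟨f, hf, rfl⟩; exact hf⟩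
  norm _ := rfl

/-- Complex conjugation on all solid tori, combined with a permutation of them. -/
def conjCopies (σ : ι → ι) (p : ι × X) : ι × X := (σ p.1, conjX p.2)

lemma conjCopies_conjCopies {σ : ι → ι} (hσ : Function.Involutive σ) (p : ι × X) :
    conjCopies σ (conjCopies σ p) = p :=
  Prod.ext (hσ _) (conjX_conjX _)

lemma isReparam_conjCopies {σ : ι → ι} (hσ : Function.Involutive σ) :
    IsReparam (conjCopies σ) where
  surj p := ⟨conjCopies σ p, conjCopies_conjCopies hσ p⟩
  smooth g := by
    have key : ∀ g ∈ smoothCopies ι, g ∘ conjCopies σ ∈ smoothCopies ι := fun g hg i =>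
      smoothOn_comp contDiff_conjPair mapsTo_conjPair_solidTorus (hg (σ i))
    constructor
    · exact fun hg => ⟨_, key g hg, funext fun p => congrArg g (conjCopies_conjCopies hσ p)⟩
    · rintro ⟨f, hf, rfl⟩
      exact key f hf
  norm _ := Complex.norm_conj _

/-- Changing the identifications of the incoming and outgoing boundary. -/
def RelCob.reparam (A : RelCob ι κ) {a : ι × X → ι × X} {b : κ × X → κ × X} (ha : IsReparam a)
    (hb : IsReparam b) : RelCob ι κ where
  W := A.W
  inc p := A.inc (a p)
  out p := A.out (b p)
  inc_emb := A.inc_emb.comp ha.smooth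
  out_emb := A.out_emb.comp hb.smooth
  disj p q := A.disj _ _
  depth_inc p := by
    rw [← ha.norm p]
    exact A.depth_inc (a p)
  depth_out p := by
    rw [← hb.norm p]
    exact A.depth_out (b p)
  depth_else w h1 h2 := A.depth_else w (by rwa [← ha.surj.range_comp A.inc])
    (by rwa [← hb.surj.range_comp A.out])

lemma RelCob.mem_wall_reparam (A : RelCob ι κ) {a : ι × X → ι × X} {b : κ × X → κ × X}
    (ha : IsReparam a) (hb : IsReparam b) (w : A.W) :
    w ∈ (A.reparam ha hb).wall ↔ w ∈ A.wall := by
  have h1 : range (A.reparam ha hb).inc = range A.inc := ha.surj.range_comp A.inc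
  have h2 : range (A.reparam ha hb).out = range A.out := hb.surj.range_comp A.out
  change (_ ∨ _ ∧ w ∉ range (A.reparam ha hb).inc ∧ w ∉ range (A.reparam ha hb).out) ↔ _
  rw [h1, h2]
  rfl

lemma involutive_id : Function.Involutive (id : ι → ι) := fun _ => rfl

/-- The cobordism with conjugated identification of the incoming boundary. -/
def RelCob.conjInc (A : RelCob ι κ) : RelCob ι κ :=
  A.reparam (isReparam_conjCopies involutive_id) isReparam_id

/-- The cobordism with conjugated identifications of both boundaries. -/
def RelCob.conjBoth (A : RelCob ι κ) : RelCob ι κ :=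
  A.reparam (isReparam_conjCopies involutive_id) (isReparam_conjCopies involutive_id)

/-- The cobordism with conjugated identifications of both boundaries, and the incoming boundaries
swapped. -/
def RelCob.conjSwap (A : RelCob (ι ⊕ ι) κ) : RelCob (ι ⊕ ι) κ :=
  A.reparam (isReparam_conjCopies (Sum.swap_swap : ∀ x : ι ⊕ ι, x.swap.swap = x))
    (isReparam_conjCopies involutive_id)

lemma IsComposite.conjInc {B : RelCob κ ρ} {A : RelCob ι κ} {W : RelCob ι ρ}
    (h : IsComposite B A W) : IsComposite B A.conjInc W.conjInc := by
  obtain ⟨jA, jB, h1, h2, h3, h4, h5, h6⟩ := h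
  exact ⟨jA, jB, h1, h2, h3, h4, fun p => h5 _, h6⟩

/-- Conjugating the identification of the middle boundary on both pieces leaves the set of glued
pairs unchanged. -/
lemma IsComposite.conjBoth {B : RelCob κ ρ} {A : RelCob ι κ} {W : RelCob ι ρ}
    (h : IsComposite B A W) : IsComposite B.conjInc A.conjBoth W.conjInc := by
  obtain ⟨jA, jB, h1, h2, h3, h4, h5, h6⟩ := h
  refine ⟨jA, jB, h1, h2, h3, fun a b => (h4 a b).trans ?_, fun p => h5 _, h6⟩
  constructor
  · rintro ⟨p, hp⟩
    refine ⟨conjCopies id p, ?_⟩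
    rw [← conjCopies_conjCopies involutive_id p] at hp
    exact hp
  · rintro ⟨p, hp⟩
    exact ⟨conjCopies id p, hp⟩

lemma IsDisjointUnion.conjInc {A : RelCob ι κ} {B : RelCob ι' κ'}
    {W : RelCob (ι ⊕ ι') (κ ⊕ κ')} (h : IsDisjointUnion A B W) :
    IsDisjointUnion A.conjInc B.conjInc W.conjInc := by
  obtain ⟨jA, jB, h1, h2, h3, h4, h5, h6, h7, h8⟩ := h
  exact ⟨jA, jB, h1, h2, h3, h4, fun i x => h5 i _, fun i x => h6 i _, h7, h8⟩

lemma isSwap_conjSwap (A : RelCob (ι ⊕ ι) κ) : IsSwap A.conjSwap A.conjBoth := by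
  refine ⟨Diffeomorph.refl _ A.W _, fun i x => ?_, fun p => rfl, fun w => ?_⟩
  · change A.inc (i, conjX x) = A.inc (i.swap.swap, conjX x)
    rw [Sum.swap_swap]
  · exact (A.mem_wall_reparam _ _ w).trans (A.mem_wall_reparam _ _ w).symm

/-- The attaching map commutes with conjugation of both coordinates, which moreover takes `beltPhi
x` to `beltPhiBar x`. After conjugating the cylinder and the handle, the outgoing identification is
thus as required, and only the incoming one has changed. -/
lemma IsHandleCobordism.conjInc {A : RelCob Unit Unit} (h : IsHandleCobordism beltPhiBar A) :
    IsHandleCobordism beltPhi A.conjInc := by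
  obtain ⟨jC, jH, h1, h2, h3, h4, h5, h6⟩ := h
  have hC : MapsTo (fun p : (ℂ × ℂ) × ℝ => (conjPair p.1, p.2)) (solidTorus ×ˢ Icc (0 : ℝ) 1)
      (solidTorus ×ˢ Icc (0 : ℝ) 1) := fun p hp => ⟨mapsTo_conjPair_solidTorus hp.1, hp.2⟩
  have hCi : ∀ p : (ℂ × ℂ) × ℝ, (conjPair (conjPair p.1), p.2) = p := fun p =>
    Prod.ext (conjPair_conjPair _) rfl
  refine ⟨fun c => jC ⟨_, hC c.2⟩, fun p => jH ⟨_, mapsTo_conjPair_handle p.2⟩,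
    IsSmoothEmb.comp h1 (isSmoothEmb_involution
      ((contDiff_conjPair.comp contDiff_fst).prodMk contDiff_snd) hC fun p _ => hCi p),
    IsSmoothEmb.comp h2 (isSmoothEmb_involution contDiff_conjPair mapsTo_conjPair_handle
      fun p _ => conjPair_conjPair p), ?_, ?_, ?_, ?_⟩
  · refine eq_univ_of_forall fun w => ?_
    rcases h3.ge (mem_univ w) with ⟨c, rfl⟩ | ⟨p, rfl⟩
    · exact Or.inl ⟨⟨_, hC c.2⟩, congrArg jC (Subtype.ext (hCi c))⟩
    · exact Or.inr ⟨⟨_, mapsTo_conjPair_handle p.2⟩,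
        congrArg jH (Subtype.ext (conjPair_conjPair p))⟩
  · intro c p
    refine (h4 _ _).trans (and_congr Iff.rfl ?_)
    exact (Function.LeftInverse.injective (g := conjPair) conjPair_conjPair).eq_iff
  · exact fun x => h5 _
  · intro x
    refine (h6 x).trans (congrArg jH (Subtype.ext ?_))
    exact Prod.ext (Complex.conj_conj _).symm rfl

/-- The reflection of the hexagon that exchanges the sides `I_1` and `I_2`. -/
def hexFlip (x : Fin 3 → ℝ) : Fin 3 → ℝ := fun k => x (Equiv.swap 1 2 k)

lemma hexFlip_hexFlip (x : Fin 3 → ℝ) : hexFlip (hexFlip x) = x := by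
  funext k
  simp [hexFlip]

lemma mapsTo_hexFlip : MapsTo hexFlip hexagon hexagon := by
  intro x hx
  refine ⟨fun k => hx.1 _, ?_⟩
  have h : x 0 + x 1 + x 2 = 3 / 2 := hx.2
  change x (Equiv.swap 1 2 0) + x (Equiv.swap 1 2 1) + x (Equiv.swap 1 2 2) = 3 / 2
  rw [Equiv.swap_apply_left, Equiv.swap_apply_right,
    Equiv.swap_apply_of_ne_of_ne (by decide) (by decide)]
  linarith

/-- The reflection of `[-1, 1]`. -/
def negIcc (s : Icc (-1 : ℝ) 1) : Icc (-1 : ℝ) 1 :=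
  ⟨-s.1, by linarith [s.2.2], by linarith [s.2.1]⟩

lemma hexFlip_hexSide (i : Fin 3) (s : Icc (-1 : ℝ) 1) :
    hexFlip (hexSide i s) = hexSide (Equiv.swap 1 2 i) (negIcc s) := by
  funext k
  fin_cases i <;> fin_cases k <;> simp [hexFlip, hexSide, negIcc, Equiv.swap_apply_def] <;> ring

lemma hexFlip_hexEnd (k : Fin 3) (s : Icc (-1 : ℝ) 1) :
    hexFlip (hexEnd k s) = hexEnd (Equiv.swap 1 2 k) (negIcc s) := by
  funext l
  fin_cases k <;> fin_cases l <;> simp [hexFlip, hexEnd, negIcc, Equiv.swap_apply_def] <;> ring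

/-- Complex conjugation of the first coordinate. -/
def conjFst (p : ℂ × ℂ) : ℂ × ℂ := (conj p.1, p.2)

lemma conjFst_conjFst (p : ℂ × ℂ) : conjFst (conjFst p) = p := Prod.ext (Complex.conj_conj _) rfl

lemma contDiff_conjFst : ContDiff ℝ ∞ conjFst :=
  (contDiff_conj.comp contDiff_fst).prodMk contDiff_snd

lemma mapsTo_conjFst_M : MapsTo conjFst double₂.M double₂.M := fun _ hp =>
  ⟨(Complex.norm_conj _).trans hp.1, hp.2⟩

lemma mapsTo_conjFst_N : MapsTo conjFst double₂.N double₂.N := fun _ hp =>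
  ⟨(Complex.norm_conj _).trans hp.1, hp.2⟩

lemma conjX_plus (m : double₂.M) :
    conjX (double₂.plus m) = double₂.minus ⟨conjFst m, mapsTo_conjFst_M m.2⟩ :=
  Subtype.ext (Prod.ext rfl (Complex.conj_conj _))

lemma conjX_minus (m : double₂.M) :
    conjX (double₂.minus m) = double₂.plus ⟨conjFst m, mapsTo_conjFst_M m.2⟩ := rfl

lemma conjX_neck (n : double₂.N) (s : Icc (-1 : ℝ) 1) :
    conjX (double₂.neck n s) = double₂.neck ⟨conjFst n, mapsTo_conjFst_N n.2⟩ (negIcc s) := by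
  refine Subtype.ext (Prod.ext rfl (Complex.ext ?_ ?_))
  · change n.1.2.re * √(1 - s.1 ^ 2 / 4) = n.1.2.re * √(1 - (-s.1) ^ 2 / 4)
    rw [neg_sq]
  · change -(-(s.1 / 2)) = -(-s.1 / 2)
    ring

/-- The hexagon is reflected so that `I_1` and `I_2` are exchanged, the strips are reversed, and the
longitude is conjugated. The reflection exchanges the two incoming ends, and at every end it
interchanges `M` and `M̄`, which conjugates the meridional coordinate. -/
theorem IsYProduct.conjSwap {A : RelCob (Unit ⊕ Unit) Unit} (h : IsYProduct double₂ A) :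
    IsYProduct double₂ A.conjSwap := by
  obtain ⟨jN, jM, h1, h2, h3, h4, h5, pL, mL, nL, pR, mR, nR, pO, mO, nO⟩ := h
  have hN : MapsTo (fun p : (ℂ × ℂ) × (Fin 3 → ℝ) => (conjFst p.1, hexFlip p.2))
      (double₂.N ×ˢ hexagon) (double₂.N ×ˢ hexagon) := fun p hp =>
    ⟨mapsTo_conjFst_N hp.1, mapsTo_hexFlip hp.2⟩
  have hM : MapsTo (fun p : (ℂ × ℂ) × ℝ => (conjFst p.1, -p.2))
      (double₂.M ×ˢ Icc (-1 : ℝ) 1) (double₂.M ×ˢ Icc (-1 : ℝ) 1) := fun p hp =>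
    ⟨mapsTo_conjFst_M hp.1, (negIcc ⟨p.2, hp.2⟩).2⟩
  have hNi : ∀ p : (ℂ × ℂ) × (Fin 3 → ℝ), (conjFst (conjFst p.1), hexFlip (hexFlip p.2)) = p :=
    fun p => Prod.ext (conjFst_conjFst _) (hexFlip_hexFlip _)
  have hMi : ∀ p : (ℂ × ℂ) × ℝ, (conjFst (conjFst p.1), - -p.2) = p :=
    fun p => Prod.ext (conjFst_conjFst _) (neg_neg _)
  have hNd : ContDiff ℝ ∞ fun p : (ℂ × ℂ) × (Fin 3 → ℝ) => (conjFst p.1, hexFlip p.2) := by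
    refine (contDiff_conjFst.comp contDiff_fst).prodMk ?_
    unfold hexFlip
    fun_prop
  have hMd : ContDiff ℝ ∞ fun p : (ℂ × ℂ) × ℝ => (conjFst p.1, -p.2) :=
    (contDiff_conjFst.comp contDiff_fst).prodMk contDiff_snd.neg
  have hjN : ∀ (n n' : ℂ × ℂ) (x x' : Fin 3 → ℝ) (h : (n, x) ∈ double₂.N ×ˢ hexagon)
      (h' : (n', x') ∈ double₂.N ×ˢ hexagon), n = n' → x = x' →
      jN ⟨(n, x), h⟩ = jN ⟨(n', x'), h'⟩ := by
    rintro n n' x x' h h' rfl rfl; rfl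
  have hjM : ∀ (i : Fin 3) (m m' : ℂ × ℂ) (s s' : ℝ) (h : (m, s) ∈ double₂.M ×ˢ Icc (-1 : ℝ) 1)
      (h' : (m', s') ∈ double₂.M ×ˢ Icc (-1 : ℝ) 1), m = m' → s = s' →
      jM i ⟨(m, s), h⟩ = jM i ⟨(m', s'), h'⟩ := by
    rintro i m m' s s' h h' rfl rfl; rfl
  refine ⟨fun p => jN ⟨_, hN p.2⟩, fun i p => jM (Equiv.swap 1 2 i) ⟨_, hM p.2⟩,
    IsSmoothEmb.comp h1 (isSmoothEmb_involution hNd hN fun p _ => hNi p),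
    fun i => IsSmoothEmb.comp (h2 _) (isSmoothEmb_involution hMd hM fun p _ => hMi p),
    ?_, ?_, ?_, ?_, ?_, ?_, ?_, ?_, ?_, ?_, ?_, ?_⟩
  · refine eq_univ_of_forall fun w => ?_
    rcases h3.ge (mem_univ w) with ⟨p, rfl⟩ | hw
    · exact Or.inl ⟨⟨_, hN p.2⟩, congrArg jN (Subtype.ext (hNi p))⟩
    · obtain ⟨i, p, rfl⟩ := mem_iUnion.1 hw
      refine Or.inr (mem_iUnion.2 ⟨Equiv.swap 1 2 i, ⟨_, hM p.2⟩, ?_⟩)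
      simp only [Equiv.swap_apply_self]
      exact congrArg (jM i) (Subtype.ext (hMi p))
  · intro i a b
    refine (h4 _ _ _).trans (and_congr ?_ ?_)
    · exact (Function.LeftInverse.injective (g := conjFst) conjFst_conjFst).eq_iff
    · have e := hexFlip_hexSide i ⟨a.1.2, a.2.2⟩
      change (hexSide (Equiv.swap 1 2 i) (negIcc ⟨a.1.2, a.2.2⟩) : Fin 3 → ℝ) = hexFlip b.1.2 ↔ _
      rw [← e]
      exact (Function.LeftInverse.injective (g := hexFlip) hexFlip_hexFlip).eq_iff
  · exact fun i i' a b hne => h5 _ _ _ _ ((Equiv.swap 1 2).injective.ne hne)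
  · intro m
    change A.inc (Sum.inr (), conjX (double₂.plus m)) = _
    rw [conjX_plus, mR]
    exact hjM _ _ _ _ _ _ _ rfl (by norm_num)
  · intro m
    change A.inc (Sum.inr (), conjX (double₂.minus m)) = _
    rw [conjX_minus, pR]
    rfl
  · intro n s
    change A.inc (Sum.inr (), conjX (double₂.neck n s)) = _
    rw [conjX_neck, nR]
    exact hjN _ _ _ _ _ _ rfl (hexFlip_hexEnd 2 s).symm
  · intro m
    change A.inc (Sum.inl (), conjX (double₂.plus m)) = _
    rw [conjX_plus, mL]
    exact hjM _ _ _ _ _ _ _ rfl (by norm_num)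
  · intro m
    change A.inc (Sum.inl (), conjX (double₂.minus m)) = _
    rw [conjX_minus, pL]
    rfl
  · intro n s
    change A.inc (Sum.inl (), conjX (double₂.neck n s)) = _
    rw [conjX_neck, nL]
    exact hjN _ _ _ _ _ _ rfl (hexFlip_hexEnd 1 s).symm
  · intro m
    change A.out ((), conjX (double₂.plus m)) = _
    rw [conjX_plus, mO]
    rfl
  · intro m
    change A.out ((), conjX (double₂.minus m)) = _
    rw [conjX_minus, pO]
    exact hjM _ _ _ _ _ _ _ rfl (by norm_num)
  · intro n s t hst
    change A.out ((), conjX (double₂.neck n s)) = _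
    rw [conjX_neck, nO _ _ (negIcc t) (by simp [negIcc, hst])]
    exact hjN _ _ _ _ _ _ rfl (hexFlip_hexEnd 0 t).symm

end Symmetry

/-- The identity isomorphism of a relative cobordism. -/
def RelCob.Iso.refl {ι κ : Type} (A : RelCob ι κ) : A.Iso A where
  toDiffeo := Diffeomorph.refl _ A.W _
  map_inc _ := rfl
  map_out _ := rfl
  map_wall _ := Iff.rfl

end YProd

end

theorem propositionp :
    (YProd.Y₁.comp (YProd.PsiBar.disjUnion YProd.PsiBar)).Same
        (YProd.PsiBar.comp YProd.Y₂) ∧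
      (YProd.Y₁.comp (YProd.Psi.disjUnion YProd.Psi)).Same
        (YProd.Psi.comp YProd.Y₂.swap) := by
  have hL := YProd.isHandleCobordism_sideData 1 YProd.sigma_one
  have hR := YProd.isHandleCobordism_sideData (-1) YProd.sigma_neg_one
  -- Both sides have literally the same representative, so the isomorphism is the identity.
  refine ⟨⟨YProd.totalData.relCob, ⟨_, YProd.isYProduct_coneData, _,
      ⟨_, hL, _, hR, YProd.isDisjointUnion_sidesData⟩, YProd.isComposite_sides⟩,
    YProd.totalData.relCob, ⟨_, YProd.isHandleCobordism_beltData, _, YProd.isYProduct_waistData, YProd.isComposite_belt⟩,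
    ⟨YProd.RelCob.Iso.refl _⟩⟩, ?_⟩
  -- The incoming identification of the same total space is conjugated. On one side this turns both
  -- copies of `Ψ̄` into `Ψ`. On the other it is distributed over the waist, turning the outer `Ψ̄`
  -- into `Ψ` and the second Y-product into itself with exchanged inputs.
  exact ⟨YProd.totalData.relCob.conjInc, ⟨_, YProd.isYProduct_coneData, _,
      ⟨_, hL.conjInc, _, hR.conjInc, YProd.isDisjointUnion_sidesData.conjInc⟩,
      YProd.isComposite_sides.conjInc⟩,
    YProd.totalData.relCob.conjInc, ⟨_, YProd.isHandleCobordism_beltData.conjInc, _,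
      ⟨_, YProd.isYProduct_waistData.conjSwap, YProd.isSwap_conjSwap _⟩, YProd.isComposite_belt.conjBoth⟩,
    ⟨YProd.RelCob.Iso.refl _⟩⟩
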